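/- Let $0\le m\le n$ and consider the implicit system $F(x,\dot x)=0$, where $F$ is an $\mathbb R^{n-m}$-valued function of $(x,\dot x)\in X\times\mathbb R^n$, $X\subset\mathbb R^n$ open. Jets $\bar x=(x,\dot x,\ddot x,\dots)\in X\times\mathbb R^n\times\mathbb R^n\times\cdots$ carry the product topology, $\tau=\sum_{i,j}x_i^{(j+1)}\partial/\partial x_i^{(j)}$ is the trivial Cartan field, $\frac{d}{dt}=L_\tau$, and $\mathfrak X_0=\{\bar x:\ L_\tau^kF(\bar x)=0\ \forall k\ge 0\}$. Fix $\bar x_0\in\mathfrak X_0$ such that, at $(x_0,\dot x_0)$, $F$ is analytic and $\operatorname{rank}\frac{\partial F}{\partial\dot x}=n-m$. All functions below are analytic functions of finitely many jet coordinates near the base point. Polynomial matrices are matrices of polynomials $\sum_k a_k\frac{d^k}{dt^k}$ (with $\frac{d}{dt}\,a=a\,\frac{d}{dt}+\dot a$) whose coefficients are such functions near $\bar x_0$; identities between them, and unimodularity (existence of a polynomial inverse), are understood on a neighbourhood of $\bar x_0$ in $\mathfrak X_0$. Put $P(F)=\frac{\partial F}{\partial x}+\frac{\partial F}{\partial\dot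 x}\frac{d}{dt}$. Write $U\in\mathrm{R\text{-}Smith}(P(F))$ if $U$ is unimodular and $VP(F)U=(I_{n-m},0)$ for some unimodular $V$; put $\hat U=U\binom{0}{I_m}$; write $Q\in\mathrm{L\text{-}Smith}(\hat U)$ if $Q$ is unimodular and $Q\hat UR=\binom{I_m}{0}$ for some unimodular $R$; put $\omega=(I_m,0)\,Q\,dx$. Strong closedness condition: there exist $U\in\mathrm{R\text{-}Smith}(P(F))$, $Q\in\mathrm{L\text{-}Smith}(\hat U)$ and a unimodular $m\times m$ matrix $M$ such that $d(M\omega)=0$ on $\mathfrak X_0$ near $\bar x_0$. A trivialization at $\bar x_0$ is a pair of mutually inverse maps $\Phi=(\varphi_0,\varphi_1,\dots)$, $\Psi$ between a neighbourhood of some $\bar y_0$ in $\mathbb R^m\times\mathbb R^m\times\cdots$ and a neighbourhood of $\bar x_0$ in $\mathfrak X_0$, with $\Phi(\bar y_0)=\bar x_0$, that are analytic (each component depending locally on finitely many coordinates) and exchange the Cartan fields. For it let $P(\varphi_0)=\sum_j\frac{\partial\varphi_0}{\partial y^{(j)}}\frac{d^j}{dt^j}$, let $\sigma_i$ be the maximal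 degree of the entries of the $i$-th column of $P(\varphi_0)$ near $\bar y_0$, and $N=\sum_{i=1}^m\sigma_i$. The minimal $N$ is the minimum of $N$ over all $U\in\mathrm{R\text{-}Smith}(P(F))$, $Q\in\mathrm{L\text{-}Smith}(\hat U)$, unimodular $Z$ and all trivializations such that $Q\,P(\varphi_0)_{|\Psi(\bar x)}=\binom{I_m}{0}Z$. The system is static feedback linearizable at $\bar x_0$ if there is an explicit system $\dot x=f(x,u)$, $u\in\mathbb R^m$, with $f$ analytic near some $(x_0,u_0)$, $f(x_0,u_0)=\dot x_0$, $F(x,f(x,u))=0$ near $(x_0,u_0)$, $\operatorname{rank}\frac{\partial f}{\partial u}(x_0,u_0)=m$, which a local analytic diffeomorphism $z=\chi(x)$ at $x_0$ and an analytic feedback $u=\alpha(x,v)$, $\alpha(x_0,v_0)=u_0$, $\frac{\partial\alpha}{\partial v}(x_0,v_0)$ invertible, transform near $(x_0,v_0)$ into a linear system $\dot z=Az+Bv$ with $(A,B)$ controllable. Then: (i) if the strong closedness condition holds, the minimal $N$ exists; (ii) the system is static feedback linearizable at $\bar x_0$ if and only if the strong closedness condition holds and $n=m+N$ for the minimal $N$.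 -/

import Mathlib

open Filter Topology

noncomputable section

/-- Jets of infinite order `(x, ẋ, ẍ, …)` of curves in `ℝⁿ`: `x j i` is the coordinate
`x_i^{(j)}`.  The topology is the product topology. -/
abbrev Jet (n : ℕ) : Type := ℕ → Fin n → ℝ

/-- The first `k` blocks `(x, ẋ, …, x^{(k-1)})` of a jet. -/
def jetTrunc {n : ℕ} (k : ℕ) (x : Jet n) : Fin k → Fin n → ℝ := fun j => x j

/-- Near `x`, the function `f` depends on finitely many coordinates only, and is an analytic
function of them. -/
def JetAnalyticAt {n : ℕ} (f : Jet n → ℝ) (x : Jet n) : Prop :=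
  ∃ (k : ℕ) (g : (Fin k → Fin n → ℝ) → ℝ),
    AnalyticAt ℝ g (jetTrunc k x) ∧ f =ᶠ[𝓝 x] fun z => g (jetTrunc k z)

/-- The coordinate vector `∂/∂x_i^{(j)}`, for `p = (j, i)`. -/
def jetBasis {n : ℕ} (p : ℕ × Fin n) : Jet n := Pi.single p.1 (Pi.single p.2 1)

/-- The partial derivative `∂f/∂x_i^{(j)}`, for `p = (j, i)`. -/
def jetPartial {n : ℕ} (p : ℕ × Fin n) (f : Jet n → ℝ) : Jet n → ℝ :=
  fun x => lineDeriv ℝ f x (jetBasis p)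

/-- The Lie derivative `∑_{j, i} x_i^{(j+1)} ∂f/∂x_i^{(j)}` along the trivial Cartan field. -/
def lieTau {n : ℕ} (f : Jet n → ℝ) : Jet n → ℝ :=
  fun x => ∑ᶠ p : ℕ × Fin n, x (p.1 + 1) p.2 * jetPartial p f x

section JetLemmas

theorem jetTrunc_continuous {n : ℕ} (k : ℕ) : Continuous (jetTrunc (n := n) k) := by
  unfold jetTrunc; fun_prop

theorem JetAnalyticAt.lift {n : ℕ} {f : Jet n → ℝ} {x : Jet n} (h : JetAnalyticAt f x) :
    ∃ k₀ : ℕ, ∀ k, k₀ ≤ k → ∃ g : (Fin k → Fin n → ℝ) → ℝ,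
      AnalyticAt ℝ g (jetTrunc k x) ∧ f =ᶠ[𝓝 x] fun z => g (jetTrunc k z) := by
  obtain ⟨k₀, g, hg, hf⟩ := h
  refine ⟨k₀, fun k hk => ⟨fun z => g (fun j => z (Fin.castLE hk j)), ?_, hf⟩⟩
  let T : (Fin k → Fin n → ℝ) →L[ℝ] (Fin k₀ → Fin n → ℝ) :=
    ContinuousLinearMap.pi fun j => ContinuousLinearMap.proj (Fin.castLE hk j)
  exact AnalyticAt.comp (g := g) (f := T) hg (T.analyticAt _)

theorem JetAnalyticAt.congr {n : ℕ} {f g : Jet n → ℝ} {x : Jet n} (h : JetAnalyticAt f x)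
    (hfg : f =ᶠ[𝓝 x] g) : JetAnalyticAt g x := by
  obtain ⟨k, u, hu, hf⟩ := h
  exact ⟨k, u, hu, hfg.symm.trans hf⟩

theorem JetAnalyticAt.const {n : ℕ} (c : ℝ) (x : Jet n) : JetAnalyticAt (fun _ => c) x :=
  ⟨0, fun _ => c, analyticAt_const, EventuallyEq.rfl⟩

theorem JetAnalyticAt.coord {n : ℕ} (j : ℕ) (i : Fin n) (x : Jet n) :
    JetAnalyticAt (fun z => z j i) x := by
  refine ⟨j + 1, fun z => z (Fin.last j) i, ?_, ?_⟩
  · let T : (Fin (j + 1) → Fin n → ℝ) →L[ℝ] ℝ :=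
      (ContinuousLinearMap.proj (R := ℝ) (φ := fun _ : Fin n => ℝ) i).comp
        (ContinuousLinearMap.proj (R := ℝ) (φ := fun _ : Fin (j + 1) => Fin n → ℝ) (Fin.last j))
    exact T.analyticAt _
  · exact Eventually.of_forall fun z => by simp [jetTrunc]

theorem JetAnalyticAt.add {n : ℕ} {f g : Jet n → ℝ} {x : Jet n} (hf : JetAnalyticAt f x)
    (hg : JetAnalyticAt g x) : JetAnalyticAt (fun z => f z + g z) x := by
  obtain ⟨k, hk⟩ := hf.lift
  obtain ⟨l, hl⟩ := hg.lift
  obtain ⟨u, hu, hfu⟩ := hk (max k l) (le_max_left _ _)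
  obtain ⟨v, hv, hgv⟩ := hl (max k l) (le_max_right _ _)
  exact ⟨_, fun z => u z + v z, hu.add hv, hfu.add hgv⟩

theorem JetAnalyticAt.mul {n : ℕ} {f g : Jet n → ℝ} {x : Jet n} (hf : JetAnalyticAt f x)
    (hg : JetAnalyticAt g x) : JetAnalyticAt (fun z => f z * g z) x := by
  obtain ⟨k, hk⟩ := hf.lift
  obtain ⟨l, hl⟩ := hg.lift
  obtain ⟨u, hu, hfu⟩ := hk (max k l) (le_max_left _ _)
  obtain ⟨v, hv, hgv⟩ := hl (max k l) (le_max_right _ _)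
  exact ⟨_, fun z => u z * v z, hu.mul hv, hfu.mul hgv⟩

theorem JetAnalyticAt.sum {n : ℕ} {ι : Type*} (s : Finset ι) {f : ι → Jet n → ℝ} {x : Jet n}
    (hf : ∀ i ∈ s, JetAnalyticAt (f i) x) : JetAnalyticAt (fun z => ∑ i ∈ s, f i z) x := by
  classical
  induction s using Finset.induction_on with
  | empty => simpa using JetAnalyticAt.const 0 x
  | insert a s ha ih =>
    have h := (hf a (Finset.mem_insert_self a s)).add
      (ih fun i hi => hf i (Finset.mem_insert_of_mem hi))
    simpa [Finset.sum_insert ha] using h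

theorem jet_line_tendsto {n : ℕ} (z v : Jet n) :
    Tendsto (fun t : ℝ => z + t • v) (𝓝 0) (𝓝 z) := by
  have h : Continuous fun t : ℝ => z + t • v := by fun_prop
  simpa using h.tendsto 0

theorem jet_lineDeriv_congr {n : ℕ} {f g : Jet n → ℝ} {z : Jet n} (h : f =ᶠ[𝓝 z] g)
    (v : Jet n) : lineDeriv ℝ f z v = lineDeriv ℝ g z v :=
  EventuallyEq.deriv_eq ((jet_line_tendsto z v).eventually h)

theorem lieTau_congr {n : ℕ} {f g : Jet n → ℝ} {x : Jet n} (h : f =ᶠ[𝓝 x] g) :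
    lieTau f =ᶠ[𝓝 x] lieTau g := by
  filter_upwards [eventually_eventually_nhds.mpr h] with z hz
  exact finsum_congr fun p => by
    rw [jetPartial, jetPartial, jet_lineDeriv_congr hz]

theorem jet_hasLineDerivAt {n k : ℕ} {f : Jet n → ℝ} {g : (Fin k → Fin n → ℝ) → ℝ} {x : Jet n}
    (hg : AnalyticAt ℝ g (jetTrunc k x)) (hf : f =ᶠ[𝓝 x] fun z => g (jetTrunc k z)) :
    ∀ᶠ z in 𝓝 x, ∀ v, HasLineDerivAt ℝ f (fderiv ℝ g (jetTrunc k z) (jetTrunc k v)) z v := by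
  have h1 : ∀ᶠ z in 𝓝 x, AnalyticAt ℝ g (jetTrunc k z) :=
    (jetTrunc_continuous k).continuousAt.eventually hg.eventually_analyticAt
  filter_upwards [h1, eventually_eventually_nhds.mpr hf] with z hz hfz v
  have h2 : HasLineDerivAt ℝ g (fderiv ℝ g (jetTrunc k z) (jetTrunc k v)) (jetTrunc k z)
      (jetTrunc k v) := hz.differentiableAt.hasFDerivAt.hasLineDerivAt _
  exact HasDerivAt.congr_of_eventuallyEq h2 ((jet_line_tendsto z v).eventually hfz)

theorem jetTrunc_jetBasis_eq_zero {n k : ℕ} {p : ℕ × Fin n} (hp : k ≤ p.1) :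
    jetTrunc k (jetBasis p) = 0 := by
  funext j
  have : (j : ℕ) ≠ p.1 := by omega
  simp [jetTrunc, jetBasis, this]

theorem JetAnalyticAt.eventually {n : ℕ} {f : Jet n → ℝ} {x : Jet n} (h : JetAnalyticAt f x) :
    ∃ k : ℕ, ∀ᶠ z in 𝓝 x, (∀ v, LineDifferentiableAt ℝ f z v) ∧
      ∀ p : ℕ × Fin n, k ≤ p.1 → jetPartial p f z = 0 := by
  obtain ⟨k, g, hg, hf⟩ := h
  refine ⟨k, ?_⟩
  filter_upwards [jet_hasLineDerivAt hg hf] with z hz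
  refine ⟨fun v => (hz v).differentiableAt, fun p hp => ?_⟩
  rw [jetPartial, (hz _).lineDeriv, jetTrunc_jetBasis_eq_zero hp, map_zero]

theorem JetAnalyticAt.partialDeriv {n : ℕ} {f : Jet n → ℝ} {x : Jet n} (h : JetAnalyticAt f x)
    (p : ℕ × Fin n) : JetAnalyticAt (jetPartial p f) x := by
  obtain ⟨k, g, hg, hf⟩ := h
  refine ⟨k, fun y => fderiv ℝ g y (jetTrunc k (jetBasis p)), ?_, ?_⟩
  · exact ((ContinuousLinearMap.apply ℝ ℝ (jetTrunc k (jetBasis p))).analyticAt _).comp hg.fderiv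
  · filter_upwards [jet_hasLineDerivAt hg hf] with z hz
    exact (hz _).lineDeriv

theorem lieTau_finite {n k : ℕ} {f : Jet n → ℝ} {z : Jet n}
    (h : ∀ p : ℕ × Fin n, k ≤ p.1 → jetPartial p f z = 0) :
    (Function.support fun p : ℕ × Fin n => z (p.1 + 1) p.2 * jetPartial p f z) ⊆
      ((Finset.range k ×ˢ Finset.univ : Finset (ℕ × Fin n)) : Set (ℕ × Fin n)) := by
  intro p hp
  by_contra hc
  have : k ≤ p.1 := by simpa using hc
  exact hp (by simp [h p this])

theorem JetAnalyticAt.lieTau {n : ℕ} {f : Jet n → ℝ} {x : Jet n} (h : JetAnalyticAt f x) :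
    JetAnalyticAt (lieTau f) x := by
  obtain ⟨k, hk⟩ := h.eventually
  refine JetAnalyticAt.congr (f := fun z => ∑ p ∈ (Finset.range k ×ˢ Finset.univ :
    Finset (ℕ × Fin n)), z (p.1 + 1) p.2 * jetPartial p f z) ?_ ?_
  · exact JetAnalyticAt.sum _ fun p _ => (JetAnalyticAt.coord _ _ x).mul (h.partialDeriv p)
  · filter_upwards [hk] with z hz
    exact (finsum_eq_sum_of_support_subset _ (lieTau_finite hz.2)).symm

theorem lieTau_add {n : ℕ} {f g : Jet n → ℝ} {x : Jet n} (hf : JetAnalyticAt f x)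
    (hg : JetAnalyticAt g x) :
    lieTau (fun z => f z + g z) =ᶠ[𝓝 x] fun z => lieTau f z + lieTau g z := by
  obtain ⟨k, hk⟩ := hf.eventually
  obtain ⟨l, hl⟩ := hg.eventually
  filter_upwards [hk, hl] with z hz hw
  rw [lieTau, lieTau, lieTau, ← finsum_add_distrib
    ((Finset.finite_toSet _).subset (lieTau_finite hz.2))
    ((Finset.finite_toSet _).subset (lieTau_finite hw.2))]
  refine finsum_congr fun p => ?_
  have : jetPartial p (fun z => f z + g z) z = jetPartial p f z + jetPartial p g z :=
    HasLineDerivAt.lineDeriv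
      (HasDerivAt.add (hz.1 _).hasLineDerivAt (hw.1 _).hasLineDerivAt)
  rw [this, mul_add]

theorem lieTau_mul {n : ℕ} {f g : Jet n → ℝ} {x : Jet n} (hf : JetAnalyticAt f x)
    (hg : JetAnalyticAt g x) :
    lieTau (fun z => f z * g z) =ᶠ[𝓝 x] fun z => f z * lieTau g z + g z * lieTau f z := by
  obtain ⟨k, hk⟩ := hf.eventually
  obtain ⟨l, hl⟩ := hg.eventually
  filter_upwards [hk, hl] with z hz hw
  have sf := lieTau_finite hz.2
  have sg := lieTau_finite hw.2
  rw [lieTau, lieTau, lieTau, mul_finsum, mul_finsum, ← finsum_add_distrib]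
  · refine finsum_congr fun p => ?_
    have : jetPartial p (fun z => f z * g z) z = jetPartial p f z * g z + f z * jetPartial p g z := by
      have h := HasDerivAt.mul (hz.1 (jetBasis p)).hasLineDerivAt (hw.1 (jetBasis p)).hasLineDerivAt
      simp only [zero_smul, add_zero] at h
      exact HasLineDerivAt.lineDeriv h
    rw [this]; ring
  · refine (Finset.finite_toSet _).subset (Set.Subset.trans ?_ sg)
    intro p hp hc
    exact hp (by simp only [hc, mul_zero])
  · refine (Finset.finite_toSet _).subset (Set.Subset.trans ?_ sf)
    intro p hp hc
    exact hp (by simp only [hc, mul_zero])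

end JetLemmas

/-- The ring of germs at `x` of analytic functions of finitely many jet coordinates. -/
def jetGerms {n : ℕ} (x : Jet n) : Subring (Germ (𝓝 x) ℝ) where
  carrier := {a | ∃ f : Jet n → ℝ, JetAnalyticAt f x ∧ a = (f : Germ (𝓝 x) ℝ)}
  mul_mem' := by
    rintro _ _ ⟨f, hf, rfl⟩ ⟨g, hg, rfl⟩
    exact ⟨_, hf.mul hg, rfl⟩
  one_mem' := ⟨_, JetAnalyticAt.const 1 x, rfl⟩
  add_mem' := by
    rintro _ _ ⟨f, hf, rfl⟩ ⟨g, hg, rfl⟩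
    exact ⟨_, hf.add hg, rfl⟩
  zero_mem' := ⟨_, JetAnalyticAt.const 0 x, rfl⟩
  neg_mem' := by
    rintro _ ⟨f, hf, rfl⟩
    refine ⟨fun z => -1 * f z, (JetAnalyticAt.const (-1) x).mul hf, ?_⟩
    refine Germ.coe_eq.mpr (Eventually.of_forall fun z => ?_)
    simp

/-- The coefficient ring at `x`. -/
abbrev JetRing {n : ℕ} (x : Jet n) : Type := jetGerms x

/-- A function representing the germ `a`. -/
def JetRing.rep {n : ℕ} {x : Jet n} (a : JetRing x) : Jet n → ℝ := a.2.choose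

theorem JetRing.rep_analytic {n : ℕ} {x : Jet n} (a : JetRing x) : JetAnalyticAt a.rep x :=
  a.2.choose_spec.1

theorem JetRing.coe_rep {n : ℕ} {x : Jet n} (a : JetRing x) :
    ((a.rep : Jet n → ℝ) : Germ (𝓝 x) ℝ) = a.1 := a.2.choose_spec.2.symm

open Classical in
/-- The germ at `x` of a function `f` that is analytic at `x` (and `0` for any other `f`). -/
def JetRing.of {n : ℕ} (x : Jet n) (f : Jet n → ℝ) : JetRing x :=
  if h : JetAnalyticAt f x then ⟨(f : Germ (𝓝 x) ℝ), f, h, rfl⟩ else 0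

/-- The derivation `d/dt = L_τ` of the ring of germs. -/
def JetRing.tau {n : ℕ} (x : Jet n) : Derivation ℤ (JetRing x) (JetRing x) :=
  Derivation.mk'
    (AddMonoidHom.toIntLinearMap
      { toFun := fun a => ⟨(lieTau a.rep : Jet n → ℝ), _, a.rep_analytic.lieTau, rfl⟩
        map_zero' := by
          refine Subtype.ext (Germ.coe_eq.mpr ?_)
          have h : (0 : JetRing x).rep =ᶠ[𝓝 x] fun _ => (0 : ℝ) :=
            Germ.coe_eq.mp (JetRing.coe_rep (0 : JetRing x))
          refine (lieTau_congr h).trans (Eventually.of_forall fun z => ?_)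
          simp [lieTau, jetPartial, lineDeriv]
        map_add' := fun a b => by
          refine Subtype.ext (Germ.coe_eq.mpr ?_)
          have h : (a + b).rep =ᶠ[𝓝 x] fun z => a.rep z + b.rep z := by
            refine Germ.coe_eq.mp ((JetRing.coe_rep (a + b)).trans ?_)
            exact (congrArg₂ (· + ·) a.coe_rep b.coe_rep).symm
          exact (lieTau_congr h).trans (lieTau_add a.rep_analytic b.rep_analytic) })
    (fun a b => by
      refine Subtype.ext ?_
      have h : (a * b).rep =ᶠ[𝓝 x] fun z => a.rep z * b.rep z := by
        refine Germ.coe_eq.mp ((JetRing.coe_rep (a * b)).trans ?_)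
        exact (congrArg₂ (· * ·) a.coe_rep b.coe_rep).symm
      have h2 := Germ.coe_eq.mpr ((lieTau_congr h).trans (lieTau_mul a.rep_analytic b.rep_analytic))
      refine h2.trans ?_
      change _ = a.1 * ((lieTau b.rep : Jet n → ℝ) : Germ (𝓝 x) ℝ)
        + b.1 * ((lieTau a.rep : Jet n → ℝ) : Germ (𝓝 x) ℝ)
      rw [← a.coe_rep, ← b.coe_rep]
      rfl)

/-- Polynomials `∑ a_k (d/dt)^k` with coefficients in a commutative ring `A` with derivation `D`.
The additive group is that of `A[X]`; the product is determined by `(d/dt) · a = a · (d/dt) + D a`. -/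
def DiffOp {A : Type*} [CommRing A] (_D : Derivation ℤ A A) : Type _ := Polynomial A

namespace DiffOp

open Polynomial

variable {A : Type*} [CommRing A] (D : Derivation ℤ A A)

instance : AddCommGroup (DiffOp D) := inferInstanceAs (AddCommGroup (Polynomial A))

/-- Applying `D` to all coefficients. -/
def coeffDeriv : Polynomial A →+ Polynomial A where
  toFun q := q.sum fun k a => monomial k (D a)
  map_zero' := by simp
  map_add' p q := by
    rw [Polynomial.sum_add_index] <;> simp

/-- Left multiplication by `d/dt`: it sends `a (d/dt)^k` to `a (d/dt)^(k+1) + D a (d/dt)^k`. -/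
def shiftOp : Polynomial A →+ Polynomial A := AddMonoidHom.mulLeft X + coeffDeriv D

/-- The product `(∑ a_k (d/dt)^k) q = ∑ a_k ((d/dt)^k q)`. -/
def opMul (p q : Polynomial A) : Polynomial A := p.sum fun k a => C a * (shiftOp D)^[k] q

theorem shiftOp_iterate_add (k : ℕ) (q r : Polynomial A) :
    (shiftOp D)^[k] (q + r) = (shiftOp D)^[k] q + (shiftOp D)^[k] r :=
  iterate_map_add (shiftOp D) k q r

theorem add_opMul (p q r : Polynomial A) : opMul D (p + q) r = opMul D p r + opMul D q r := by
  unfold opMul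
  rw [Polynomial.sum_add_index] <;> simp [add_mul]

theorem opMul_add (p q r : Polynomial A) : opMul D p (q + r) = opMul D p q + opMul D p r := by
  simp only [opMul, shiftOp_iterate_add, mul_add, Polynomial.sum_add]

theorem zero_opMul (q : Polynomial A) : opMul D 0 q = 0 := by simp [opMul]

theorem opMul_zero (p : Polynomial A) : opMul D p 0 = 0 := by
  simp [opMul, iterate_map_zero, Polynomial.sum]

theorem coeffDeriv_monomial (k : ℕ) (a : A) : coeffDeriv D (monomial k a) = monomial k (D a) := by
  simp [coeffDeriv, Polynomial.sum_monomial_index]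

theorem coeffDeriv_C_mul (a : A) (q : Polynomial A) :
    coeffDeriv D (C a * q) = C a * coeffDeriv D q + C (D a) * q := by
  induction q using Polynomial.induction_on' with
  | add p q hp hq => simp only [mul_add, map_add, hp, hq]; abel
  | monomial k b =>
    simp only [C_mul_monomial, coeffDeriv_monomial, Derivation.leibniz, smul_eq_mul, map_add]
    rw [mul_comm b]

theorem shiftOp_C_mul (a : A) (q : Polynomial A) :
    shiftOp D (C a * q) = C a * shiftOp D q + C (D a) * q := by
  simp only [shiftOp, AddMonoidHom.add_apply, AddMonoidHom.coe_mulLeft, coeffDeriv_C_mul]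
  ring

theorem opMul_monomial (k : ℕ) (a : A) (q : Polynomial A) :
    opMul D (monomial k a) q = C a * (shiftOp D)^[k] q :=
  Polynomial.sum_monomial_index _ _ (by simp)

theorem shiftOp_monomial (k : ℕ) (a : A) :
    shiftOp D (monomial k a) = monomial (k + 1) a + monomial k (D a) := by
  simp [shiftOp, coeffDeriv_monomial, X_mul_monomial]

theorem opMul_C_mul (a : A) (p q : Polynomial A) :
    opMul D (C a * p) q = C a * opMul D p q := by
  induction p using Polynomial.induction_on' with
  | add p r hp hr => simp only [mul_add, add_opMul, hp, hr]
  | monomial k b => simp only [C_mul_monomial, opMul_monomial, C_mul, mul_assoc]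

theorem opMul_shiftOp (p q : Polynomial A) :
    opMul D (shiftOp D p) q = shiftOp D (opMul D p q) := by
  induction p using Polynomial.induction_on' with
  | add p r hp hr => simp only [map_add, add_opMul, hp, hr]
  | monomial k b =>
    simp only [shiftOp_monomial, add_opMul, opMul_monomial, shiftOp_C_mul,
      Function.iterate_succ_apply']

theorem opMul_assoc (p q r : Polynomial A) :
    opMul D (opMul D p q) r = opMul D p (opMul D q r) := by
  induction p using Polynomial.induction_on' with
  | add p s hp hs => simp only [add_opMul, hp, hs]
  | monomial k b =>
    rw [opMul_monomial, opMul_monomial, opMul_C_mul]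
    congr 1
    induction k with
    | zero => rfl
    | succ k ih => rw [Function.iterate_succ_apply', Function.iterate_succ_apply', opMul_shiftOp, ih]

theorem one_opMul (q : Polynomial A) : opMul D 1 q = q := by
  have h := opMul_monomial D 0 1 q
  simpa using h

theorem opMul_one (p : Polynomial A) : opMul D p 1 = p := by
  induction p using Polynomial.induction_on' with
  | add p s hp hs => simp only [add_opMul, hp, hs]
  | monomial k b =>
    have h : ∀ k : ℕ, (shiftOp D)^[k] (1 : Polynomial A) = monomial k 1 := by
      intro k
      induction k with
      | zero => rfl
      | succ k ih => rw [Function.iterate_succ_apply', ih, shiftOp_monomial]; simp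
    rw [opMul_monomial, h, C_mul_monomial, mul_one]

/-- The non-commutative ring `A[d/dt]`. -/
instance : Ring (DiffOp D) :=
  { (inferInstance : AddCommGroup (DiffOp D)) with
    mul p q := opMul D p q
    one := (1 : Polynomial A)
    left_distrib := opMul_add D
    right_distrib := add_opMul D
    zero_mul := zero_opMul D
    mul_zero := opMul_zero D
    mul_assoc := opMul_assoc D
    one_mul := one_opMul D
    mul_one := opMul_one D }

variable {D}

/-- The coefficient of `(d/dt)^k`. -/
def coeff (P : DiffOp D) (k : ℕ) : A := Polynomial.coeff P k

/-- The degree in `d/dt` (with degree `0` for the zero polynomial). -/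
def degree (P : DiffOp D) : ℕ := Polynomial.natDegree P

/-- The monomial `a (d/dt)^k`. -/
def mono (D : Derivation ℤ A A) (k : ℕ) (a : A) : DiffOp D := (monomial k a : Polynomial A)

end DiffOp

/-- The ring of polynomials in `d/dt` over the germs at `x`. -/
abbrev JetOp {n : ℕ} (x : Jet n) : Type := DiffOp (JetRing.tau x)

section BlockMatrices

variable (R : Type*) [Ring R]

/-- The `p × q` matrix `(I_p, 0)`, `I_p` or `(I_q ; 0)`, according to `p < q`, `p = q`, `p > q`. -/
def rectId (p q : ℕ) : Matrix (Fin p) (Fin q) R :=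
  Matrix.of fun i j => if (i : ℕ) = (j : ℕ) then 1 else 0

/-- The `n × m` matrix `(0_{n-m,m} ; I_m)`, for `m ≤ n`. -/
def lowerId (n m : ℕ) : Matrix (Fin n) (Fin m) R :=
  Matrix.of fun i j => if (i : ℕ) = (n - m) + (j : ℕ) then 1 else 0

end BlockMatrices

section System

variable {n m : ℕ} (F : (Fin n → ℝ) × (Fin n → ℝ) → Fin (n - m) → ℝ)

/-- The function `F_i(x, ẋ)` on jets. -/
def sysFun (i : Fin (n - m)) : Jet n → ℝ := fun x => F (x 0, x 1) i

/-- The set `𝔛₀` of jets at which `L_τ^k F = 0` for all `k`. -/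
def solSet : Set (Jet n) := {x | ∀ (k : ℕ) (i : Fin (n - m)), (lieTau^[k] (sysFun F i)) x = 0}

/-- The tangent vectors of `𝔛₀` at `x`: those annihilated by `d(L_τ^k F)` for all `k`. -/
def solTangent (x : Jet n) : Set (Jet n) :=
  {v | ∀ (k : ℕ) (i : Fin (n - m)), lineDeriv ℝ (lieTau^[k] (sysFun F i)) x v = 0}

variable {x₀ : Jet n}

/-- Equality of two germs on a neighbourhood of `x₀` in `𝔛₀`. -/
def EqOnSol (a b : JetRing x₀) : Prop := ∀ᶠ x in 𝓝[solSet F] x₀, a.rep x = b.rep x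

/-- Equality, on a neighbourhood of `x₀` in `𝔛₀`, of two polynomial matrices. -/
def OpMatEq {p q : ℕ} (P Q : Matrix (Fin p) (Fin q) (JetOp x₀)) : Prop :=
  ∀ i j k, EqOnSol F ((P i j).coeff k) ((Q i j).coeff k)

/-- Unimodular matrices (near `x₀`, on `𝔛₀`): those that have a polynomial inverse. -/
def Unimodular {p : ℕ} (U : Matrix (Fin p) (Fin p) (JetOp x₀)) : Prop :=
  ∃ U' : Matrix (Fin p) (Fin p) (JetOp x₀), OpMatEq F (U * U') 1 ∧ OpMatEq F (U' * U) 1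

/-- The matrix `P(F) = ∂F/∂x + ∂F/∂ẋ d/dt`. -/
def varMatrix (x₀ : Jet n) : Matrix (Fin (n - m)) (Fin n) (JetOp x₀) :=
  Matrix.of fun i j =>
    DiffOp.mono _ 0 (JetRing.of x₀ (jetPartial (0, j) (sysFun F i))) +
      DiffOp.mono _ 1 (JetRing.of x₀ (jetPartial (1, j) (sysFun F i)))

/-- `U` is a right Smith factor of `P(F)`: `V P(F) U = (I, 0)` for a unimodular `V`. -/
def RightSmith (U : Matrix (Fin n) (Fin n) (JetOp x₀)) : Prop :=
  Unimodular F U ∧ ∃ V : Matrix (Fin (n - m)) (Fin (n - m)) (JetOp x₀),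
    Unimodular F V ∧ OpMatEq F (V * varMatrix F x₀ * U) (rectId _ (n - m) n)

/-- `Q` is a left Smith factor of the `n × m` matrix `H`: `Q H R = (I ; 0)` for a unimodular `R`. -/
def LeftSmith (H : Matrix (Fin n) (Fin m) (JetOp x₀)) (Q : Matrix (Fin n) (Fin n) (JetOp x₀)) :
    Prop :=
  Unimodular F Q ∧ ∃ R : Matrix (Fin m) (Fin m) (JetOp x₀),
    Unimodular F R ∧ OpMatEq F (Q * H * R) (rectId _ n m)

/-- `Û = U (0 ; I_m)`. -/
def hatMatrix (m : ℕ) (U : Matrix (Fin n) (Fin n) (JetOp x₀)) : Matrix (Fin n) (Fin m) (JetOp x₀) :=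
  U * lowerId _ n m

/-- Germs at `x₀` of 1-forms: finite sums `∑ a_p dx_i^{(j)}`, `p = (j, i)`. -/
abbrev OneForm (x₀ : Jet n) : Type := (ℕ × Fin n) →₀ JetRing x₀

/-- The Lie derivative `d/dt` of a 1-form: `L_τ (a dx_i^{(j)}) = (L_τ a) dx_i^{(j)} + a dx_i^{(j+1)}`. -/
def lieForm (η : OneForm x₀) : OneForm x₀ :=
  η.sum fun p a => Finsupp.single p (JetRing.tau x₀ a) + Finsupp.single (p.1 + 1, p.2) a

/-- The action `(∑ a_k (d/dt)^k) η = ∑ a_k L_τ^k η` on 1-forms. -/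
def opAct (P : JetOp x₀) (η : OneForm x₀) : OneForm x₀ :=
  Polynomial.sum P fun k a => a • lieForm^[k] η

/-- The action of a polynomial matrix on a vector of 1-forms. -/
def matAct {p q : ℕ} (M : Matrix (Fin p) (Fin q) (JetOp x₀)) (ω : Fin q → OneForm x₀) :
    Fin p → OneForm x₀ := fun i => ∑ j, opAct (M i j) (ω j)

/-- The vector `dx = (dx_1, …, dx_n)`. -/
def coordForms (x₀ : Jet n) : Fin n → OneForm x₀ := fun i => Finsupp.single (0, i) 1

/-- `ω = (I_m, 0) Q dx`. -/
def omegaForms (m : ℕ) (Q : Matrix (Fin n) (Fin n) (JetOp x₀)) : Fin m → OneForm x₀ :=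
  matAct (rectId _ m n * Q) (coordForms x₀)

/-- The restriction of `η = ∑ a_p dx_p` to `𝔛₀` is closed near `x₀`:
`dη (v, w) = ∑ (da_p(v) w_p - da_p(w) v_p)` vanishes for all vectors `v`, `w` tangent to `𝔛₀`. -/
def ClosedOnSol (η : OneForm x₀) : Prop :=
  ∀ᶠ x in 𝓝[solSet F] x₀, ∀ v ∈ solTangent F x, ∀ w ∈ solTangent F x,
    (η.sum fun p a => lineDeriv ℝ a.rep x v * w p.1 p.2 - lineDeriv ℝ a.rep x w * v p.1 p.2) = 0

/-- Strong closedness, near `x₀` on `𝔛₀`, of the ideal generated by `ω_1, …, ω_r`: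
`d(Mω) = 0` for a unimodular `M`. -/
def StronglyClosed {r : ℕ} (ω : Fin r → OneForm x₀) : Prop :=
  ∃ M : Matrix (Fin r) (Fin r) (JetOp x₀), Unimodular F M ∧ ∀ i, ClosedOnSol F (matAct M ω i)

/-- There are `U` and `Q` for which the ideal generated by `ω_1, …, ω_m` is strongly closed. -/
def StrongClosednessCondition (x₀ : Jet n) : Prop :=
  ∃ U Q : Matrix (Fin n) (Fin n) (JetOp x₀),
    RightSmith F U ∧ LeftSmith F (hatMatrix m U) Q ∧ StronglyClosed F (omegaForms m Q)

/-- `Φ` and `Ψ` are mutually inverse trivializations at `(x₀, y₀)`: Lie-Bäcklund isomorphisms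
between a neighbourhood `Y` of `y₀` in `ℝ^m_∞` and a neighbourhood `X ∩ 𝔛₀` of `x₀` in `𝔛₀`. -/
def IsTrivialization (x₀ : Jet n) (y₀ : Jet m) (Φ : Jet m → Jet n) (Ψ : Jet n → Jet m) : Prop :=
  ∃ (X : Set (Jet n)) (Y : Set (Jet m)),
    IsOpen X ∧ x₀ ∈ X ∧ IsOpen Y ∧ y₀ ∈ Y ∧ Φ y₀ = x₀ ∧ Ψ x₀ = y₀ ∧
    (∀ y ∈ Y, ∀ j i, JetAnalyticAt (fun z => Φ z j i) y) ∧
    (∀ x ∈ X, ∀ j i, JetAnalyticAt (fun z => Ψ z j i) x) ∧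
    Set.MapsTo Φ Y (X ∩ solSet F) ∧ Set.MapsTo Ψ (X ∩ solSet F) Y ∧
    Set.InvOn Ψ Φ Y (X ∩ solSet F) ∧
    (∀ y ∈ Y, ∀ j i, lieTau (fun z => Φ z j i) y = Φ y (j + 1) i) ∧
    (∀ x ∈ X ∩ solSet F, ∀ j i, lieTau (fun z => Ψ z j i) x = Ψ x (j + 1) i)

/-- The matrix `P(φ₀) = ∑_j ∂φ₀/∂y^{(j)} (d/dt)^j` at `y₀`, where `φ₀` is the first component
of `Φ`. -/
def outputMatrix (Φ : Jet m → Jet n) (y₀ : Jet m) : Matrix (Fin n) (Fin m) (JetOp y₀) :=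
  Matrix.of fun i k =>
    ∑ᶠ j : ℕ, DiffOp.mono _ j (JetRing.of y₀ (jetPartial (j, k) fun y => Φ y 0 i))

/-- The maximal degree `σ_k` of the entries of the `k`-th column. -/
def colDegree {y₀ : Jet m} (P : Matrix (Fin n) (Fin m) (JetOp y₀)) (k : Fin m) : ℕ :=
  Finset.univ.sup fun i => (P i k).degree

/-- `Θ` is the matrix `P` evaluated at `Ψ(x)`, for `x` in `𝔛₀` near `x₀`. -/
def IsPullback (Ψ : Jet n → Jet m) (P : Matrix (Fin n) (Fin m) (JetOp (Ψ x₀)))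
    (Θ : Matrix (Fin n) (Fin m) (JetOp x₀)) : Prop :=
  ∀ i k j, ∀ᶠ x in 𝓝[solSet F] x₀, ((Θ i k).coeff j).rep x = ((P i k).coeff j).rep (Ψ x)

/-- The integers `N = σ_1 + … + σ_m`, `σ_k` being the column degrees of `P(φ₀)`, over all choices
of `Û`, `Q`, `Z` and of a trivialization with `Q P(φ₀) = (I_m ; 0) Z` (at `y = Ψ(x)`). -/
def outputOrders (x₀ : Jet n) : Set ℕ :=
  {N | ∃ (U Q : Matrix (Fin n) (Fin n) (JetOp x₀)) (Z : Matrix (Fin m) (Fin m) (JetOp x₀))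
      (Φ : Jet m → Jet n) (Ψ : Jet n → Jet m) (Θ : Matrix (Fin n) (Fin m) (JetOp x₀)),
    RightSmith F U ∧ LeftSmith F (hatMatrix m U) Q ∧ Unimodular F Z ∧
    IsTrivialization F x₀ (Ψ x₀) Φ Ψ ∧ IsPullback F Ψ (outputMatrix Φ (Ψ x₀)) Θ ∧
    OpMatEq F (Q * Θ) (rectId _ n m * Z) ∧
    N = ∑ k, colDegree (outputMatrix Φ (Ψ x₀)) k}

end System

section StaticFeedback

variable {n m : ℕ}

/-- Controllability of `ż = A z + B v`: the matrix `(B, AB, …, A^{n-1}B)` has rank `n`. -/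
def IsControllablePair (A : Matrix (Fin n) (Fin n) ℝ) (B : Matrix (Fin n) (Fin m) ℝ) : Prop :=
  (Matrix.of fun (i : Fin n) (q : Fin n × Fin m) => (A ^ (q.1 : ℕ) * B) i q.2).rank = n

/-- The explicit system `ẋ = f(x, u)` is static feedback linearizable at `(a, u₀)`: a local
diffeomorphism `z = χ(x)` and a regular static feedback `u = α(x, v)` transform it, locally, into a
controllable linear system `ż = A z + B v`. -/
def ExplicitStaticFeedbackLinearizableAt (f : (Fin n → ℝ) × (Fin m → ℝ) → Fin n → ℝ)
    (a : Fin n → ℝ) (u₀ : Fin m → ℝ) : Prop :=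
  ∃ (χ : (Fin n → ℝ) → Fin n → ℝ) (v₀ : Fin m → ℝ)
    (α : (Fin n → ℝ) × (Fin m → ℝ) → Fin m → ℝ)
    (A : Matrix (Fin n) (Fin n) ℝ) (B : Matrix (Fin n) (Fin m) ℝ),
    AnalyticAt ℝ χ a ∧ Function.Bijective (fderiv ℝ χ a) ∧
    AnalyticAt ℝ α (a, v₀) ∧ α (a, v₀) = u₀ ∧
    Function.Bijective (fderiv ℝ (fun v => α (a, v)) v₀) ∧
    IsControllablePair A B ∧
    ∀ᶠ p in 𝓝 (a, v₀),
      fderiv ℝ χ p.1 (f (p.1, α p)) = A.mulVec (χ p.1) + B.mulVec p.2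

/-- The implicit system `F(x, ẋ) = 0` is static feedback linearizable at `x₀`: so is an explicit
system `ẋ = f(x, u)` compatible with it, `rank ∂f/∂u = m`, around `(x, ẋ) = (x₀ 0, x₀ 1)`. -/
def StaticFeedbackLinearizableAt (F : (Fin n → ℝ) × (Fin n → ℝ) → Fin (n - m) → ℝ)
    (x₀ : Jet n) : Prop :=
  ∃ (f : (Fin n → ℝ) × (Fin m → ℝ) → Fin n → ℝ) (u₀ : Fin m → ℝ),
    AnalyticAt ℝ f (x₀ 0, u₀) ∧ f (x₀ 0, u₀) = x₀ 1 ∧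
    Function.Injective (fderiv ℝ (fun u => f (x₀ 0, u)) u₀) ∧
    (∀ᶠ p in 𝓝 (x₀ 0, u₀), F (p.1, f p) = 0) ∧
    ExplicitStaticFeedbackLinearizableAt f (x₀ 0) u₀

end StaticFeedback

end

/-! Everything is reduced to trivializations. The strong closedness condition holds at $x_0$ exactly
when a trivialization exists, and every trivialization satisfies $QP(\varphi_0)=\binom{I_m}{0}Z$ for
suitable $U$, $Q$ and $Z=I$. So the minimal $N$ is the minimum of $\sum_k\sigma_k$ over all
trivializations, and it exists as soon as there is one, being the least element of a nonempty set of
natural numbers.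

Geometry of $\mathfrak X_0$. Since $\partial F/\partial\dot x$ has full rank, $F=0$ is locally a
graph over $x$ and a projection of $\dot x$ (`RegularSystemAt.nonempty_chart`). Differentiating the
graph repeatedly gives a retraction `SolChart.ret` of an open set of jets onto $\mathfrak X_0$; it
is the identity on $\mathfrak X_0$, and its differential is the identity on the tangent vectors
there. Composition with it turns an identity on $\mathfrak X_0$ into one on an open set. Hence
functions, forms and polynomials in $d/dt$ restricted to $\mathfrak X_0$ have a well-defined
calculus, and the polynomials form the quotient ring `SolOp`. Two algebraic facts on $P(F)$ follow
by comparing leading coefficients: the rows annihilating $dx$ on $\mathfrak X_0$ are left multiples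
of $P(F)$ (`exists_left_factor`), and $P(F)$ can be cancelled on the right (`cancel_varMatrix`).

Closedness and trivializations. The Smith identities mean that $E=M(I_m,0)Q$ completes $P(F)$ to an
invertible matrix with inverse $(W,\Theta)$ (`Completion.of_smith`). If the forms $E\,dx$ are
closed, the Poincaré lemma on $\mathfrak X_0$ gives functions $\psi$ with $d\psi=E\,dx$. From
$E\Theta=1$ the differentials of all derivatives of $\psi$ are independent, and from
$dx=\Theta\,d\psi$ they generate $dx$; so $x$ is an analytic function of finitely many derivatives
of $\psi$, and prolonging gives a trivialization (`exists_isTrivialization_of_closed`). Conversely,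
for a trivialization the chain rule shows that $E=P(\psi_0)$ and $\Theta=P(\varphi_0)$, pulled back
to $\mathfrak X_0$, form such a completion, whose forms $E\,dx=d\psi$ are exact
(`TrivFacts.exists_completion`, `TrivFacts.smith`).

Linearization. For a trivialization, $\varphi_0$ is a function $f$ of the $m+\sum\sigma_k$
coordinates $y_k^{(j)}$, $j\le\sigma_k$. It is submersive, because every vector is the $x$-component
of a tangent vector of $\mathfrak X_0$; so $n\le m+N$ always (`le_sum_colDegree`). If $n=m+N$, then
$f$ is a local diffeomorphism and its inverse carries the system to chains of integrators.
Conversely, a linearizable system can be brought to Brunovsky form with chain lengths $\sigma_k+1$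
of total $n$ (`exists_brunovsky`). The heads of the chains are the output of a trivialization with
column degrees at most $\sigma_k$, so $m+N\le n$ for this $N$; the general inequality then gives
both equality and minimality. -/

noncomputable section

set_option linter.unusedSectionVars false

/-! ### Differential calculus for maps on jets that depend on finitely many coordinates. -/

section JetMaps

variable {n m l : ℕ} {E E' : Type*} [NormedAddCommGroup E] [NormedSpace ℝ E]
  [CompleteSpace E] [NormedAddCommGroup E'] [NormedSpace ℝ E'] [CompleteSpace E']

theorem jetTrunc_add (k : ℕ) (x y : Jet n) : jetTrunc k (x + y) = jetTrunc k x + jetTrunc k y := rfl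

theorem jetTrunc_smul (k : ℕ) (c : ℝ) (x : Jet n) : jetTrunc k (c • x) = c • jetTrunc k x := rfl

/-- The jet whose first `k` blocks are `u`, the others being those of `x`. -/
def jetPad {k : ℕ} (x : Jet n) (u : Fin k → Fin n → ℝ) : Jet n :=
  fun j => if h : j < k then u ⟨j, h⟩ else x j

@[simp] theorem jetTrunc_jetPad {k : ℕ} (x : Jet n) (u : Fin k → Fin n → ℝ) :
    jetTrunc k (jetPad x u) = u := by
  funext j; simp [jetTrunc, jetPad]

@[simp] theorem jetPad_jetTrunc {k : ℕ} (x : Jet n) : jetPad x (jetTrunc k x) = x := by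
  funext j; by_cases h : j < k <;> simp [jetTrunc, jetPad, h]

theorem continuous_jetPad {k : ℕ} (x : Jet n) : Continuous (jetPad (k := k) x) := by
  refine continuous_pi fun j => ?_
  by_cases h : j < k
  · simpa [jetPad, h] using continuous_apply _
  · simpa [jetPad, h] using continuous_const

theorem tendsto_jetPad {k : ℕ} (x : Jet n) : Tendsto (jetPad x) (𝓝 (jetTrunc k x)) (𝓝 x) := by
  simpa using (continuous_jetPad (k := k) x).tendsto (jetTrunc k x)

/-- The shifted jet `(ẋ, ẍ, …)`: the value of the Cartan field. -/
def jetShift (x : Jet n) : Jet n := fun j => x (j + 1)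

/-- Analyticity of a map from jets to a normed space: locally, an analytic function of finitely
many blocks. -/
def JetMapAnalyticAt (f : Jet n → E) (x : Jet n) : Prop :=
  ∃ (k : ℕ) (g : (Fin k → Fin n → ℝ) → E),
    AnalyticAt ℝ g (jetTrunc k x) ∧ f =ᶠ[𝓝 x] fun z => g (jetTrunc k z)

theorem JetAnalyticAt.toMap {f : Jet n → ℝ} {x : Jet n} (h : JetAnalyticAt f x) :
    JetMapAnalyticAt f x := h

theorem JetMapAnalyticAt.toFun {f : Jet n → ℝ} {x : Jet n} (h : JetMapAnalyticAt f x) :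
    JetAnalyticAt f x := h

namespace JetMapAnalyticAt

theorem lift {f : Jet n → E} {x : Jet n} (h : JetMapAnalyticAt f x) :
    ∃ k₀ : ℕ, ∀ k, k₀ ≤ k → ∃ g : (Fin k → Fin n → ℝ) → E,
      AnalyticAt ℝ g (jetTrunc k x) ∧ f =ᶠ[𝓝 x] fun z => g (jetTrunc k z) := by
  obtain ⟨k₀, g, hg, hf⟩ := h
  refine ⟨k₀, fun k hk => ⟨fun z => g (fun j => z (Fin.castLE hk j)), ?_, hf⟩⟩
  let T : (Fin k → Fin n → ℝ) →L[ℝ] (Fin k₀ → Fin n → ℝ) :=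
    ContinuousLinearMap.pi fun j => ContinuousLinearMap.proj (Fin.castLE hk j)
  exact AnalyticAt.comp (g := g) (f := T) hg (T.analyticAt _)

theorem congr {f g : Jet n → E} {x : Jet n} (h : JetMapAnalyticAt f x) (hfg : f =ᶠ[𝓝 x] g) :
    JetMapAnalyticAt g x := by
  obtain ⟨k, u, hu, hf⟩ := h
  exact ⟨k, u, hu, hfg.symm.trans hf⟩

theorem trunc (k : ℕ) (x : Jet n) : JetMapAnalyticAt (jetTrunc k) x :=
  ⟨k, id, analyticAt_id, EventuallyEq.rfl⟩

theorem comp_analytic {f : Jet n → E} {x : Jet n} {h : E → E'} (hh : AnalyticAt ℝ h (f x))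
    (hf : JetMapAnalyticAt f x) : JetMapAnalyticAt (fun z => h (f z)) x := by
  obtain ⟨k, g, hg, hfg⟩ := hf
  rw [hfg.eq_of_nhds] at hh
  exact ⟨k, fun u => h (g u), hh.comp hg, hfg.mono fun z hz => congrArg h hz⟩

theorem clm (L : E →L[ℝ] E') {f : Jet n → E} {x : Jet n} (hf : JetMapAnalyticAt f x) :
    JetMapAnalyticAt (fun z => L (f z)) x :=
  comp_analytic (L.analyticAt _) hf

theorem prodMk {f : Jet n → E} {g : Jet n → E'} {x : Jet n} (hf : JetMapAnalyticAt f x)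
    (hg : JetMapAnalyticAt g x) : JetMapAnalyticAt (fun z => (f z, g z)) x := by
  obtain ⟨k, hk⟩ := hf.lift
  obtain ⟨l, hl⟩ := hg.lift
  obtain ⟨u, hu, hfu⟩ := hk (max k l) (le_max_left _ _)
  obtain ⟨v, hv, hgv⟩ := hl (max k l) (le_max_right _ _)
  refine ⟨_, fun z => (u z, v z), hu.prod hv, ?_⟩
  filter_upwards [hfu, hgv] with z h1 h2
  rw [h1, h2]

theorem pi {ι : Type*} [Fintype ι] {G : ι → Type*} [∀ i, NormedAddCommGroup (G i)]
    [∀ i, NormedSpace ℝ (G i)] [∀ i, CompleteSpace (G i)] {f : ∀ i, Jet n → G i} {x : Jet n}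
    (hf : ∀ i, JetMapAnalyticAt (f i) x) : JetMapAnalyticAt (fun z i => f i z) x := by
  choose k hk using fun i => (hf i).lift
  choose g hg hfg using fun i => hk i (Finset.univ.sup k) (Finset.le_sup (Finset.mem_univ i))
  refine ⟨_, fun u i => g i u, AnalyticAt.pi hg, ?_⟩
  filter_upwards [eventually_all.mpr hfg] with z hz
  funext i; exact hz i

theorem apply {ι : Type*} [Fintype ι] {f : Jet n → ι → ℝ} {x : Jet n}
    (hf : JetMapAnalyticAt f x) (i : ι) : JetAnalyticAt (fun z => f z i) x :=
  clm (ContinuousLinearMap.proj (R := ℝ) (φ := fun _ : ι => ℝ) i) hf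

theorem block (j : ℕ) (x : Jet n) : JetMapAnalyticAt (fun z : Jet n => z j) x :=
  pi fun i => (JetAnalyticAt.coord j i x).toMap

theorem continuousAt {f : Jet n → E} {x : Jet n} (h : JetMapAnalyticAt f x) :
    ContinuousAt f x := by
  obtain ⟨k, g, hg, hf⟩ := h
  exact (ContinuousAt.comp (f := jetTrunc k) hg.continuousAt
    (jetTrunc_continuous k).continuousAt).congr hf.symm

theorem eventually {f : Jet n → E} {x : Jet n} (h : JetMapAnalyticAt f x) :
    ∀ᶠ z in 𝓝 x, JetMapAnalyticAt f z := by
  obtain ⟨k, g, hg, hf⟩ := h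
  filter_upwards [(jetTrunc_continuous k).continuousAt.eventually hg.eventually_analyticAt,
    eventually_eventually_nhds.mpr hf] with z h1 h2
  exact ⟨k, g, h1, h2⟩

theorem hasLineDerivAt_of_eq {k : ℕ} {f : Jet n → E} {g : (Fin k → Fin n → ℝ) → E} {x : Jet n}
    (hg : AnalyticAt ℝ g (jetTrunc k x)) (hf : f =ᶠ[𝓝 x] fun z => g (jetTrunc k z)) :
    ∀ᶠ z in 𝓝 x, ∀ v, HasLineDerivAt ℝ f (fderiv ℝ g (jetTrunc k z) (jetTrunc k v)) z v := by
  have h1 : ∀ᶠ z in 𝓝 x, AnalyticAt ℝ g (jetTrunc k z) :=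
    (jetTrunc_continuous k).continuousAt.eventually hg.eventually_analyticAt
  filter_upwards [h1, eventually_eventually_nhds.mpr hf] with z hz hfz v
  have h2 : HasLineDerivAt ℝ g (fderiv ℝ g (jetTrunc k z) (jetTrunc k v)) (jetTrunc k z)
      (jetTrunc k v) := hz.differentiableAt.hasFDerivAt.hasLineDerivAt _
  exact HasDerivAt.congr_of_eventuallyEq h2 ((jet_line_tendsto z v).eventually hfz)

theorem hasLineDerivAt {f : Jet n → E} {x : Jet n} (h : JetMapAnalyticAt f x) (v : Jet n) :
    HasLineDerivAt ℝ f (lineDeriv ℝ f x v) x v := by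
  obtain ⟨k, g, hg, hf⟩ := h
  exact ((hasLineDerivAt_of_eq hg hf).self_of_nhds v).lineDifferentiableAt.hasLineDerivAt

theorem lineDeriv_add {f : Jet n → E} {x : Jet n} (h : JetMapAnalyticAt f x) (v w : Jet n) :
    lineDeriv ℝ f x (v + w) = lineDeriv ℝ f x v + lineDeriv ℝ f x w := by
  obtain ⟨k, g, hg, hf⟩ := h
  have := (hasLineDerivAt_of_eq hg hf).self_of_nhds
  rw [(this _).lineDeriv, (this v).lineDeriv, (this w).lineDeriv, jetTrunc_add, map_add]

theorem lineDeriv_smul {f : Jet n → E} {x : Jet n} (h : JetMapAnalyticAt f x) (c : ℝ)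
    (v : Jet n) : lineDeriv ℝ f x (c • v) = c • lineDeriv ℝ f x v := by
  obtain ⟨k, g, hg, hf⟩ := h
  have := (hasLineDerivAt_of_eq hg hf).self_of_nhds
  rw [(this _).lineDeriv, (this v).lineDeriv, jetTrunc_smul, map_smul]

theorem lineDeriv_sub {f : Jet n → E} {x : Jet n} (h : JetMapAnalyticAt f x) (v w : Jet n) :
    lineDeriv ℝ f x (v - w) = lineDeriv ℝ f x v - lineDeriv ℝ f x w := by
  have h1 := h.lineDeriv_add v ((-1 : ℝ) • w)
  rw [h.lineDeriv_smul] at h1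
  simpa [sub_eq_add_neg] using h1

theorem lineDeriv_zero {f : Jet n → E} {x : Jet n} (h : JetMapAnalyticAt f x) :
    lineDeriv ℝ f x 0 = 0 := by
  simpa using h.lineDeriv_smul 0 0

theorem lineDeriv_sum {f : Jet n → E} {x : Jet n} (h : JetMapAnalyticAt f x) {ι : Type*}
    (s : Finset ι) (v : ι → Jet n) :
    lineDeriv ℝ f x (∑ i ∈ s, v i) = ∑ i ∈ s, lineDeriv ℝ f x (v i) := by
  classical
  induction s using Finset.induction_on with
  | empty => simpa using h.lineDeriv_zero
  | insert a s ha ih => rw [Finset.sum_insert ha, Finset.sum_insert ha, h.lineDeriv_add, ih]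

/-- Locally, only finitely many blocks of a vector contribute to a derivative. -/
theorem lineDeriv_eq_zero {f : Jet n → E} {x : Jet n} (h : JetMapAnalyticAt f x) :
    ∃ k, ∀ᶠ z in 𝓝 x, ∀ v, jetTrunc k v = 0 → lineDeriv ℝ f z v = 0 := by
  obtain ⟨k, g, hg, hf⟩ := h
  refine ⟨k, ?_⟩
  filter_upwards [hasLineDerivAt_of_eq hg hf] with z hz v hv
  rw [(hz v).lineDeriv, hv, map_zero]

theorem lineDeriv_comp_analytic {f : Jet n → E} {x : Jet n} {h : E → E'}
    (hh : DifferentiableAt ℝ h (f x)) (hf : JetMapAnalyticAt f x) (v : Jet n) :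
    lineDeriv ℝ (fun z => h (f z)) x v = fderiv ℝ h (f x) (lineDeriv ℝ f x v) := by
  have h1 : HasDerivAt (fun t : ℝ => f (x + t • v)) (lineDeriv ℝ f x v) 0 := hf.hasLineDerivAt v
  have h2 : HasFDerivAt h (fderiv ℝ h (f x)) (f (x + (0 : ℝ) • v)) := by
    simpa using hh.hasFDerivAt
  exact HasLineDerivAt.lineDeriv (h2.comp_hasDerivAt 0 h1)

theorem lineDeriv_clm (L : E →L[ℝ] E') {f : Jet n → E} {x : Jet n} (hf : JetMapAnalyticAt f x)
    (v : Jet n) : lineDeriv ℝ (fun z => L (f z)) x v = L (lineDeriv ℝ f x v) := by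
  rw [lineDeriv_comp_analytic L.differentiableAt hf, L.fderiv]

theorem lineDeriv_prodMk {f : Jet n → E} {g : Jet n → E'} {x : Jet n}
    (hf : JetMapAnalyticAt f x) (hg : JetMapAnalyticAt g x) (v : Jet n) :
    lineDeriv ℝ (fun z => (f z, g z)) x v = (lineDeriv ℝ f x v, lineDeriv ℝ g x v) :=
  HasLineDerivAt.lineDeriv (HasDerivAt.prodMk (hf.hasLineDerivAt v) (hg.hasLineDerivAt v))

theorem lineDeriv_pi {ι : Type*} [Fintype ι] {G : ι → Type*} [∀ i, NormedAddCommGroup (G i)]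
    [∀ i, NormedSpace ℝ (G i)] [∀ i, CompleteSpace (G i)] {f : ∀ i, Jet n → G i} {x : Jet n}
    (hf : ∀ i, JetMapAnalyticAt (f i) x) (v : Jet n) :
    lineDeriv ℝ (fun z i => f i z) x v = fun i => lineDeriv ℝ (f i) x v :=
  HasLineDerivAt.lineDeriv (hasDerivAt_pi.mpr fun i => (hf i).hasLineDerivAt v)

theorem lineDeriv_apply {ι : Type*} [Fintype ι] {f : Jet n → ι → ℝ} {x : Jet n}
    (hf : JetMapAnalyticAt f x) (i : ι) (v : Jet n) :
    lineDeriv ℝ (fun z => f z i) x v = lineDeriv ℝ f x v i :=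
  lineDeriv_clm (ContinuousLinearMap.proj (R := ℝ) (φ := fun _ : ι => ℝ) i) hf v

theorem lineDeriv_trunc (k : ℕ) (x v : Jet n) :
    lineDeriv ℝ (jetTrunc (n := n) k) x v = jetTrunc k v := by
  have h : HasDerivAt (fun t : ℝ => jetTrunc k x + t • jetTrunc k v) (jetTrunc k v) 0 := by
    simpa using ((hasDerivAt_id (0 : ℝ)).smul_const (jetTrunc k v)).const_add (jetTrunc k x)
  exact HasLineDerivAt.lineDeriv h

theorem lineDeriv_block (j : ℕ) (x v : Jet n) :
    lineDeriv ℝ (fun z : Jet n => z j) x v = v j := by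
  have h : HasDerivAt (fun t : ℝ => x j + t • v j) (v j) 0 := by
    simpa using ((hasDerivAt_id (0 : ℝ)).smul_const (v j)).const_add (x j)
  exact HasLineDerivAt.lineDeriv h

theorem lineDeriv_coord (j : ℕ) (i : Fin n) (x v : Jet n) :
    lineDeriv ℝ (fun z : Jet n => z j i) x v = v j i := by
  rw [lineDeriv_apply (block j x), lineDeriv_block]

theorem lineDeriv_left {f : Jet n → E} {x : Jet n} (h : JetMapAnalyticAt f x) (v : Jet n) :
    JetMapAnalyticAt (fun z => lineDeriv ℝ f z v) x := by
  obtain ⟨k, g, hg, hf⟩ := h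
  refine ⟨k, fun y => fderiv ℝ g y (jetTrunc k v), ?_, ?_⟩
  · exact ((ContinuousLinearMap.apply ℝ E (jetTrunc k v)).analyticAt _).comp hg.fderiv
  · filter_upwards [hasLineDerivAt_of_eq hg hf] with z hz
    exact (hz _).lineDeriv

end JetMapAnalyticAt

theorem JetAnalyticAt.sub {f g : Jet n → ℝ} {x : Jet n} (hf : JetAnalyticAt f x)
    (hg : JetAnalyticAt g x) : JetAnalyticAt (fun z => f z - g z) x :=
  ((hf.add ((JetAnalyticAt.const (-1) x).mul hg))).congr
    (Eventually.of_forall fun z => by ring)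

theorem JetAnalyticAt.lineDeriv_mul {f g : Jet n → ℝ} {x : Jet n} (hf : JetAnalyticAt f x)
    (hg : JetAnalyticAt g x) (v : Jet n) :
    lineDeriv ℝ (fun z => f z * g z) x v = lineDeriv ℝ f x v * g x + f x * lineDeriv ℝ g x v := by
  have h := HasDerivAt.mul (hf.toMap.hasLineDerivAt v) (hg.toMap.hasLineDerivAt v)
  simp only [zero_smul, add_zero] at h
  exact HasLineDerivAt.lineDeriv h

theorem JetAnalyticAt.lineDeriv_fun_sum {ι : Type*} (s : Finset ι) {f : ι → Jet n → ℝ} {x : Jet n}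
    (hf : ∀ i ∈ s, JetAnalyticAt (f i) x) (v : Jet n) :
    lineDeriv ℝ (fun z => ∑ i ∈ s, f i z) x v = ∑ i ∈ s, lineDeriv ℝ (f i) x v := by
  have h : HasDerivAt (fun t : ℝ => ∑ i ∈ s, f i (x + t • v)) (∑ i ∈ s, lineDeriv ℝ (f i) x v) 0 :=
    HasDerivAt.fun_sum fun i hi => (hf i hi).toMap.hasLineDerivAt v
  exact HasLineDerivAt.lineDeriv h

theorem jetMap_lineDeriv_congr {f g : Jet n → E} {z : Jet n} (h : f =ᶠ[𝓝 z] g) (v : Jet n) :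
    lineDeriv ℝ f z v = lineDeriv ℝ g z v :=
  EventuallyEq.deriv_eq ((jet_line_tendsto z v).eventually h)

/-- The components of a map between jet spaces are analytic at `x`. -/
def JetFieldAnalyticAt (Φ : Jet n → Jet m) (x : Jet n) : Prop :=
  ∀ j i, JetAnalyticAt (fun z => Φ z j i) x

/-- The differential at `x` of a map between jet spaces. -/
def jetDiff (Φ : Jet n → Jet m) (x v : Jet n) : Jet m := fun j i => lineDeriv ℝ (fun z => Φ z j i) x v

namespace JetFieldAnalyticAt

theorem blockMap {Φ : Jet n → Jet m} {x : Jet n} (h : JetFieldAnalyticAt Φ x) (j : ℕ) :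
    JetMapAnalyticAt (fun z => Φ z j) x :=
  JetMapAnalyticAt.pi fun i => (h j i).toMap

theorem truncMap {Φ : Jet n → Jet m} {x : Jet n} (h : JetFieldAnalyticAt Φ x) (k : ℕ) :
    JetMapAnalyticAt (fun z => jetTrunc k (Φ z)) x :=
  JetMapAnalyticAt.pi fun j : Fin k => h.blockMap (j : ℕ)

theorem lineDeriv_blockMap {Φ : Jet n → Jet m} {x : Jet n} (h : JetFieldAnalyticAt Φ x) (j : ℕ)
    (v : Jet n) : lineDeriv ℝ (fun z => Φ z j) x v = jetDiff Φ x v j :=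
  JetMapAnalyticAt.lineDeriv_pi (f := fun i z => Φ z j i) (fun i => (h j i).toMap) v

theorem lineDeriv_truncMap {Φ : Jet n → Jet m} {x : Jet n} (h : JetFieldAnalyticAt Φ x) (k : ℕ)
    (v : Jet n) : lineDeriv ℝ (fun z => jetTrunc k (Φ z)) x v = jetTrunc k (jetDiff Φ x v) := by
  refine (JetMapAnalyticAt.lineDeriv_pi (f := fun (j : Fin k) z => Φ z j)
    (fun j => h.blockMap (j : ℕ)) v).trans ?_
  funext j
  exact h.lineDeriv_blockMap _ _

theorem continuousAt {Φ : Jet n → Jet m} {x : Jet n} (h : JetFieldAnalyticAt Φ x) :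
    ContinuousAt Φ x :=
  continuousAt_pi.mpr fun j => (h.blockMap j).continuousAt

theorem comp_map {Φ : Jet n → Jet m} {x : Jet n} (h : JetFieldAnalyticAt Φ x) {f : Jet m → E}
    (hf : JetMapAnalyticAt f (Φ x)) : JetMapAnalyticAt (fun z => f (Φ z)) x := by
  obtain ⟨k, g, hg, hfg⟩ := hf
  have e : (fun z => f (Φ z)) =ᶠ[𝓝 x] fun z => g (jetTrunc k (Φ z)) :=
    h.continuousAt.eventually hfg
  exact (JetMapAnalyticAt.comp_analytic (f := fun z => jetTrunc k (Φ z)) hg (h.truncMap k)).congr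
    e.symm

theorem comp_fun {Φ : Jet n → Jet m} {x : Jet n} (h : JetFieldAnalyticAt Φ x) {f : Jet m → ℝ}
    (hf : JetAnalyticAt f (Φ x)) : JetAnalyticAt (fun z => f (Φ z)) x :=
  h.comp_map hf.toMap

theorem lineDeriv_comp {Φ : Jet n → Jet m} {x : Jet n} (h : JetFieldAnalyticAt Φ x)
    {f : Jet m → E} (hf : JetMapAnalyticAt f (Φ x)) (v : Jet n) :
    lineDeriv ℝ (fun z => f (Φ z)) x v = lineDeriv ℝ f (Φ x) (jetDiff Φ x v) := by
  obtain ⟨k, g, hg, hfg⟩ := hf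
  rw [jetMap_lineDeriv_congr (g := fun z => g (jetTrunc k (Φ z))) (h.continuousAt.eventually hfg)]
  rw [JetMapAnalyticAt.lineDeriv_comp_analytic (f := fun z => jetTrunc k (Φ z))
    hg.differentiableAt (h.truncMap k), h.lineDeriv_truncMap,
    ((JetMapAnalyticAt.hasLineDerivAt_of_eq hg hfg).self_of_nhds _).lineDeriv]

end JetFieldAnalyticAt

theorem jetShift_analytic (x : Jet n) : JetFieldAnalyticAt (jetShift (n := n)) x :=
  fun j i => JetAnalyticAt.coord (j + 1) i x

theorem jetDiff_jetShift (x v : Jet n) : jetDiff (jetShift (n := n)) x v = jetShift v := by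
  funext j i; exact JetMapAnalyticAt.lineDeriv_coord (j + 1) i x v

/-- The derivative of `f` along the vector field `ξ`. -/
def lieAlong (ξ : Jet n → Jet n) (f : Jet n → E) : Jet n → E := fun x => lineDeriv ℝ f x (ξ x)

/-- A vector as the finite sum of its coordinate vectors, up to a vector with no low blocks. -/
theorem jetTrunc_sum_jetBasis (k : ℕ) (v : Jet n) :
    jetTrunc k (v - ∑ p ∈ (Finset.range k ×ˢ Finset.univ : Finset (ℕ × Fin n)),
      v p.1 p.2 • jetBasis p) = 0 := by
  funext j i
  have : ∑ p ∈ (Finset.range k ×ˢ Finset.univ : Finset (ℕ × Fin n)),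
      v p.1 p.2 * (jetBasis p : Jet n) j i = v j i := by
    rw [Finset.sum_eq_single ((j : ℕ), i)]
    · simp [jetBasis]
    · rintro ⟨a, b⟩ - hab
      by_cases h : a = j
      · subst h
        have : b ≠ i := fun h => hab (by rw [h])
        simp [jetBasis, Ne.symm this]
      · simp [jetBasis, Ne.symm h]
    · simp
  simp [jetTrunc, Finset.sum_apply, this]

theorem JetAnalyticAt.lineDeriv_eq_sum {f : Jet n → ℝ} {x : Jet n} (h : JetAnalyticAt f x) :
    ∃ k₀ : ℕ, ∀ᶠ z in 𝓝 x, (∀ p : ℕ × Fin n, k₀ ≤ p.1 → jetPartial p f z = 0) ∧ ∀ k, k₀ ≤ k → ∀ v,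
      lineDeriv ℝ f z v = ∑ p ∈ (Finset.range k ×ˢ Finset.univ : Finset (ℕ × Fin n)),
        v p.1 p.2 * jetPartial p f z := by
  obtain ⟨k₀, hk₀⟩ := h.toMap.lineDeriv_eq_zero
  refine ⟨k₀, ?_⟩
  filter_upwards [hk₀, h.toMap.eventually] with z hz hfz
  refine ⟨fun p hp => hz _ (jetTrunc_jetBasis_eq_zero hp), fun k hk v => ?_⟩
  have h0 : jetTrunc k₀ (v - ∑ p ∈ (Finset.range k ×ˢ Finset.univ : Finset (ℕ × Fin n)),
      v p.1 p.2 • jetBasis p) = 0 := by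
    funext j
    exact congrFun (jetTrunc_sum_jetBasis k v) (Fin.castLE hk j)
  have h1 := hz _ h0
  rw [hfz.lineDeriv_sub, hfz.lineDeriv_sum, sub_eq_zero] at h1
  rw [h1]
  exact Finset.sum_congr rfl fun p _ => hfz.lineDeriv_smul _ _

theorem JetAnalyticAt.lieAlong {f : Jet n → ℝ} {x : Jet n} {ξ : Jet n → Jet n}
    (h : JetAnalyticAt f x) (hξ : JetFieldAnalyticAt ξ x) : JetAnalyticAt (lieAlong ξ f) x := by
  obtain ⟨k, hk⟩ := h.lineDeriv_eq_sum
  refine JetAnalyticAt.congr (f := fun z => ∑ p ∈ (Finset.range k ×ˢ Finset.univ :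
    Finset (ℕ × Fin n)), ξ z p.1 p.2 * jetPartial p f z) ?_ ?_
  · exact JetAnalyticAt.sum _ fun p _ => (hξ _ _).mul (h.partialDeriv p)
  · filter_upwards [hk] with z hz
    exact (hz.2 k le_rfl _).symm

/-- The sum defining `lieTau` is finite for a function of finitely many coordinates, so it is the
directional derivative along the shifted jet. This gives access to the chain rule for the Cartan
field. -/
theorem lieTau_eq_lieAlong {f : Jet n → ℝ} {x : Jet n} (h : JetAnalyticAt f x) :
    lieTau f x = lineDeriv ℝ f x (jetShift x) := by
  obtain ⟨k, hk⟩ := h.lineDeriv_eq_sum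
  have hx := hk.self_of_nhds
  rw [hx.2 k le_rfl, lieTau]
  exact finsum_eq_sum_of_support_subset _ (lieTau_finite hx.1)

/-- The derivative of `L_ξ f` in the direction `v`. -/
theorem lineDeriv_lieAlong {f : Jet n → E} {ξ : Jet n → Jet n} {x : Jet n}
    (hf : JetMapAnalyticAt f x) (hξ : JetFieldAnalyticAt ξ x) (v : Jet n) :
    lineDeriv ℝ (lieAlong ξ f) x v =
      lieAlong ξ (fun z => lineDeriv ℝ f z v) x + lineDeriv ℝ f x (jetDiff ξ x v) := by
  obtain ⟨k, g, hg, hfg⟩ := hf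
  have hd := JetMapAnalyticAt.hasLineDerivAt_of_eq hg hfg
  have e1 : lieAlong ξ f =ᶠ[𝓝 x] fun z => fderiv ℝ g (jetTrunc k z) (jetTrunc k (ξ z)) :=
    hd.mono fun z hz => (hz _).lineDeriv
  have e2 : (fun z => lineDeriv ℝ f z v) =ᶠ[𝓝 x]
      fun z => fderiv ℝ g (jetTrunc k z) (jetTrunc k v) :=
    hd.mono fun z hz => (hz _).lineDeriv
  have hg2 : DifferentiableAt ℝ (fderiv ℝ g) (jetTrunc k x) := hg.fderiv.differentiableAt
  have hT : ∀ w : Jet n, HasDerivAt (fun t : ℝ => fderiv ℝ g (jetTrunc k (x + t • w)))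
      (fderiv ℝ (fderiv ℝ g) (jetTrunc k x) (jetTrunc k w)) 0 := by
    intro w
    have h1 : HasDerivAt (fun t : ℝ => jetTrunc k x + t • jetTrunc k w) (jetTrunc k w) 0 := by
      simpa using ((hasDerivAt_id (0 : ℝ)).smul_const (jetTrunc k w)).const_add (jetTrunc k x)
    have h2 : HasFDerivAt (fderiv ℝ g) (fderiv ℝ (fderiv ℝ g) (jetTrunc k x))
        (jetTrunc k (x + (0 : ℝ) • w)) := by simpa using hg2.hasFDerivAt
    exact h2.comp_hasDerivAt 0 h1
  have d1 : HasLineDerivAt ℝ (fun z => fderiv ℝ g (jetTrunc k z) (jetTrunc k (ξ z)))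
      (fderiv ℝ (fderiv ℝ g) (jetTrunc k x) (jetTrunc k v) (jetTrunc k (ξ x)) +
        fderiv ℝ g (jetTrunc k x) (jetTrunc k (jetDiff ξ x v))) x v := by
    have h3 : HasDerivAt (fun t : ℝ => jetTrunc k (ξ (x + t • v)))
        (jetTrunc k (jetDiff ξ x v)) 0 := by
      have := (hξ.truncMap k).hasLineDerivAt v
      rwa [hξ.lineDeriv_truncMap] at this
    have := (hT v).clm_apply h3
    simp only [zero_smul, add_zero] at this
    exact this
  have d2 : HasLineDerivAt ℝ (fun z => fderiv ℝ g (jetTrunc k z) (jetTrunc k v))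
      (fderiv ℝ (fderiv ℝ g) (jetTrunc k x) (jetTrunc k (ξ x)) (jetTrunc k v)) x (ξ x) := by
    have := (hT (ξ x)).clm_apply (hasDerivAt_const (0 : ℝ) (jetTrunc k v))
    simp only [zero_smul, add_zero, map_zero] at this
    exact this
  rw [jetMap_lineDeriv_congr e1, d1.lineDeriv, lieAlong, jetMap_lineDeriv_congr e2, d2.lineDeriv,
    (hd.self_of_nhds _).lineDeriv]
  -- What remains is the second derivative of `g` with $v$ and $\xi(x)$ interchanged; it is
  -- symmetric because `g` is analytic.
  congr 1
  exact (hg.contDiffAt.isSymmSndFDerivAt_of_omega).eq _ _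

theorem JetAnalyticAt.lieTau_eventuallyEq {f : Jet n → ℝ} {x : Jet n} (h : JetAnalyticAt f x) :
    _root_.lieTau f =ᶠ[𝓝 x] _root_.lieAlong jetShift f :=
  h.toMap.eventually.mono fun _ hz => lieTau_eq_lieAlong hz

/-- The commutation of $d$ with $L_\tau$: the Cartan field is linear in the jet, so its differential
is again the shift. -/
theorem lineDeriv_lieTau {f : Jet n → ℝ} {x : Jet n} (hf : JetAnalyticAt f x) (v : Jet n) :
    lineDeriv ℝ (lieTau f) x v =
      lieTau (fun z => lineDeriv ℝ f z v) x + lineDeriv ℝ f x (jetShift v) := by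
  rw [jetMap_lineDeriv_congr hf.lieTau_eventuallyEq,
    lineDeriv_lieAlong hf.toMap (jetShift_analytic x), jetDiff_jetShift,
    lieTau_eq_lieAlong (hf.toMap.lineDeriv_left v).toFun]
  rfl

/-- Lie derivatives along related vector fields. -/
theorem lieAlong_comp {Φ : Jet n → Jet m} {ξ : Jet n → Jet n} {ζ : Jet m → Jet m} {x : Jet n}
    (h : JetFieldAnalyticAt Φ x) (hrel : jetDiff Φ x (ξ x) = ζ (Φ x)) {f : Jet m → E}
    (hf : JetMapAnalyticAt f (Φ x)) :
    lieAlong ξ (fun z => f (Φ z)) x = lieAlong ζ f (Φ x) := by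
  rw [lieAlong, h.lineDeriv_comp hf, hrel, lieAlong]

theorem JetAnalyticAt.iterate_lieTau {f : Jet n → ℝ} {x : Jet n} (h : JetAnalyticAt f x) (k : ℕ) :
    JetAnalyticAt (_root_.lieTau^[k] f) x := by
  induction k with
  | zero => exact h
  | succ k ih => rw [Function.iterate_succ_apply']; exact ih.lieTau

theorem JetAnalyticAt.eventually_at {f : Jet n → ℝ} {x : Jet n} (h : JetAnalyticAt f x) :
    ∀ᶠ z in 𝓝 x, JetAnalyticAt f z := h.toMap.eventually

end JetMaps

/-! ### The chart of $F=0$ and the retraction onto $\mathfrak X_0$. -/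

section Chart

variable {n m : ℕ} {F : (Fin n → ℝ) × (Fin n → ℝ) → Fin (n - m) → ℝ} {x₀ : Jet n}

/-- The standing assumptions on the implicit system at the base point. -/
structure RegularSystemAt (F : (Fin n → ℝ) × (Fin n → ℝ) → Fin (n - m) → ℝ) (x₀ : Jet n) :
    Prop where
  analytic : AnalyticAt ℝ F (x₀ 0, x₀ 1)
  surj : Function.Surjective (fderiv ℝ (fun v => F (x₀ 0, v)) (x₀ 1))
  mem : x₀ ∈ solSet F

/-- The partial derivative `∂F/∂ẋ`. -/
def velDeriv (F : (Fin n → ℝ) × (Fin n → ℝ) → Fin (n - m) → ℝ) (p : (Fin n → ℝ) × (Fin n → ℝ)) :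
    (Fin n → ℝ) →L[ℝ] (Fin (n - m) → ℝ) :=
  (fderiv ℝ F p).comp (ContinuousLinearMap.inr ℝ _ _)

theorem velDeriv_apply (p : (Fin n → ℝ) × (Fin n → ℝ)) (v : Fin n → ℝ) :
    velDeriv F p v = fderiv ℝ F p (0, v) := rfl

theorem RegularSystemAt.velDeriv_eq (h : RegularSystemAt F x₀) :
    fderiv ℝ (fun v => F (x₀ 0, v)) (x₀ 1) = velDeriv F (x₀ 0, x₀ 1) := by
  have h1 : HasFDerivAt (fun v : Fin n → ℝ => ((x₀ 0, v) : (Fin n → ℝ) × (Fin n → ℝ)))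
      (ContinuousLinearMap.inr ℝ _ _) (x₀ 1) := hasFDerivAt_prodMk_right _ _
  exact (h.analytic.differentiableAt.hasFDerivAt.comp (x₀ 1) h1).fderiv

theorem velDeriv_analyticAt {p : (Fin n → ℝ) × (Fin n → ℝ)} (h : AnalyticAt ℝ F p) :
    AnalyticAt ℝ (velDeriv F) p :=
  AnalyticAt.comp (((ContinuousLinearMap.compL ℝ (Fin n → ℝ) ((Fin n → ℝ) × (Fin n → ℝ))
    (Fin (n - m) → ℝ)).flip (ContinuousLinearMap.inr ℝ _ _)).analyticAt _) h.fderiv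

/-- A right inverse `L` of `∂F/∂ẋ` at the base point. -/
theorem RegularSystemAt.exists_rightInverse (h : RegularSystemAt F x₀) :
    ∃ L : (Fin (n - m) → ℝ) →L[ℝ] (Fin n → ℝ), ∀ u, velDeriv F (x₀ 0, x₀ 1) (L u) = u := by
  have hs : Function.Surjective (velDeriv F (x₀ 0, x₀ 1)) := h.velDeriv_eq ▸ h.surj
  obtain ⟨L, hL⟩ := (velDeriv F (x₀ 0, x₀ 1)).toLinearMap.exists_rightInverse_of_surjective
    (LinearMap.range_eq_top.mpr hs)
  exact ⟨LinearMap.toContinuousLinearMap L, fun u => LinearMap.congr_fun hL u⟩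

/-- The local description of `F(x, ẋ) = 0` as a graph `ẋ = g(x, π ẋ)`. -/
structure SolChart (F : (Fin n → ℝ) × (Fin n → ℝ) → Fin (n - m) → ℝ) (x₀ : Jet n) where
  L : (Fin (n - m) → ℝ) →L[ℝ] (Fin n → ℝ)
  pr : (Fin n → ℝ) →L[ℝ] (Fin n → ℝ)
  g : (Fin n → ℝ) × (Fin n → ℝ) → Fin n → ℝ
  L_right : ∀ u, velDeriv F (x₀ 0, x₀ 1) (L u) = u
  pr_eq : ∀ v, pr v = v - L (velDeriv F (x₀ 0, x₀ 1) v)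
  g_analytic : AnalyticAt ℝ g (x₀ 0, x₀ 1)
  g_base : g (x₀ 0, x₀ 1) = x₀ 1
  g_sol : ∀ᶠ p in 𝓝 (x₀ 0, x₀ 1), F (p.1, g p) = 0 ∧ pr (g p) = pr p.2
  g_unique : ∀ᶠ p in 𝓝 (x₀ 0, x₀ 1), F p = 0 → g p = p.2

theorem RegularSystemAt.base_eq_zero (h : RegularSystemAt F x₀) : F (x₀ 0, x₀ 1) = 0 := by
  funext i; exact h.mem 0 i

/-- The inverse function theorem for $(x,\dot x)\mapsto(x,\,LF+\pi\dot x)$ with $\pi=1-LD$,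
$D=\partial F/\partial\dot x$ at the base point. Its derivative is unitriangular because $LD+\pi=1$.
The chart is the $\dot x$-component of the inverse at $(x,\pi\dot x)$. -/
theorem RegularSystemAt.nonempty_chart (h : RegularSystemAt F x₀) : Nonempty (SolChart F x₀) := by
  obtain ⟨L, hL⟩ := h.exists_rightInverse
  set D := velDeriv F (x₀ 0, x₀ 1) with hD
  set pr : (Fin n → ℝ) →L[ℝ] (Fin n → ℝ) := ContinuousLinearMap.id ℝ _ - L.comp D with hpr
  have hpr' : ∀ v, pr v = v - L (D v) := fun v => by simp [hpr]
  have hDpr : ∀ v, D (pr v) = 0 := fun v => by rw [hpr', map_sub, hL, sub_self]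
  let b : (Fin n → ℝ) × (Fin n → ℝ) := (x₀ 0, x₀ 1)
  let N : (Fin n → ℝ) × (Fin n → ℝ) → (Fin n → ℝ) × (Fin n → ℝ) :=
    fun p => (p.1, L (F p) + pr p.2)
  have hN : AnalyticAt ℝ N b :=
    analyticAt_fst.prod (((L.analyticAt _).comp h.analytic).add
      ((pr.analyticAt _).comp analyticAt_snd))
  let N' : ((Fin n → ℝ) × (Fin n → ℝ)) →L[ℝ] (Fin n → ℝ) × (Fin n → ℝ) :=
    (ContinuousLinearMap.fst ℝ _ _).prod
      (L.comp (fderiv ℝ F b) + pr.comp (ContinuousLinearMap.snd ℝ _ _))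
  have hN' : HasFDerivAt N N' b :=
    hasFDerivAt_fst.prodMk ((L.hasFDerivAt.comp b h.analytic.differentiableAt.hasFDerivAt).add
      (pr.hasFDerivAt.comp b hasFDerivAt_snd))
  have hsplit : ∀ v : (Fin n → ℝ) × (Fin n → ℝ),
      fderiv ℝ F b v = fderiv ℝ F b (v.1, 0) + D v.2 := by
    intro v
    rw [hD, velDeriv_apply, ← map_add]
    simp
  have hN'a : ∀ v, N' v = (v.1, L (fderiv ℝ F b (v.1, 0)) + v.2) := by
    intro v
    have : N' v = (v.1, L (fderiv ℝ F b v) + pr v.2) := rfl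
    rw [this, hsplit, hpr', map_add]
    congr 1; abel
  let N'e : ((Fin n → ℝ) × (Fin n → ℝ)) ≃L[ℝ] (Fin n → ℝ) × (Fin n → ℝ) :=
    ContinuousLinearEquiv.equivOfInverse N'
      ((ContinuousLinearMap.fst ℝ _ _).prod (ContinuousLinearMap.snd ℝ _ _ -
        L.comp ((fderiv ℝ F b).comp ((ContinuousLinearMap.inl ℝ _ _).comp
          (ContinuousLinearMap.fst ℝ _ _)))))
      (fun v => by rw [hN'a]; simp) (fun v => by rw [hN'a]; simp)
  have hN'' : HasFDerivAt N (N'e : _ →L[ℝ] _) b := hN'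
  have hc : ContDiffAt ℝ ⊤ N b := hN.contDiffAt
  let e := hc.toOpenPartialHomeomorph N hN'' (by simp)
  have he : ∀ p, e p = N p := fun p => rfl
  have hb : b ∈ e.source := hc.mem_toOpenPartialHomeomorph_source hN'' (by simp)
  have hNb : N b = (x₀ 0, pr (x₀ 1)) := by
    change (x₀ 0, L (F (x₀ 0, x₀ 1)) + pr (x₀ 1)) = _
    rw [h.base_eq_zero]; simp
  have hes : AnalyticAt ℝ e.symm (N b) := e.analyticAt_symm' hb hN hN''.fderiv
  let q : (Fin n → ℝ) × (Fin n → ℝ) →L[ℝ] (Fin n → ℝ) × (Fin n → ℝ) :=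
    (ContinuousLinearMap.fst ℝ _ _).prod (pr.comp (ContinuousLinearMap.snd ℝ _ _))
  have hqb : q b = N b := hNb.symm
  have hes' : AnalyticAt ℝ (fun p => e.symm (q p)) b :=
    AnalyticAt.fun_comp (hqb ▸ hes) (q.analyticAt _)
  have htar : ∀ᶠ p in 𝓝 b, q p ∈ e.target :=
    q.continuous.continuousAt.eventually (by
      rw [hqb]; exact e.open_target.mem_nhds (e.map_source hb))
  refine ⟨⟨L, pr, fun p => (e.symm (q p)).2, hL, hpr', analyticAt_snd.fun_comp hes', ?_, ?_, ?_⟩⟩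
  · change (e.symm (q b)).2 = _
    rw [hqb, ← he, e.left_inv hb]
  · filter_upwards [htar] with p hp
    have h1 : N (e.symm (q p)) = q p := e.right_inv hp
    have h2 : (e.symm (q p)).1 = p.1 := (Prod.ext_iff.mp h1).1
    have h3 : L (F (e.symm (q p))) + pr (e.symm (q p)).2 = pr p.2 := (Prod.ext_iff.mp h1).2
    -- Applying $D$ isolates $F$, since $DL=1$ and $D\pi=0$.
    have h4 : F (e.symm (q p)) = 0 := by
      have := congrArg D h3
      rwa [map_add, hDpr, hDpr, hL, add_zero] at this
    rw [← h2]
    exact ⟨h4, by simpa [h4] using h3⟩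
  · filter_upwards [e.open_source.mem_nhds hb] with p hp hFp
    have h1 : N p = q p := by
      change (p.1, L (F p) + pr p.2) = (p.1, pr p.2)
      rw [hFp]; simp
    rw [← h1, ← he, e.left_inv hp]

/-- The points `(x, ẋ)` at which the chart describes `F(x, ẋ) = 0`. -/
structure SolChart.Good (c : SolChart F x₀) (p : (Fin n → ℝ) × (Fin n → ℝ)) : Prop where
  F_analytic : AnalyticAt ℝ F p
  g_analytic : AnalyticAt ℝ c.g p
  g_sol : ∀ᶠ q in 𝓝 p, F (q.1, c.g q) = 0 ∧ c.pr (c.g q) = c.pr q.2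
  g_unique : F p = 0 → c.g p = p.2
  unit : IsUnit ((velDeriv F p).comp c.L)

/-- A vector in the kernel of $\pi$ lies in the range of $L$, and there $\partial F/\partial\dot x$
at $p$ is still injective because its product with $L$ is a unit. -/
theorem SolChart.Good.injective {c : SolChart F x₀} {p : (Fin n → ℝ) × (Fin n → ℝ)}
    (h : c.Good p) {v : Fin n → ℝ} (h1 : velDeriv F p v = 0) (h2 : c.pr v = 0) : v = 0 := by
  rw [c.pr_eq, sub_eq_zero] at h2
  obtain ⟨u, hu⟩ := h.unit
  have h3 : (velDeriv F p).comp c.L (velDeriv F (x₀ 0, x₀ 1) v) = 0 := by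
    rw [ContinuousLinearMap.comp_apply, ← h2, h1]
  have h4 : velDeriv F (x₀ 0, x₀ 1) v = 0 := by
    have h5 := congrArg ((u⁻¹ : ((Fin (n - m) → ℝ) →L[ℝ] (Fin (n - m) → ℝ))ˣ) :
      (Fin (n - m) → ℝ) →L[ℝ] (Fin (n - m) → ℝ)) h3
    rw [← hu, ← mul_apply_eq_comp, u.inv_mul] at h5
    simpa using h5
  rw [h2, h4, map_zero]

theorem SolChart.eventually_good (h : RegularSystemAt F x₀) (c : SolChart F x₀) :
    ∀ᶠ p in 𝓝 (x₀ 0, x₀ 1), c.Good p := by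
  have hu : ∀ᶠ p in 𝓝 (x₀ 0, x₀ 1), IsUnit ((velDeriv F p).comp c.L) := by
    have h1 : ContinuousAt (fun p => (velDeriv F p).comp c.L) (x₀ 0, x₀ 1) :=
      ContinuousAt.comp (((ContinuousLinearMap.compL ℝ (Fin (n - m) → ℝ) (Fin n → ℝ)
        (Fin (n - m) → ℝ)).flip c.L).continuous.continuousAt)
        (velDeriv_analyticAt h.analytic).continuousAt
    refine h1.eventually (Units.isOpen.mem_nhds ?_)
    have : (velDeriv F (x₀ 0, x₀ 1)).comp c.L = 1 := by
      ext1 u; exact c.L_right u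
    change IsUnit ((velDeriv F (x₀ 0, x₀ 1)).comp c.L)
    rw [this]
    exact isUnit_one
  filter_upwards [h.analytic.eventually_analyticAt, c.g_analytic.eventually_analyticAt,
    eventually_eventually_nhds.mpr c.g_sol, c.g_unique, hu] with p h1 h2 h3 h4 h5
  exact ⟨h1, h2, h3, h4, h5⟩

/-- The blocks `(x, ẋ)` of a jet. -/
def jetPair (x : Jet n) : (Fin n → ℝ) × (Fin n → ℝ) := (x 0, x 1)

theorem jetPair_analytic (x : Jet n) : JetMapAnalyticAt (jetPair (n := n)) x :=
  (JetMapAnalyticAt.block 0 x).prodMk (JetMapAnalyticAt.block 1 x)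

theorem lineDeriv_jetPair (x v : Jet n) : lineDeriv ℝ (jetPair (n := n)) x v = (v 0, v 1) := by
  refine (JetMapAnalyticAt.lineDeriv_prodMk (JetMapAnalyticAt.block 0 x)
    (JetMapAnalyticAt.block 1 x) v).trans ?_
  rw [JetMapAnalyticAt.lineDeriv_block, JetMapAnalyticAt.lineDeriv_block]

theorem continuous_jetPair : Continuous (jetPair (n := n)) := by
  unfold jetPair; fun_prop

theorem sysFun_analytic {x : Jet n} (h : AnalyticAt ℝ F (jetPair x)) (i : Fin (n - m)) :
    JetAnalyticAt (sysFun F i) x :=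
  (JetMapAnalyticAt.comp_analytic (f := jetPair) h (jetPair_analytic x)).apply i

theorem lineDeriv_sysFun {x : Jet n} (h : AnalyticAt ℝ F (jetPair x)) (i : Fin (n - m))
    (v : Jet n) : lineDeriv ℝ (sysFun F i) x v = fderiv ℝ F (jetPair x) (v 0, v 1) i := by
  have := JetMapAnalyticAt.lineDeriv_comp_analytic (f := jetPair) h.differentiableAt
    (jetPair_analytic x) v
  rw [lineDeriv_jetPair] at this
  rw [← this]
  exact JetMapAnalyticAt.lineDeriv_apply
    (JetMapAnalyticAt.comp_analytic (f := jetPair) h (jetPair_analytic x)) i v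

/-- The leading term of `d (L_τ^j F)`. -/
theorem lineDeriv_iterate_sysFun (j : ℕ) : ∀ {x : Jet n}, AnalyticAt ℝ F (jetPair x) →
    ∀ (i : Fin (n - m)) {v : Jet n}, (∀ a ≤ j, v a = 0) →
    lineDeriv ℝ (lieTau^[j] (sysFun F i)) x v = velDeriv F (jetPair x) (v (j + 1)) i := by
  induction j with
  | zero =>
    intro x hx i v hv
    rw [Function.iterate_zero, id, lineDeriv_sysFun hx, hv 0 le_rfl]; rfl
  | succ j ih =>
    intro x hx i v hv
    rw [Function.iterate_succ_apply',
      lineDeriv_lieTau ((sysFun_analytic hx i).iterate_lieTau j)]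
    have h1 : (fun z => lineDeriv ℝ (lieTau^[j] (sysFun F i)) z v) =ᶠ[𝓝 x] fun _ => 0 := by
      filter_upwards [continuous_jetPair.continuousAt.eventually hx.eventually_analyticAt]
        with z hz
      rw [ih hz i fun a ha => hv a (by omega), hv (j + 1) le_rfl, map_zero]; rfl
    have h2 : lieTau (fun z => lineDeriv ℝ (lieTau^[j] (sysFun F i)) z v) x = 0 := by
      rw [(lieTau_congr h1).eq_of_nhds]
      simp [lieTau, jetPartial, lineDeriv]
    rw [h2, zero_add, ih hx i (v := jetShift v) fun a ha => hv (a + 1) (by omega)]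
    rfl

/-- The Cartan field of the chart, extended to a neighbourhood of `𝔛₀`. -/
def SolChart.field (c : SolChart F x₀) (x : Jet n) : Jet n :=
  fun j => if j = 0 then c.g (x 0, x 1) else x (j + 1)

/-- The local retraction onto `𝔛₀`. -/
def SolChart.ret (c : SolChart F x₀) (x : Jet n) : Jet n :=
  fun j i => (lieAlong c.field)^[j] (fun z => z 0 i) x

theorem SolChart.field_analytic (c : SolChart F x₀) {x : Jet n} (h : c.Good (jetPair x)) :
    JetFieldAnalyticAt c.field x := by
  intro j i
  by_cases hj : j = 0
  · subst hj
    exact (JetMapAnalyticAt.comp_analytic (f := jetPair) h.g_analytic (jetPair_analytic x)).apply i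
  · simpa [SolChart.field, hj] using JetAnalyticAt.coord (j + 1) i x

theorem SolChart.ret_analytic (c : SolChart F x₀) {x : Jet n} (h : c.Good (jetPair x)) :
    JetFieldAnalyticAt c.ret x := by
  intro j i
  change JetAnalyticAt ((lieAlong c.field)^[j] (fun z => z 0 i)) x
  induction j with
  | zero => exact JetAnalyticAt.coord 0 i x
  | succ j ih => rw [Function.iterate_succ_apply']; exact ih.lieAlong (c.field_analytic h)

/-- The blocks of the retraction are by definition the successive Lie derivatives along the chart
field, so the retraction carries that field to the Cartan field. The properties of `ret` at higher
orders are obtained by differentiating lower-order identities along the chart field. -/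
theorem SolChart.ret_rel (c : SolChart F x₀) (x : Jet n) :
    jetDiff c.ret x (c.field x) = jetShift (c.ret x) := by
  funext j i
  simp only [jetShift, SolChart.ret, Function.iterate_succ_apply']
  rfl

theorem SolChart.ret_zero (c : SolChart F x₀) (x : Jet n) : c.ret x 0 = x 0 := rfl

theorem SolChart.ret_one (c : SolChart F x₀) (x : Jet n) : c.ret x 1 = c.g (jetPair x) := by
  funext i
  change lineDeriv ℝ (fun z : Jet n => z 0 i) x (c.field x) = _
  rw [JetMapAnalyticAt.lineDeriv_coord]
  rfl

theorem SolChart.jetPair_ret (c : SolChart F x₀) (x : Jet n) :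
    jetPair (c.ret x) = (x 0, c.g (jetPair x)) := by
  rw [jetPair, c.ret_zero, c.ret_one]

/-- An open set of jets that the retraction maps to `𝔛₀`. -/
def SolChart.dom (c : SolChart F x₀) : Set (Jet n) :=
  interior {x | c.Good (jetPair x) ∧ c.Good (jetPair (c.ret x))}

theorem SolChart.mem_dom (h : RegularSystemAt F x₀) (c : SolChart F x₀) : x₀ ∈ c.dom := by
  rw [SolChart.dom, mem_interior_iff_mem_nhds]
  have h1 : ∀ᶠ x in 𝓝 x₀, c.Good (jetPair x) :=
    continuous_jetPair.continuousAt.eventually (c.eventually_good h)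
  have h2 : ContinuousAt (fun x => jetPair (c.ret x)) x₀ :=
    continuous_jetPair.continuousAt.comp (c.ret_analytic h1.self_of_nhds).continuousAt
  have h3 : ∀ᶠ x in 𝓝 x₀, c.Good (jetPair (c.ret x)) := by
    refine h2.eventually ?_
    have h4 : jetPair (c.ret x₀) = (x₀ 0, x₀ 1) := by
      rw [c.jetPair_ret]; exact congrArg _ c.g_base
    change ∀ᶠ y in 𝓝 (jetPair (c.ret x₀)), c.Good y
    rw [h4]
    exact c.eventually_good h
  exact h1.and h3

theorem SolChart.isOpen_dom (c : SolChart F x₀) : IsOpen c.dom := isOpen_interior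

theorem SolChart.eventually_dom (c : SolChart F x₀) {x : Jet n} (hx : x ∈ c.dom) :
    ∀ᶠ z in 𝓝 x, z ∈ c.dom :=
  c.isOpen_dom.mem_nhds hx

/-- Differentiate the identity of order $j$ along the chart field: `ret_rel` raises the order on the
left, and the field is the shift in the blocks of positive index on the right. -/
theorem SolChart.pr_ret (c : SolChart F x₀) {x : Jet n} (hx : x ∈ c.dom) (j : ℕ) :
    c.pr (c.ret x (j + 1)) = c.pr (x (j + 1)) := by
  induction j generalizing x with
  | zero =>
    rw [zero_add, c.ret_one]
    exact (interior_subset hx).1.g_sol.self_of_nhds.2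
  | succ j ih =>
    have h0 := (interior_subset hx).1
    have h1 : (fun z => c.pr (c.ret z (j + 1))) =ᶠ[𝓝 x] fun z => c.pr (z (j + 1)) :=
      (c.eventually_dom hx).mono fun z hz => ih hz
    have h2 := jetMap_lineDeriv_congr h1 (c.field x)
    rw [JetMapAnalyticAt.lineDeriv_clm c.pr ((c.ret_analytic h0).blockMap (j + 1)),
      JetMapAnalyticAt.lineDeriv_clm c.pr (JetMapAnalyticAt.block (j + 1) x),
      JetMapAnalyticAt.lineDeriv_block, (c.ret_analytic h0).lineDeriv_blockMap, c.ret_rel] at h2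
    simpa [jetShift, SolChart.field] using h2

/-- $F$ vanishes on the graph; differentiating the vanishing of $L_\tau^kF$ along the retraction in
the direction of the chart field gives the vanishing of $L_\tau^{k+1}F$. -/
theorem SolChart.ret_mem (c : SolChart F x₀) {x : Jet n} (hx : x ∈ c.dom) :
    c.ret x ∈ solSet F := by
  intro k i
  induction k generalizing x with
  | zero =>
    change F (jetPair (c.ret x)) i = 0
    rw [c.jetPair_ret]
    exact congrFun (interior_subset hx).1.g_sol.self_of_nhds.1 i
  | succ k ih =>
    have h0 := (interior_subset hx).1
    have h1 := ((sysFun_analytic (interior_subset hx).2.F_analytic i).iterate_lieTau k)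
    rw [Function.iterate_succ_apply', lieTau_eq_lieAlong h1]
    have h2 : (fun z => (lieTau^[k] (sysFun F i)) (c.ret z)) =ᶠ[𝓝 x] fun _ => 0 :=
      (c.eventually_dom hx).mono fun z hz => ih hz
    have h3 := lieAlong_comp (c.ret_analytic h0) (c.ret_rel x) h1.toMap
    rw [lieAlong, lieAlong, jetMap_lineDeriv_congr h2] at h3
    rw [← h3]
    simp [lineDeriv]

theorem SolChart.jetDiff_ret_mem (c : SolChart F x₀) {x : Jet n} (hx : x ∈ c.dom) (v : Jet n) :
    jetDiff c.ret x v ∈ solTangent F (c.ret x) := by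
  intro k i
  have h1 := ((sysFun_analytic (interior_subset hx).2.F_analytic i).iterate_lieTau k)
  rw [← (c.ret_analytic (interior_subset hx).1).lineDeriv_comp h1.toMap]
  have h2 : (fun z => (lieTau^[k] (sysFun F i)) (c.ret z)) =ᶠ[𝓝 x] fun _ => 0 :=
    (c.eventually_dom hx).mono fun z hz => c.ret_mem hz k i
  rw [jetMap_lineDeriv_congr h2]
  simp [lineDeriv]

/-- A tangent vector of `𝔛₀` is determined by its components `v₀` and `π v_{j+1}`. -/
theorem SolChart.tangent_eq_zero (c : SolChart F x₀) {x v : Jet n} (hx : c.Good (jetPair x))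
    (hv : v ∈ solTangent F x) (h0 : v 0 = 0) (h1 : ∀ j, c.pr (v (j + 1)) = 0) : v = 0 := by
  have : ∀ j, ∀ a ≤ j, v a = 0 := by
    intro j
    induction j with
    | zero => intro a ha; obtain rfl : a = 0 := by omega
              exact h0
    | succ j ih =>
      intro a ha
      rcases Nat.lt_or_ge a (j + 1) with h | h
      · exact ih a (by omega)
      · obtain rfl : a = j + 1 := by omega
        refine hx.injective ?_ (h1 j)
        funext i
        rw [← lineDeriv_iterate_sysFun j hx.F_analytic i ih]
        exact hv j i
  funext j
  exact this j j le_rfl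

theorem SolChart.jetDiff_ret_apply (c : SolChart F x₀) {x : Jet n} (hx : x ∈ c.dom) (v : Jet n) :
    jetDiff c.ret x v 0 = v 0 ∧ ∀ j, c.pr (jetDiff c.ret x v (j + 1)) = c.pr (v (j + 1)) := by
  have h0 := c.ret_analytic (interior_subset hx).1
  constructor
  · rw [← h0.lineDeriv_blockMap]
    exact JetMapAnalyticAt.lineDeriv_block 0 x v
  · intro j
    have h1 : (fun z => c.pr (c.ret z (j + 1))) =ᶠ[𝓝 x] fun z => c.pr (z (j + 1)) :=
      (c.eventually_dom hx).mono fun z hz => c.pr_ret hz j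
    have h2 := jetMap_lineDeriv_congr h1 v
    rwa [JetMapAnalyticAt.lineDeriv_clm c.pr (h0.blockMap (j + 1)),
      JetMapAnalyticAt.lineDeriv_clm c.pr (JetMapAnalyticAt.block (j + 1) x),
      JetMapAnalyticAt.lineDeriv_block, h0.lineDeriv_blockMap] at h2

/-- $L_\tau^jF$ is affine in the block of index $j+1$. The assumption $j\ge1$ keeps $(x,\dot x)$
fixed along the whole line, so analyticity and the constant slope hold on all of it and not only
near its origin. -/
theorem iterate_sysFun_segment {x δ : Jet n} (hx : AnalyticAt ℝ F (jetPair x)) (i : Fin (n - m))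
    {j : ℕ} (hj : 1 ≤ j) (hδ : ∀ a ≤ j, δ a = 0) :
    (lieTau^[j] (sysFun F i)) (x + δ) =
      (lieTau^[j] (sysFun F i)) x + velDeriv F (jetPair x) (δ (j + 1)) i := by
  have hp : ∀ t : ℝ, jetPair (x + t • δ) = jetPair x := by
    intro t
    simp [jetPair, hδ 0 (by omega), hδ 1 hj]
  set c := velDeriv F (jetPair x) (δ (j + 1)) i with hc
  have h1 : ∀ t : ℝ, HasDerivAt (fun s : ℝ => (lieTau^[j] (sysFun F i)) (x + s • δ) - s * c) 0 t := by
    intro t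
    have hx' : AnalyticAt ℝ F (jetPair (x + t • δ)) := by rwa [hp]
    have h2 := ((sysFun_analytic hx' i).iterate_lieTau j).toMap.hasLineDerivAt δ
    rw [lineDeriv_iterate_sysFun j hx' i hδ, hp] at h2
    have h3 : HasDerivAt (fun s : ℝ => (lieTau^[j] (sysFun F i)) (x + s • δ)) c t := by
      have h4 : HasDerivAt (fun s : ℝ => (lieTau^[j] (sysFun F i)) (x + t • δ + s • δ)) c (t - t) := by
        rw [sub_self]; exact h2
      have h5 := h4.comp_sub_const t t
      refine h5.congr_of_eventuallyEq (Eventually.of_forall fun s => ?_)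
      have e : x + s • δ = x + t • δ + (s - t) • δ := by
        rw [add_assoc, ← add_smul, add_sub_cancel]
      exact congrArg _ e
    have h4 := HasDerivAt.fun_sub h3 ((hasDerivAt_id t).mul_const c)
    simpa using h4
  have h2 := is_const_of_deriv_eq_zero (fun t => (h1 t).differentiableAt)
    (fun t => (h1 t).deriv) 1 0
  simp only [one_smul, one_mul, zero_smul, add_zero, zero_mul, sub_zero] at h2
  linarith

/-- Uniqueness of the graph settles the first two blocks. If the blocks up to index $j+1$ agree,
then $L_\tau^{j+1}F$, zero at both jets, shows that the next difference is killed by $\partial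
F/\partial\dot x$; it is also killed by $\pi$, so it vanishes. -/
theorem SolChart.ret_eq_self (c : SolChart F x₀) {x : Jet n} (hx : x ∈ c.dom)
    (hs : x ∈ solSet F) : c.ret x = x := by
  have hg := (interior_subset hx).1
  have hF : F (jetPair x) = 0 := by funext i; exact hs 0 i
  have h1 : ∀ j, ∀ a ≤ j + 1, c.ret x a = x a := by
    intro j
    induction j with
    | zero =>
      intro a ha
      interval_cases a
      · rfl
      · rw [c.ret_one]; exact hg.g_unique hF
    | succ j ih =>
      intro a ha
      rcases Nat.lt_or_ge a (j + 2) with h | h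
      · exact ih a (by omega)
      · obtain rfl : a = j + 2 := by omega
        have hδ : ∀ a ≤ j + 1, (c.ret x - x) a = 0 := fun a ha => by
          rw [Pi.sub_apply, ih a ha, sub_self]
        refine sub_eq_zero.mp (hg.injective (v := (c.ret x - x) (j + 1 + 1)) ?_ ?_)
        · funext i
          have h3 := iterate_sysFun_segment hg.F_analytic i (by omega) hδ
          rw [add_sub_cancel, c.ret_mem hx, hs] at h3
          simpa using h3.symm
        · rw [Pi.sub_apply, map_sub, c.pr_ret hx, sub_self]
  funext j
  exact h1 j j (by omega)

/-- The image of $v$ and $v$ itself are both tangent and have the same free components, which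
determine a tangent vector. -/
theorem SolChart.jetDiff_ret_eq_self (c : SolChart F x₀) {x : Jet n} (hx : x ∈ c.dom)
    (hs : x ∈ solSet F) {v : Jet n} (hv : v ∈ solTangent F x) : jetDiff c.ret x v = v := by
  have hg := (interior_subset hx).1
  have h1 := c.jetDiff_ret_mem hx v
  rw [c.ret_eq_self hx hs] at h1
  have h2 := c.jetDiff_ret_apply hx v
  refine sub_eq_zero.mp (c.tangent_eq_zero hg (fun k i => ?_) ?_ fun j => ?_)
  · rw [((sysFun_analytic hg.F_analytic i).iterate_lieTau k).toMap.lineDeriv_sub, h1 k i, hv k i,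
      sub_self]
  · rw [Pi.sub_apply, h2.1, sub_self]
  · rw [Pi.sub_apply, map_sub, h2.2, sub_self]

/-- The Cartan field is tangent to $\mathfrak X_0$: its pairing with $d(L_\tau^kF)$ is
$L_\tau^{k+1}F$. -/
theorem jetShift_mem_solTangent {x : Jet n} (hx : AnalyticAt ℝ F (jetPair x))
    (hs : x ∈ solSet F) : jetShift x ∈ solTangent F x := by
  intro k i
  rw [← lieTau_eq_lieAlong ((sysFun_analytic hx i).iterate_lieTau k)]
  have := hs (k + 1) i
  rwa [Function.iterate_succ_apply'] at this

end Chart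

/-! ### Representatives of germs. -/

namespace JetRing

variable {n : ℕ} {x₀ : Jet n}

theorem rep_eq {a : JetRing x₀} {f : Jet n → ℝ} (h : a.1 = (f : Germ (𝓝 x₀) ℝ)) :
    a.rep =ᶠ[𝓝 x₀] f :=
  Germ.coe_eq.mp (a.coe_rep.trans h)

theorem ext_rep {a b : JetRing x₀} (h : a.rep =ᶠ[𝓝 x₀] b.rep) : a = b := by
  refine Subtype.ext ?_
  rw [← a.coe_rep, ← b.coe_rep]
  exact Germ.coe_eq.mpr h

theorem rep_add (a b : JetRing x₀) : (a + b).rep =ᶠ[𝓝 x₀] fun z => a.rep z + b.rep z :=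
  rep_eq (congrArg₂ (· + ·) a.coe_rep b.coe_rep).symm

theorem rep_mul (a b : JetRing x₀) : (a * b).rep =ᶠ[𝓝 x₀] fun z => a.rep z * b.rep z :=
  rep_eq (congrArg₂ (· * ·) a.coe_rep b.coe_rep).symm

theorem rep_zero : (0 : JetRing x₀).rep =ᶠ[𝓝 x₀] fun _ => (0 : ℝ) := rep_eq rfl

theorem rep_one : (1 : JetRing x₀).rep =ᶠ[𝓝 x₀] fun _ => (1 : ℝ) := rep_eq rfl

theorem rep_tau (a : JetRing x₀) : (tau x₀ a).rep =ᶠ[𝓝 x₀] lieTau a.rep := rep_eq rfl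

theorem rep_sum {ι : Type*} (s : Finset ι) (a : ι → JetRing x₀) :
    (∑ i ∈ s, a i).rep =ᶠ[𝓝 x₀] fun z => ∑ i ∈ s, (a i).rep z := by
  classical
  induction s using Finset.induction_on with
  | empty => simpa using rep_zero
  | insert i s hi ih =>
    simp only [Finset.sum_insert hi]
    filter_upwards [rep_add (a i) (∑ j ∈ s, a j), ih] with z h1 h2
    rw [h1, h2]

theorem rep_of {f : Jet n → ℝ} (h : JetAnalyticAt f x₀) : (of x₀ f).rep =ᶠ[𝓝 x₀] f :=
  rep_eq (by rw [of, dif_pos h])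

theorem of_congr {f g : Jet n → ℝ} (h : JetAnalyticAt f x₀) (hfg : f =ᶠ[𝓝 x₀] g) :
    of x₀ f = of x₀ g :=
  ext_rep ((rep_of h).trans (hfg.trans (rep_of (h.congr hfg)).symm))

theorem of_zero : of x₀ (fun _ => 0) = 0 :=
  ext_rep ((rep_of (JetAnalyticAt.const 0 x₀)).trans rep_zero.symm)

end JetRing

/-! ### Coefficients of products in the ring of polynomials in $d/dt$. -/

namespace DiffOp

open Polynomial

variable {A : Type*} [CommRing A] {D : Derivation ℤ A A}

@[ext] theorem ext {P Q : DiffOp D} (h : ∀ k, coeff P k = coeff Q k) : P = Q :=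
  Polynomial.ext h

@[simp] theorem coeff_zero (k : ℕ) : coeff (0 : DiffOp D) k = 0 := Polynomial.coeff_zero k

@[simp] theorem coeff_add (P Q : DiffOp D) (k : ℕ) : coeff (P + Q) k = coeff P k + coeff Q k :=
  Polynomial.coeff_add P Q k

@[simp] theorem coeff_sub (P Q : DiffOp D) (k : ℕ) : coeff (P - Q) k = coeff P k - coeff Q k :=
  Polynomial.coeff_sub P Q k

/-- Taking a coefficient, as an additive map. -/
def coeffHom (D : Derivation ℤ A A) (k : ℕ) : DiffOp D →+ A where
  toFun P := coeff P k
  map_zero' := coeff_zero k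
  map_add' P Q := coeff_add P Q k

theorem coeff_sum {ι : Type*} (s : Finset ι) (P : ι → DiffOp D) (k : ℕ) :
    coeff (∑ i ∈ s, P i) k = ∑ i ∈ s, coeff (P i) k :=
  map_sum (coeffHom D k) P s

theorem coeff_mono (j : ℕ) (a : A) (k : ℕ) : coeff (mono D j a) k = if j = k then a else 0 :=
  Polynomial.coeff_monomial

theorem coeff_one (k : ℕ) : coeff (1 : DiffOp D) k = if k = 0 then 1 else 0 := by
  refine (Polynomial.coeff_one (R := A)).trans ?_
  simp

theorem mono_zero (j : ℕ) : mono D j 0 = 0 := Polynomial.monomial_zero_right j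

theorem exists_bound (P : DiffOp D) : ∃ N, ∀ j, N ≤ j → coeff P j = 0 :=
  ⟨Polynomial.natDegree P + 1, fun _ hj => Polynomial.coeff_eq_zero_of_natDegree_lt hj⟩

/-- The operator `d/dt`. -/
def dt (D : Derivation ℤ A A) : DiffOp D := mono D 1 1

theorem dt_mul (Q : DiffOp D) : dt D * Q = (shiftOp D Q : Polynomial A) := by
  refine (opMul_monomial D 1 1 Q).trans ?_
  simp

theorem dt_pow_mul (j : ℕ) (Q : DiffOp D) : dt D ^ j * Q = ((shiftOp D)^[j] Q : Polynomial A) := by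
  induction j with
  | zero => rw [pow_zero, one_mul]; rfl
  | succ j ih =>
    have h1 : dt D ^ (j + 1) * Q = dt D * (dt D ^ j * Q) := by rw [pow_succ', mul_assoc]
    exact ((h1.trans (dt_mul _)).trans (congrArg (shiftOp D) ih)).trans
      (Function.iterate_succ_apply' (shiftOp D) j Q).symm

theorem coeff_coeffDeriv (q : Polynomial A) (k : ℕ) :
    Polynomial.coeff (coeffDeriv D q) k = D (Polynomial.coeff q k) := by
  induction q using Polynomial.induction_on' with
  | add p q hp hq => simp only [map_add, Polynomial.coeff_add, hp, hq]
  | monomial j a =>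
    rw [coeffDeriv_monomial, Polynomial.coeff_monomial, Polynomial.coeff_monomial]
    split_ifs <;> simp

theorem coeff_shiftOp_zero (q : Polynomial A) :
    Polynomial.coeff (shiftOp D q) 0 = D (Polynomial.coeff q 0) := by
  rw [shiftOp, AddMonoidHom.add_apply, Polynomial.coeff_add, coeff_coeffDeriv]
  simp

theorem coeff_shiftOp_succ (q : Polynomial A) (k : ℕ) :
    Polynomial.coeff (shiftOp D q) (k + 1) =
      Polynomial.coeff q k + D (Polynomial.coeff q (k + 1)) := by
  rw [shiftOp, AddMonoidHom.add_apply, Polynomial.coeff_add, coeff_coeffDeriv]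
  simp

theorem coeff_dt_mul_zero (Q : DiffOp D) : coeff (dt D * Q) 0 = D (coeff Q 0) := by
  rw [dt_mul]; exact coeff_shiftOp_zero Q

theorem coeff_dt_mul_succ (Q : DiffOp D) (k : ℕ) :
    coeff (dt D * Q) (k + 1) = coeff Q k + D (coeff Q (k + 1)) := by
  rw [dt_mul]; exact coeff_shiftOp_succ Q k

theorem coeff_opMul {p : Polynomial A} (q : Polynomial A) {N : ℕ}
    (hN : ∀ j, N ≤ j → Polynomial.coeff p j = 0) (k : ℕ) :
    Polynomial.coeff (opMul D p q) k =
      ∑ j ∈ Finset.range N, Polynomial.coeff p j * Polynomial.coeff ((shiftOp D)^[j] q) k := by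
  rw [opMul, Polynomial.sum_def, Polynomial.finsetSum_coeff]
  simp only [Polynomial.coeff_C_mul]
  refine Finset.sum_subset (fun j hj => ?_) fun j _ hj => ?_
  · by_contra hc
    exact Polynomial.mem_support_iff.mp hj (hN j (by simpa using hc))
  · rw [Polynomial.notMem_support_iff.mp hj, zero_mul]

theorem coeff_mul {P Q : DiffOp D} {N : ℕ} (hN : ∀ j, N ≤ j → coeff P j = 0) (k : ℕ) :
    coeff (P * Q) k = ∑ j ∈ Finset.range N, coeff P j * coeff (dt D ^ j * Q) k := by
  refine (coeff_opMul (D := D) (p := P) Q hN k).trans (Finset.sum_congr rfl fun j _ => ?_)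
  rw [dt_pow_mul]; rfl

theorem mono_eq (j : ℕ) (a : A) : mono D j a = mono D 0 a * dt D ^ j := by
  ext k
  rw [coeff_mul (N := 1) (fun i hi => by rw [coeff_mono, if_neg (by omega)]), Finset.sum_range_one,
    pow_zero, one_mul, coeff_mono, coeff_mono, if_pos rfl]
  have : ∀ j k, coeff (dt D ^ j) k = if j = k then 1 else 0 := by
    intro j
    induction j with
    | zero => intro k; rw [pow_zero, coeff_one]; simp [eq_comm]
    | succ j ih =>
      intro k
      rw [pow_succ']
      cases k with
      | zero => rw [coeff_dt_mul_zero, ih]; split_ifs <;> simp_all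
      | succ k => rw [coeff_dt_mul_succ, ih, ih]; split_ifs <;> simp_all
  rw [this]; split_ifs <;> simp

end DiffOp

/-! ### The module of 1-forms over the polynomials in $d/dt$. -/

section Action

variable {n : ℕ} {x₀ : Jet n}

theorem lieForm_add (η ζ : OneForm x₀) : lieForm (η + ζ) = lieForm η + lieForm ζ := by
  unfold lieForm
  refine Finsupp.sum_add_index' (by simp) fun p a b => ?_
  rw [map_add, Finsupp.single_add, Finsupp.single_add]; abel

theorem lieForm_zero : lieForm (0 : OneForm x₀) = 0 := by simp [lieForm]

theorem lieForm_single (p : ℕ × Fin n) (a : JetRing x₀) :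
    lieForm (Finsupp.single p a) =
      Finsupp.single p (JetRing.tau x₀ a) + Finsupp.single (p.1 + 1, p.2) a :=
  Finsupp.sum_single_index (by simp)

theorem lieForm_smul (a : JetRing x₀) (η : OneForm x₀) :
    lieForm (a • η) = JetRing.tau x₀ a • η + a • lieForm η := by
  induction η using Finsupp.induction_linear with
  | zero => simp [lieForm_zero]
  | add η ζ h1 h2 => rw [smul_add, lieForm_add, lieForm_add, h1, h2, smul_add, smul_add]; abel
  | single p b =>
    rw [Finsupp.smul_single, lieForm_single, lieForm_single, smul_eq_mul, Derivation.leibniz,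
      smul_add, Finsupp.smul_single, Finsupp.smul_single, Finsupp.smul_single, smul_eq_mul,
      smul_eq_mul, smul_eq_mul, smul_eq_mul, Finsupp.single_add, mul_comm b]
    abel

theorem lieForm_iterate_add (k : ℕ) (η ζ : OneForm x₀) :
    lieForm^[k] (η + ζ) = lieForm^[k] η + lieForm^[k] ζ := by
  induction k with
  | zero => rfl
  | succ k ih => simp only [Function.iterate_succ_apply', ih, lieForm_add]

theorem opAct_add (P : JetOp x₀) (η ζ : OneForm x₀) :
    opAct P (η + ζ) = opAct P η + opAct P ζ := by
  simp only [opAct, lieForm_iterate_add, smul_add]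
  exact Polynomial.sum_add P (fun k a => a • lieForm^[k] η) fun k a => a • lieForm^[k] ζ

theorem add_opAct (P Q : JetOp x₀) (η : OneForm x₀) :
    opAct (P + Q) η = opAct P η + opAct Q η :=
  Polynomial.sum_add_index _ _ _ (by simp) (by simp [add_smul])

theorem mono_opAct (k : ℕ) (a : JetRing x₀) (η : OneForm x₀) :
    opAct (DiffOp.mono _ k a) η = a • lieForm^[k] η :=
  Polynomial.sum_monomial_index _ _ (by simp)

theorem one_opAct (η : OneForm x₀) : opAct 1 η = η := by
  have := mono_opAct 0 1 η
  rwa [one_smul] at this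

theorem DiffOp.induction_mono {A : Type*} [CommRing A] {D : Derivation ℤ A A}
    {p : DiffOp D → Prop} (P : DiffOp D) (hadd : ∀ P Q, p P → p Q → p (P + Q))
    (hmono : ∀ k a, p (DiffOp.mono D k a)) : p P :=
  Polynomial.induction_on' (motive := p) P hadd hmono

theorem zero_opAct (η : OneForm x₀) : opAct 0 η = 0 := Polynomial.sum_zero_index _

theorem dt_mul_mono (k : ℕ) (b : JetRing x₀) :
    DiffOp.dt (JetRing.tau x₀) * DiffOp.mono _ k b =
      DiffOp.mono _ (k + 1) b + DiffOp.mono _ k (JetRing.tau x₀ b) :=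
  (DiffOp.dt_mul _).trans (DiffOp.shiftOp_monomial _ k b)

/-- The rule $\frac{d}{dt}a=a\frac{d}{dt}+\dot a$ is the Leibniz rule for $L_\tau$ on $a\eta$; this
makes the action compatible with products. -/
theorem dt_mul_opAct (Q : JetOp x₀) (η : OneForm x₀) :
    opAct (DiffOp.dt _ * Q) η = lieForm (opAct Q η) := by
  induction Q using DiffOp.induction_mono with
  | hadd P Q hp hq => rw [mul_add, add_opAct, add_opAct, hp, hq, lieForm_add]
  | hmono k b =>
    rw [dt_mul_mono, add_opAct, mono_opAct, mono_opAct, mono_opAct, lieForm_smul,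
      Function.iterate_succ_apply', add_comm]

theorem mono_zero_mul_opAct (a : JetRing x₀) (Q : JetOp x₀) (η : OneForm x₀) :
    opAct (DiffOp.mono _ 0 a * Q) η = a • opAct Q η := by
  induction Q using DiffOp.induction_mono with
  | hadd P Q hp hq => rw [mul_add, add_opAct, add_opAct, hp, hq, smul_add]
  | hmono k b =>
    have : DiffOp.mono (JetRing.tau x₀) 0 a * DiffOp.mono _ k b = DiffOp.mono _ k (a * b) :=
      (DiffOp.opMul_monomial _ 0 a _).trans (Polynomial.C_mul_monomial)
    rw [this, mono_opAct, mono_opAct, mul_smul]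

theorem mul_opAct (P Q : JetOp x₀) (η : OneForm x₀) :
    opAct (P * Q) η = opAct P (opAct Q η) := by
  induction P using DiffOp.induction_mono with
  | hadd P R hp hq => rw [add_mul, add_opAct, add_opAct, hp, hq]
  | hmono k b =>
    rw [DiffOp.mono_eq, mul_assoc, mono_zero_mul_opAct, mono_zero_mul_opAct]
    congr 1
    induction k with
    | zero => rw [pow_zero, one_mul, one_opAct]
    | succ k ih =>
      rw [pow_succ', mul_assoc, dt_mul_opAct, ih, dt_mul_opAct]

/-- 1-forms are a left module over the polynomials in `d/dt`. -/
instance opModule : Module (JetOp x₀) (OneForm x₀) where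
  smul := opAct
  one_smul := one_opAct
  mul_smul := mul_opAct
  smul_zero P := by
    have h := opAct_add P 0 0
    rw [add_zero] at h
    exact left_eq_add.mp h
  smul_add := opAct_add
  add_smul := add_opAct
  zero_smul := zero_opAct

theorem opAct_eq_smul (P : JetOp x₀) (η : OneForm x₀) : opAct P η = P • η := rfl

theorem matAct_apply {p q : ℕ} (M : Matrix (Fin p) (Fin q) (JetOp x₀)) (ω : Fin q → OneForm x₀)
    (i : Fin p) : matAct M ω i = ∑ j, M i j • ω j := rfl

theorem matAct_mul {p q r : ℕ} (M : Matrix (Fin p) (Fin q) (JetOp x₀))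
    (N : Matrix (Fin q) (Fin r) (JetOp x₀)) (ω : Fin r → OneForm x₀) :
    matAct (M * N) ω = matAct M (matAct N ω) := by
  funext i
  simp only [matAct_apply, Matrix.mul_apply, Finset.sum_smul, Finset.smul_sum, mul_smul]
  exact Finset.sum_comm

theorem matAct_add {p q : ℕ} (M N : Matrix (Fin p) (Fin q) (JetOp x₀)) (ω : Fin q → OneForm x₀) :
    matAct (M + N) ω = matAct M ω + matAct N ω := by
  funext i
  simp only [matAct_apply, Matrix.add_apply, add_smul, Finset.sum_add_distrib, Pi.add_apply]

theorem matAct_one {p : ℕ} (ω : Fin p → OneForm x₀) : matAct 1 ω = ω := by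
  funext i
  rw [matAct_apply, Finset.sum_eq_single i (fun j _ hj => ?_) (by simp), Matrix.one_apply_eq,
    one_smul]
  rw [Matrix.one_apply_ne (Ne.symm hj)]
  exact zero_opAct _

/-- Since $L_\tau^k\,dx_l=dx_l^{(k)}$, the forms $dx_1,\dots,dx_n$ are a basis of the 1-forms over
the polynomials, and the coefficients of a form are those of its row. -/
theorem opAct_coord (P : JetOp x₀) (l : Fin n) (p : ℕ × Fin n) :
    (P • coordForms x₀ l) p = if l = p.2 then P.coeff p.1 else 0 := by
  have hk : ∀ k, lieForm^[k] (coordForms x₀ l) = Finsupp.single (k, l) 1 := by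
    intro k
    induction k with
    | zero => rfl
    | succ k ih =>
      rw [Function.iterate_succ_apply', ih, lieForm_single, Derivation.map_one_eq_zero,
        Finsupp.single_zero, zero_add]
  induction P using DiffOp.induction_mono with
  | hadd P Q hp hq => rw [add_smul, Finsupp.add_apply, hp, hq, DiffOp.coeff_add]; split_ifs <;> simp
  | hmono k b =>
    rw [← opAct_eq_smul, mono_opAct, hk, Finsupp.smul_apply, DiffOp.coeff_mono]
    rcases p with ⟨j, i⟩
    by_cases h1 : l = i <;> by_cases h2 : k = j <;> simp [h1, h2]

end Action

/-! ### Restriction of functions, operators and forms to $\mathfrak X_0$. -/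

section OnSol

variable {n m : ℕ} {E : Type*} [NormedAddCommGroup E] [NormedSpace ℝ E] [CompleteSpace E]
  {F : (Fin n → ℝ) × (Fin n → ℝ) → Fin (n - m) → ℝ} {x₀ : Jet n}

theorem SolChart.tendsto_ret (c : SolChart F x₀) {x : Jet n} (hx : x ∈ c.dom)
    (hs : x ∈ solSet F) : Tendsto c.ret (𝓝 x) (𝓝[solSet F] x) := by
  refine tendsto_nhdsWithin_iff.mpr ⟨?_, (c.eventually_dom hx).mono fun z hz => c.ret_mem hz⟩
  have h := (c.ret_analytic (interior_subset hx).1).continuousAt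
  rwa [ContinuousAt, c.ret_eq_self hx hs] at h

theorem SolChart.eventually_sol (h : RegularSystemAt F x₀) (c : SolChart F x₀) :
    ∀ᶠ x in 𝓝[solSet F] x₀, x ∈ c.dom ∧ x ∈ solSet F :=
  ((c.eventually_dom (c.mem_dom h)).filter_mono nhdsWithin_le_nhds).and self_mem_nhdsWithin

/-- After composition with the retraction the two functions agree on a full neighbourhood, and the
differential of the retraction fixes $v$. -/
theorem SolChart.lineDeriv_eq (c : SolChart F x₀) {x : Jet n} (hx : x ∈ c.dom)
    (hs : x ∈ solSet F) {f g : Jet n → E} (hf : JetMapAnalyticAt f x) (hg : JetMapAnalyticAt g x)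
    (hfg : f =ᶠ[𝓝[solSet F] x] g) {v : Jet n} (hv : v ∈ solTangent F x) :
    lineDeriv ℝ f x v = lineDeriv ℝ g x v := by
  have h0 := c.ret_analytic (interior_subset hx).1
  have e : (fun z => f (c.ret z)) =ᶠ[𝓝 x] fun z => g (c.ret z) :=
    (c.tendsto_ret hx hs).eventually hfg
  have hr := c.ret_eq_self hx hs
  have h1 := jetMap_lineDeriv_congr e v
  rwa [h0.lineDeriv_comp (by rwa [hr]), h0.lineDeriv_comp (by rwa [hr]), hr,
    c.jetDiff_ret_eq_self hx hs hv] at h1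

theorem RegularSystemAt.eventually_lineDeriv_eq (h : RegularSystemAt F x₀) {f g : Jet n → E}
    (hf : JetMapAnalyticAt f x₀) (hg : JetMapAnalyticAt g x₀) (hfg : f =ᶠ[𝓝[solSet F] x₀] g) :
    ∀ᶠ x in 𝓝[solSet F] x₀, ∀ v ∈ solTangent F x, lineDeriv ℝ f x v = lineDeriv ℝ g x v := by
  obtain ⟨c⟩ := h.nonempty_chart
  filter_upwards [c.eventually_sol h, hf.eventually.filter_mono nhdsWithin_le_nhds,
    hg.eventually.filter_mono nhdsWithin_le_nhds, eventually_eventually_nhdsWithin.mpr hfg]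
    with x hx h1 h2 h3 v hv
  exact c.lineDeriv_eq hx.1 hx.2 h1 h2 h3 hv

theorem RegularSystemAt.eventually_shift (h : RegularSystemAt F x₀) :
    ∀ᶠ x in 𝓝[solSet F] x₀, jetShift x ∈ solTangent F x := by
  obtain ⟨c⟩ := h.nonempty_chart
  filter_upwards [c.eventually_sol h] with x hx
  exact jetShift_mem_solTangent (interior_subset hx.1).1.F_analytic hx.2

/-- The Cartan field is tangent to $\mathfrak X_0$, so $L_\tau f$ there depends only on $f$
restricted to $\mathfrak X_0$. This is why $d/dt$ descends to the quotient ring. -/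
theorem RegularSystemAt.lieTau_eq (h : RegularSystemAt F x₀) {f g : Jet n → ℝ}
    (hf : JetAnalyticAt f x₀) (hg : JetAnalyticAt g x₀) (hfg : f =ᶠ[𝓝[solSet F] x₀] g) :
    lieTau f =ᶠ[𝓝[solSet F] x₀] lieTau g := by
  filter_upwards [h.eventually_lineDeriv_eq hf.toMap hg.toMap hfg, h.eventually_shift,
    hf.eventually_at.filter_mono nhdsWithin_le_nhds,
    hg.eventually_at.filter_mono nhdsWithin_le_nhds] with x h1 h2 h3 h4
  rw [lieTau_eq_lieAlong h3, lieTau_eq_lieAlong h4, h1 _ h2]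

namespace EqOnSol

theorem of_rep {a b : JetRing x₀} {f g : Jet n → ℝ} (ha : a.rep =ᶠ[𝓝 x₀] f)
    (hb : b.rep =ᶠ[𝓝 x₀] g) (h : f =ᶠ[𝓝[solSet F] x₀] g) : EqOnSol F a b :=
  ((ha.filter_mono nhdsWithin_le_nhds).trans h).trans (hb.filter_mono nhdsWithin_le_nhds).symm

theorem refl (a : JetRing x₀) : EqOnSol F a a := Eventually.of_forall fun _ => rfl

theorem symm {a b : JetRing x₀} (h : EqOnSol F a b) : EqOnSol F b a := h.mono fun _ hx => hx.symm

theorem trans {a b c : JetRing x₀} (h : EqOnSol F a b) (h' : EqOnSol F b c) : EqOnSol F a c := by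
  filter_upwards [h, h'] with x h1 h2
  exact h1.trans h2

theorem add {a b a' b' : JetRing x₀} (h : EqOnSol F a b) (h' : EqOnSol F a' b') :
    EqOnSol F (a + a') (b + b') := by
  refine of_rep (JetRing.rep_add a a') (JetRing.rep_add b b') ?_
  filter_upwards [h, h'] with x h1 h2
  rw [h1, h2]

theorem mul {a b a' b' : JetRing x₀} (h : EqOnSol F a b) (h' : EqOnSol F a' b') :
    EqOnSol F (a * a') (b * b') := by
  refine of_rep (JetRing.rep_mul a a') (JetRing.rep_mul b b') ?_
  filter_upwards [h, h'] with x h1 h2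
  rw [h1, h2]

theorem sum {ι : Type*} {s : Finset ι} {a b : ι → JetRing x₀} (h : ∀ i ∈ s, EqOnSol F (a i) (b i)) :
    EqOnSol F (∑ i ∈ s, a i) (∑ i ∈ s, b i) := by
  refine of_rep (JetRing.rep_sum s a) (JetRing.rep_sum s b) ?_
  filter_upwards [(Finset.eventually_all s).mpr h] with x hx
  exact Finset.sum_congr rfl hx

theorem tau (h : RegularSystemAt F x₀) {a b : JetRing x₀} (hab : EqOnSol F a b) :
    EqOnSol F (JetRing.tau x₀ a) (JetRing.tau x₀ b) :=
  of_rep (JetRing.rep_tau a) (JetRing.rep_tau b)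
    (h.lieTau_eq a.rep_analytic b.rep_analytic hab)

end EqOnSol

theorem opCon_dt_mul (h : RegularSystemAt F x₀) {P Q : JetOp x₀}
    (hPQ : ∀ k, EqOnSol F (P.coeff k) (Q.coeff k)) (k : ℕ) :
    EqOnSol F ((DiffOp.dt _ * P).coeff k) ((DiffOp.dt _ * Q).coeff k) := by
  cases k with
  | zero =>
    rw [DiffOp.coeff_dt_mul_zero, DiffOp.coeff_dt_mul_zero]
    exact (hPQ 0).tau h
  | succ k =>
    rw [DiffOp.coeff_dt_mul_succ, DiffOp.coeff_dt_mul_succ]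
    exact (hPQ k).add ((hPQ (k + 1)).tau h)

/-- Equality on `𝔛₀` near `x₀`, as a congruence on the ring of polynomials in `d/dt`. -/
def opCon (h : RegularSystemAt F x₀) : RingCon (JetOp x₀) where
  r P Q := ∀ k, EqOnSol F (P.coeff k) (Q.coeff k)
  iseqv := ⟨fun _ _ => EqOnSol.refl _, fun h k => (h k).symm, fun h h' k => (h k).trans (h' k)⟩
  add' hP hQ k := by
    rw [DiffOp.coeff_add, DiffOp.coeff_add]
    exact (hP k).add (hQ k)
  mul' {P P' Q Q'} hP hQ k := by
    obtain ⟨N, hN⟩ := P.exists_bound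
    obtain ⟨N', hN'⟩ := P'.exists_bound
    rw [DiffOp.coeff_mul (N := max N N') (fun j hj => hN j (le_trans (le_max_left _ _) hj)),
      DiffOp.coeff_mul (N := max N N') (fun j hj => hN' j (le_trans (le_max_right _ _) hj))]
    have h1 : ∀ j k, EqOnSol F ((DiffOp.dt _ ^ j * Q).coeff k) ((DiffOp.dt _ ^ j * Q').coeff k) := by
      intro j
      induction j with
      | zero => simpa using hQ
      | succ j ih =>
        intro k
        rw [pow_succ', mul_assoc, mul_assoc]
        exact opCon_dt_mul h ih k
    exact EqOnSol.sum fun j _ => (hP j).mul (h1 j k)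

/-- The polynomials in `d/dt` over functions on `𝔛₀` near `x₀`. -/
abbrev SolOp (h : RegularSystemAt F x₀) : Type := (opCon h).Quotient

/-- Restriction to `𝔛₀`. -/
def solMap (h : RegularSystemAt F x₀) : JetOp x₀ →+* SolOp h := (opCon h).mk'

theorem solMap_eq_iff (h : RegularSystemAt F x₀) {P Q : JetOp x₀} :
    solMap h P = solMap h Q ↔ ∀ k, EqOnSol F (P.coeff k) (Q.coeff k) :=
  RingCon.eq (opCon h)

theorem solMap_surjective (h : RegularSystemAt F x₀) : Function.Surjective (solMap h) :=
  RingCon.mk'_surjective _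

theorem opMatEq_iff (h : RegularSystemAt F x₀) {p q : ℕ} {P Q : Matrix (Fin p) (Fin q) (JetOp x₀)} :
    OpMatEq F P Q ↔ P.map (solMap h) = Q.map (solMap h) := by
  rw [← Matrix.ext_iff]
  exact forall_congr' fun i => forall_congr' fun j => (solMap_eq_iff h).symm

theorem unimodular_iff (h : RegularSystemAt F x₀) {p : ℕ} {U : Matrix (Fin p) (Fin p) (JetOp x₀)} :
    Unimodular F U ↔ ∃ U' : Matrix (Fin p) (Fin p) (SolOp h),
      U.map (solMap h) * U' = 1 ∧ U' * U.map (solMap h) = 1 := by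
  have hone : (1 : Matrix (Fin p) (Fin p) (JetOp x₀)).map (solMap h) = 1 :=
    Matrix.map_one _ (map_zero _) (map_one _)
  constructor
  · rintro ⟨U', h1, h2⟩
    rw [opMatEq_iff h, Matrix.map_mul, hone] at h1 h2
    exact ⟨U'.map (solMap h), h1, h2⟩
  · rintro ⟨U', h1, h2⟩
    choose s hs using solMap_surjective h
    have h3 : (U'.map s).map (solMap h) = U' := by
      ext i j; exact hs _
    refine ⟨U'.map s, ?_, ?_⟩
    · rw [opMatEq_iff h, Matrix.map_mul, hone, h3, h1]
    · rw [opMatEq_iff h, Matrix.map_mul, hone, h3, h2]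

/-- The value of a 1-form at a point and a vector. -/
def formEval (η : OneForm x₀) (x v : Jet n) : ℝ := η.sum fun p a => a.rep x * v p.1 p.2

/-- The chosen representative of the zero germ vanishes only near $x_0$, so enlarging the support is
harmless only locally. Finitely many coefficients are involved, and one neighbourhood serves all
vectors. -/
theorem formEval_eq_sum (η : OneForm x₀) {s : Finset (ℕ × Fin n)} (hs : η.support ⊆ s) :
    ∀ᶠ x in 𝓝 x₀, ∀ v, formEval η x v = ∑ p ∈ s, (η p).rep x * v p.1 p.2 := by
  have h0 : ∀ p ∈ s, ∀ᶠ x in 𝓝 x₀, p ∉ η.support → (η p).rep x = 0 := by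
    intro p _
    by_cases hp : p ∈ η.support
    · exact Eventually.of_forall fun x hx => absurd hp hx
    · filter_upwards [JetRing.rep_zero (x₀ := x₀)] with x hx _
      rw [Finsupp.notMem_support_iff.mp hp, hx]
  filter_upwards [(Finset.eventually_all s).mpr h0] with x hx v
  refine Finset.sum_subset hs fun p hp hp' => ?_
  change (η p).rep x * _ = 0
  rw [hx p hp hp', zero_mul]

theorem formEval_add (η ζ : OneForm x₀) :
    ∀ᶠ x in 𝓝 x₀, ∀ v, formEval (η + ζ) x v = formEval η x v + formEval ζ x v := by
  classical
  have hs := Finsupp.support_add (g₁ := η) (g₂ := ζ)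
  filter_upwards [formEval_eq_sum (η + ζ) hs, formEval_eq_sum η Finset.subset_union_left,
    formEval_eq_sum ζ Finset.subset_union_right,
    (Finset.eventually_all (η.support ∪ ζ.support)).mpr fun p _ => JetRing.rep_add (η p) (ζ p)]
    with x h1 h2 h3 h4 v
  rw [h1, h2, h3, ← Finset.sum_add_distrib]
  refine Finset.sum_congr rfl fun p hp => ?_
  rw [Finsupp.add_apply, h4 p hp, add_mul]

theorem formEval_smul (a : JetRing x₀) (η : OneForm x₀) :
    ∀ᶠ x in 𝓝 x₀, ∀ v, formEval (a • η) x v = a.rep x * formEval η x v := by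
  filter_upwards [formEval_eq_sum (a • η) Finsupp.support_smul,
    (Finset.eventually_all η.support).mpr fun p _ => JetRing.rep_mul a (η p)] with x h1 h2 v
  rw [h1, formEval, Finsupp.sum, Finset.mul_sum]
  refine Finset.sum_congr rfl fun p hp => ?_
  rw [Finsupp.smul_apply, smul_eq_mul, h2 p hp, mul_assoc]

theorem formEval_zero (x v : Jet n) : formEval (0 : OneForm x₀) x v = 0 := Finsupp.sum_zero_index

theorem formEval_single (p : ℕ × Fin n) (a : JetRing x₀) :
    ∀ᶠ x in 𝓝 x₀, ∀ v, formEval (Finsupp.single p a) x v = a.rep x * v p.1 p.2 := by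
  filter_upwards [formEval_eq_sum (Finsupp.single p a) Finsupp.support_single_subset] with x h v
  rw [h, Finset.sum_singleton, Finsupp.single_eq_same]

theorem formEval_finsetSum {ι : Type*} (s : Finset ι) (η : ι → OneForm x₀) :
    ∀ᶠ x in 𝓝 x₀, ∀ v, formEval (∑ i ∈ s, η i) x v = ∑ i ∈ s, formEval (η i) x v := by
  classical
  induction s using Finset.induction_on with
  | empty => exact Eventually.of_forall fun x v => by simp [formEval_zero]
  | insert i s hi ih =>
    filter_upwards [formEval_add (η i) (∑ j ∈ s, η j), ih] with x h1 h2 v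
    rw [Finset.sum_insert hi, Finset.sum_insert hi, h1, h2]

theorem formEval_add_right (η : OneForm x₀) (x v w : Jet n) :
    formEval η x (v + w) = formEval η x v + formEval η x w := by
  simp [formEval, mul_add, Finsupp.sum, Finset.sum_add_distrib]

theorem formEval_smul_right (η : OneForm x₀) (x v : Jet n) (r : ℝ) :
    formEval η x (r • v) = r * formEval η x v := by
  simp [formEval, Finsupp.sum, Finset.mul_sum, mul_left_comm]

theorem formEval_rep_analytic (η : OneForm x₀) :
    ∀ᶠ x in 𝓝 x₀, ∀ p ∈ η.support, JetAnalyticAt (η p).rep x :=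
  (Finset.eventually_all η.support).mpr fun p _ => (η p).rep_analytic.eventually_at

theorem formEval_analytic (η : OneForm x₀) :
    ∀ᶠ x in 𝓝 x₀, ∀ v, JetAnalyticAt (fun z => formEval η z v) x := by
  filter_upwards [formEval_rep_analytic η] with x hx v
  exact JetAnalyticAt.sum _ fun p hp => (hx p hp).mul (JetAnalyticAt.const _ _)

theorem formEval_lineDeriv {η : OneForm x₀} {x : Jet n}
    (hx : ∀ p ∈ η.support, JetAnalyticAt (η p).rep x) (v w : Jet n) :
    lineDeriv ℝ (fun z => formEval η z v) x w =
      ∑ p ∈ η.support, lineDeriv ℝ (η p).rep x w * v p.1 p.2 := by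
  refine (JetAnalyticAt.lineDeriv_fun_sum _ (fun p hp => (hx p hp).mul
    (JetAnalyticAt.const (v p.1 p.2) x)) w).trans (Finset.sum_congr rfl fun p hp => ?_)
  rw [JetAnalyticAt.lineDeriv_mul (hx p hp) (JetAnalyticAt.const (v p.1 p.2) x)]
  simp [lineDeriv]

/-- Cartan's formula $(L_\tau\eta)(v)=\tau(\eta(v))-\eta([\tau,v])$ for a constant field $v$, whose
bracket with the linear field $\tau$ is minus the shift of $v$. -/
theorem formEval_lieForm (η : OneForm x₀) :
    ∀ᶠ x in 𝓝 x₀, ∀ v, formEval (lieForm η) x v =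
      lineDeriv ℝ (fun z => formEval η z v) x (jetShift x) + formEval η x (jetShift v) := by
  induction η using Finsupp.induction_linear with
  | zero =>
    refine Eventually.of_forall fun x v => ?_
    rw [lieForm_zero]
    simp [formEval_zero, lineDeriv]
  | add η ζ h1 h2 =>
    filter_upwards [h1, h2, eventually_eventually_nhds.mpr (formEval_add η ζ),
      formEval_add (lieForm η) (lieForm ζ), formEval_analytic η, formEval_analytic ζ]
      with x e1 e2 e3 e4 a1 a2 v
    have e5 : (fun z => formEval (η + ζ) z v) =ᶠ[𝓝 x]
        fun z => formEval η z v + formEval ζ z v := e3.mono fun z hz => hz v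
    have e6 : lineDeriv ℝ (fun z => formEval η z v + formEval ζ z v) x (jetShift x) = _ :=
      HasLineDerivAt.lineDeriv (HasDerivAt.add ((a1 v).toMap.hasLineDerivAt (jetShift x))
        ((a2 v).toMap.hasLineDerivAt (jetShift x)))
    rw [lieForm_add, e4, e1, e2, jetMap_lineDeriv_congr e5, e3.self_of_nhds, e6]
    ring
  | single p a =>
    filter_upwards [formEval_single (p.1 + 1, p.2) a, formEval_single p (JetRing.tau x₀ a),
      eventually_eventually_nhds.mpr (formEval_single p a), a.rep_analytic.eventually_at,
      JetRing.rep_tau a, formEval_add (Finsupp.single p (JetRing.tau x₀ a))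
        (Finsupp.single (p.1 + 1, p.2) a)] with x h1 h2 h3 h4 h5 h6 v
    have e5 : (fun z => formEval (Finsupp.single p a) z v) =ᶠ[𝓝 x]
        fun z => a.rep z * v p.1 p.2 := h3.mono fun z hz => hz v
    rw [lieForm_single, h6, h1, h2, h3.self_of_nhds, jetMap_lineDeriv_congr e5,
      JetAnalyticAt.lineDeriv_mul h4 (JetAnalyticAt.const (v p.1 p.2) x), h5,
      lieTau_eq_lieAlong h4]
    simp [lineDeriv, jetShift]

/-- Equality of the restrictions of two 1-forms to `𝔛₀`, near `x₀`. -/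
def FormEq (F : (Fin n → ℝ) × (Fin n → ℝ) → Fin (n - m) → ℝ) (η ζ : OneForm x₀) : Prop :=
  ∀ᶠ x in 𝓝[solSet F] x₀, ∀ v ∈ solTangent F x, formEval η x v = formEval ζ x v

namespace FormEq

theorem refl (η : OneForm x₀) : FormEq F η η := Eventually.of_forall fun _ _ _ => rfl

theorem symm {η ζ : OneForm x₀} (h : FormEq F η ζ) : FormEq F ζ η :=
  h.mono fun _ hx v hv => (hx v hv).symm

theorem trans {η ζ θ : OneForm x₀} (h : FormEq F η ζ) (h' : FormEq F ζ θ) : FormEq F η θ := by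
  filter_upwards [h, h'] with x h1 h2 v hv
  exact (h1 v hv).trans (h2 v hv)

theorem add {η ζ η' ζ' : OneForm x₀} (h : FormEq F η ζ) (h' : FormEq F η' ζ') :
    FormEq F (η + η') (ζ + ζ') := by
  filter_upwards [h, h', (formEval_add η η').filter_mono nhdsWithin_le_nhds,
    (formEval_add ζ ζ').filter_mono nhdsWithin_le_nhds] with x h1 h2 h3 h4 v hv
  rw [h3, h4, h1 v hv, h2 v hv]

theorem smul {a b : JetRing x₀} (hab : EqOnSol F a b) {η ζ : OneForm x₀} (h : FormEq F η ζ) :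
    FormEq F (a • η) (b • ζ) := by
  filter_upwards [h, hab, (formEval_smul a η).filter_mono nhdsWithin_le_nhds,
    (formEval_smul b ζ).filter_mono nhdsWithin_le_nhds] with x h1 h2 h3 h4 v hv
  rw [h3, h4, h1 v hv, h2]

theorem sum {ι : Type*} {s : Finset ι} {η ζ : ι → OneForm x₀} (h : ∀ i ∈ s, FormEq F (η i) (ζ i)) :
    FormEq F (∑ i ∈ s, η i) (∑ i ∈ s, ζ i) := by
  filter_upwards [(Finset.eventually_all s).mpr h,
    (formEval_finsetSum s η).filter_mono nhdsWithin_le_nhds,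
    (formEval_finsetSum s ζ).filter_mono nhdsWithin_le_nhds] with x h1 h2 h3 v hv
  rw [h2, h3]
  exact Finset.sum_congr rfl fun i hi => h1 i hi v hv

/-- The pullback of $\zeta$ by the retraction vanishes on an open set of jets; differentiating it
there along the chart field gives $L_\tau\zeta$ on tangent vectors. Working on $\mathfrak X_0$ alone
would not allow this, as a fixed vector $v$ is not tangent at neighbouring points. -/
theorem lieForm_zero (h : RegularSystemAt F x₀) {ζ : OneForm x₀} (hζ : FormEq F ζ 0) :
    FormEq F (lieForm ζ) 0 := by
  obtain ⟨c⟩ := h.nonempty_chart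
  filter_upwards [c.eventually_sol h, eventually_eventually_nhdsWithin.mpr hζ,
    (formEval_rep_analytic ζ).filter_mono nhdsWithin_le_nhds,
    (formEval_lieForm ζ).filter_mono nhdsWithin_le_nhds] with x hx h0 hb hl v hv
  simp only [formEval_zero] at h0 ⊢
  have hr := c.ret_eq_self hx.1 hx.2
  have hg := (interior_subset hx.1).1
  have ha := c.ret_analytic hg
  have hd := c.jetDiff_ret_eq_self hx.1 hx.2 hv
  have hB : (fun z => ∑ p ∈ ζ.support, (ζ p).rep (c.ret z) *
      lineDeriv ℝ (fun y => c.ret y p.1 p.2) z v) =ᶠ[𝓝 x] fun _ => (0 : ℝ) := by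
    filter_upwards [(c.tendsto_ret hx.1 hx.2).eventually h0, c.eventually_dom hx.1] with z h1 h2
    exact h1 _ (c.jetDiff_ret_mem h2 v)
  have ha1 : ∀ p ∈ ζ.support, JetAnalyticAt (fun z => (ζ p).rep (c.ret z)) x :=
    fun p hp => ha.comp_fun (by rw [hr]; exact hb p hp)
  have ha2 : ∀ p : ℕ × Fin n, JetAnalyticAt
      (fun z => lineDeriv ℝ (fun y => c.ret y p.1 p.2) z v) x :=
    fun p => (ha p.1 p.2).toMap.lineDeriv_left v
  have h1 := jetMap_lineDeriv_congr hB (c.field x)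
  rw [JetAnalyticAt.lineDeriv_fun_sum _ fun p hp => (ha1 p hp).mul (ha2 p)] at h1
  have hz : lineDeriv ℝ (fun _ : Jet n => (0 : ℝ)) x (c.field x) = 0 := by simp [lineDeriv]
  rw [hz] at h1
  have h2 : ∀ p ∈ ζ.support, lineDeriv ℝ (fun z => (ζ p).rep (c.ret z) *
      lineDeriv ℝ (fun y => c.ret y p.1 p.2) z v) x (c.field x) =
      lineDeriv ℝ (ζ p).rep x (jetShift x) * v p.1 p.2 + (ζ p).rep x * (v (p.1 + 1) p.2 -
        jetDiff c.ret x (jetDiff c.field x v) p.1 p.2) := by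
    intro p hp
    rw [JetAnalyticAt.lineDeriv_mul (ha1 p hp) (ha2 p)]
    have e1 : lineDeriv ℝ (fun z => (ζ p).rep (c.ret z)) x (c.field x) =
        lineDeriv ℝ (ζ p).rep x (jetShift x) := by
      have := lieAlong_comp ha (c.ret_rel x) (f := (ζ p).rep) (by rw [hr]; exact (hb p hp).toMap)
      rwa [hr] at this
    have e2 : lineDeriv ℝ (fun y => c.ret y p.1 p.2) x v = v p.1 p.2 :=
      congrFun (congrFun hd p.1) p.2
    have e3 := lineDeriv_lieAlong (ha p.1 p.2).toMap (c.field_analytic hg) v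
    have e4 : lieAlong c.field (fun z => c.ret z p.1 p.2) = fun z => c.ret z (p.1 + 1) p.2 := by
      funext z
      simp only [SolChart.ret, Function.iterate_succ_apply']
    have e5 : lineDeriv ℝ (fun y => c.ret y (p.1 + 1) p.2) x v = v (p.1 + 1) p.2 :=
      congrFun (congrFun hd (p.1 + 1)) p.2
    rw [e4, e5] at e3
    rw [e1, e2, hr]
    congr 2
    rw [eq_sub_iff_add_eq]
    exact e3.symm
  rw [Finset.sum_congr rfl h2] at h1
  -- The differential of the chart field applied to $v$ need not be tangent, but its image under the
  -- differential of the retraction is, so $\zeta$ kills this term.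
  have h3 : ∑ p ∈ ζ.support, (ζ p).rep x * jetDiff c.ret x (jetDiff c.field x v) p.1 p.2 = 0 := by
    have h4 := c.jetDiff_ret_mem hx.1 (jetDiff c.field x v)
    rw [hr] at h4
    exact h0.self_of_nhdsWithin hx.2 _ h4
  simp only [mul_sub, Finset.sum_add_distrib, Finset.sum_sub_distrib, h3, sub_zero] at h1
  rw [hl, formEval_lineDeriv hb]
  exact h1

theorem lieForm (h : RegularSystemAt F x₀) {η ζ : OneForm x₀} (hη : FormEq F η ζ) :
    FormEq F (_root_.lieForm η) (_root_.lieForm ζ) := by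
  have key : ∀ η ζ : OneForm x₀, FormEq F (η + (-1 : JetRing x₀) • ζ) 0 → FormEq F η ζ := by
    intro η ζ h
    have h1 := h.add (FormEq.refl ζ)
    simpa using h1
  refine key _ _ ?_
  have h1 : FormEq F (η + (-1 : JetRing x₀) • ζ) 0 := by
    have := hη.add (FormEq.refl ((-1 : JetRing x₀) • ζ))
    simpa using this
  have h2 := h1.lieForm_zero h
  rwa [lieForm_add, lieForm_smul, map_neg, Derivation.map_one_eq_zero, neg_zero, zero_smul,
    zero_add] at h2

theorem opAct (h : RegularSystemAt F x₀) {P Q : JetOp x₀}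
    (hPQ : ∀ k, EqOnSol F (P.coeff k) (Q.coeff k)) {η ζ : OneForm x₀} (hη : FormEq F η ζ) :
    FormEq F (P • η) (Q • ζ) := by
  have h1 : ∀ k, FormEq F (_root_.lieForm^[k] η) (_root_.lieForm^[k] ζ) := by
    intro k
    induction k with
    | zero => exact hη
    | succ k ih =>
      rw [Function.iterate_succ_apply', Function.iterate_succ_apply']
      exact ih.lieForm h
  obtain ⟨N, hN⟩ := P.exists_bound
  obtain ⟨N', hN'⟩ := Q.exists_bound
  have h2 : ∀ (P : JetOp x₀) (M : ℕ), (∀ j, M ≤ j → P.coeff j = 0) → ∀ η : OneForm x₀,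
      P • η = ∑ j ∈ Finset.range M, P.coeff j • _root_.lieForm^[j] η := by
    intro P M hM η
    refine Finset.sum_subset (fun j hj => ?_) fun j _ hj => ?_
    · by_contra hc
      exact Polynomial.mem_support_iff.mp hj (hM j (by simpa using hc))
    · exact (congrArg (· • _) (Polynomial.notMem_support_iff.mp hj)).trans (zero_smul _ _)
  rw [h2 P (max N N') fun j hj => hN j (le_trans (le_max_left _ _) hj),
    h2 Q (max N N') fun j hj => hN' j (le_trans (le_max_right _ _) hj)]
  exact FormEq.sum fun j _ => FormEq.smul (hPQ j) (h1 j)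

theorem matAct (h : RegularSystemAt F x₀) {p q : ℕ} {P Q : Matrix (Fin p) (Fin q) (JetOp x₀)}
    (hPQ : OpMatEq F P Q) {η ζ : Fin q → OneForm x₀} (hη : ∀ j, FormEq F (η j) (ζ j)) (i : Fin p) :
    FormEq F (_root_.matAct P η i) (_root_.matAct Q ζ i) :=
  FormEq.sum fun j _ => FormEq.opAct h (hPQ i j) (hη j)

end FormEq

end OnSol

/-! ### Smith factors and completions of $P(F)$ over an arbitrary ring. -/

section Blocks

variable {R : Type*} [Ring R] {n a b : ℕ}

theorem rectId_mul_rectId (h : a ≤ n) : rectId R a n * rectId R n a = 1 := by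
  ext i j
  rw [Matrix.mul_apply, Finset.sum_eq_single (Fin.castLE h i)]
  · by_cases hij : i = j
    · subst hij; simp [rectId]
    · have : (i : ℕ) ≠ j := fun h => hij (Fin.ext h)
      simp [rectId, this, hij]
  · intro k _ hk
    have : (i : ℕ) ≠ k := fun h => hk (Fin.ext h.symm)
    simp [rectId, this]
  · simp

theorem rectId_mul_lowerId (h : a + b = n) : rectId R a n * lowerId R n b = 0 := by
  ext i j
  rw [Matrix.mul_apply]
  refine Finset.sum_eq_zero fun k _ => ?_
  by_cases h1 : (i : ℕ) = k
  · have : (k : ℕ) ≠ n - b + j := by omega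
    simp [lowerId, this]
  · simp [rectId, h1]

theorem lowerId_transpose_mul_lowerId (h : b ≤ n) :
    (lowerId R n b).transpose * lowerId R n b = 1 := by
  ext i j
  rw [Matrix.mul_apply, Finset.sum_eq_single ⟨n - b + i, by omega⟩]
  · by_cases hij : i = j
    · subst hij; simp [lowerId]
    · have : (i : ℕ) ≠ j := fun h => hij (Fin.ext h)
      simp [lowerId, this, hij]
  · intro k _ hk
    have : (k : ℕ) ≠ n - b + i := fun h => hk (Fin.ext h)
    simp [lowerId, this]
  · simp

theorem lowerId_transpose_mul_rectId (h : a + b = n) :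
    (lowerId R n b).transpose * rectId R n a = 0 := by
  ext i j
  rw [Matrix.mul_apply]
  refine Finset.sum_eq_zero fun k _ => ?_
  by_cases h1 : (k : ℕ) = j
  · have : (k : ℕ) ≠ n - b + i := by omega
    simp [lowerId, this]
  · simp [rectId, h1]

theorem rectId_add_lowerId (h : a + b = n) :
    rectId R n a * rectId R a n + lowerId R n b * (lowerId R n b).transpose = 1 := by
  ext i j
  rw [Matrix.add_apply, Matrix.mul_apply, Matrix.mul_apply, Matrix.one_apply]
  by_cases hi : (i : ℕ) < a
  · rw [Finset.sum_eq_single (⟨i, hi⟩ : Fin a)]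
    · rw [Finset.sum_eq_zero]
      · simp [rectId, Fin.ext_iff]
      · intro k _
        have : (i : ℕ) ≠ n - b + k := by omega
        simp [lowerId, this]
    · intro k _ hk
      have : (i : ℕ) ≠ k := fun h => hk (Fin.ext h.symm)
      simp [rectId, this]
    · simp
  · rw [Finset.sum_eq_zero]
    · rw [Finset.sum_eq_single (⟨i - a, by omega⟩ : Fin b)]
      · have h1 : (i : ℕ) = n - b + (i - a) := by omega
        simp [lowerId, ← h1, Fin.ext_iff, eq_comm]
      · intro k _ hk
        have : (i : ℕ) ≠ n - b + k := fun h => hk (Fin.ext (by simp; omega))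
        simp [lowerId, this]
      · simp
    · intro k _
      have : (i : ℕ) ≠ k := by omega
      simp [rectId, this]

theorem rectId_map {S : Type*} [Ring S] (f : R →+* S) (p q : ℕ) :
    (rectId R p q).map f = rectId S p q := by
  ext i j; by_cases h : (i : ℕ) = j <;> simp [rectId, h]

theorem lowerId_map {S : Type*} [Ring S] (f : R →+* S) (p q : ℕ) :
    (lowerId R p q).map f = lowerId S p q := by
  ext i j; by_cases h : (i : ℕ) = p - q + j <;> simp [lowerId, h]

/-- A flat description of a presented module: `PF` is completed by `E` to an invertible matrix
with inverse `(W, Θ)`. -/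
structure Completion {m : ℕ} (PF : Matrix (Fin (n - m)) (Fin n) R) (E : Matrix (Fin m) (Fin n) R)
    (Θ : Matrix (Fin n) (Fin m) R) (W : Matrix (Fin n) (Fin (n - m)) R) : Prop where
  EΘ : E * Θ = 1
  PFΘ : PF * Θ = 0
  EW : E * W = 0
  PFW : PF * W = 1
  sum : Θ * E + W * PF = 1

namespace Completion

variable {m : ℕ} {PF : Matrix (Fin (n - m)) (Fin n) R} {E : Matrix (Fin m) (Fin n) R}
    {Θ : Matrix (Fin n) (Fin m) R} {W : Matrix (Fin n) (Fin (n - m)) R}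

/-- In this order of the blocks $(W,\Theta)$ is a right Smith factor of $P(F)$ with $\hat U=\Theta$;
in the order of `left_factor`, $E$ above $P(F)$ is a left Smith factor of $\Theta$. -/
theorem right_inverse (h : Completion PF E Θ W) (hm : m ≤ n) :
    (rectId R n (n - m) * PF + lowerId R n m * E) *
      (W * rectId R (n - m) n + Θ * (lowerId R n m).transpose) = 1 := by
  have e1 : (rectId R n (n - m) * PF) * (W * rectId R (n - m) n) =
      rectId R n (n - m) * rectId R (n - m) n := by
    rw [Matrix.mul_assoc, ← Matrix.mul_assoc PF, h.PFW, Matrix.one_mul]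
  have e2 : (rectId R n (n - m) * PF) * (Θ * (lowerId R n m).transpose) = 0 := by
    rw [Matrix.mul_assoc, ← Matrix.mul_assoc PF, h.PFΘ, Matrix.zero_mul, Matrix.mul_zero]
  have e3 : (lowerId R n m * E) * (W * rectId R (n - m) n) = 0 := by
    rw [Matrix.mul_assoc, ← Matrix.mul_assoc E, h.EW, Matrix.zero_mul, Matrix.mul_zero]
  have e4 : (lowerId R n m * E) * (Θ * (lowerId R n m).transpose) =
      lowerId R n m * (lowerId R n m).transpose := by
    rw [Matrix.mul_assoc, ← Matrix.mul_assoc E, h.EΘ, Matrix.one_mul]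
  rw [Matrix.add_mul, Matrix.mul_add, Matrix.mul_add, e1, e2, e3, e4, add_zero, zero_add,
    rectId_add_lowerId (Nat.sub_add_cancel hm)]

theorem left_inverse (h : Completion PF E Θ W) (hm : m ≤ n) :
    (W * rectId R (n - m) n + Θ * (lowerId R n m).transpose) *
      (rectId R n (n - m) * PF + lowerId R n m * E) = 1 := by
  have hs := Nat.sub_add_cancel hm
  have e1 : (W * rectId R (n - m) n) * (rectId R n (n - m) * PF) = W * PF := by
    rw [Matrix.mul_assoc, ← Matrix.mul_assoc _ _ PF, rectId_mul_rectId (by omega), Matrix.one_mul]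
  have e2 : (W * rectId R (n - m) n) * (lowerId R n m * E) = 0 := by
    rw [Matrix.mul_assoc, ← Matrix.mul_assoc _ _ E, rectId_mul_lowerId hs, Matrix.zero_mul,
      Matrix.mul_zero]
  have e3 : (Θ * (lowerId R n m).transpose) * (rectId R n (n - m) * PF) = 0 := by
    rw [Matrix.mul_assoc, ← Matrix.mul_assoc _ _ PF, lowerId_transpose_mul_rectId hs,
      Matrix.zero_mul, Matrix.mul_zero]
  have e4 : (Θ * (lowerId R n m).transpose) * (lowerId R n m * E) = Θ * E := by
    rw [Matrix.mul_assoc, ← Matrix.mul_assoc _ _ E, lowerId_transpose_mul_lowerId hm,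
      Matrix.one_mul]
  rw [Matrix.add_mul, Matrix.mul_add, Matrix.mul_add, e1, e2, e3, e4, add_zero, zero_add,
    add_comm, h.sum]

/-- The same with the roles of the two blocks exchanged. -/
theorem left_factor (h : Completion PF E Θ W) (hm : m ≤ n) :
    (rectId R n m * E + lowerId R n (n - m) * PF) *
        (Θ * rectId R m n + W * (lowerId R n (n - m)).transpose) = 1 ∧
      (Θ * rectId R m n + W * (lowerId R n (n - m)).transpose) *
        (rectId R n m * E + lowerId R n (n - m) * PF) = 1 := by
  have hs : m + (n - m) = n := by omega
  constructor
  · have e1 : (rectId R n m * E) * (Θ * rectId R m n) = rectId R n m * rectId R m n := by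
      rw [Matrix.mul_assoc, ← Matrix.mul_assoc E, h.EΘ, Matrix.one_mul]
    have e2 : (rectId R n m * E) * (W * (lowerId R n (n - m)).transpose) = 0 := by
      rw [Matrix.mul_assoc, ← Matrix.mul_assoc E, h.EW, Matrix.zero_mul, Matrix.mul_zero]
    have e3 : (lowerId R n (n - m) * PF) * (Θ * rectId R m n) = 0 := by
      rw [Matrix.mul_assoc, ← Matrix.mul_assoc PF, h.PFΘ, Matrix.zero_mul, Matrix.mul_zero]
    have e4 : (lowerId R n (n - m) * PF) * (W * (lowerId R n (n - m)).transpose) =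
        lowerId R n (n - m) * (lowerId R n (n - m)).transpose := by
      rw [Matrix.mul_assoc, ← Matrix.mul_assoc PF, h.PFW, Matrix.one_mul]
    rw [Matrix.add_mul, Matrix.mul_add, Matrix.mul_add, e1, e2, e3, e4, add_zero, zero_add,
      rectId_add_lowerId hs]
  · have e1 : (Θ * rectId R m n) * (rectId R n m * E) = Θ * E := by
      rw [Matrix.mul_assoc, ← Matrix.mul_assoc _ _ E, rectId_mul_rectId hm, Matrix.one_mul]
    have e2 : (Θ * rectId R m n) * (lowerId R n (n - m) * PF) = 0 := by
      rw [Matrix.mul_assoc, ← Matrix.mul_assoc _ _ PF, rectId_mul_lowerId hs, Matrix.zero_mul,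
        Matrix.mul_zero]
    have e3 : (W * (lowerId R n (n - m)).transpose) * (rectId R n m * E) = 0 := by
      rw [Matrix.mul_assoc, ← Matrix.mul_assoc _ _ E, lowerId_transpose_mul_rectId hs,
        Matrix.zero_mul, Matrix.mul_zero]
    have e4 : (W * (lowerId R n (n - m)).transpose) * (lowerId R n (n - m) * PF) = W * PF := by
      rw [Matrix.mul_assoc, ← Matrix.mul_assoc _ _ PF,
        lowerId_transpose_mul_lowerId (Nat.sub_le n m), Matrix.one_mul]
    rw [Matrix.add_mul, Matrix.mul_add, Matrix.mul_add, e1, e2, e3, e4, add_zero, zero_add, h.sum]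

/-- Two of the identities follow from the others when `PF` can be cancelled on the right. -/
theorem of_cancel (EΘ : E * Θ = 1) (PFΘ : PF * Θ = 0) (sum : Θ * E + W * PF = 1)
    (cancel : ∀ {p : ℕ} (Y : Matrix (Fin p) (Fin (n - m)) R), Y * PF = 0 → Y = 0) :
    Completion PF E Θ W := by
  have hW : W * PF = 1 - Θ * E := by rw [← sum]; abel
  refine ⟨EΘ, PFΘ, cancel _ ?_, sub_eq_zero.mp (cancel _ ?_), sum⟩
  · rw [Matrix.mul_assoc, hW, Matrix.mul_sub, Matrix.mul_one, ← Matrix.mul_assoc, EΘ,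
      Matrix.one_mul, sub_self]
  · rw [Matrix.sub_mul, Matrix.mul_assoc, hW, Matrix.mul_sub, Matrix.mul_one, ← Matrix.mul_assoc,
      PFΘ, Matrix.zero_mul, sub_zero, Matrix.one_mul, sub_self]

/-- From the Smith factors to a completion. -/
theorem of_smith (hm : m ≤ n) {U U' Q Q' : Matrix (Fin n) (Fin n) R}
    {V V' : Matrix (Fin (n - m)) (Fin (n - m)) R} {Rm Rm' M M' : Matrix (Fin m) (Fin m) R}
    (hU : U * U' = 1) (hV' : V' * V = 1) (hQ : Q * Q' = 1)
    (hQ' : Q' * Q = 1) (hR : Rm * Rm' = 1) (hM : M * M' = 1) (hM' : M' * M = 1)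
    (hPF : V * PF * U = rectId R (n - m) n)
    (hH : Q * (U * lowerId R n m) * Rm = rectId R n m) :
    ∃ W : Matrix (Fin n) (Fin (n - m)) R,
      (M * (rectId R m n * Q)) * (Q' * (rectId R n m * M')) = 1 ∧
      PF * (Q' * (rectId R n m * M')) = 0 ∧
      (Q' * (rectId R n m * M')) * (M * (rectId R m n * Q)) + W * PF = 1 := by
  have hs := Nat.sub_add_cancel hm
  have hQr : ∀ {p : ℕ} (X : Matrix (Fin n) (Fin p) R), Q * (Q' * X) = X := fun X => by
    rw [← Matrix.mul_assoc, hQ, Matrix.one_mul]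
  have hrr : ∀ {p : ℕ} (X : Matrix (Fin m) (Fin p) R), rectId R m n * (rectId R n m * X) = X :=
    fun X => by rw [← Matrix.mul_assoc, rectId_mul_rectId hm, Matrix.one_mul]
  have hMr : ∀ {p : ℕ} (X : Matrix (Fin m) (Fin p) R), M' * (M * X) = X := fun X => by
    rw [← Matrix.mul_assoc, hM', Matrix.one_mul]
  have hhat : U * lowerId R n m = Q' * (rectId R n m * Rm') := by
    rw [← hH, Matrix.mul_assoc (Q * _), hR, Matrix.mul_one, ← Matrix.mul_assoc, hQ', Matrix.one_mul]
  have hVPF : V * PF = rectId R (n - m) n * U' := by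
    rw [← hPF, Matrix.mul_assoc, hU, Matrix.mul_one]
  have hPFU : PF * (U * lowerId R n m) = 0 := by
    have h1 : PF = V' * (V * PF) := by rw [← Matrix.mul_assoc, hV', Matrix.one_mul]
    rw [h1, Matrix.mul_assoc, ← Matrix.mul_assoc (V * PF), hPF, rectId_mul_lowerId hs,
      Matrix.mul_zero]
  have hΘ : Q' * (rectId R n m * M') = (U * lowerId R n m) * (Rm * M') := by
    rw [hhat, Matrix.mul_assoc, Matrix.mul_assoc, ← Matrix.mul_assoc Rm']
    -- Only $RR'=1$ is given; the other product is read off from the Smith identity by cancelling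
    -- $\binom{I}{0}$.
    have h1 : Rm' * Rm = 1 := by
      have h2 : rectId R n m * (Rm' * Rm) = rectId R n m := by
        have h3 : Q * (U * lowerId R n m) * Rm = Q * (Q' * (rectId R n m * Rm')) * Rm := by rw [hhat]
        rw [hH, hQr, Matrix.mul_assoc] at h3
        exact h3.symm
      rw [← hrr (Rm' * Rm), h2, rectId_mul_rectId hm]
    rw [h1, Matrix.one_mul]
  have hone : U * rectId R n (n - m) * (V * PF) +
      U * lowerId R n m * ((lowerId R n m).transpose * U') = 1 := by
    rw [hVPF, Matrix.mul_assoc U, Matrix.mul_assoc U, ← Matrix.mul_add,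
      ← Matrix.mul_assoc _ _ U', ← Matrix.mul_assoc _ _ U', ← Matrix.add_mul,
      rectId_add_lowerId hs, Matrix.one_mul, hU]
  set Θ := Q' * (rectId R n m * M') with hΘd
  set E := M * (rectId R m n * Q) with hEd
  have hΘE : Θ * E * (U * lowerId R n m) = U * lowerId R n m := by
    rw [hhat, hΘd, hEd]
    simp only [Matrix.mul_assoc]
    rw [hQr, hrr, hMr]
  -- The identity splits as a right factor times $VP(F)$ plus $\hat U$ times a row block. Since
  -- $\Theta E$ fixes $\hat U$, multiplication by $1-\Theta E$ kills the second summand and leaves a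
  -- left multiple of $P(F)$.
  refine ⟨(1 - Θ * E) * (U * rectId R n (n - m)) * V, ?_, ?_, ?_⟩
  · rw [hEd, hΘd]
    simp only [Matrix.mul_assoc]
    rw [hQr, hrr, hM]
  · rw [hΘ, ← Matrix.mul_assoc, hPFU, Matrix.zero_mul]
  · have h1 : (1 - Θ * E) * (U * lowerId R n m * ((lowerId R n m).transpose * U')) = 0 := by
      rw [← Matrix.mul_assoc, Matrix.sub_mul, Matrix.one_mul, hΘE, sub_self, Matrix.zero_mul]
    have h2 := congrArg (fun Z => (1 - Θ * E) * Z) hone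
    simp only [Matrix.mul_add, h1, add_zero, Matrix.mul_one] at h2
    rw [Matrix.mul_assoc _ V PF, Matrix.mul_assoc (1 - Θ * E), h2]
    abel

end Completion

end Blocks

/-! ### Differentials of functions and division by $P(F)$. -/

section Differentials

variable {n m : ℕ} {F : (Fin n → ℝ) × (Fin n → ℝ) → Fin (n - m) → ℝ} {x₀ : Jet n}

/-- The row of polynomials `∑_j ∂f/∂x_l^{(j)} (d/dt)^j`. -/
def opRow (x₀ : Jet n) (f : Jet n → ℝ) (l : Fin n) : JetOp x₀ :=
  ∑ᶠ j : ℕ, DiffOp.mono _ j (JetRing.of x₀ (jetPartial (j, l) f))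

theorem JetAnalyticAt.of_partial_eq_zero {f : Jet n → ℝ} (h : JetAnalyticAt f x₀) :
    ∃ k, ∀ p : ℕ × Fin n, k ≤ p.1 → JetRing.of x₀ (jetPartial p f) = 0 := by
  obtain ⟨k, hk⟩ := h.lineDeriv_eq_sum
  refine ⟨k, fun p hp => ?_⟩
  rw [JetRing.of_congr (h.partialDeriv p) (g := fun _ => 0) (hk.mono fun z hz => hz.1 p hp),
    JetRing.of_zero]

theorem opRow_coeff {f : Jet n → ℝ} (h : JetAnalyticAt f x₀) (l : Fin n) (j : ℕ) :
    (opRow x₀ f l).coeff j = JetRing.of x₀ (jetPartial (j, l) f) := by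
  obtain ⟨k, hk⟩ := h.of_partial_eq_zero
  rw [opRow, finsum_eq_sum_of_support_subset (s := Finset.range k), DiffOp.coeff_sum]
  · simp only [DiffOp.coeff_mono]
    rw [Finset.sum_ite_eq']
    split_ifs with hj
    · rfl
    · exact (hk (j, l) (by simpa using hj)).symm
  · intro j hj
    by_contra hc
    refine hj ?_
    change DiffOp.mono _ j _ = 0
    rw [hk (j, l) (by simpa using hc), DiffOp.mono_zero]

/-- The differential of a function, as a germ of a 1-form. -/
def diffForm (x₀ : Jet n) (f : Jet n → ℝ) : OneForm x₀ := ∑ l, opRow x₀ f l • coordForms x₀ l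

theorem diffForm_apply {f : Jet n → ℝ} (h : JetAnalyticAt f x₀) (p : ℕ × Fin n) :
    diffForm x₀ f p = JetRing.of x₀ (jetPartial p f) := by
  rw [diffForm, Finsupp.finsetSum_apply]
  simp only [opAct_coord]
  simp [opRow_coeff h]

theorem formEval_diffForm {f : Jet n → ℝ} (h : JetAnalyticAt f x₀) :
    ∀ᶠ x in 𝓝 x₀, ∀ v, formEval (diffForm x₀ f) x v = lineDeriv ℝ f x v := by
  obtain ⟨k, hk⟩ := h.of_partial_eq_zero
  obtain ⟨l, hl⟩ := h.lineDeriv_eq_sum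
  set s : Finset (ℕ × Fin n) := Finset.range (max k l) ×ˢ Finset.univ with hs
  have hsupp : (diffForm x₀ f).support ⊆ s := by
    intro p hp
    by_contra hc
    refine Finsupp.mem_support_iff.mp hp ?_
    rw [diffForm_apply h, hk]
    have : max k l ≤ p.1 := by simpa [hs] using hc
    exact le_trans (le_max_left _ _) this
  filter_upwards [formEval_eq_sum _ hsupp, hl, (Finset.eventually_all s).mpr fun p _ =>
    JetRing.rep_of (h.partialDeriv p)] with x h1 h2 h3 v
  rw [h1, h2.2 _ (le_max_right k l)]
  refine Finset.sum_congr rfl fun p hp => ?_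
  rw [diffForm_apply h, h3 p hp, mul_comm]

theorem diffForm_congr (h : RegularSystemAt F x₀) {f g : Jet n → ℝ} (hf : JetAnalyticAt f x₀)
    (hg : JetAnalyticAt g x₀) (hfg : f =ᶠ[𝓝[solSet F] x₀] g) :
    FormEq F (diffForm x₀ f) (diffForm x₀ g) := by
  filter_upwards [(formEval_diffForm hf).filter_mono nhdsWithin_le_nhds,
    (formEval_diffForm hg).filter_mono nhdsWithin_le_nhds,
    h.eventually_lineDeriv_eq hf.toMap hg.toMap hfg] with x h1 h2 h3 v hv
  rw [h1, h2, h3 v hv]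

theorem diffForm_lieTau {f : Jet n → ℝ} (h : JetAnalyticAt f x₀) :
    FormEq F (diffForm x₀ (lieTau f)) (lieForm (diffForm x₀ f)) := by
  refine Filter.Eventually.filter_mono nhdsWithin_le_nhds ?_
  filter_upwards [formEval_diffForm h.lieTau, formEval_lieForm (diffForm x₀ f),
    eventually_eventually_nhds.mpr (formEval_diffForm h), h.eventually_at] with x h1 h2 h3 h4 v _
  have e : (fun z => formEval (diffForm x₀ f) z v) =ᶠ[𝓝 x] fun z => lineDeriv ℝ f z v :=
    h3.mono fun z hz => hz v
  rw [h1, h2, h3.self_of_nhds, lineDeriv_lieTau h4, jetMap_lineDeriv_congr e,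
    lieTau_eq_lieAlong (h4.toMap.lineDeriv_left v).toFun]

theorem diffForm_iterate_lieTau (h : RegularSystemAt F x₀) {f : Jet n → ℝ}
    (hf : JetAnalyticAt f x₀) (k : ℕ) :
    FormEq F (diffForm x₀ (lieTau^[k] f)) (lieForm^[k] (diffForm x₀ f)) := by
  induction k with
  | zero => exact FormEq.refl _
  | succ k ih =>
    rw [Function.iterate_succ_apply', Function.iterate_succ_apply']
    exact (diffForm_lieTau (hf.iterate_lieTau k)).trans (ih.lieForm h)

theorem RegularSystemAt.sysFun_analytic (h : RegularSystemAt F x₀) (i : Fin (n - m)) :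
    JetAnalyticAt (sysFun F i) x₀ :=
  _root_.sysFun_analytic (x := x₀) h.analytic i

theorem varMatrix_eq (h : RegularSystemAt F x₀) (i : Fin (n - m)) (l : Fin n) :
    varMatrix F x₀ i l = opRow x₀ (sysFun F i) l := by
  ext j
  rw [opRow_coeff (h.sysFun_analytic i), varMatrix, Matrix.of_apply, DiffOp.coeff_add,
    DiffOp.coeff_mono, DiffOp.coeff_mono]
  rcases j with _ | _ | j
  · simp
  · simp
  · rw [if_neg (by omega), if_neg (by omega), add_zero]
    have : jetPartial (j + 1 + 1, l) (sysFun F i) =ᶠ[𝓝 x₀] fun _ => 0 := by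
      filter_upwards [continuous_jetPair.continuousAt.eventually h.analytic.eventually_analyticAt]
        with z hz
      rw [jetPartial, lineDeriv_sysFun hz]
      have h0 : (jetBasis (j + 1 + 1, l) : Jet n) 0 = 0 := by simp [jetBasis]
      have h1 : (jetBasis (j + 1 + 1, l) : Jet n) 1 = 0 := by simp [jetBasis]
      rw [h0, h1, Prod.mk_zero_zero, map_zero]; rfl
    rw [JetRing.of_congr ((h.sysFun_analytic i).partialDeriv _) this, JetRing.of_zero]

theorem matAct_varMatrix (h : RegularSystemAt F x₀) (i : Fin (n - m)) :
    FormEq F (matAct (varMatrix F x₀) (coordForms x₀) i) 0 := by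
  have e : matAct (varMatrix F x₀) (coordForms x₀) i = diffForm x₀ (sysFun F i) := by
    rw [matAct_apply, diffForm]
    exact Finset.sum_congr rfl fun l _ => by rw [varMatrix_eq h]
  rw [e]
  filter_upwards [(formEval_diffForm (h.sysFun_analytic i)).filter_mono nhdsWithin_le_nhds]
    with x h1 v hv
  rw [h1, formEval_zero]
  exact hv 0 i

/-- Evaluation of germs at the base point. -/
def evalBase (x₀ : Jet n) : JetRing x₀ →+* ℝ where
  toFun a := a.rep x₀
  map_one' := JetRing.rep_one.eq_of_nhds
  map_mul' a b := (JetRing.rep_mul a b).eq_of_nhds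
  map_zero' := JetRing.rep_zero.eq_of_nhds
  map_add' a b := (JetRing.rep_add a b).eq_of_nhds

/-- The germs form a local ring with residue map `evalBase`, so invertibility of a matrix of germs
can be checked at the base point. -/
theorem JetRing.isUnit_of_evalBase_ne_zero {a : JetRing x₀} (h : evalBase x₀ a ≠ 0) : IsUnit a := by
  have h0 : a.rep x₀ ≠ 0 := h
  have h1 : JetAnalyticAt (fun z => (a.rep z)⁻¹) x₀ :=
    JetMapAnalyticAt.comp_analytic (h := fun r : ℝ => r⁻¹) (analyticAt_inv h0)
      a.rep_analytic.toMap
  refine IsUnit.of_mul_eq_one (JetRing.of x₀ fun z => (a.rep z)⁻¹) (JetRing.ext_rep ?_)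
  filter_upwards [JetRing.rep_mul a (JetRing.of x₀ fun z => (a.rep z)⁻¹), JetRing.rep_of h1,
    JetRing.rep_one (x₀ := x₀), a.rep_analytic.toMap.continuousAt.eventually_ne h0] with z e1 e2 e3 e4
  rw [e1, e2, e3, mul_inv_cancel₀ e4]

/-- Constants, as germs. -/
def constGerm (x₀ : Jet n) (r : ℝ) : JetRing x₀ := JetRing.of x₀ fun _ => r

theorem rep_constGerm (r : ℝ) : (constGerm x₀ r).rep =ᶠ[𝓝 x₀] fun _ => r :=
  JetRing.rep_of (JetAnalyticAt.const r x₀)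

theorem evalBase_constGerm (r : ℝ) : evalBase x₀ (constGerm x₀ r) = r := (rep_constGerm r).eq_of_nhds

/-- The matrix of germs `∂F/∂ẋ`. -/
def velMatrix (F : (Fin n → ℝ) × (Fin n → ℝ) → Fin (n - m) → ℝ) (x₀ : Jet n) :
    Matrix (Fin (n - m)) (Fin n) (JetRing x₀) :=
  Matrix.of fun i l => JetRing.of x₀ (jetPartial (1, l) (sysFun F i))

theorem evalBase_velMatrix (h : RegularSystemAt F x₀) (i : Fin (n - m)) (l : Fin n) :
    evalBase x₀ (velMatrix F x₀ i l) = velDeriv F (x₀ 0, x₀ 1) (Pi.single l 1) i := by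
  have h1 : evalBase x₀ (velMatrix F x₀ i l) = jetPartial (1, l) (sysFun F i) x₀ :=
    (JetRing.rep_of ((h.sysFun_analytic i).partialDeriv (1, l))).eq_of_nhds
  rw [h1, jetPartial, lineDeriv_sysFun (x := x₀) h.analytic, velDeriv_apply]
  have h0 : (jetBasis (1, l) : Jet n) 0 = 0 := by simp [jetBasis]
  have h1 : (jetBasis (1, l) : Jet n) 1 = Pi.single l 1 := by simp [jetBasis]
  rw [h0, h1]
  rfl

/-- A right inverse `Λ` of `∂F/∂ẋ` over the germs such that `1 - Λ ∂F/∂ẋ` factors through the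
projection of the chart. -/
theorem SolChart.exists_germ_inverse (h : RegularSystemAt F x₀) (c : SolChart F x₀) :
    ∃ (Λ : Matrix (Fin n) (Fin (n - m)) (JetRing x₀)),
      velMatrix F x₀ * Λ = 1 ∧
      (1 - Λ * velMatrix F x₀) * (Matrix.of fun i l => constGerm x₀ (c.pr (Pi.single l 1) i)) =
        1 - Λ * velMatrix F x₀ := by
  classical
  let Lc : Matrix (Fin n) (Fin (n - m)) (JetRing x₀) :=
    Matrix.of fun l i => constGerm x₀ (c.L (Pi.single i 1) l)
  let V0 : Matrix (Fin (n - m)) (Fin n) (JetRing x₀) :=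
    Matrix.of fun i l => constGerm x₀ (velDeriv F (x₀ 0, x₀ 1) (Pi.single l 1) i)
  set K := velMatrix F x₀ * Lc with hK
  have hsum : ∀ {a b : ℕ} (T : (Fin a → ℝ) →L[ℝ] (Fin b → ℝ)) (v : Fin a → ℝ) (i : Fin b),
      ∑ l, T (Pi.single l 1) i * v l = T v i := by
    intro a b T v i
    conv_rhs => rw [pi_eq_sum_univ' v, map_sum, Finset.sum_apply]
    refine Finset.sum_congr rfl fun l _ => ?_
    rw [map_smul, Pi.smul_apply, smul_eq_mul, mul_comm]
  have hK1 : (evalBase x₀).mapMatrix K = 1 := by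
    ext i j
    rw [RingHom.mapMatrix_apply, Matrix.map_apply, hK, Matrix.mul_apply, map_sum]
    have : ∀ l, evalBase x₀ (velMatrix F x₀ i l * Lc l j) =
        velDeriv F (x₀ 0, x₀ 1) (Pi.single l 1) i * c.L (Pi.single j 1) l := fun l => by
      rw [map_mul, evalBase_velMatrix h]
      exact congrArg _ (evalBase_constGerm _)
    rw [Finset.sum_congr rfl fun l _ => this l, hsum, c.L_right, Matrix.one_apply, Pi.single_apply]
  have hdet : IsUnit K.det := by
    refine JetRing.isUnit_of_evalBase_ne_zero ?_
    rw [RingHom.map_det, hK1, Matrix.det_one]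
    exact one_ne_zero
  have hpr : (Matrix.of fun i l => constGerm x₀ (c.pr (Pi.single l 1) i)) = 1 - Lc * V0 := by
    refine Matrix.ext fun i l => JetRing.ext_rep ?_
    have e1 : ((1 : Matrix (Fin n) (Fin n) (JetRing x₀)) i l) =
        constGerm x₀ ((Pi.single l 1 : Fin n → ℝ) i) := by
      by_cases hil : i = l
      · subst hil
        rw [Matrix.one_apply_eq, Pi.single_eq_same]
        exact JetRing.ext_rep (JetRing.rep_one.trans (rep_constGerm 1).symm)
      · rw [Matrix.one_apply_ne hil, Pi.single_eq_of_ne hil]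
        exact JetRing.of_zero.symm
    have e2 : (1 - Lc * V0 : Matrix (Fin n) (Fin n) (JetRing x₀)) i l + (Lc * V0) i l = constGerm x₀ ((Pi.single l 1 : Fin n → ℝ) i) := by
      rw [← e1, Matrix.sub_apply, sub_add_cancel]
    have e3 : ((Lc * V0) i l).rep =ᶠ[𝓝 x₀]
        fun _ => c.L (velDeriv F (x₀ 0, x₀ 1) (Pi.single l 1)) i := by
      rw [Matrix.mul_apply]
      have h1 : ∀ k, (Lc i k * V0 k l).rep =ᶠ[𝓝 x₀] fun _ =>
          c.L (Pi.single k 1) i * velDeriv F (x₀ 0, x₀ 1) (Pi.single l 1) k := by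
        intro k
        filter_upwards [JetRing.rep_mul (Lc i k) (V0 k l),
          rep_constGerm (x₀ := x₀) (c.L (Pi.single k 1) i),
          rep_constGerm (x₀ := x₀) (velDeriv F (x₀ 0, x₀ 1) (Pi.single l 1) k)] with z a1 a2 a3
        rw [a1]
        exact congrArg₂ (· * ·) a2 a3
      filter_upwards [JetRing.rep_sum Finset.univ fun k => Lc i k * V0 k l,
        eventually_all.mpr h1] with z a1 a2
      rw [a1, Finset.sum_congr rfl fun k _ => a2 k, hsum]
    filter_upwards [rep_constGerm (x₀ := x₀) (c.pr (Pi.single l 1) i), e3,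
      rep_constGerm (x₀ := x₀) ((Pi.single l 1 : Fin n → ℝ) i),
      JetRing.rep_add ((1 - Lc * V0 : Matrix (Fin n) (Fin n) (JetRing x₀)) i l) ((Lc * V0) i l)] with z a1 a2 a3 a4
    rw [e2, a3, a2] at a4
    rw [Matrix.of_apply, a1, c.pr_eq, Pi.sub_apply, a4]
    ring
  -- With $K=\frac{\partial F}{\partial\dot x}L$, equal to $1$ at the base point and hence
  -- invertible, put $\Lambda=LK^{-1}$. Then $1-\Lambda\frac{\partial F}{\partial\dot x}$ kills $L$,
  -- so multiplying it by $\pi=1-LD$ changes nothing.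
  refine ⟨Lc * K⁻¹, ?_, ?_⟩
  · rw [← Matrix.mul_assoc, ← hK, Matrix.mul_nonsing_inv _ hdet]
  · rw [hpr, Matrix.mul_sub, Matrix.mul_one, ← Matrix.mul_assoc, Matrix.sub_mul, Matrix.one_mul,
      Matrix.mul_assoc (Lc * K⁻¹) _ Lc, ← hK, Matrix.mul_assoc Lc _ K, Matrix.nonsing_inv_mul _ hdet,
      Matrix.mul_one, sub_self, Matrix.zero_mul, sub_zero]

theorem varMatrix_coeff (i : Fin (n - m)) (l : Fin n) {j : ℕ} (hj : 2 ≤ j) :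
    (varMatrix F x₀ i l).coeff j = 0 := by
  rw [varMatrix, Matrix.of_apply, DiffOp.coeff_add, DiffOp.coeff_mono, DiffOp.coeff_mono,
    if_neg (by omega), if_neg (by omega), add_zero]

/-- The two leading facts about the coefficients of `(d/dt)^k P(F)`. -/
theorem dt_pow_varMatrix_coeff (k : ℕ) (i : Fin (n - m)) (l : Fin n) :
    (DiffOp.dt _ ^ k * varMatrix F x₀ i l).coeff (k + 1) = velMatrix F x₀ i l ∧
      ∀ j, k + 2 ≤ j → (DiffOp.dt _ ^ k * varMatrix F x₀ i l).coeff j = 0 := by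
  induction k with
  | zero =>
    rw [pow_zero, one_mul]
    refine ⟨?_, fun j hj => varMatrix_coeff i l hj⟩
    rw [varMatrix, Matrix.of_apply, DiffOp.coeff_add, DiffOp.coeff_mono, DiffOp.coeff_mono]
    simp [velMatrix]
  | succ k ih =>
    rw [pow_succ', mul_assoc]
    refine ⟨?_, fun j hj => ?_⟩
    · rw [DiffOp.coeff_dt_mul_succ, ih.1, ih.2 _ le_rfl, map_zero, add_zero]
    · obtain ⟨j, rfl⟩ : ∃ i, j = i + 1 := ⟨j - 1, by omega⟩
      rw [DiffOp.coeff_dt_mul_succ, ih.2 _ (by omega), ih.2 _ (by omega), map_zero, add_zero]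

theorem mono_mul_dt_pow_coeff (k : ℕ) (a : JetRing x₀) (P : JetOp x₀) (j : ℕ) :
    (DiffOp.mono _ k a * P).coeff j = a * (DiffOp.dt _ ^ k * P).coeff j := by
  rw [DiffOp.coeff_mul (N := k + 1) (fun i hi => by rw [DiffOp.coeff_mono, if_neg (by omega)]),
    Finset.sum_range_succ, Finset.sum_eq_zero, zero_add, DiffOp.coeff_mono, if_pos rfl]
  intro i hi
  rw [DiffOp.coeff_mono, if_neg (Finset.mem_range.mp hi).ne', zero_mul]

/-- Division by `P(F)`: the remainder has its coefficients of positive degree factoring through the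
projection of the chart. -/
theorem exists_division {Λ : Matrix (Fin n) (Fin (n - m)) (JetRing x₀)}
    {q : Matrix (Fin n) (Fin n) (JetRing x₀)}
    (hq : (1 - Λ * velMatrix F x₀) * q = 1 - Λ * velMatrix F x₀)
    (N : ℕ) : ∀ (ζ : Fin n → JetOp x₀), (∀ l j, N ≤ j → (ζ l).coeff j = 0) →
    ∃ (W : Fin (n - m) → JetOp x₀) (ζ' : Fin n → JetOp x₀),
      (∀ l, ζ l = ∑ i, W i * varMatrix F x₀ i l + ζ' l) ∧
      ∀ j, 1 ≤ j → ∃ β : Fin n → JetRing x₀, ∀ l, (ζ' l).coeff j = Matrix.vecMul β q l := by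
  induction N with
  | zero =>
    intro ζ hζ
    refine ⟨0, ζ, fun l => by simp, fun j _ => ⟨0, fun l => ?_⟩⟩
    rw [hζ l j (Nat.zero_le _), Matrix.zero_vecMul]; rfl
  | succ N ih =>
    intro ζ hζ
    -- A row with coefficients of order zero only is its own remainder; reduction concerns positive
    -- orders.
    rcases Nat.eq_zero_or_pos N with rfl | hN
    · refine ⟨0, ζ, fun l => by simp, fun j hj => ⟨0, fun l => ?_⟩⟩
      rw [hζ l j (by omega), Matrix.zero_vecMul]; rfl
    · obtain ⟨N, rfl⟩ : ∃ k, N = k + 1 := ⟨N - 1, by omega⟩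
      -- The top coefficient splits as $z=t\frac{\partial F}{\partial\dot x}+\beta$ with
      -- $t=z\Lambda$. The first part is the leading coefficient of $t\frac{d^N}{dt^N}P(F)$ and is
      -- divided out; $\beta$ satisfies $\beta q=\beta$ and goes into the remainder.
      let z : Fin n → JetRing x₀ := fun l => (ζ l).coeff (N + 1)
      let t : Fin (n - m) → JetRing x₀ := Matrix.vecMul z Λ
      let β : Fin n → JetRing x₀ := Matrix.vecMul z (1 - Λ * velMatrix F x₀)
      have hβ : Matrix.vecMul β q = β := by rw [Matrix.vecMul_vecMul, hq]
      let ζ₁ : Fin n → JetOp x₀ := fun l => ζ l - ∑ i, DiffOp.mono _ N (t i) * varMatrix F x₀ i l -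
        DiffOp.mono _ (N + 1) (β l)
      obtain ⟨W, ζ', h1, h2⟩ := ih ζ₁ (by
        intro l j hj
        rw [DiffOp.coeff_sub, DiffOp.coeff_sub, DiffOp.coeff_sum, DiffOp.coeff_mono]
        simp only [mono_mul_dt_pow_coeff]
        rcases Nat.eq_or_lt_of_le hj with rfl | hj
        · rw [if_pos rfl, sub_sub, sub_eq_zero]
          have h3 : β = z - Matrix.vecMul t (velMatrix F x₀) := by
            have h4 : β = Matrix.vecMul z (1 - Λ * velMatrix F x₀) := rfl
            rw [h4, Matrix.vecMul_vecMul, Matrix.vecMul_sub, Matrix.vecMul_one]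
          rw [h3, Pi.sub_apply]
          simp only [(dt_pow_varMatrix_coeff N _ l).1]
          change z l = Matrix.vecMul t (velMatrix F x₀) l + _
          abel
        · rw [hζ l j hj, if_neg (by omega), Finset.sum_eq_zero, sub_zero, sub_zero]
          intro i _
          rw [(dt_pow_varMatrix_coeff N i l).2 j hj, mul_zero])
      refine ⟨fun i => W i + DiffOp.mono _ N (t i), fun l => ζ' l + DiffOp.mono _ (N + 1) (β l),
        fun l => ?_, fun j hj => ?_⟩
      · have := h1 l
        simp only [add_mul, Finset.sum_add_distrib]
        rw [sub_eq_iff_eq_add, sub_eq_iff_eq_add] at this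
        rw [this]; abel
      · obtain ⟨b, hb⟩ := h2 j hj
        by_cases hjN : j = N + 1
        · refine ⟨b + β, fun l => ?_⟩
          rw [DiffOp.coeff_add, hb, DiffOp.coeff_mono, if_pos hjN.symm, Matrix.add_vecMul, hβ]
          rfl
        · refine ⟨b, fun l => ?_⟩
          rw [DiffOp.coeff_add, hb, DiffOp.coeff_mono, if_neg (Ne.symm hjN), add_zero]

end Differentials

/-! ### The relations between the $dx_i$ on $\mathfrak X_0$ and cancellation of $P(F)$. -/

section Annihilator

variable {n m : ℕ} {F : (Fin n → ℝ) × (Fin n → ℝ) → Fin (n - m) → ℝ} {x₀ : Jet n}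

theorem solMap_sub_eq_zero_iff (h : RegularSystemAt F x₀) {P : JetOp x₀} :
    solMap h P = 0 ↔ ∀ k, EqOnSol F (P.coeff k) 0 := by
  rw [← map_zero (solMap h), solMap_eq_iff]
  rfl

/-- A form whose coefficients of positive order factor through the projection of the chart and
which vanishes on the tangent vectors of `𝔛₀` has coefficients vanishing on `𝔛₀`. -/
theorem SolChart.coeff_eq_zero (h : RegularSystemAt F x₀) (c : SolChart F x₀) {η : OneForm x₀}
    (hη : FormEq F η 0)
    (hβ : ∀ j, 1 ≤ j → ∃ β : Fin n → JetRing x₀, ∀ l, η (j, l) =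
      Matrix.vecMul β (Matrix.of fun i l => constGerm x₀ (c.pr (Pi.single l 1) i)) l)
    (p : ℕ × Fin n) : EqOnSol F (η p) 0 := by
  classical
  by_cases hp : p ∈ η.support
  swap
  · rw [Finsupp.notMem_support_iff.mp hp]
    exact EqOnSol.refl _
  have key : ∀ᶠ x in 𝓝 x₀, ∀ v : Jet n, v 0 = 0 → (∀ j, c.pr (v (j + 1)) = 0) →
      formEval η x v = 0 := by
    obtain ⟨N, hN⟩ : ∃ N, η.support ⊆ Finset.range N ×ˢ (Finset.univ : Finset (Fin n)) := by
      refine ⟨η.support.sup Prod.fst + 1, fun q hq => ?_⟩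
      simpa using Nat.lt_succ_of_le (Finset.le_sup (f := Prod.fst) hq)
    choose! β hβ using hβ
    have hrep : ∀ q ∈ Finset.range N ×ˢ (Finset.univ : Finset (Fin n)), ∀ᶠ x in 𝓝 x₀, 1 ≤ q.1 →
        (η q).rep x = ∑ i, (β q.1 i).rep x * c.pr (Pi.single q.2 1) i := by
      intro q _
      by_cases hq : 1 ≤ q.1
      swap
      · exact Eventually.of_forall fun _ h => absurd h hq
      have e := hβ q.1 hq q.2
      rw [Matrix.vecMul, dotProduct] at e
      filter_upwards [JetRing.rep_sum Finset.univ (fun i => β q.1 i *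
          constGerm x₀ (c.pr (Pi.single q.2 1) i)),
        eventually_all.mpr fun i => JetRing.rep_mul (β q.1 i)
          (constGerm x₀ (c.pr (Pi.single q.2 1) i)),
        eventually_all.mpr fun i => rep_constGerm (x₀ := x₀) (c.pr (Pi.single q.2 1) i)]
        with x h1 h2 h3 _
      have e' : η q = ∑ i, β q.1 i * constGerm x₀ (c.pr (Pi.single q.2 1) i) := e
      rw [e', h1]
      exact Finset.sum_congr rfl fun i _ => by rw [h2, h3]
    filter_upwards [formEval_eq_sum η hN, (Finset.eventually_all _).mpr hrep] with x h1 h2 v hv0 hv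
    rw [h1, Finset.sum_product]
    refine Finset.sum_eq_zero fun j hj => ?_
    rcases j with _ | j
    · exact Finset.sum_eq_zero fun l _ => by rw [hv0]; simp
    · have e : ∀ l, (η (j + 1, l)).rep x * v (j + 1) l =
          ∑ i, (β (j + 1) i).rep x * (v (j + 1) l * c.pr (Pi.single l 1) i) := fun l => by
        rw [h2 (j + 1, l) (by simpa using hj) (by simp), Finset.sum_mul]
        exact Finset.sum_congr rfl fun i _ => by ring
      simp only [e]
      rw [Finset.sum_comm]
      refine Finset.sum_eq_zero fun i _ => ?_
      rw [← Finset.mul_sum]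
      have e2 : ∑ l, v (j + 1) l * c.pr (Pi.single l 1) i = c.pr (v (j + 1)) i := by
        conv_rhs => rw [pi_eq_sum_univ' (v (j + 1)), map_sum, Finset.sum_apply]
        exact Finset.sum_congr rfl fun l _ => by rw [map_smul, Pi.smul_apply, smul_eq_mul]
      rw [e2, hv, Pi.zero_apply, mul_zero]
  filter_upwards [c.eventually_sol h, hη, key.filter_mono nhdsWithin_le_nhds,
    (formEval_eq_sum η (Finset.Subset.refl _)).filter_mono nhdsWithin_le_nhds,
    JetRing.rep_zero.filter_mono nhdsWithin_le_nhds] with x hx h1 h2 h3 h4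
  rw [h4]
  have e1 : (η p).rep x = formEval η x (jetBasis p) := by
    rw [h3, Finset.sum_eq_single p]
    · simp [jetBasis]
    · intro q _ hq
      have : (jetBasis p : Jet n) q.1 q.2 = 0 := by
        simp only [jetBasis]
        by_cases h5 : q.1 = p.1
        · have h6 : q.2 ≠ p.2 := fun h6 => hq (Prod.ext h5 h6)
          rw [h5, Pi.single_eq_same, Pi.single_eq_of_ne h6]
        · rw [Pi.single_eq_of_ne h5]; rfl
      rw [this, mul_zero]
    · exact fun hc => absurd hp hc
  -- The coordinate vector differs from its image under the differential of the retraction by a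
  -- vector without free components. The form kills that difference by its special shape, and kills
  -- the image because it is tangent.
  have e2 := c.jetDiff_ret_apply hx.1 (jetBasis p)
  have e3 := c.jetDiff_ret_mem hx.1 (jetBasis p)
  rw [c.ret_eq_self hx.1 hx.2] at e3
  have e4 := h1 _ e3
  rw [formEval_zero] at e4
  have e5 := h2 (jetBasis p + (-1 : ℝ) • jetDiff c.ret x (jetBasis p))
    (by rw [Pi.add_apply, Pi.smul_apply, e2.1]; simp) fun j => by
      rw [Pi.add_apply, Pi.smul_apply, map_add, map_smul, e2.2]; simp
  rw [formEval_add_right, formEval_smul_right, e4, mul_zero, add_zero] at e5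
  rw [e1, e5]

/-- The rows annihilating `dx` on `𝔛₀` are left multiples of `P(F)`. -/
theorem RegularSystemAt.exists_left_factor (h : RegularSystemAt F x₀) {ζ : Fin n → JetOp x₀}
    (hζ : FormEq F (∑ l, ζ l • coordForms x₀ l) 0) :
    ∃ W : Fin (n - m) → JetOp x₀, ∀ l,
      solMap h (ζ l) = solMap h (∑ i, W i * varMatrix F x₀ i l) := by
  obtain ⟨c⟩ := h.nonempty_chart
  obtain ⟨Λ, _, hΛ⟩ := c.exists_germ_inverse h
  choose N hN using fun l => (ζ l).exists_bound
  obtain ⟨W, ζ', h1, h2⟩ := exists_division hΛ (Finset.univ.sup N) ζ fun l j hj =>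
    hN l j (le_trans (Finset.le_sup (Finset.mem_univ l)) hj)
  refine ⟨W, fun l => ?_⟩
  have hco : ∀ p : ℕ × Fin n, (∑ l, ζ' l • coordForms x₀ l) p = (ζ' p.2).coeff p.1 := by
    intro p
    rw [Finsupp.finsetSum_apply]
    simp only [opAct_coord]
    simp
  have hform : FormEq F (∑ l, ζ' l • coordForms x₀ l) 0 := by
    have e1 : ∑ l, ζ l • coordForms x₀ l =
        (∑ i, W i • matAct (varMatrix F x₀) (coordForms x₀) i) + ∑ l, ζ' l • coordForms x₀ l := by
      simp only [matAct_apply, Finset.smul_sum, smul_smul]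
      rw [Finset.sum_comm, ← Finset.sum_add_distrib]
      refine Finset.sum_congr rfl fun l _ => ?_
      rw [h1 l, add_smul, Finset.sum_smul]
    have e2 : FormEq F (∑ i, W i • matAct (varMatrix F x₀) (coordForms x₀) i) 0 := by
      have := FormEq.sum (F := F) (s := Finset.univ)
        (η := fun i => W i • matAct (varMatrix F x₀) (coordForms x₀) i) (ζ := fun _ => 0)
        fun i _ => by
          have := FormEq.opAct h (fun k => EqOnSol.refl ((W i).coeff k)) (matAct_varMatrix h i)
          rwa [smul_zero] at this
      rwa [Finset.sum_const_zero] at this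
    have e3 := e2.add (FormEq.refl (F := F) (∑ l, ζ' l • coordForms x₀ l))
    rw [← e1, zero_add] at e3
    exact e3.symm.trans hζ
  have hz : solMap h (ζ' l) = 0 := by
    rw [solMap_sub_eq_zero_iff]
    intro k
    have := c.coeff_eq_zero h hform (fun j hj => ?_) (k, l)
    · rwa [hco] at this
    · obtain ⟨β, hβ⟩ := h2 j hj
      exact ⟨β, fun l => by rw [hco, hβ]⟩
  rw [h1, map_add, hz, add_zero]

/-- `P(F)` is cancellable on the right. -/
theorem RegularSystemAt.cancel_varMatrix (h : RegularSystemAt F x₀) {p : ℕ}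
    (Y : Matrix (Fin p) (Fin (n - m)) (SolOp h))
    (hY : Y * (varMatrix F x₀).map (solMap h) = 0) : Y = 0 := by
  obtain ⟨c⟩ := h.nonempty_chart
  obtain ⟨Λ, hΛ, _⟩ := c.exists_germ_inverse h
  have row : ∀ N (y : Fin (n - m) → JetOp x₀), (∀ i j, N ≤ j → (y i).coeff j = 0) →
      (∀ l, solMap h (∑ i, y i * varMatrix F x₀ i l) = 0) → ∀ i, solMap h (y i) = 0 := by
    intro N
    induction N with
    | zero =>
      intro y hy _ i
      rw [solMap_sub_eq_zero_iff]
      intro k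
      rw [hy i k (Nat.zero_le _)]
      exact EqOnSol.refl _
    | succ N ih =>
      intro y hy h0
      let a : Fin (n - m) → JetRing x₀ := fun i => (y i).coeff N
      have hl : ∀ l, EqOnSol F (Matrix.vecMul a (velMatrix F x₀) l) 0 := by
        intro l
        have e := (solMap_sub_eq_zero_iff h).mp (h0 l) (N + 1)
        rw [DiffOp.coeff_sum] at e
        -- The leading coefficient of $yP(F)$ is $a\frac{\partial F}{\partial\dot x}$;
        -- multiplication by the right inverse $\Lambda$ then gives $a=0$ on $\mathfrak X_0$.
        have e2 : ∀ i, (y i * varMatrix F x₀ i l).coeff (N + 1) = a i * velMatrix F x₀ i l := by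
          intro i
          rw [DiffOp.coeff_mul (hy i), Finset.sum_range_succ, (dt_pow_varMatrix_coeff N i l).1,
            Finset.sum_eq_zero, zero_add]
          intro j hj
          rw [(dt_pow_varMatrix_coeff j i l).2 _ (by have := Finset.mem_range.mp hj; omega), mul_zero]
        rw [Finset.sum_congr rfl fun i _ => e2 i] at e
        exact e
      have ha : ∀ i, EqOnSol F (a i) 0 := by
        intro i
        have e : a i = ∑ l, Matrix.vecMul a (velMatrix F x₀) l * Λ l i := by
          change _ = Matrix.vecMul (Matrix.vecMul a (velMatrix F x₀)) Λ i
          rw [Matrix.vecMul_vecMul, hΛ, Matrix.vecMul_one]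
        rw [e]
        have := EqOnSol.sum (F := F) (s := Finset.univ)
          (a := fun l => Matrix.vecMul a (velMatrix F x₀) l * Λ l i) (b := fun _ => 0) fun l _ => by
            have := (hl l).mul (EqOnSol.refl (F := F) (Λ l i))
            rwa [zero_mul] at this
        rwa [Finset.sum_const_zero] at this
      have hm0 : ∀ i, solMap h (DiffOp.mono _ N (a i)) = 0 := by
        intro i
        rw [solMap_sub_eq_zero_iff]
        intro k
        rw [DiffOp.coeff_mono]
        split_ifs
        · exact ha i
        · exact EqOnSol.refl _
      have hs : ∀ i, solMap h (y i - DiffOp.mono _ N (a i)) = solMap h (y i) := by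
        intro i
        rw [map_sub, hm0, sub_zero]
      intro i
      rw [← hs i]
      refine ih (fun i => y i - DiffOp.mono _ N (a i)) (fun i j hj => ?_) (fun l => ?_) i
      · rw [DiffOp.coeff_sub, DiffOp.coeff_mono]
        rcases Nat.eq_or_lt_of_le hj with rfl | hj
        · rw [if_pos rfl]; exact sub_self _
        · rw [hy i j hj, if_neg (by omega), sub_zero]
      · rw [← h0 l, map_sum, map_sum]
        exact Finset.sum_congr rfl fun i _ => by rw [map_mul, map_mul, hs i]
  choose y hy using fun r i => solMap_surjective h (Y r i)
  ext r i
  choose N hN using fun i => (y r i).exists_bound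
  have := row (Finset.univ.sup N) (y r)
    (fun i j hj => hN i j (le_trans (Finset.le_sup (Finset.mem_univ i)) hj)) (fun l => ?_) i
  · rw [hy] at this
    exact this
  · have e := congrFun (congrFun hY r) l
    rw [Matrix.mul_apply] at e
    rw [map_sum]
    refine Eq.trans (Finset.sum_congr rfl fun i _ => ?_) e
    rw [map_mul, hy]
    rfl

end Annihilator

/-! ### Prolonged maps and a criterion for trivializations in terms of their lowest components. -/

section Prolongation

variable {n m : ℕ} {F : (Fin n → ℝ) × (Fin n → ℝ) → Fin (n - m) → ℝ} {x₀ : Jet n} {y₀ : Jet m}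

/-- The prolongation `(φ, L_τ φ, L_τ² φ, …)`. -/
def jetProlong (φ : Fin n → Jet m → ℝ) (y : Jet m) : Jet n := fun j i => (lieTau^[j] (φ i)) y

theorem jetProlong_analytic {φ : Fin n → Jet m → ℝ} {y : Jet m} (h : ∀ i, JetAnalyticAt (φ i) y) :
    JetFieldAnalyticAt (jetProlong φ) y := fun j i => (h i).iterate_lieTau j

/-- Prolongations exchange the Cartan fields by construction, so conditions on them need checking at
order zero only. -/
theorem jetDiff_jetProlong {φ : Fin n → Jet m → ℝ} {y : Jet m} (h : ∀ i, JetAnalyticAt (φ i) y) :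
    jetDiff (jetProlong φ) y (jetShift y) = jetShift (jetProlong φ y) := by
  funext j i
  change lineDeriv ℝ (lieTau^[j] (φ i)) y (jetShift y) = (lieTau^[j + 1] (φ i)) y
  rw [← lieTau_eq_lieAlong ((h i).iterate_lieTau j), Function.iterate_succ_apply']

theorem lieTau_comp {Φ : Jet m → Jet n} {y : Jet m} (h : JetFieldAnalyticAt Φ y)
    (hrel : jetDiff Φ y (jetShift y) = jetShift (Φ y)) {f : Jet n → ℝ}
    (hf : JetAnalyticAt f (Φ y)) : lieTau (fun z => f (Φ z)) y = lieTau f (Φ y) := by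
  rw [lieTau_eq_lieAlong (h.comp_fun hf), lieTau_eq_lieAlong hf]
  exact lieAlong_comp (ξ := jetShift) (ζ := jetShift) h hrel hf.toMap

theorem iterate_lieTau_comp {Φ : Jet m → Jet n} {Y : Set (Jet m)} (hY : IsOpen Y)
    (h : ∀ y ∈ Y, JetFieldAnalyticAt Φ y)
    (hrel : ∀ y ∈ Y, jetDiff Φ y (jetShift y) = jetShift (Φ y)) {f : Jet n → ℝ}
    (hf : ∀ y ∈ Y, JetAnalyticAt f (Φ y)) (k : ℕ) :
    ∀ y ∈ Y, (lieTau^[k] (fun z => f (Φ z))) y = (lieTau^[k] f) (Φ y) := by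
  induction k with
  | zero => exact fun _ _ => rfl
  | succ k ih =>
    intro y hy
    rw [Function.iterate_succ_apply', Function.iterate_succ_apply',
      ← lieTau_comp (h y hy) (hrel y hy) ((hf y hy).iterate_lieTau k)]
    exact (lieTau_congr (Filter.eventually_of_mem (hY.mem_nhds hy) ih)).self_of_nhds

theorem lieTau_coord (k : ℕ) (i : Fin n) : lieTau (fun z : Jet n => z k i) = fun z => z (k + 1) i := by
  funext z
  rw [lieTau_eq_lieAlong (JetAnalyticAt.coord k i z), JetMapAnalyticAt.lineDeriv_coord]
  rfl

theorem iterate_lieTau_coord (k : ℕ) (i : Fin n) :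
    lieTau^[k] (fun z : Jet n => z 0 i) = fun z => z k i := by
  induction k with
  | zero => rfl
  | succ k ih => rw [Function.iterate_succ_apply', ih, lieTau_coord]

theorem iterate_lieTau_eqOn {Y : Set (Jet m)} (hY : IsOpen Y) {f g : Jet m → ℝ}
    (h : ∀ y ∈ Y, f y = g y) (k : ℕ) : ∀ y ∈ Y, (lieTau^[k] f) y = (lieTau^[k] g) y := by
  induction k with
  | zero => exact h
  | succ k ih =>
    intro y hy
    rw [Function.iterate_succ_apply', Function.iterate_succ_apply']
    exact (lieTau_congr (Filter.eventually_of_mem (hY.mem_nhds hy) ih)).self_of_nhds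

theorem iterate_lieTau_zero (k : ℕ) : lieTau^[k] (fun _ : Jet m => (0 : ℝ)) = fun _ => 0 := by
  induction k with
  | zero => rfl
  | succ k ih =>
    rw [Function.iterate_succ_apply', ih]
    funext y
    simp [lieTau, jetPartial, lineDeriv]

/-- Functions agreeing on `𝔛₀` have iterated Lie derivatives agreeing on `𝔛₀`. -/
theorem SolChart.iterate_lieTau_eqOn (c : SolChart F x₀) {X : Set (Jet n)} (hX : IsOpen X)
    (hXd : X ⊆ c.dom) {f g : Jet n → ℝ} (hf : ∀ x ∈ X, JetAnalyticAt f x)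
    (hg : ∀ x ∈ X, JetAnalyticAt g x) (h : ∀ x ∈ X ∩ solSet F, f x = g x) (k : ℕ) :
    ∀ x ∈ X ∩ solSet F, (lieTau^[k] f) x = (lieTau^[k] g) x := by
  induction k with
  | zero => exact h
  | succ k ih =>
    intro x hx
    have h1 := (hf x hx.1).iterate_lieTau k
    have h2 := (hg x hx.1).iterate_lieTau k
    rw [Function.iterate_succ_apply', Function.iterate_succ_apply', lieTau_eq_lieAlong h1,
      lieTau_eq_lieAlong h2]
    refine c.lineDeriv_eq (hXd hx.1) hx.2 h1.toMap h2.toMap ?_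
      (jetShift_mem_solTangent (interior_subset (hXd hx.1)).1.F_analytic hx.2)
    exact Filter.eventually_of_mem (inter_mem_nhdsWithin _ (hX.mem_nhds hx.1))
      fun z hz => ih z ⟨hz.2, hz.1⟩

/-- If the lowest components of `Φ ∘ Ψ` are the identity on `𝔛₀`, so are all components. -/
theorem eventually_jetProlong_eq (h : RegularSystemAt F x₀) {φ : Fin n → Jet m → ℝ}
    {ψ : Fin m → Jet n → ℝ} (hφ : ∀ i, JetAnalyticAt (φ i) (jetProlong ψ x₀))
    (hψ : ∀ i, JetAnalyticAt (ψ i) x₀)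
    (h1 : ∀ᶠ x in 𝓝[solSet F] x₀, ∀ i, φ i (jetProlong ψ x) = x 0 i) :
    ∀ᶠ x in 𝓝[solSet F] x₀, jetProlong φ (jetProlong ψ x) = x := by
  obtain ⟨c⟩ := h.nonempty_chart
  have hψc : ContinuousAt (jetProlong ψ) x₀ := (jetProlong_analytic hψ).continuousAt
  have hφe : ∀ᶠ y in 𝓝 (jetProlong ψ x₀), ∀ i, JetAnalyticAt (φ i) y :=
    eventually_all.mpr fun i => (hφ i).eventually_at
  have hψe : ∀ᶠ x in 𝓝 x₀, ∀ i, JetAnalyticAt (ψ i) x :=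
    eventually_all.mpr fun i => (hψ i).eventually_at
  obtain ⟨X1, hX1s, hX1o, hX1m⟩ := eventually_nhds_iff.mp
    (((eventually_nhdsWithin_iff.mp h1).and hψe).and
      ((hψc.eventually hφe).and (c.eventually_dom (c.mem_dom h))))
  refine eventually_nhdsWithin_iff.mpr
    (Filter.eventually_of_mem (hX1o.mem_nhds hX1m) fun x hx hs => ?_)
  funext k i
  have e1 := iterate_lieTau_comp hX1o (fun z hz => jetProlong_analytic (hX1s z hz).1.2)
    (fun z hz => jetDiff_jetProlong (hX1s z hz).1.2) (f := φ i)
    (fun z hz => (hX1s z hz).2.1 i) k x hx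
  have e2 := c.iterate_lieTau_eqOn hX1o (fun z hz => (hX1s z hz).2.2)
    (f := fun z => φ i (jetProlong ψ z)) (g := fun z => z 0 i)
    (fun z hz => (jetProlong_analytic (hX1s z hz).1.2).comp_fun ((hX1s z hz).2.1 i))
    (fun z hz => JetAnalyticAt.coord 0 i z) (fun z hz => (hX1s z hz.1).1.1 hz.2 i) k x ⟨hx, hs⟩
  rw [iterate_lieTau_coord] at e2
  exact e1.symm.trans e2

/-- A pair of prolongations is a trivialization as soon as its lowest components are as they
should be. -/
theorem isTrivialization_jetProlong (h : RegularSystemAt F x₀) {φ : Fin n → Jet m → ℝ}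
    {ψ : Fin m → Jet n → ℝ} (hφ : ∀ i, JetAnalyticAt (φ i) y₀) (hψ : ∀ i, JetAnalyticAt (ψ i) x₀)
    (hy₀ : jetProlong ψ x₀ = y₀)
    (h1 : ∀ᶠ x in 𝓝[solSet F] x₀, ∀ i, φ i (jetProlong ψ x) = x 0 i)
    (h2 : ∀ᶠ y in 𝓝 y₀, ∀ i, sysFun F i (jetProlong φ y) = 0)
    (h3 : ∀ᶠ y in 𝓝 y₀, ∀ i, ψ i (jetProlong φ y) = y 0 i) :
    IsTrivialization F x₀ y₀ (jetProlong φ) (jetProlong ψ) := by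
  have hφc : ContinuousAt (jetProlong φ) y₀ := (jetProlong_analytic hφ).continuousAt
  have hφe : ∀ᶠ y in 𝓝 y₀, ∀ i, JetAnalyticAt (φ i) y :=
    eventually_all.mpr fun i => (hφ i).eventually_at
  have hψe : ∀ᶠ x in 𝓝 x₀, ∀ i, JetAnalyticAt (ψ i) x :=
    eventually_all.mpr fun i => (hψ i).eventually_at
  obtain ⟨X1, hX1s, hX1o, hX1m⟩ := eventually_nhds_iff.mp
    ((eventually_nhdsWithin_iff.mp (eventually_jetProlong_eq h (hy₀.symm ▸ hφ) hψ h1)).and hψe)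
  have lev1 : ∀ x ∈ X1 ∩ solSet F, jetProlong φ (jetProlong ψ x) = x :=
    fun x hx => (hX1s x hx.1).1 hx.2
  have hΦ0 : jetProlong φ y₀ = x₀ := by rw [← hy₀]; exact lev1 x₀ ⟨hX1m, h.mem⟩
  have hFe : ∀ᶠ x in 𝓝 x₀, AnalyticAt ℝ F (jetPair x) :=
    continuous_jetPair.continuousAt.eventually h.analytic.eventually_analyticAt
  obtain ⟨Y1, hY1s, hY1o, hY1m⟩ := eventually_nhds_iff.mp
    ((h2.and h3).and (hφe.and ((hφc.eventually (hΦ0.symm ▸ hFe)).and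
      (hφc.eventually (hΦ0.symm ▸ hψe)))))
  have solY : ∀ y ∈ Y1, jetProlong φ y ∈ solSet F := by
    intro y hy k i
    rw [← iterate_lieTau_comp hY1o (fun z hz => jetProlong_analytic (hY1s z hz).2.1)
      (fun z hz => jetDiff_jetProlong (hY1s z hz).2.1) (f := sysFun F i)
      (fun z hz => sysFun_analytic (hY1s z hz).2.2.1 i) k y hy,
      iterate_lieTau_eqOn hY1o (g := fun _ => 0) (fun z hz => (hY1s z hz).1.1 i) k y hy,
      iterate_lieTau_zero]
  have lev2 : ∀ y ∈ Y1, jetProlong ψ (jetProlong φ y) = y := by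
    intro y hy
    funext k i
    have e1 := iterate_lieTau_comp hY1o (fun z hz => jetProlong_analytic (hY1s z hz).2.1)
      (fun z hz => jetDiff_jetProlong (hY1s z hz).2.1) (f := ψ i)
      (fun z hz => (hY1s z hz).2.2.2 i) k y hy
    have e2 := iterate_lieTau_eqOn hY1o (f := fun z => ψ i (jetProlong φ z))
      (g := fun z => z 0 i) (fun z hz => (hY1s z hz).1.2 i) k y hy
    rw [iterate_lieTau_coord] at e2
    exact e1.symm.trans e2
  -- Each neighbourhood is cut down by the preimage of the other, so that both maps land where the
  -- inversion formulas hold.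
  have oX : IsOpen (X1 ∩ jetProlong ψ ⁻¹' Y1) :=
    ContinuousOn.isOpen_inter_preimage (fun x hx =>
      (jetProlong_analytic (hX1s x hx).2).continuousAt.continuousWithinAt) hX1o hY1o
  have oY : IsOpen (Y1 ∩ jetProlong φ ⁻¹' X1) :=
    ContinuousOn.isOpen_inter_preimage (fun y hy =>
      (jetProlong_analytic (hY1s y hy).2.1).continuousAt.continuousWithinAt) hY1o hX1o
  refine ⟨X1 ∩ jetProlong ψ ⁻¹' Y1, Y1 ∩ jetProlong φ ⁻¹' X1, oX,
    ⟨hX1m, by rw [Set.mem_preimage, hy₀]; exact hY1m⟩, oY,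
    ⟨hY1m, by rw [Set.mem_preimage, hΦ0]; exact hX1m⟩, hΦ0, hy₀,
    fun y hy => jetProlong_analytic (hY1s y hy.1).2.1,
    fun x hx => jetProlong_analytic (hX1s x hx.1).2,
    fun y hy => ⟨⟨hy.2, by rw [Set.mem_preimage, lev2 y hy.1]; exact hy.1⟩, solY y hy.1⟩,
    fun x hx => ⟨hx.1.2, by rw [Set.mem_preimage, lev1 x ⟨hx.1.1, hx.2⟩]; exact hx.1.1⟩,
    ⟨fun y hy => lev2 y hy.1, fun x hx => lev1 x ⟨hx.1.1, hx.2⟩⟩, fun y _ j i => ?_,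
    fun x _ j i => ?_⟩
  · change lieTau (lieTau^[j] (φ i)) y = (lieTau^[j + 1] (φ i)) y
    rw [Function.iterate_succ_apply']
  · change lieTau (lieTau^[j] (ψ i)) x = (lieTau^[j + 1] (ψ i)) x
    rw [Function.iterate_succ_apply']

end Prolongation

/-! ### Closed forms on $\mathfrak X_0$. -/

section Closedness

variable {n m : ℕ} {F : (Fin n → ℝ) × (Fin n → ℝ) → Fin (n - m) → ℝ} {x₀ : Jet n}

/-- The formula for the derivative of $L_\xi f$ with $\xi$ constant. -/
theorem JetAnalyticAt.lineDeriv_comm {f : Jet n → ℝ} {x : Jet n} (h : JetAnalyticAt f x)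
    (v w : Jet n) : lineDeriv ℝ (fun z => lineDeriv ℝ f z w) x v =
      lineDeriv ℝ (fun z => lineDeriv ℝ f z v) x w := by
  have hw : JetFieldAnalyticAt (fun _ : Jet n => w) x := fun j i => JetAnalyticAt.const _ _
  have h0 : jetDiff (fun _ : Jet n => w) x v = 0 := by
    funext j i
    simp [jetDiff, lineDeriv]
  have := lineDeriv_lieAlong h.toMap hw v
  rw [h0, h.toMap.lineDeriv_zero, add_zero] at this
  exact this

theorem closedOnSol_iff (η : OneForm x₀) : ClosedOnSol F η ↔
    ∀ᶠ x in 𝓝[solSet F] x₀, ∀ v ∈ solTangent F x, ∀ w ∈ solTangent F x,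
      lineDeriv ℝ (fun z => formEval η z w) x v = lineDeriv ℝ (fun z => formEval η z v) x w := by
  have key : ∀ᶠ x in 𝓝[solSet F] x₀, ∀ v w,
      (η.sum fun p a => lineDeriv ℝ a.rep x v * w p.1 p.2 - lineDeriv ℝ a.rep x w * v p.1 p.2) =
        lineDeriv ℝ (fun z => formEval η z w) x v - lineDeriv ℝ (fun z => formEval η z v) x w := by
    filter_upwards [(formEval_rep_analytic η).filter_mono nhdsWithin_le_nhds] with x hx v w
    rw [formEval_lineDeriv hx, formEval_lineDeriv hx, ← Finset.sum_sub_distrib]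
    rfl
  refine eventually_congr (key.mono fun x hx => forall_congr' fun v => forall_congr' fun _ =>
    forall_congr' fun w => forall_congr' fun _ => ?_)
  rw [hx, sub_eq_zero]

theorem closedOnSol_diffForm {f : Jet n → ℝ} (h : JetAnalyticAt f x₀) :
    ClosedOnSol F (diffForm x₀ f) := by
  rw [closedOnSol_iff]
  refine Filter.Eventually.filter_mono nhdsWithin_le_nhds ?_
  filter_upwards [eventually_eventually_nhds.mpr (formEval_diffForm h), h.eventually_at]
    with x h1 h2 v _ w _
  rw [jetMap_lineDeriv_congr (h1.mono fun z hz => hz w),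
    jetMap_lineDeriv_congr (h1.mono fun z hz => hz v), h2.lineDeriv_comm]

end Closedness

/-! ### From a trivialization to Smith factors and exact forms. -/

section FlatOutput

variable {n m : ℕ} {F : (Fin n → ℝ) × (Fin n → ℝ) → Fin (n - m) → ℝ} {x₀ : Jet n}

theorem jetShift_jetBasis_zero (k : Fin n) : jetShift (jetBasis (0, k)) = 0 := by
  funext j
  simp [jetShift, jetBasis]

theorem jetShift_jetBasis_succ (j : ℕ) (k : Fin n) :
    jetShift (jetBasis (j + 1, k)) = jetBasis (j, k) := by
  funext a
  by_cases h : a = j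
  · subst h; simp [jetShift, jetBasis]
  · simp [jetShift, jetBasis, h]

theorem hatMatrix_eq (U : Matrix (Fin n) (Fin n) (JetOp x₀)) :
    hatMatrix m U = U * lowerId (JetOp x₀) n m := rfl

theorem omegaForms_eq (Q : Matrix (Fin n) (Fin n) (JetOp x₀)) :
    omegaForms m Q = matAct (rectId (JetOp x₀) m n * Q) (coordForms x₀) := rfl

theorem exists_pullback_op {Ψ : Jet n → Jet m} (hΨ : JetFieldAnalyticAt Ψ x₀)
    (P : JetOp (Ψ x₀)) : ∃ T : JetOp x₀, ∀ j,
      (T.coeff j).rep =ᶠ[𝓝 x₀] fun x => (P.coeff j).rep (Ψ x) := by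
  obtain ⟨N, hN⟩ := P.exists_bound
  refine ⟨∑ j ∈ Finset.range N, DiffOp.mono _ j (JetRing.of x₀ fun x => (P.coeff j).rep (Ψ x)),
    fun j => ?_⟩
  have h1 : (∑ j ∈ Finset.range N,
      DiffOp.mono _ j (JetRing.of x₀ fun x => (P.coeff j).rep (Ψ x)) : JetOp x₀).coeff j =
        if j < N then JetRing.of x₀ fun x => (P.coeff j).rep (Ψ x) else 0 := by
    rw [DiffOp.coeff_sum]
    simp only [DiffOp.coeff_mono]
    rw [Finset.sum_ite_eq']
    simp
  rw [h1]
  split_ifs with hj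
  · exact JetRing.rep_of (hΨ.comp_fun (P.coeff j).rep_analytic)
  · rw [hN j (not_lt.mp hj)]
    have e : (fun x => (0 : JetRing (Ψ x₀)).rep (Ψ x)) =ᶠ[𝓝 x₀] fun _ => 0 :=
      hΨ.continuousAt.eventually JetRing.rep_zero
    exact JetRing.rep_zero.trans e.symm

/-- The germwise content of `IsTrivialization`, at the base points `x₀` and `Ψ(x₀)`. -/
structure TrivFacts (F : (Fin n → ℝ) × (Fin n → ℝ) → Fin (n - m) → ℝ) (x₀ : Jet n)
    (Φ : Jet m → Jet n) (Ψ : Jet n → Jet m) : Prop where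
  base : Φ (Ψ x₀) = x₀
  anaΦ : ∀ᶠ y in 𝓝 (Ψ x₀), JetFieldAnalyticAt Φ y
  anaΨ : ∀ᶠ x in 𝓝 x₀, JetFieldAnalyticAt Ψ x
  lieΦ : ∀ᶠ y in 𝓝 (Ψ x₀), ∀ j i, lieTau (fun z => Φ z j i) y = Φ y (j + 1) i
  lieΨ : ∀ᶠ x in 𝓝[solSet F] x₀, ∀ j i, lieTau (fun z => Ψ z j i) x = Ψ x (j + 1) i
  left : ∀ᶠ x in 𝓝[solSet F] x₀, Φ (Ψ x) = x
  right : ∀ᶠ y in 𝓝 (Ψ x₀), Ψ (Φ y) = y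
  sol : ∀ᶠ y in 𝓝 (Ψ x₀), Φ y ∈ solSet F

theorem IsTrivialization.facts {Φ : Jet m → Jet n} {Ψ : Jet n → Jet m}
    (ht : IsTrivialization F x₀ (Ψ x₀) Φ Ψ) : TrivFacts F x₀ Φ Ψ := by
  obtain ⟨X, Y, hX, hxX, hY, hyY, h1, _, h3, h4, h5, h6, h7, h8, h9⟩ := ht
  have eY := hY.mem_nhds hyY
  have eX := hX.mem_nhds hxX
  have eS : ∀ᶠ x in 𝓝[solSet F] x₀, x ∈ X ∩ solSet F := by
    filter_upwards [inter_mem_nhdsWithin (solSet F) eX] with x hx using ⟨hx.2, hx.1⟩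
  exact ⟨h1, Filter.eventually_of_mem eY h3, Filter.eventually_of_mem eX h4,
    Filter.eventually_of_mem eY h8, eS.mono fun x hx => h9 x hx, eS.mono fun x hx => h7.2 hx,
    Filter.eventually_of_mem eY fun y hy => h7.1 hy,
    Filter.eventually_of_mem eY fun y hy => (h5 hy).2⟩

namespace TrivFacts

variable {Φ : Jet m → Jet n} {Ψ : Jet n → Jet m}

theorem tendsto (ht : TrivFacts F x₀ Φ Ψ) : Tendsto Ψ (𝓝[solSet F] x₀) (𝓝 (Ψ x₀)) :=
  ht.anaΨ.self_of_nhds.continuousAt.tendsto.mono_left nhdsWithin_le_nhds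

theorem relΨ (ht : TrivFacts F x₀ Φ Ψ) :
    ∀ᶠ x in 𝓝[solSet F] x₀, jetDiff Ψ x (jetShift x) = jetShift (Ψ x) := by
  filter_upwards [ht.lieΨ, ht.anaΨ.filter_mono nhdsWithin_le_nhds] with x h1 h2
  funext j i
  rw [jetDiff, ← lieTau_eq_lieAlong (h2 j i), h1]
  rfl

theorem eqIterΨ (h : RegularSystemAt F x₀) (ht : TrivFacts F x₀ Φ Ψ) (i : Fin m) (j : ℕ) :
    (fun x => Ψ x j i) =ᶠ[𝓝[solSet F] x₀] lieTau^[j] (fun x => Ψ x 0 i) := by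
  induction j with
  | zero => exact EventuallyEq.rfl
  | succ j ih =>
    rw [Function.iterate_succ_apply']
    have h1 := ht.anaΨ.self_of_nhds
    refine EventuallyEq.trans ?_ (h.lieTau_eq (h1 j i) ((h1 0 i).iterate_lieTau j) ih)
    exact ht.lieΨ.mono fun x hx => (hx j i).symm

/-- Partial derivatives commute with $L_\tau$ up to a shift of the coordinate vector. This is the
recursion satisfied by the coefficients under left multiplication by $d/dt$. -/
theorem partialΦ_succ (ht : TrivFacts F x₀ Φ Ψ) (a : ℕ) (l : Fin n) (p : ℕ × Fin m) :
    jetPartial p (fun y => Φ y (a + 1) l) =ᶠ[𝓝 (Ψ x₀)] fun y =>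
      lieTau (jetPartial p fun y => Φ y a l) y +
        lineDeriv ℝ (fun y => Φ y a l) y (jetShift (jetBasis p)) := by
  filter_upwards [eventually_eventually_nhds.mpr ht.lieΦ, ht.anaΦ] with y h1 h2
  have e : (fun y => Φ y (a + 1) l) =ᶠ[𝓝 y] lieTau fun y => Φ y a l :=
    h1.mono fun z hz => (hz a l).symm
  rw [jetPartial, jetMap_lineDeriv_congr e, lineDeriv_lieTau (h2 a l)]
  rfl

/-- The coefficients of `(d/dt)^a P(φ₀)` are the partial derivatives of `φ_a`. -/
theorem coeff_dt_pow (h : RegularSystemAt F x₀) (ht : TrivFacts F x₀ Φ Ψ) {l : Fin n} {k : Fin m}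
    {T : JetOp x₀} (hT : ∀ j, ∀ᶠ x in 𝓝[solSet F] x₀,
      (T.coeff j).rep x = jetPartial (j, k) (fun y => Φ y 0 l) (Ψ x)) (a : ℕ) : ∀ j,
    ∀ᶠ x in 𝓝[solSet F] x₀, ((DiffOp.dt _ ^ a * T).coeff j).rep x =
      jetPartial (j, k) (fun y => Φ y a l) (Ψ x) := by
  have hΨ := ht.anaΨ.self_of_nhds
  have hΦ := ht.anaΦ.self_of_nhds
  induction a with
  | zero => intro j; rw [pow_zero, one_mul]; exact hT j
  | succ a ih =>
    have tau : ∀ j, ∀ᶠ x in 𝓝[solSet F] x₀,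
        (JetRing.tau x₀ ((DiffOp.dt _ ^ a * T).coeff j)).rep x =
          lieTau (jetPartial (j, k) fun y => Φ y a l) (Ψ x) := by
      intro j
      have hp := (hΦ a l).partialDeriv (j, k)
      have e1 := h.lieTau_eq (((DiffOp.dt _ ^ a * T).coeff j).rep_analytic)
        (hΨ.comp_fun hp) (ih j)
      filter_upwards [e1, (JetRing.rep_tau ((DiffOp.dt _ ^ a * T).coeff j)).filter_mono
        nhdsWithin_le_nhds, ht.relΨ, ht.anaΨ.filter_mono nhdsWithin_le_nhds,
        ht.tendsto.eventually hp.eventually_at] with x a1 a2 a3 a4 a5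
      rw [a2, a1, lieTau_comp a4 a3 a5]
    intro j
    rw [pow_succ', mul_assoc]
    rcases j with _ | j
    · rw [DiffOp.coeff_dt_mul_zero]
      filter_upwards [tau 0, ht.tendsto.eventually (ht.partialΦ_succ a l (0, k)),
        ht.tendsto.eventually ht.anaΦ] with x a1 a2 a3
      rw [a1, a2, jetShift_jetBasis_zero, (a3 a l).toMap.lineDeriv_zero, add_zero]
    · rw [DiffOp.coeff_dt_mul_succ]
      filter_upwards [tau (j + 1), ht.tendsto.eventually (ht.partialΦ_succ a l (j + 1, k)), ih j,
        (JetRing.rep_add ((DiffOp.dt _ ^ a * T).coeff j)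
          (JetRing.tau x₀ ((DiffOp.dt _ ^ a * T).coeff (j + 1)))).filter_mono nhdsWithin_le_nhds]
        with x a1 a2 a3 a4
      rw [a4, a1, a2, a3, jetShift_jetBasis_succ, add_comm]
      rfl

/-- The chain rule `P(f) P(φ₀) = P(f ∘ Φ)`. -/
theorem coeff_opRow_mul (h : RegularSystemAt F x₀) (ht : TrivFacts F x₀ Φ Ψ) {k : Fin m}
    {T : Fin n → JetOp x₀} (hT : ∀ l j, ∀ᶠ x in 𝓝[solSet F] x₀,
      ((T l).coeff j).rep x = jetPartial (j, k) (fun y => Φ y 0 l) (Ψ x))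
    {f : Jet n → ℝ} (hf : JetAnalyticAt f x₀) (j : ℕ) :
    ∀ᶠ x in 𝓝[solSet F] x₀, ((∑ l, opRow x₀ f l * T l).coeff j).rep x =
      jetPartial (j, k) (fun y => f (Φ y)) (Ψ x) := by
  obtain ⟨N₁, hN₁⟩ := hf.of_partial_eq_zero
  obtain ⟨N₂, hN₂⟩ := hf.lineDeriv_eq_sum
  set N := max N₁ N₂
  have e : (∑ l, opRow x₀ f l * T l).coeff j = ∑ l, ∑ a ∈ Finset.range N,
      JetRing.of x₀ (jetPartial (a, l) f) * (DiffOp.dt _ ^ a * T l).coeff j := by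
    rw [DiffOp.coeff_sum]
    refine Finset.sum_congr rfl fun l _ => ?_
    rw [DiffOp.coeff_mul (N := N) fun a ha => by
      rw [opRow_coeff hf]; exact hN₁ (a, l) (le_trans (le_max_left _ _) ha)]
    exact Finset.sum_congr rfl fun a _ => by rw [opRow_coeff hf]
  have e1 : ∀ᶠ x in 𝓝[solSet F] x₀, ((∑ l, opRow x₀ f l * T l).coeff j).rep x =
      ∑ l, ∑ a ∈ Finset.range N, jetPartial (a, l) f x *
        jetPartial (j, k) (fun y => Φ y a l) (Ψ x) := by
    rw [e]
    have h1 : ∀ l a, ∀ᶠ x in 𝓝[solSet F] x₀, (JetRing.of x₀ (jetPartial (a, l) f) *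
        (DiffOp.dt _ ^ a * T l).coeff j).rep x =
          jetPartial (a, l) f x * jetPartial (j, k) (fun y => Φ y a l) (Ψ x) := by
      intro l a
      filter_upwards [(JetRing.rep_mul (JetRing.of x₀ (jetPartial (a, l) f))
          ((DiffOp.dt _ ^ a * T l).coeff j)).filter_mono nhdsWithin_le_nhds,
        (JetRing.rep_of (hf.partialDeriv (a, l))).filter_mono nhdsWithin_le_nhds,
        ht.coeff_dt_pow h (hT l) a j] with x a1 a2 a3
      rw [a1, a2, a3]
    have h2 : ∀ l, ∀ᶠ x in 𝓝[solSet F] x₀, (∑ a ∈ Finset.range N,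
        JetRing.of x₀ (jetPartial (a, l) f) * (DiffOp.dt _ ^ a * T l).coeff j).rep x =
          ∑ a ∈ Finset.range N, jetPartial (a, l) f x *
            jetPartial (j, k) (fun y => Φ y a l) (Ψ x) := by
      intro l
      filter_upwards [(JetRing.rep_sum (Finset.range N) fun a =>
          JetRing.of x₀ (jetPartial (a, l) f) *
            (DiffOp.dt _ ^ a * T l).coeff j).filter_mono nhdsWithin_le_nhds,
        (Finset.eventually_all (Finset.range N)).mpr fun a _ => h1 l a] with x a1 a2
      rw [a1]
      exact Finset.sum_congr rfl a2
    filter_upwards [(JetRing.rep_sum Finset.univ fun l => ∑ a ∈ Finset.range N,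
        JetRing.of x₀ (jetPartial (a, l) f) *
          (DiffOp.dt _ ^ a * T l).coeff j).filter_mono nhdsWithin_le_nhds,
      eventually_all.mpr h2] with x a1 a2
    rw [a1]
    exact Finset.sum_congr rfl fun l _ => a2 l
  filter_upwards [e1, ht.left, ht.tendsto.eventually ht.anaΦ,
    hN₂.filter_mono nhdsWithin_le_nhds, (hf.eventually_at).filter_mono nhdsWithin_le_nhds]
    with x a1 a2 a3 a4 a5
  rw [a1, jetPartial, a3.lineDeriv_comp (f := f) (by rw [a2]; exact a5.toMap), a2,
    a4.2 N (le_max_right _ _), Finset.sum_product_right]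
  exact Finset.sum_congr rfl fun l _ => Finset.sum_congr rfl fun a _ => by rw [mul_comm]; rfl

/-- The matrix `P(ψ₀)`. -/
theorem form_eq (h : RegularSystemAt F x₀) (ht : TrivFacts F x₀ Φ Ψ) {l : Fin n}
    {T : Fin m → JetOp x₀} (hT : ∀ k j, ∀ᶠ x in 𝓝[solSet F] x₀,
      ((T k).coeff j).rep x = jetPartial (j, k) (fun y => Φ y 0 l) (Ψ x)) :
    FormEq F (∑ k, T k • diffForm x₀ (fun x => Ψ x 0 k)) (coordForms x₀ l) := by
  have hΨ := ht.anaΨ.self_of_nhds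
  have hΦ := ht.anaΦ.self_of_nhds
  obtain ⟨N₂, hN₂⟩ := (hΦ 0 l).lineDeriv_eq_sum
  choose N₁ hN₁ using fun k => (T k).exists_bound
  set N := max (Finset.univ.sup N₁) N₂
  have e : (∑ k, T k • diffForm x₀ (fun x => Ψ x 0 k)) = ∑ k, ∑ j ∈ Finset.range N,
      (T k).coeff j • lieForm^[j] (diffForm x₀ (fun x => Ψ x 0 k)) := by
    refine Finset.sum_congr rfl fun k _ => ?_
    rw [← opAct_eq_smul, opAct]
    have hs : (T k : Polynomial (JetRing x₀)).support ⊆ Finset.range N := by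
      intro j hj
      by_contra hc
      refine Polynomial.mem_support_iff.mp hj (hN₁ k j ?_)
      have hc' : N ≤ j := not_lt.mp fun hj' => hc (Finset.mem_coe.mpr (Finset.mem_range.mpr hj'))
      exact (Finset.le_sup (f := N₁) (Finset.mem_univ k)).trans ((le_max_left _ _).trans hc')
    exact Finset.sum_subset hs fun j _ hj => by
      rw [Polynomial.notMem_support_iff.mp hj]; exact zero_smul _ _
  rw [e]
  have e1 : FormEq F (∑ k, ∑ j ∈ Finset.range N,
      (T k).coeff j • lieForm^[j] (diffForm x₀ (fun x => Ψ x 0 k)))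
      (∑ k, ∑ j ∈ Finset.range N, (T k).coeff j • diffForm x₀ (fun x => Ψ x j k)) := by
    refine FormEq.sum fun k _ => FormEq.sum fun j _ => FormEq.smul (EqOnSol.refl _) ?_
    exact (diffForm_iterate_lieTau h (hΨ 0 k) j).symm.trans
      (diffForm_congr h ((hΨ 0 k).iterate_lieTau j) (hΨ j k) (ht.eqIterΨ h k j).symm)
  refine e1.trans ?_
  have hcoord : ∀ᶠ x in 𝓝[solSet F] x₀, ∀ v ∈ solTangent F x,
      lineDeriv ℝ (fun z => Φ (Ψ z) 0 l) x v = lineDeriv ℝ (fun z : Jet n => z 0 l) x v :=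
    h.eventually_lineDeriv_eq (hΨ.comp_fun (hΦ 0 l)).toMap (JetAnalyticAt.coord 0 l x₀).toMap
      (ht.left.mono fun x hx => by change Φ (Ψ x) 0 l = x 0 l; rw [hx])
  filter_upwards [hcoord, ht.anaΨ.filter_mono nhdsWithin_le_nhds, ht.tendsto.eventually ht.anaΦ,
    ht.tendsto.eventually hN₂, eventually_all.mpr fun k => (Finset.eventually_all
      (Finset.range N)).mpr fun j _ => hT k j,
    (formEval_finsetSum Finset.univ fun k => ∑ j ∈ Finset.range N,
      (T k).coeff j • diffForm x₀ (fun x => Ψ x j k)).filter_mono nhdsWithin_le_nhds,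
    eventually_all.mpr fun k => (formEval_finsetSum (Finset.range N) fun j =>
      (T k).coeff j • diffForm x₀ (fun x => Ψ x j k)).filter_mono nhdsWithin_le_nhds,
    eventually_all.mpr fun k => (Finset.eventually_all (Finset.range N)).mpr fun j _ =>
      (formEval_smul ((T k).coeff j) (diffForm x₀ (fun x => Ψ x j k))).filter_mono
        nhdsWithin_le_nhds,
    eventually_all.mpr fun k => (Finset.eventually_all (Finset.range N)).mpr fun j _ =>
      (formEval_diffForm (hΨ j k)).filter_mono nhdsWithin_le_nhds,
    (formEval_single (x₀ := x₀) (0, l) 1).filter_mono nhdsWithin_le_nhds,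
    (JetRing.rep_one (x₀ := x₀)).filter_mono nhdsWithin_le_nhds]
    with x a1 a2 a3 a4 a5 a6 a7 a8 a9 a10 a11 v hv
  rw [coordForms, a10, a11, one_mul, a6]
  have := a1 v hv
  rw [a2.lineDeriv_comp (a3 0 l).toMap, a4.2 N (le_max_right _ _), Finset.sum_product_right,
    JetMapAnalyticAt.lineDeriv_coord] at this
  rw [← this]
  refine Finset.sum_congr rfl fun k _ => ?_
  rw [a7]
  refine Finset.sum_congr rfl fun j hj => ?_
  rw [a8 k j hj, a9 k j hj, a5 k j hj, mul_comm]
  rfl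

/-- The matrices attached to a trivialization. -/
theorem exists_completion (h : RegularSystemAt F x₀) (ht : TrivFacts F x₀ Φ Ψ) :
    ∃ (Θ : Matrix (Fin n) (Fin m) (JetOp x₀)) (W : Matrix (Fin n) (Fin (n - m)) (JetOp x₀)),
      IsPullback F Ψ (outputMatrix Φ (Ψ x₀)) Θ ∧
      Completion ((varMatrix F x₀).map (solMap h))
        ((Matrix.of fun i l => opRow x₀ (fun x => Ψ x 0 i) l).map (solMap h))
        (Θ.map (solMap h)) (W.map (solMap h)) := by
  have hΨ := ht.anaΨ.self_of_nhds
  have hΦ := ht.anaΦ.self_of_nhds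
  choose Θ hΘ using fun i k => exists_pullback_op hΨ (outputMatrix Φ (Ψ x₀) i k)
  have hΘ' : ∀ i k j, ∀ᶠ x in 𝓝[solSet F] x₀, ((Θ i k).coeff j).rep x =
      jetPartial (j, k) (fun y => Φ y 0 i) (Ψ x) := by
    intro i k j
    have e : (outputMatrix Φ (Ψ x₀) i k).coeff j =
        JetRing.of (Ψ x₀) (jetPartial (j, k) fun y => Φ y 0 i) := opRow_coeff (hΦ 0 i) k j
    filter_upwards [(hΘ i k j).filter_mono nhdsWithin_le_nhds,
      ht.tendsto.eventually (JetRing.rep_of ((hΦ 0 i).partialDeriv (j, k)))] with x h1 h2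
    rw [h1, e, h2]
  have hrow : ∀ (f : Jet n → ℝ) (hf : JetAnalyticAt f x₀) (k : Fin m) (a : JetOp x₀),
      (∀ j, ∀ᶠ x in 𝓝[solSet F] x₀, (a.coeff j).rep x =
        jetPartial (j, k) (fun y => f (Φ y)) (Ψ x)) →
      ∑ l, solMap h (opRow x₀ f l) * solMap h (Θ l k) = solMap h a := by
    intro f hf k a ha
    simp only [← map_mul, ← map_sum]
    rw [solMap_eq_iff]
    intro j
    filter_upwards [ht.coeff_opRow_mul h (fun l => hΘ' l k) hf j, ha j] with x h1 h2
    rw [h1, h2]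
  set E : Matrix (Fin m) (Fin n) (JetOp x₀) := Matrix.of fun i l => opRow x₀ (fun x => Ψ x 0 i) l
  have hEΘ : E.map (solMap h) * (Matrix.of Θ).map (solMap h) = 1 := by
    ext i k
    rw [Matrix.mul_apply]
    refine (hrow (fun x => Ψ x 0 i) (hΨ 0 i) k (if i = k then 1 else 0) fun j => ?_).trans ?_
    · have e : jetPartial (j, k) (fun y => Ψ (Φ y) 0 i) =ᶠ[𝓝 (Ψ x₀)]
          fun _ => (jetBasis (j, k) : Jet m) 0 i := by
        filter_upwards [eventually_eventually_nhds.mpr ht.right] with y hy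
        rw [jetPartial, jetMap_lineDeriv_congr (g := fun z : Jet m => z 0 i)
          (hy.mono fun z hz => by rw [hz]), JetMapAnalyticAt.lineDeriv_coord]
      filter_upwards [ht.tendsto.eventually e,
        (JetRing.rep_one (x₀ := x₀)).filter_mono nhdsWithin_le_nhds,
        (JetRing.rep_zero (x₀ := x₀)).filter_mono nhdsWithin_le_nhds] with x h1 h2 h3
      rw [h1]
      by_cases hj : j = 0
      · subst hj
        by_cases hik : i = k
        · subst hik; simp [DiffOp.coeff_one, h2, jetBasis]
        · rw [if_neg hik, DiffOp.coeff_zero, h3]; simp [jetBasis, hik]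
      · have : (jetBasis (j, k) : Jet m) 0 = 0 := by simp [jetBasis, Ne.symm hj]
        rw [this]
        by_cases hik : i = k
        · rw [if_pos hik, DiffOp.coeff_one, if_neg hj, h3]; rfl
        · rw [if_neg hik, DiffOp.coeff_zero, h3]; rfl
    · rw [Matrix.one_apply]; split_ifs <;> simp
  have hPFΘ : (varMatrix F x₀).map (solMap h) * (Matrix.of Θ).map (solMap h) = 0 := by
    ext i k
    rw [Matrix.mul_apply]
    refine (Finset.sum_congr rfl fun l _ => ?_).trans
      ((hrow (sysFun F i) (h.sysFun_analytic i) k 0 fun j => ?_).trans (map_zero _))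
    · rw [Matrix.map_apply, varMatrix_eq h]; rfl
    · have e : jetPartial (j, k) (fun y => sysFun F i (Φ y)) =ᶠ[𝓝 (Ψ x₀)] fun _ => 0 := by
        filter_upwards [eventually_eventually_nhds.mpr ht.sol] with y hy
        have e' : (fun y => sysFun F i (Φ y)) =ᶠ[𝓝 y] fun _ => 0 := hy.mono fun z hz => hz 0 i
        rw [jetPartial, jetMap_lineDeriv_congr e']
        simp [lineDeriv]
      filter_upwards [ht.tendsto.eventually e,
        (JetRing.rep_zero (x₀ := x₀)).filter_mono nhdsWithin_le_nhds] with x h1 h3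
      rw [h1, DiffOp.coeff_zero, h3]
  -- The rows of $1-\Theta E$ annihilate $dx$ on $\mathfrak X_0$, because $E\,dx=d\psi$ and
  -- $\Theta\,d\psi=dx$; hence they are left multiples of $P(F)$.
  have hW : ∀ i, ∃ W : Fin (n - m) → JetOp x₀, ∀ l,
      solMap h (((1 : Matrix (Fin n) (Fin n) (JetOp x₀)) - Matrix.of Θ * E) i l) =
        solMap h (∑ r, W r * varMatrix F x₀ r l) := by
    intro i
    refine h.exists_left_factor ?_
    have e1 : (∑ l, ((1 : Matrix (Fin n) (Fin n) (JetOp x₀)) - Matrix.of Θ * E) i l •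
        coordForms x₀ l) = coordForms x₀ i +
          (-1 : JetRing x₀) • ∑ k, Θ i k • diffForm x₀ (fun x => Ψ x 0 k) := by
      have h1 := congrFun (matAct_one (x₀ := x₀) (coordForms x₀)) i
      have h2 := congrFun (matAct_mul (Matrix.of Θ) E (coordForms x₀)) i
      rw [matAct_apply] at h1 h2
      simp only [Matrix.sub_apply, sub_smul, Finset.sum_sub_distrib]
      rw [h1, h2, neg_one_smul, sub_eq_add_neg]
      rfl
    rw [e1]
    have := (FormEq.refl (F := F) (coordForms x₀ i)).add
      (FormEq.smul (EqOnSol.refl (F := F) (-1 : JetRing x₀)) (ht.form_eq h (hΘ' i)))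
    rwa [neg_one_smul (JetRing x₀) (coordForms x₀ i), add_neg_cancel] at this
  choose W hW using hW
  refine ⟨Matrix.of Θ, Matrix.of W, fun i k j => (hΘ i k j).filter_mono nhdsWithin_le_nhds,
    Completion.of_cancel hEΘ hPFΘ ?_ fun Y hY => h.cancel_varMatrix Y hY⟩
  ext i l
  have := hW i l
  have e : ((Matrix.of Θ).map (solMap h) * E.map (solMap h)) i l =
      solMap h ((Matrix.of Θ * E) i l) := by
    rw [← Matrix.map_mul]; rfl
  have e2 : ((Matrix.of W).map (solMap h) * (varMatrix F x₀).map (solMap h)) i l =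
      solMap h (∑ r, W i r * varMatrix F x₀ r l) := by
    rw [← Matrix.map_mul]; rfl
  have e3 : solMap h ((1 : Matrix (Fin n) (Fin n) (JetOp x₀)) i l) =
      (1 : Matrix (Fin n) (Fin n) (SolOp h)) i l := by
    rw [Matrix.one_apply, Matrix.one_apply]; split_ifs <;> simp
  rw [Matrix.add_apply, e, e2, ← this, Matrix.sub_apply, map_sub, e3]
  abel

/-- Take $U=(W,\Theta)$ and let $Q$ be $E$ stacked above $P(F)$, with $V=R=M=Z=1$. Then $\hat
U=\Theta$, the matrix of the trivialization itself, and $\omega=d\psi$ is exact. -/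
theorem smith (h : RegularSystemAt F x₀) (hm : m ≤ n) (ht : TrivFacts F x₀ Φ Ψ) :
    ∃ (U Q : Matrix (Fin n) (Fin n) (JetOp x₀)) (Θ : Matrix (Fin n) (Fin m) (JetOp x₀)),
      RightSmith F U ∧ LeftSmith F (hatMatrix m U) Q ∧ StronglyClosed F (omegaForms m Q) ∧
      IsPullback F Ψ (outputMatrix Φ (Ψ x₀)) Θ ∧
      OpMatEq F (Q * Θ) (rectId (JetOp x₀) n m * (1 : Matrix (Fin m) (Fin m) (JetOp x₀))) := by
  obtain ⟨Θ, W, hΘ, hc⟩ := ht.exists_completion h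
  set E : Matrix (Fin m) (Fin n) (JetOp x₀) := Matrix.of fun i l => opRow x₀ (fun x => Ψ x 0 i) l
    with hE
  have hl := hc.left_factor hm
  have hr := hc.right_inverse hm
  have hr' := hc.left_inverse hm
  have huni1 : ∀ {p : ℕ}, Unimodular F (1 : Matrix (Fin p) (Fin p) (JetOp x₀)) := fun {p} =>
    ⟨1, by rw [Matrix.mul_one]; exact fun i j k => EqOnSol.refl _,
      by rw [Matrix.mul_one]; exact fun i j k => EqOnSol.refl _⟩
  have hnm : n - m + m = n := by omega
  have hmn : m + (n - m) = n := by omega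
  have hQΘ : OpMatEq F ((rectId (JetOp x₀) n m * E +
      lowerId (JetOp x₀) n (n - m) * varMatrix F x₀) * Θ) (rectId _ n m) := by
    rw [opMatEq_iff h]
    simp only [Matrix.map_mul, Matrix.map_add _ (map_add (solMap h)), rectId_map, lowerId_map,
      Matrix.add_mul, Matrix.mul_assoc]
    rw [hc.EΘ, hc.PFΘ, Matrix.mul_one, Matrix.mul_zero, add_zero]
  have hhat : hatMatrix m (W * rectId (JetOp x₀) (n - m) n +
      Θ * (lowerId (JetOp x₀) n m).transpose) = Θ := by
    rw [hatMatrix_eq, Matrix.add_mul, Matrix.mul_assoc, Matrix.mul_assoc,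
      rectId_mul_lowerId hnm, lowerId_transpose_mul_lowerId hm, Matrix.mul_zero,
      Matrix.mul_one, zero_add]
  have htr : ∀ {b : ℕ}, (lowerId (JetOp x₀) n b).transpose.map (solMap h) =
      (lowerId (SolOp h) n b).transpose := by
    intro b
    rw [Matrix.transpose_map, lowerId_map]
  refine ⟨W * rectId (JetOp x₀) (n - m) n + Θ * (lowerId (JetOp x₀) n m).transpose,
    rectId (JetOp x₀) n m * E + lowerId (JetOp x₀) n (n - m) * varMatrix F x₀, Θ, ⟨?_, 1, huni1, ?_⟩, ⟨?_, 1, huni1, ?_⟩,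
    ⟨1, huni1, fun i => ?_⟩, hΘ, ?_⟩
  · rw [unimodular_iff h]
    simp only [Matrix.map_mul, Matrix.map_add _ (map_add (solMap h)), rectId_map, htr]
    exact ⟨_, hr', hr⟩
  · rw [opMatEq_iff h]
    simp only [Matrix.one_mul, Matrix.map_mul, Matrix.map_add _ (map_add (solMap h)), rectId_map,
      htr, Matrix.mul_add, ← Matrix.mul_assoc]
    rw [hc.PFW, hc.PFΘ, Matrix.one_mul, Matrix.zero_mul, add_zero]
  · rw [unimodular_iff h]
    simp only [Matrix.map_mul, Matrix.map_add _ (map_add (solMap h)), rectId_map, lowerId_map]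
    exact ⟨_, hl⟩
  · rw [hhat, Matrix.mul_one]
    exact hQΘ
  · rw [matAct_one, omegaForms_eq, Matrix.mul_add, ← Matrix.mul_assoc, ← Matrix.mul_assoc,
      rectId_mul_rectId hm, rectId_mul_lowerId hmn, Matrix.one_mul, Matrix.zero_mul, add_zero]
    exact closedOnSol_diffForm (ht.anaΨ.self_of_nhds 0 i)
  · rw [Matrix.mul_one]
    exact hQΘ

/-- The condition linking $Q$, $Z$ and the trivialization excludes no trivialization, so the minimum
is taken over all of them. -/
theorem _root_.IsTrivialization.mem_outputOrders (h : RegularSystemAt F x₀) (hm : m ≤ n)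
    (ht : IsTrivialization F x₀ (Ψ x₀) Φ Ψ) : StrongClosednessCondition F x₀ ∧
    ∑ k, colDegree (outputMatrix Φ (Ψ x₀)) k ∈ outputOrders F x₀ := by
  obtain ⟨U, Q, Θ, h1, h2, h3, h4, h5⟩ := ht.facts.smith h hm
  refine ⟨⟨U, Q, h1, h2, h3⟩, U, Q, 1, Φ, Ψ, Θ, h1, h2, ⟨1, ?_, ?_⟩, ht, h4, h5, rfl⟩ <;>
  · rw [Matrix.mul_one]; exact fun i j k => EqOnSol.refl _

end TrivFacts

end FlatOutput

/-! ### Analytic inverse functions, factorization through submersions and the Poincaré lemma. -/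

section Analysis

variable {E E' G : Type*} [NormedAddCommGroup E] [NormedSpace ℝ E] [CompleteSpace E]
  [NormedAddCommGroup E'] [NormedSpace ℝ E'] [CompleteSpace E']
  [NormedAddCommGroup G] [NormedSpace ℝ G] [CompleteSpace G]

/-- The analytic inverse function theorem. -/
theorem AnalyticAt.exists_localInverse {f : E → E'} {a : E} (hf : AnalyticAt ℝ f a)
    (f' : E ≃L[ℝ] E') (hf' : HasFDerivAt f (f' : E →L[ℝ] E') a) :
    ∃ g : E' → E, AnalyticAt ℝ g (f a) ∧ g (f a) = a ∧ (∀ᶠ x in 𝓝 a, g (f x) = x) ∧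
      ∀ᶠ y in 𝓝 (f a), f (g y) = y := by
  have hc : ContDiffAt ℝ ⊤ f a := hf.contDiffAt
  let e := hc.toOpenPartialHomeomorph f hf' (by simp)
  have he : ∀ p, e p = f p := fun p => rfl
  have hb : a ∈ e.source := hc.mem_toOpenPartialHomeomorph_source hf' (by simp)
  have hes : AnalyticAt ℝ e.symm (f a) := e.analyticAt_symm' hb hf hf'.fderiv
  refine ⟨e.symm, hes, ?_, ?_, ?_⟩
  · rw [← he, e.left_inv hb]
  · exact (e.eventually_left_inverse hb)
  · exact (e.eventually_right_inverse' hb)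

/-- An analytic function whose derivative vanishes along the fibres of an analytic submersion
factors through it analytically. -/
theorem AnalyticAt.exists_factorization {f : E → G} {q : E → E'} {a : E} (hf : AnalyticAt ℝ f a)
    (hq : AnalyticAt ℝ q a) (R : E' →L[ℝ] E) (hR : ∀ u, fderiv ℝ q a (R u) = u)
    (hker : ∀ᶠ x in 𝓝 a, ∀ v, fderiv ℝ q x v = 0 → fderiv ℝ f x v = 0) :
    ∃ φ : E' → G, AnalyticAt ℝ φ (q a) ∧ ∀ᶠ x in 𝓝 a, f x = φ (q x) := by
  set L := fderiv ℝ q a with hL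
  -- This map straightens the submersion: $L\circ e=q$, and its derivative at $a$ is the identity
  -- because $L$ is the derivative of $q$ there.
  let e : E → E := fun x => R (q x) + (x - R (L x))
  have he : AnalyticAt ℝ e a :=
    ((R.analyticAt _).comp hq).add (analyticAt_id.sub ((R.comp L).analyticAt _))
  have hed : HasFDerivAt e (ContinuousLinearEquiv.refl ℝ E : E →L[ℝ] E) a := by
    have h1 : HasFDerivAt e (R.comp L + (ContinuousLinearMap.id ℝ E - R.comp L)) a :=
      (R.hasFDerivAt.comp a hq.differentiableAt.hasFDerivAt).add
        ((hasFDerivAt_id a).sub (R.comp L).hasFDerivAt)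
    rwa [add_sub_cancel] at h1
  have hLe : ∀ x, L (e x) = q x := fun x => by
    simp only [e, map_add, map_sub, hR]; abel
  obtain ⟨g, hg, hga, hgl, hgr⟩ := he.exists_localInverse _ hed
  set w := e a
  have hfg : AnalyticAt ℝ (fun y => f (g y)) w := (hga.symm ▸ hf : AnalyticAt ℝ f (g w)).fun_comp hg
  have hgc : Tendsto g (𝓝 w) (𝓝 a) := by
    have := hg.continuousAt.tendsto
    rwa [hga] at this
  have hz : ∀ᶠ y in 𝓝 w, ∀ v, L v = 0 → fderiv ℝ (fun y => f (g y)) y v = 0 := by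
    filter_upwards [eventually_eventually_nhds.mpr hgr, hg.eventually_analyticAt,
      hgc.eventually hq.eventually_analyticAt, hgc.eventually hf.eventually_analyticAt,
      hgc.eventually hker] with y h1 h2 h3 h4 h5 v hv
    have e1 := h4.differentiableAt.hasFDerivAt.comp y h2.differentiableAt.hasFDerivAt
    have e2 := h3.differentiableAt.hasFDerivAt.comp y h2.differentiableAt.hasFDerivAt
    have e3 : (q ∘ g) =ᶠ[𝓝 y] L := h1.mono fun z hz => by
      rw [Function.comp_apply, ← hLe, hz]
    have e4 := (e2.congr_of_eventuallyEq e3.symm).unique L.hasFDerivAt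
    have e5 : fderiv ℝ q (g y) (fderiv ℝ g y v) = 0 := by
      rw [← hv, ← e4]; rfl
    have e6 : fderiv ℝ (fun y => f (g y)) y = _ := e1.fderiv
    rw [e6]
    exact h5 _ e5
  obtain ⟨r, hr, hball⟩ := Metric.eventually_nhds_iff_ball.mp (hz.and hfg.eventually_analyticAt)
  -- The point of the slice $w+\operatorname{im}R$ in the fibre of $y$ under $L$. The segment
  -- joining them stays in the ball and runs in $\ker L$, so the function is constant on it.
  let s : E → E := fun y => w + R (L (y - w))
  have hs : Continuous s := by fun_prop
  have hsw : s w = w := by simp [s]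
  have hconst : ∀ᶠ y in 𝓝 w, f (g y) = f (g (s y)) := by
    have hin : ∀ᶠ y in 𝓝 w, s y ∈ Metric.ball w r :=
      hs.continuousAt.eventually (by rw [hsw]; exact Metric.ball_mem_nhds w hr)
    filter_upwards [hin, Metric.ball_mem_nhds w hr] with y h1 h2
    have hd : L (s y - y) = 0 := by
      simp only [s, map_sub, map_add, hR]; abel
    have hseg : ∀ t ∈ Set.Icc (0 : ℝ) 1, y + t • (s y - y) ∈ Metric.ball w r := fun t ht =>
      (convex_ball w r).add_smul_sub_mem h2 h1 ht
    have hder : ∀ t ∈ Set.Icc (0 : ℝ) 1,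
        HasDerivAt (fun t : ℝ => f (g (y + t • (s y - y)))) 0 t := by
      intro t ht
      have h3 := hball _ (hseg t ht)
      have h4 : HasDerivAt (fun t : ℝ => y + t • (s y - y)) (s y - y) t := by
        simpa using ((hasDerivAt_id t).smul_const (s y - y)).const_add y
      have h5 := HasFDerivAt.comp_hasDerivAt t h3.2.differentiableAt.hasFDerivAt h4
      rw [h3.1 _ hd] at h5
      exact h5
    have := constant_of_has_deriv_right_zero
      (fun t ht => (hder t ht).continuousAt.continuousWithinAt)
      (fun t ht => (hder t ⟨ht.1, ht.2.le⟩).hasDerivWithinAt) 1 ⟨zero_le_one, le_rfl⟩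
    simp only [one_smul, zero_smul, add_zero, add_sub_cancel] at this
    exact this.symm
  refine ⟨fun u => f (g (w + R (u - L w))), ?_, ?_⟩
  · have h0 : w + R (q a - L w) = w := by rw [hLe, sub_self, map_zero, add_zero]
    have h1 : AnalyticAt ℝ (fun u => w + R (u - L w)) (q a) :=
      analyticAt_const.add ((R.analyticAt _).comp (analyticAt_id.sub analyticAt_const))
    exact AnalyticAt.fun_comp (g := fun y => f (g y)) (h0.symm ▸ hfg) h1
  · filter_upwards [hgl, he.continuousAt.eventually hconst] with x h1 h2
    rw [h1] at h2
    rw [h2, ← hLe x, ← map_sub]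

/-- The Poincaré lemma with an analytic primitive. -/
theorem AnalyticAt.exists_primitive {Ω : E → E →L[ℝ] ℝ} {a : E} (hΩ : AnalyticAt ℝ Ω a)
    (hcl : ∀ᶠ x in 𝓝 a, ∀ v w, fderiv ℝ Ω x v w = fderiv ℝ Ω x w v) :
    ∃ ψ : E → ℝ, AnalyticAt ℝ ψ a ∧ ∀ᶠ x in 𝓝 a, fderiv ℝ ψ x = Ω x := by
  have hΩ' := hΩ
  obtain ⟨p, r, hp⟩ := hΩ
  -- The series of the radial integral $\int_0^1\Omega(a+ty)\,y\,dt$: the term of degree $n$ of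
  -- $\Omega$ contributes one of degree $n+1$ with factor $1/(n+1)$. The inverse of $0$ in degree
  -- zero is harmless since the constant term is zero.
  let q : FormalMultilinearSeries ℝ E ℝ := fun n => (n : ℝ)⁻¹ • (p.unshift 0) n
  have hq0 : p.radius ≤ q.radius := by
    rw [← p.radius_unshift 0]
    refine FormalMultilinearSeries.radius_le_of_le fun {n} => ?_
    rw [norm_smul]
    refine mul_le_of_le_one_left (norm_nonneg _) ?_
    rw [norm_inv, Real.norm_natCast]
    rcases n with _ | n
    · simp
    · exact inv_le_one_of_one_le₀ (by exact_mod_cast Nat.succ_pos n)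
  have hr : r ≤ q.radius := hp.r_le.trans hq0
  have hq : HasFPowerSeriesOnBall (fun x => q.sum (x - a)) q a r := by
    have := ((q.hasFPowerSeriesOnBall (hp.r_pos.trans_le hr)).mono hp.r_pos hr).comp_sub a
    rwa [zero_add] at this
  set ψ : E → ℝ := fun x => q.sum (x - a)
  have hψ : AnalyticAt ℝ ψ a := ⟨q, r, hq⟩
  have hrad : ∀ y ∈ Metric.eball (0 : E) r, fderiv ℝ ψ (a + y) y = Ω (a + y) y := by
    intro y hy
    have h1 := (hq.fderiv.hasSum hy).mapL (ContinuousLinearMap.apply ℝ ℝ y)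
    have h2 := (hp.hasSum hy).mapL (ContinuousLinearMap.apply ℝ ℝ y)
    refine h1.unique ?_
    refine HasSum.congr_fun (f := fun n => p n (fun _ => y) y) h2 fun n => ?_
    simp only [ContinuousLinearMap.apply_apply]
    rw [q.derivSeries_apply_diag]
    have h3 : (n : ℝ) + 1 ≠ 0 := by positivity
    simp only [q, FormalMultilinearSeries.unshift]
    rw [smul_apply, nsmul_eq_mul, smul_eq_mul]
    push_cast
    rw [← mul_assoc, mul_inv_cancel₀ h3, one_mul]
    simp
    rfl
  -- The error $D=d\psi-\Omega$ is closed and vanishes on the radial vector $x-a$; it remains to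
  -- show that these two properties force it to vanish.
  let D : E → E →L[ℝ] ℝ := fun x => fderiv ℝ ψ x - Ω x
  have hD : AnalyticAt ℝ D a := hψ.fderiv.sub hΩ'
  have hDs : ∀ᶠ x in 𝓝 a, ∀ v w, fderiv ℝ D x v w = fderiv ℝ D x w v := by
    filter_upwards [hcl, hψ.eventually_analyticAt, hΩ'.eventually_analyticAt]
      with x h1 h2 h3 v w
    have h4 : fderiv ℝ D x = fderiv ℝ (fderiv ℝ ψ) x - fderiv ℝ Ω x :=
      fderiv_sub h2.fderiv.differentiableAt h3.differentiableAt
    have h5 : IsSymmSndFDerivAt ℝ ψ x := h2.contDiffAt.isSymmSndFDerivAt (n := ⊤) (by simp)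
    rw [h4]
    simp only [sub_apply]
    rw [h1 v w, h5 v w]
  have hDr : ∀ᶠ x in 𝓝 a, D x (x - a) = 0 := by
    filter_upwards [Metric.eball_mem_nhds a hp.r_pos] with x hx
    have := hrad (x - a) (by simpa [edist_eq_enorm_sub] using hx)
    rw [add_sub_cancel] at this
    simp [D, this]
  obtain ⟨ρ, hρ, hball⟩ := Metric.eventually_nhds_iff_ball.mp
    ((hDs.and hD.eventually_analyticAt).and (eventually_eventually_nhds.mpr hDr))
  refine ⟨ψ, hψ, ?_⟩
  filter_upwards [Metric.ball_mem_nhds a hρ] with x hx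
  suffices h : ∀ v, D x v = 0 by
    ext v
    exact sub_eq_zero.mp (h v)
  intro v
  have hseg : ∀ t ∈ Set.Icc (0 : ℝ) 1, a + t • (x - a) ∈ Metric.ball a ρ := fun t ht =>
    (convex_ball a ρ).add_smul_sub_mem (Metric.mem_ball_self hρ) hx ht
  -- Differentiating $D_z(z-a)=0$ in the direction $v$ and using the symmetry of the derivative of
  -- $D$ shows that $t\,D_{a+t(x-a)}v$ has zero derivative; it vanishes at $t=0$.
  have hder : ∀ t ∈ Set.Icc (0 : ℝ) 1,
      HasDerivAt (fun t : ℝ => t * D (a + t • (x - a)) v) 0 t := by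
    intro t ht
    obtain ⟨⟨h1, h2⟩, h3⟩ := hball _ (hseg t ht)
    set z := a + t • (x - a) with hz
    have h4 : HasDerivAt (fun t : ℝ => a + t • (x - a)) (x - a) t := by
      simpa using ((hasDerivAt_id t).smul_const (x - a)).const_add a
    have h5 : HasDerivAt (fun t : ℝ => D (a + t • (x - a)) v) (fderiv ℝ D z (x - a) v) t := by
      have := HasFDerivAt.comp_hasDerivAt t h2.differentiableAt.hasFDerivAt h4
      exact ((ContinuousLinearMap.apply ℝ ℝ v).hasFDerivAt.comp_hasDerivAt t this)
    have h6 := (hasDerivAt_id t).mul h5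
    have h7 : HasFDerivAt (fun z => D z (z - a))
        ((D z).comp (ContinuousLinearMap.id ℝ E) + (fderiv ℝ D z).flip (z - a)) z :=
      h2.differentiableAt.hasFDerivAt.clm_apply ((hasFDerivAt_id z).sub_const a)
    have h3' : (fun _ => (0 : ℝ)) =ᶠ[𝓝 z] fun z => D z (z - a) := h3.mono fun y hy => hy.symm
    have h8 := (h7.congr_of_eventuallyEq h3').unique (hasFDerivAt_const 0 z)
    have h9 : D z v + fderiv ℝ D z v (z - a) = 0 := by
      have := DFunLike.congr_fun h8 v
      simpa using this
    refine h6.congr_deriv ?_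
    have h10 : z - a = t • (x - a) := by rw [hz]; abel
    rw [h1 v (z - a), h10, map_smul] at h9
    simpa using h9
  have := constant_of_has_deriv_right_zero
    (fun t ht => (hder t ht).continuousAt.continuousWithinAt)
    (fun t ht => (hder t ⟨ht.1, ht.2.le⟩).hasDerivWithinAt) 1 ⟨zero_le_one, le_rfl⟩
  simpa using this

end Analysis

/-! ### Primitives of forms closed on $\mathfrak X_0$. -/

section Primitive

variable {n m : ℕ} {F : (Fin n → ℝ) × (Fin n → ℝ) → Fin (n - m) → ℝ} {x₀ : Jet n}

/-- The Poincaré lemma on `𝔛₀`. -/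
theorem RegularSystemAt.exists_primitive (h : RegularSystemAt F x₀) {η : OneForm x₀}
    (hη : ClosedOnSol F η) : ∃ ψ : Jet n → ℝ, JetAnalyticAt ψ x₀ ∧ FormEq F (diffForm x₀ ψ) η := by
  obtain ⟨c⟩ := h.nonempty_chart
  have hret := c.ret_analytic (interior_subset (c.mem_dom h)).1
  have hret0 : c.ret x₀ = x₀ := c.ret_eq_self (c.mem_dom h) h.mem
  -- The pullback $\sum_p a_p\,dr_p$ of $\eta$ by the retraction is closed on a full neighbourhood
  -- and involves finitely many coordinates, so the finite-dimensional Poincaré lemma applies. On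
  -- tangent vectors of $\mathfrak X_0$ it agrees with $\eta$.
  let a : η.support → Jet n → ℝ := fun p x => (η p).rep (c.ret x)
  let r : η.support → Jet n → ℝ := fun p x => c.ret x p.1.1 p.1.2
  have ha : ∀ p, JetAnalyticAt (a p) x₀ := fun p =>
    hret.comp_fun (f := (η p).rep) (hret0.symm ▸ (η p).rep_analytic)
  have hr : ∀ p, JetAnalyticAt (r p) x₀ := fun p => hret p.1.1 p.1.2
  obtain ⟨k, g, hg, hag⟩ : JetMapAnalyticAt (fun x (p : η.support) => (a p x, r p x)) x₀ :=
    JetMapAnalyticAt.pi fun p => (ha p).toMap.prodMk (hr p).toMap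
  let A : η.support → (Fin k → Fin n → ℝ) → ℝ := fun p u => (g u p).1
  let R : η.support → (Fin k → Fin n → ℝ) → ℝ := fun p u => (g u p).2
  have hA : ∀ p, AnalyticAt ℝ (A p) (jetTrunc k x₀) := fun p =>
    ((ContinuousLinearMap.fst ℝ ℝ ℝ).comp
      (ContinuousLinearMap.proj (R := ℝ) (φ := fun _ : η.support => ℝ × ℝ) p)).analyticAt _ |>.comp hg
  have hR : ∀ p, AnalyticAt ℝ (R p) (jetTrunc k x₀) := fun p =>
    ((ContinuousLinearMap.snd ℝ ℝ ℝ).comp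
      (ContinuousLinearMap.proj (R := ℝ) (φ := fun _ : η.support => ℝ × ℝ) p)).analyticAt _ |>.comp hg
  have hrR : ∀ p, r p =ᶠ[𝓝 x₀] fun z => R p (jetTrunc k z) := fun p =>
    hag.mono fun z hz => congrArg Prod.snd (congrFun hz p)
  let Ω : (Fin k → Fin n → ℝ) → (Fin k → Fin n → ℝ) →L[ℝ] ℝ := fun u => ∑ p, A p u • fderiv ℝ (R p) u
  have hΩ : AnalyticAt ℝ Ω (jetTrunc k x₀) := by
    have : AnalyticAt ℝ (∑ p, fun u => A p u • fderiv ℝ (R p) u) (jetTrunc k x₀) :=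
      Finset.analyticAt_sum _ fun p _ => (hA p).smul (hR p).fderiv
    convert this using 1
    funext u
    simp [Ω]
  have hΩβ : ∀ᶠ x in 𝓝 x₀, ∀ v, Ω (jetTrunc k x) (jetTrunc k v) =
      ∑ p, a p x * lineDeriv ℝ (r p) x v := by
    filter_upwards [eventually_all.mpr fun p =>
      JetMapAnalyticAt.hasLineDerivAt_of_eq (hR p) (hrR p), hag] with x h1 h2 v
    simp only [Ω, sum_apply, smul_apply, smul_eq_mul]
    refine Finset.sum_congr rfl fun p _ => ?_
    rw [(h1 p v).lineDeriv]
    congr 1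
    exact (congrArg Prod.fst (congrFun h2 p)).symm
  have hsym : ∀ᶠ x in 𝓝 x₀, ∀ v w, fderiv ℝ Ω (jetTrunc k x) (jetTrunc k v) (jetTrunc k w) =
      fderiv ℝ Ω (jetTrunc k x) (jetTrunc k w) (jetTrunc k v) := by
    have hk : ∀ᶠ x in 𝓝 x₀, ∀ v w, fderiv ℝ Ω (jetTrunc k x) (jetTrunc k v) (jetTrunc k w) =
        ∑ p, (lineDeriv ℝ (a p) x v * lineDeriv ℝ (r p) x w +
          a p x * lineDeriv ℝ (fun z => lineDeriv ℝ (r p) z w) x v) := by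
      filter_upwards [eventually_eventually_nhds.mpr hΩβ,
        (jetTrunc_continuous k).continuousAt.eventually hΩ.eventually_analyticAt,
        eventually_all.mpr fun p => (ha p).eventually_at,
        eventually_all.mpr fun p => (hr p).eventually_at] with x h1 h2 h3 h4 v w
      have e1 : lineDeriv ℝ (fun z => Ω (jetTrunc k z) (jetTrunc k w)) x v =
          fderiv ℝ Ω (jetTrunc k x) (jetTrunc k v) (jetTrunc k w) := by
        have h5 : HasFDerivAt (fun u => Ω u (jetTrunc k w))
            ((ContinuousLinearMap.apply ℝ ℝ (jetTrunc k w)).comp (fderiv ℝ Ω (jetTrunc k x)))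
            (jetTrunc k x) :=
          (ContinuousLinearMap.apply ℝ ℝ (jetTrunc k w)).hasFDerivAt.comp _
            h2.differentiableAt.hasFDerivAt
        rw [JetMapAnalyticAt.lineDeriv_comp_analytic (h := fun u => Ω u (jetTrunc k w))
          h5.differentiableAt (JetMapAnalyticAt.trunc k x), h5.fderiv,
          JetMapAnalyticAt.lineDeriv_trunc]
        rfl
      rw [← e1, jetMap_lineDeriv_congr (h1.mono fun z hz => hz w),
        JetAnalyticAt.lineDeriv_fun_sum _ fun p _ => (h3 p).mul ((h4 p).toMap.lineDeriv_left w).toFun]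
      refine Finset.sum_congr rfl fun p _ => ?_
      rw [(h3 p).lineDeriv_mul ((h4 p).toMap.lineDeriv_left w).toFun]
    have hcl : ∀ᶠ x in 𝓝 x₀, ∀ v w, ∑ p, (lineDeriv ℝ (a p) x v * lineDeriv ℝ (r p) x w -
        lineDeriv ℝ (a p) x w * lineDeriv ℝ (r p) x v) = 0 := by
      have h1 : ∀ᶠ x in 𝓝 x₀, ∀ p ∈ η.support, JetAnalyticAt (η p).rep (c.ret x) :=
        ((c.tendsto_ret (c.mem_dom h) h.mem).mono_right nhdsWithin_le_nhds).eventually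
          (formEval_rep_analytic η)
      filter_upwards [(c.tendsto_ret (c.mem_dom h) h.mem).eventually hη, h1,
        c.eventually_dom (c.mem_dom h)] with x h2 h3 h4 v w
      have h5 := c.ret_analytic (interior_subset h4).1
      have h6 := h2 _ (c.jetDiff_ret_mem h4 v) _ (c.jetDiff_ret_mem h4 w)
      rw [Finsupp.sum, ← Finset.sum_coe_sort] at h6
      refine Eq.trans (Finset.sum_congr rfl fun p _ => ?_) h6
      rw [← h5.lineDeriv_comp (h3 p p.2).toMap, ← h5.lineDeriv_comp (h3 p p.2).toMap]
      rfl
    filter_upwards [hk, hcl, eventually_all.mpr fun p => (hr p).eventually_at] with x h1 h2 h3 v w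
    rw [h1, h1, ← sub_eq_zero, ← Finset.sum_sub_distrib, ← h2 v w]
    refine Finset.sum_congr rfl fun p _ => ?_
    rw [(h3 p).lineDeriv_comm]
    ring
  obtain ⟨ψ, hψ, hψΩ⟩ := hΩ.exists_primitive (by
    filter_upwards [(tendsto_jetPad x₀).eventually hsym] with u hu v w
    have := hu (jetPad 0 v) (jetPad 0 w)
    rwa [jetTrunc_jetPad, jetTrunc_jetPad, jetTrunc_jetPad] at this)
  refine ⟨fun x => ψ (jetTrunc k x), ⟨k, ψ, hψ, EventuallyEq.rfl⟩, ?_⟩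
  filter_upwards [(formEval_diffForm (f := fun x => ψ (jetTrunc k x))
      ⟨k, ψ, hψ, EventuallyEq.rfl⟩).filter_mono nhdsWithin_le_nhds,
    ((jetTrunc_continuous k).continuousAt.eventually hψΩ).filter_mono nhdsWithin_le_nhds,
    ((jetTrunc_continuous k).continuousAt.eventually
      hψ.eventually_analyticAt).filter_mono nhdsWithin_le_nhds,
    hΩβ.filter_mono nhdsWithin_le_nhds, c.eventually_sol h] with x h1 h2 h3 h4 h5 v hv
  rw [h1, JetMapAnalyticAt.lineDeriv_comp_analytic (h := ψ) h3.differentiableAt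
    (JetMapAnalyticAt.trunc k x), JetMapAnalyticAt.lineDeriv_trunc, h2, h4, formEval, Finsupp.sum,
    ← Finset.sum_coe_sort η.support fun p => (η p).rep x * v p.1 p.2]
  refine Finset.sum_congr rfl fun p _ => ?_
  have e1 : a p x = (η p).rep x := by simp only [a]; rw [c.ret_eq_self h5.1 h5.2]
  have e2 : lineDeriv ℝ (r p) x v = v p.1.1 p.1.2 := by
    have := congrFun (congrFun (c.jetDiff_ret_eq_self h5.1 h5.2 hv) p.1.1) p.1.2
    exact this
  rw [e1, e2]

end Primitive

/-! ### Tangent vectors at the base point built from the columns of $\Theta$. -/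

section DualVectors

variable {n m : ℕ} {F : (Fin n → ℝ) × (Fin n → ℝ) → Fin (n - m) → ℝ} {x₀ : Jet n}

theorem JetRing.tau_of {f : Jet n → ℝ} (hf : JetAnalyticAt f x₀) :
    JetRing.tau x₀ (JetRing.of x₀ f) = JetRing.of x₀ (lieTau f) :=
  JetRing.ext_rep ((JetRing.rep_tau _).trans
    ((lieTau_congr (JetRing.rep_of hf)).trans (JetRing.rep_of hf.lieTau).symm))

theorem JetRing.of_add {f g : Jet n → ℝ} (hf : JetAnalyticAt f x₀) (hg : JetAnalyticAt g x₀) :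
    JetRing.of x₀ (fun z => f z + g z) = JetRing.of x₀ f + JetRing.of x₀ g := by
  refine JetRing.ext_rep ((JetRing.rep_of (hf.add hg)).trans ?_)
  filter_upwards [JetRing.rep_add (JetRing.of x₀ f) (JetRing.of x₀ g), JetRing.rep_of hf,
    JetRing.rep_of hg] with z h1 h2 h3
  rw [h1, h2, h3]

theorem opRow_lieTau {f : Jet n → ℝ} (hf : JetAnalyticAt f x₀) (l : Fin n) :
    opRow x₀ (lieTau f) l = DiffOp.dt _ * opRow x₀ f l := by
  ext j
  rw [opRow_coeff hf.lieTau]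
  rcases j with _ | j
  · rw [DiffOp.coeff_dt_mul_zero, opRow_coeff hf, JetRing.tau_of (hf.partialDeriv _)]
    refine congrArg Subtype.val (JetRing.of_congr (hf.lieTau.partialDeriv _) ?_)
    filter_upwards [hf.eventually_at] with z hz
    rw [jetPartial, lineDeriv_lieTau hz, jetShift_jetBasis_zero, hz.toMap.lineDeriv_zero, add_zero]
    rfl
  · rw [DiffOp.coeff_dt_mul_succ, opRow_coeff hf, opRow_coeff hf,
      JetRing.tau_of (hf.partialDeriv _), ← JetRing.of_add (hf.partialDeriv _)
      (hf.partialDeriv _).lieTau]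
    refine congrArg Subtype.val (JetRing.of_congr (hf.lieTau.partialDeriv _) ?_)
    filter_upwards [hf.eventually_at] with z hz
    rw [jetPartial, lineDeriv_lieTau hz, jetShift_jetBasis_succ, add_comm]
    rfl

theorem opRow_iterate_lieTau {f : Jet n → ℝ} (hf : JetAnalyticAt f x₀) (l : Fin n) (k : ℕ) :
    opRow x₀ (lieTau^[k] f) l = DiffOp.dt _ ^ k * opRow x₀ f l := by
  induction k with
  | zero => rw [pow_zero, one_mul]; rfl
  | succ k ih =>
    rw [Function.iterate_succ_apply', opRow_lieTau (hf.iterate_lieTau k), ih, pow_succ', mul_assoc]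

theorem iterate_lieForm_eq (k : ℕ) (η : OneForm x₀) :
    lieForm^[k] η = (DiffOp.dt (JetRing.tau x₀) ^ k) • η := by
  induction k with
  | zero => rw [pow_zero, one_smul]; rfl
  | succ k ih =>
    rw [Function.iterate_succ_apply', ih, pow_succ', ← opAct_eq_smul, ← opAct_eq_smul, dt_mul_opAct]

/-- The vector `v_l^{(a)} = ((d/dt)^a T_l)_k(x₀)`. -/
def opVector (T : Fin n → JetOp x₀) (k : ℕ) : Jet n :=
  fun a l => evalBase x₀ ((DiffOp.dt _ ^ a * T l).coeff k)

/-- Pairing a row with such a vector is multiplying operators and reading off one coefficient. Thus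
operator identities become statements about tangent vectors. -/
theorem formEval_opVector (P T : Fin n → JetOp x₀) (k : ℕ) :
    formEval (∑ l, P l • coordForms x₀ l) x₀ (opVector T k) =
      evalBase x₀ ((∑ l, P l * T l).coeff k) := by
  choose N hN using fun l => (P l).exists_bound
  set M := Finset.univ.sup N
  have hM : ∀ l j, M ≤ j → (P l).coeff j = 0 := fun l j hj =>
    hN l j ((Finset.le_sup (f := N) (Finset.mem_univ l)).trans hj)
  have hco : ∀ p : ℕ × Fin n, (∑ l, P l • coordForms x₀ l) p = (P p.2).coeff p.1 := by
    intro p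
    rw [Finsupp.finsetSum_apply]
    simp only [opAct_coord]
    simp
  have hs : (∑ l, P l • coordForms x₀ l).support ⊆
      Finset.range M ×ˢ (Finset.univ : Finset (Fin n)) := by
    intro p hp
    by_contra hc
    refine Finsupp.mem_support_iff.mp hp ?_
    rw [hco]
    exact hM _ _ (by simpa using hc)
  rw [(formEval_eq_sum _ hs).self_of_nhds, Finset.sum_product_right, DiffOp.coeff_sum, map_sum]
  refine Finset.sum_congr rfl fun l _ => ?_
  rw [DiffOp.coeff_mul (hM l), map_sum]
  refine Finset.sum_congr rfl fun a _ => ?_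
  rw [map_mul, hco]
  rfl

theorem evalBase_coeff_eq (h : RegularSystemAt F x₀) {P Q : JetOp x₀}
    (hPQ : solMap h P = solMap h Q) (k : ℕ) :
    evalBase x₀ (P.coeff k) = evalBase x₀ (Q.coeff k) :=
  ((solMap_eq_iff h).mp hPQ k).self_of_nhdsWithin h.mem

/-- $P(F)T=0$ gives $\frac{d^j}{dt^j}P(F)T=0$ for every $j$, and the rows of $\frac{d^j}{dt^j}P(F)$
represent $d(L_\tau^jF)$. -/
theorem opVector_mem (h : RegularSystemAt F x₀) {T : Fin n → JetOp x₀}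
    (hT : ∀ i, solMap h (∑ l, varMatrix F x₀ i l * T l) = 0) (k : ℕ) :
    opVector T k ∈ solTangent F x₀ := by
  intro j i
  have hF := h.sysFun_analytic i
  rw [← (formEval_diffForm (hF.iterate_lieTau j)).self_of_nhds, diffForm, formEval_opVector]
  have e : (∑ l, opRow x₀ (lieTau^[j] (sysFun F i)) l * T l) =
      DiffOp.dt _ ^ j * ∑ l, varMatrix F x₀ i l * T l := by
    rw [Finset.mul_sum]
    refine Finset.sum_congr rfl fun l _ => ?_
    rw [opRow_iterate_lieTau hF, varMatrix_eq h, mul_assoc]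
  rw [e, evalBase_coeff_eq h (Q := 0) (by rw [map_mul, hT, mul_zero, map_zero]) k,
    DiffOp.coeff_zero, map_zero]

/-- Applied to $d\psi=E\,dx$ and the columns of $\Theta$ with $E\Theta=1$, this makes the vectors
dual to the differentials of the derivatives of $\psi$. -/
theorem FormEq.lineDeriv_opVector (h : RegularSystemAt F x₀) {f : Jet n → ℝ}
    (hf : JetAnalyticAt f x₀) {P T : Fin n → JetOp x₀}
    (hfP : FormEq F (diffForm x₀ f) (∑ l, P l • coordForms x₀ l))
    (hT : ∀ i, solMap h (∑ l, varMatrix F x₀ i l * T l) = 0) (j k : ℕ) :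
    lineDeriv ℝ (lieTau^[j] f) x₀ (opVector T k) =
      evalBase x₀ ((DiffOp.dt _ ^ j * ∑ l, P l * T l).coeff k) := by
  rw [← (formEval_diffForm (hf.iterate_lieTau j)).self_of_nhds]
  have e1 : FormEq F (diffForm x₀ (lieTau^[j] f))
      (∑ l, (DiffOp.dt (JetRing.tau x₀) ^ j * P l) • coordForms x₀ l) := by
    refine (diffForm_iterate_lieTau h hf j).trans ?_
    rw [iterate_lieForm_eq]
    have := FormEq.opAct h (fun i => EqOnSol.refl ((DiffOp.dt (JetRing.tau x₀) ^ j).coeff i)) hfP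
    rw [Finset.smul_sum] at this
    simpa only [smul_smul] using this
  have e2 := e1.self_of_nhdsWithin h.mem _ (opVector_mem h hT k)
  rw [e2, formEval_opVector, Finset.mul_sum]
  simp only [mul_assoc]

theorem DiffOp.coeff_dt_pow {A : Type*} [CommRing A] {D : Derivation ℤ A A} (j k : ℕ) :
    (DiffOp.dt D ^ j).coeff k = if j = k then 1 else 0 := by
  have h1 : DiffOp.mono D 0 (1 : A) = 1 := by
    ext k
    rw [coeff_mono, coeff_one]
    simp only [eq_comm]
  have := DiffOp.mono_eq (D := D) j 1
  rw [h1, one_mul] at this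
  rw [← this, DiffOp.coeff_mono]

theorem FormEq.smul_diffForm (h : RegularSystemAt F x₀) {f : Jet n → ℝ} (hf : JetAnalyticAt f x₀)
    {T : JetOp x₀} {N : ℕ} (hN : ∀ j, N ≤ j → T.coeff j = 0) :
    FormEq F (T • diffForm x₀ f)
      (∑ j ∈ Finset.range N, T.coeff j • diffForm x₀ (lieTau^[j] f)) := by
  have e : T • diffForm x₀ f =
      ∑ j ∈ Finset.range N, T.coeff j • _root_.lieForm^[j] (diffForm x₀ f) := by
    rw [← opAct_eq_smul, _root_.opAct]
    have hs : (T : Polynomial (JetRing x₀)).support ⊆ Finset.range N := by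
      intro j hj
      by_contra hc
      exact Polynomial.mem_support_iff.mp hj (hN j (by simpa using hc))
    exact Finset.sum_subset hs fun j _ hj => by
      rw [Polynomial.notMem_support_iff.mp hj]; exact zero_smul _ _
  rw [e]
  exact FormEq.sum fun j _ => FormEq.smul (EqOnSol.refl _) (diffForm_iterate_lieTau h hf j).symm

end DualVectors

/-! ### From closed forms to a trivialization. -/

section FlatFromClosed

variable {n m : ℕ} {F : (Fin n → ℝ) × (Fin n → ℝ) → Fin (n - m) → ℝ} {x₀ : Jet n}

/-- If `ψ` is submersive on `𝔛₀` to all orders, then equations holding along it hold near `y₀`. -/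
theorem SolChart.eventually_of_comp (h : RegularSystemAt F x₀) (c : SolChart F x₀)
    {ψ : Fin m → Jet n → ℝ} (hψ : ∀ i, JetAnalyticAt (ψ i) x₀)
    (hsurj : ∀ K (u : Fin K → Fin m → ℝ), ∃ v ∈ solTangent F x₀,
      jetTrunc K (jetDiff (jetProlong ψ) x₀ v) = u)
    {g : Jet m → ℝ} (hg : JetAnalyticAt g (jetProlong ψ x₀))
    (h0 : ∀ᶠ x in 𝓝[solSet F] x₀, g (jetProlong ψ x) = 0) :
    ∀ᶠ y in 𝓝 (jetProlong ψ x₀), g y = 0 := by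
  have hd := c.mem_dom h
  have hret := c.ret_analytic (interior_subset hd).1
  have hret0 : c.ret x₀ = x₀ := c.ret_eq_self hd h.mem
  have hΨ : JetFieldAnalyticAt (jetProlong ψ) (c.ret x₀) := hret0.symm ▸ jetProlong_analytic hψ
  obtain ⟨K, g', hg', hgg'⟩ := hg
  obtain ⟨k, q, hq, hHq⟩ : JetMapAnalyticAt (fun x => jetTrunc K (jetProlong ψ (c.ret x))) x₀ :=
    hret.comp_map (hΨ.truncMap K)
  have hq0 : q (jetTrunc k x₀) = jetTrunc K (jetProlong ψ x₀) := by
    have := hHq.self_of_nhds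
    simp only [hret0] at this
    exact this.symm
  have hqs : LinearMap.range (fderiv ℝ q (jetTrunc k x₀)).toLinearMap = ⊤ := by
    rw [LinearMap.range_eq_top]
    intro u
    obtain ⟨v, hv, hvu⟩ := hsurj K u
    refine ⟨jetTrunc k v, ?_⟩
    have e1 := ((JetMapAnalyticAt.hasLineDerivAt_of_eq hq hHq).self_of_nhds v).lineDeriv
    have e2 := hret.lineDeriv_comp (hΨ.truncMap K) v
    rw [hΨ.lineDeriv_truncMap, hret0, c.jetDiff_ret_eq_self hd h.mem hv, hvu] at e2
    exact e1.symm.trans e2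
  -- A submersion is open: a property valid at the images of all points near the base point holds on
  -- a whole neighbourhood of the image.
  have hmap := hq.hasStrictFDerivAt.map_nhds_eq_of_surj hqs
  have hT : ContinuousAt (jetProlong ψ) x₀ := (jetProlong_analytic hψ).continuousAt
  have hr : Tendsto c.ret (𝓝 x₀) (𝓝 x₀) :=
    (c.tendsto_ret hd h.mem).mono_right nhdsWithin_le_nhds
  have e1 : ∀ᶠ x in 𝓝 x₀, g' (q (jetTrunc k x)) = 0 := by
    filter_upwards [hHq, (c.tendsto_ret hd h.mem).eventually h0,
      hr.eventually (hT.eventually hgg')] with x h1 h2 h3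
    rw [← h1, ← h3, h2]
  have e2 : ∀ᶠ u in 𝓝 (jetTrunc k x₀), g' (q u) = 0 := by
    filter_upwards [(tendsto_jetPad x₀).eventually e1] with u hu
    rwa [jetTrunc_jetPad] at hu
  have e3 : ∀ᶠ w in 𝓝 (jetTrunc K (jetProlong ψ x₀)), g' w = 0 := by
    rw [← hq0, ← hmap]
    exact e2
  filter_upwards [hgg', (jetTrunc_continuous K).continuousAt.eventually e3] with y h1 h2
  rw [h1, h2]

/-- A trivialization with output `ψ` exists as soon as the differentials of the derivatives of `ψ`
are independent and generate `dx`. -/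
theorem exists_isTrivialization (h : RegularSystemAt F x₀) {ψ : Fin m → Jet n → ℝ}
    (hψ : ∀ i, JetAnalyticAt (ψ i) x₀)
    (hsurj : ∀ K (u : Fin K → Fin m → ℝ), ∃ v ∈ solTangent F x₀,
      jetTrunc K (jetDiff (jetProlong ψ) x₀ v) = u)
    {N : ℕ} (hgen : ∀ᶠ x in 𝓝[solSet F] x₀, ∀ v ∈ solTangent F x,
      jetTrunc N (jetDiff (jetProlong ψ) x v) = 0 → v 0 = 0) :
    ∃ φ : Fin n → Jet m → ℝ,
      IsTrivialization F x₀ (jetProlong ψ x₀) (jetProlong φ) (jetProlong ψ) := by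
  obtain ⟨c⟩ := h.nonempty_chart
  have hd := c.mem_dom h
  have hret := c.ret_analytic (interior_subset hd).1
  have hret0 : c.ret x₀ = x₀ := c.ret_eq_self hd h.mem
  have hΨ : JetFieldAnalyticAt (jetProlong ψ) (c.ret x₀) := hret0.symm ▸ jetProlong_analytic hψ
  obtain ⟨k₀, hk₀⟩ := JetMapAnalyticAt.lift (f := fun x => jetTrunc N (jetProlong ψ (c.ret x)))
    (x := x₀) (hret.comp_map (hΨ.truncMap N))
  -- Positivity of $k$ ensures that the block $x$ is among the retained coordinates.
  obtain ⟨k, hk, hkk⟩ : ∃ k, 0 < k ∧ k₀ ≤ k := ⟨k₀ + 1, Nat.succ_pos _, Nat.le_succ _⟩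
  obtain ⟨q, hq, hHq⟩ := hk₀ k hkk
  have hr : Tendsto c.ret (𝓝 x₀) (𝓝 x₀) :=
    (c.tendsto_ret hd h.mem).mono_right nhdsWithin_le_nhds
  have hψe : ∀ᶠ x in 𝓝 x₀, ∀ i, JetAnalyticAt (ψ i) x :=
    eventually_all.mpr fun i => (hψ i).eventually_at
  have hline : ∀ᶠ x in 𝓝 x₀, ∀ v, fderiv ℝ q (jetTrunc k x) (jetTrunc k v) =
      jetTrunc N (jetDiff (jetProlong ψ) (c.ret x) (jetDiff c.ret x v)) := by
    filter_upwards [JetMapAnalyticAt.hasLineDerivAt_of_eq hq hHq, c.eventually_dom hd,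
      hr.eventually hψe] with x h1 h2 h3 v
    have h4 := c.ret_analytic (interior_subset h2).1
    have h5 := jetProlong_analytic h3
    rw [← (h1 v).lineDeriv, ← h5.lineDeriv_truncMap, ← h4.lineDeriv_comp (h5.truncMap N)]
  have hqs : Function.Surjective (fderiv ℝ q (jetTrunc k x₀)) := by
    intro u
    obtain ⟨v, hv, hvu⟩ := hsurj N u
    refine ⟨jetTrunc k v, ?_⟩
    rw [hline.self_of_nhds, c.jetDiff_ret_eq_self hd h.mem hv, hret0, hvu]
  obtain ⟨R, hR⟩ := (fderiv ℝ q (jetTrunc k x₀)).toLinearMap.exists_rightInverse_of_surjective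
    (LinearMap.range_eq_top.mpr hqs)
  let T0 : (Fin k → Fin n → ℝ) →L[ℝ] (Fin n → ℝ) := ContinuousLinearMap.proj ⟨0, hk⟩
  have hT0 : ∀ x : Jet n, T0 (jetTrunc k x) = x 0 := fun x => rfl
  -- A vector killed by the first $N$ derivatives of $\psi$ along the retraction is sent to a
  -- tangent vector with zero $x$-component, and the retraction does not change $x$. So $x$ factors
  -- through these derivatives.
  have hker : ∀ᶠ u in 𝓝 (jetTrunc k x₀), ∀ v, fderiv ℝ q u v = 0 → fderiv ℝ T0 u v = 0 := by
    have e : ∀ᶠ x in 𝓝 x₀, ∀ v, fderiv ℝ q (jetTrunc k x) (jetTrunc k v) = 0 → v 0 = 0 := by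
      filter_upwards [hline, c.eventually_dom hd, (c.tendsto_ret hd h.mem).eventually hgen]
        with x h1 h2 h3 v hv
      rw [h1] at hv
      rw [← (c.jetDiff_ret_apply h2 v).1]
      exact h3 _ (c.jetDiff_ret_mem h2 v) hv
    filter_upwards [(tendsto_jetPad x₀).eventually e] with u hu v hv
    have h1 := hu (jetPad 0 v)
    rw [jetTrunc_jetPad, jetTrunc_jetPad] at h1
    rw [T0.fderiv, ← jetTrunc_jetPad (0 : Jet n) v, hT0]
    exact h1 hv
  obtain ⟨φ, hφ, hφq⟩ := (T0.analyticAt _).exists_factorization hq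
    (LinearMap.toContinuousLinearMap R) (fun u => LinearMap.congr_fun hR u) hker
  have hq0 : q (jetTrunc k x₀) = jetTrunc N (jetProlong ψ x₀) := by
    have := hHq.self_of_nhds
    simp only [hret0] at this
    exact this.symm
  have hφa : ∀ i, JetAnalyticAt (fun y => φ (jetTrunc N y) i) (jetProlong ψ x₀) := fun i =>
    (JetMapAnalyticAt.comp_analytic (h := φ) (hq0 ▸ hφ) (JetMapAnalyticAt.trunc N _)).apply i
  have hc1 : ∀ᶠ x in 𝓝[solSet F] x₀, ∀ i, φ (jetTrunc N (jetProlong ψ x)) i = x 0 i := by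
    filter_upwards [c.eventually_sol h, hHq.filter_mono nhdsWithin_le_nhds,
      ((jetTrunc_continuous k).continuousAt.eventually hφq).filter_mono nhdsWithin_le_nhds]
      with x h1 h2 h3 i
    rw [c.ret_eq_self h1.1 h1.2] at h2
    rw [h2, ← h3, hT0]
  have hid := eventually_jetProlong_eq h hφa hψ hc1
  have hΦ0 : jetProlong (fun i y => φ (jetTrunc N y) i) (jetProlong ψ x₀) = x₀ :=
    hid.self_of_nhdsWithin h.mem
  have hΦa := jetProlong_analytic hφa
  refine ⟨fun i y => φ (jetTrunc N y) i, isTrivialization_jetProlong h hφa hψ rfl hc1 ?_ ?_⟩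
  -- Since $\Phi\circ\Psi$ is the identity on $\mathfrak X_0$, the required equations hold along
  -- $\Psi$; submersivity to all orders carries them over to a neighbourhood of $y_0$.
  · refine eventually_all.mpr fun i => c.eventually_of_comp h hψ hsurj
      (g := fun y => sysFun F i (jetProlong (fun i y => φ (jetTrunc N y) i) y))
      (hΦa.comp_fun (hΦ0.symm ▸ h.sysFun_analytic i)) ?_
    filter_upwards [hid, self_mem_nhdsWithin] with x h1 h2
    rw [h1]
    exact h2 0 i
  · refine eventually_all.mpr fun i => ?_
    have := c.eventually_of_comp h hψ hsurj
      (g := fun y => ψ i (jetProlong (fun i y => φ (jetTrunc N y) i) y) - y 0 i)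
      ((hΦa.comp_fun (hΦ0.symm ▸ hψ i)).sub (JetAnalyticAt.coord 0 i _)) (by
        filter_upwards [hid] with x h1
        rw [h1]
        exact sub_self _)
    exact this.mono fun y hy => sub_eq_zero.mp hy

/-- Closed forms completing `P(F)` to a unimodular matrix are the differentials of a flat output. -/
theorem exists_isTrivialization_of_closed (h : RegularSystemAt F x₀)
    {E : Matrix (Fin m) (Fin n) (JetOp x₀)} {Θ : Matrix (Fin n) (Fin m) (JetOp x₀)}
    {W : Matrix (Fin n) (Fin (n - m)) (JetOp x₀)}
    (hEΘ : E.map (solMap h) * Θ.map (solMap h) = 1)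
    (hPFΘ : (varMatrix F x₀).map (solMap h) * Θ.map (solMap h) = 0)
    (hsum : Θ.map (solMap h) * E.map (solMap h) +
      W.map (solMap h) * (varMatrix F x₀).map (solMap h) = 1)
    (hcl : ∀ i, ClosedOnSol F (matAct E (coordForms x₀) i)) :
    ∃ (Φ : Jet m → Jet n) (Ψ : Jet n → Jet m), IsTrivialization F x₀ (Ψ x₀) Φ Ψ := by
  choose ψ hψ hψE using fun i => h.exists_primitive (hcl i)
  have hPF : ∀ i' i, solMap h (∑ l, varMatrix F x₀ i l * Θ l i') = 0 := by
    intro i' i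
    have := congrFun (congrFun hPFΘ i) i'
    rw [Matrix.mul_apply] at this
    rw [map_sum]
    exact (Finset.sum_congr rfl fun l _ => map_mul _ _ _).trans this
  have hEE : ∀ i i', solMap h (∑ l, E i l * Θ l i') = solMap h (if i = i' then 1 else 0) := by
    intro i i'
    have := congrFun (congrFun hEΘ i) i'
    rw [Matrix.mul_apply, Matrix.one_apply] at this
    rw [map_sum]
    simp only [map_mul]
    refine Eq.trans this ?_
    split_ifs <;> simp
  -- Duality from $\frac{d^j}{dt^j}E\Theta=\frac{d^j}{dt^j}$. Linear combinations of these vectors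
  -- then realize any prescribed finite jet of $\psi$.
  have hline : ∀ i j i' k, lineDeriv ℝ (lieTau^[j] (ψ i)) x₀ (opVector (fun l => Θ l i') k) =
      if i = i' ∧ j = k then 1 else 0 := by
    intro i j i' k
    rw [(hψE i).lineDeriv_opVector h (hψ i) (hPF i') j k, evalBase_coeff_eq h
      (Q := DiffOp.dt _ ^ j * if i = i' then 1 else 0) (by rw [map_mul, map_mul, hEE]) k]
    by_cases hi : i = i'
    · simp only [hi, if_true, mul_one, DiffOp.coeff_dt_pow, true_and]
      split_ifs <;> simp
    · simp only [hi, if_false, mul_zero, DiffOp.coeff_zero, map_zero, false_and]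
  have hΨa := jetProlong_analytic hψ
  have hsurj : ∀ K (u : Fin K → Fin m → ℝ), ∃ v ∈ solTangent F x₀,
      jetTrunc K (jetDiff (jetProlong ψ) x₀ v) = u := by
    intro K u
    refine ⟨∑ k : Fin K, ∑ i' : Fin m, u k i' • opVector (fun l => Θ l i') k, ?_, ?_⟩
    · intro a b
      have hF := (h.sysFun_analytic b).iterate_lieTau a
      rw [hF.toMap.lineDeriv_sum]
      refine Finset.sum_eq_zero fun k _ => ?_
      rw [hF.toMap.lineDeriv_sum]
      refine Finset.sum_eq_zero fun i' _ => ?_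
      rw [hF.toMap.lineDeriv_smul, opVector_mem h (hPF i') k a b, smul_zero]
    · funext j i
      change lineDeriv ℝ (lieTau^[j] (ψ i)) x₀ _ = _
      have hF := (hψ i).iterate_lieTau j
      rw [hF.toMap.lineDeriv_sum, Finset.sum_eq_single j, hF.toMap.lineDeriv_sum,
        Finset.sum_eq_single i, hF.toMap.lineDeriv_smul, hline, if_pos ⟨rfl, rfl⟩, smul_eq_mul,
        mul_one]
      · intro i' _ hi
        rw [hF.toMap.lineDeriv_smul, hline, if_neg (fun hc => hi hc.1.symm), smul_zero]
      · exact fun hc => absurd (Finset.mem_univ _) hc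
      · intro k _ hk
        rw [hF.toMap.lineDeriv_sum]
        refine Finset.sum_eq_zero fun i' _ => ?_
        rw [hF.toMap.lineDeriv_smul, hline, if_neg (fun hc => hk (Fin.ext hc.2.symm)), smul_zero]
      · exact fun hc => absurd (Finset.mem_univ _) hc
  choose N hN using fun l i => (Θ l i).exists_bound
  set M := Finset.univ.sup fun l => Finset.univ.sup (N l)
  have hM : ∀ l i j, M ≤ j → (Θ l i).coeff j = 0 := fun l i j hj =>
    hN l i j (((Finset.le_sup (f := N l) (Finset.mem_univ i)).trans
      (Finset.le_sup (f := fun l => Finset.univ.sup (N l)) (Finset.mem_univ l))).trans hj)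
  have hgen : ∀ᶠ x in 𝓝[solSet F] x₀, ∀ v ∈ solTangent F x,
      jetTrunc M (jetDiff (jetProlong ψ) x v) = 0 → v 0 = 0 := by
    -- On $\mathfrak X_0$ the term $WP(F)\,dx$ vanishes, leaving $dx=\Theta\,d\psi$ with only
    -- finitely many derivatives of $\psi$ involved.
    have hmat : OpMatEq F (Θ * E + W * varMatrix F x₀) 1 := by
      rw [opMatEq_iff h, Matrix.map_add _ (map_add (solMap h)), Matrix.map_mul, Matrix.map_mul, hsum,
        Matrix.map_one _ (map_zero _) (map_one _)]
    have hdx : ∀ l, FormEq F (∑ i, ∑ j ∈ Finset.range M,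
        (Θ l i).coeff j • diffForm x₀ (lieTau^[j] (ψ i))) (coordForms x₀ l) := by
      intro l
      have e1 := FormEq.matAct h hmat (fun j => FormEq.refl (F := F) (coordForms x₀ j)) l
      rw [matAct_one, matAct_add, Pi.add_apply, matAct_mul, matAct_mul] at e1
      have e2 : FormEq F (matAct W (matAct (varMatrix F x₀) (coordForms x₀)) l) 0 := by
        have := FormEq.matAct h (P := W) (Q := W) (fun _ _ _ => EqOnSol.refl _)
          (ζ := 0) (fun i => matAct_varMatrix h i) l
        have e0 : matAct W (0 : Fin (n - m) → OneForm x₀) l = 0 := by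
          rw [matAct_apply]
          exact Finset.sum_eq_zero fun j _ => smul_zero _
        rwa [e0] at this
      have e3 : FormEq F (matAct Θ (matAct E (coordForms x₀)) l) (coordForms x₀ l) := by
        have := ((FormEq.refl (F := F) (matAct Θ (matAct E (coordForms x₀)) l)).add e2).symm.trans e1
        rwa [add_zero] at this
      refine FormEq.trans ?_ e3
      refine FormEq.trans (FormEq.sum fun i _ => (FormEq.smul_diffForm h (hψ i) (hM l i)).symm) ?_
      exact FormEq.sum fun i _ => FormEq.opAct h (fun _ => EqOnSol.refl _) (hψE i)
    have hval : ∀ᶠ x in 𝓝 x₀, ∀ l v, jetTrunc M (jetDiff (jetProlong ψ) x v) = 0 →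
        formEval (∑ i, ∑ j ∈ Finset.range M,
          (Θ l i).coeff j • diffForm x₀ (lieTau^[j] (ψ i))) x v = 0 := by
      refine eventually_all.mpr fun l => ?_
      filter_upwards [formEval_finsetSum Finset.univ fun i => ∑ j ∈ Finset.range M,
          (Θ l i).coeff j • diffForm x₀ (lieTau^[j] (ψ i)),
        eventually_all.mpr fun i => formEval_finsetSum (Finset.range M) fun j =>
          (Θ l i).coeff j • diffForm x₀ (lieTau^[j] (ψ i)),
        eventually_all.mpr fun i => (Finset.eventually_all (Finset.range M)).mpr fun j _ =>
          formEval_smul ((Θ l i).coeff j) (diffForm x₀ (lieTau^[j] (ψ i))),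
        eventually_all.mpr fun i => (Finset.eventually_all (Finset.range M)).mpr fun j _ =>
          formEval_diffForm ((hψ i).iterate_lieTau j)] with x a1 a2 a3 a4 v hv
      rw [a1]
      refine Finset.sum_eq_zero fun i _ => ?_
      rw [a2]
      refine Finset.sum_eq_zero fun j hj => ?_
      rw [a3 i j hj, a4 i j hj]
      have : lineDeriv ℝ (lieTau^[j] (ψ i)) x v = 0 :=
        congrFun (congrFun hv ⟨j, Finset.mem_range.mp hj⟩) i
      rw [this, mul_zero]
    filter_upwards [eventually_all.mpr hdx, hval.filter_mono nhdsWithin_le_nhds,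
      (eventually_all.mpr fun l => formEval_single (x₀ := x₀) (0, l) 1).filter_mono
        nhdsWithin_le_nhds,
      (JetRing.rep_one (x₀ := x₀)).filter_mono nhdsWithin_le_nhds] with x a1 a2 a3 a4 v hv h0
    funext l
    have e := a1 l v hv
    rw [a2 l v h0, coordForms, a3, a4, one_mul] at e
    exact e.symm
  obtain ⟨φ, hφ⟩ := exists_isTrivialization h hψ hsurj hgen
  exact ⟨_, _, hφ⟩

/-- The unimodular $M$ is absorbed into $E=M(I_m,0)Q$, whose rows then represent closed forms;
`Completion.of_smith` supplies $\Theta$ and $W$. -/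
theorem StrongClosednessCondition.exists_isTrivialization (h : RegularSystemAt F x₀) (hm : m ≤ n)
    (hs : StrongClosednessCondition F x₀) :
    ∃ (Φ : Jet m → Jet n) (Ψ : Jet n → Jet m), IsTrivialization F x₀ (Ψ x₀) Φ Ψ := by
  obtain ⟨U, Q, ⟨hU, V, hV, hVU⟩, ⟨hQ, Rm, hRm, hQR⟩, M, hM, hcl⟩ := hs
  rw [unimodular_iff h] at hU hV hQ hRm hM
  obtain ⟨U', hU1, _⟩ := hU
  obtain ⟨V', _, hV2⟩ := hV
  obtain ⟨Q', hQ1, hQ2⟩ := hQ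
  obtain ⟨R', hR1, _⟩ := hRm
  obtain ⟨M', hM1, hM2⟩ := hM
  have hVU' : V.map (solMap h) * (varMatrix F x₀).map (solMap h) * U.map (solMap h) =
      rectId (SolOp h) (n - m) n := by
    have := (opMatEq_iff h).mp hVU
    rwa [Matrix.map_mul, Matrix.map_mul, rectId_map] at this
  have hQR' : Q.map (solMap h) * (U.map (solMap h) * lowerId (SolOp h) n m) * Rm.map (solMap h) =
      rectId (SolOp h) n m := by
    have := (opMatEq_iff h).mp hQR
    rwa [hatMatrix_eq, Matrix.map_mul, Matrix.map_mul, Matrix.map_mul, rectId_map, lowerId_map] at this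
  obtain ⟨W, h1, h2, h3⟩ := Completion.of_smith hm hU1 hV2 hQ1 hQ2 hR1 hM1 hM2 hVU' hQR'
  choose Θ hΘ using fun i j => solMap_surjective h ((Q' * (rectId (SolOp h) n m * M')) i j)
  choose W₁ hW₁ using fun i j => solMap_surjective h (W i j)
  have eΘ : (Matrix.of Θ).map (solMap h) = Q' * (rectId (SolOp h) n m * M') := by
    ext i j; exact hΘ i j
  have eW : (Matrix.of W₁).map (solMap h) = W := by ext i j; exact hW₁ i j
  have eE : (M * (rectId (JetOp x₀) m n * Q)).map (solMap h) =
      M.map (solMap h) * (rectId (SolOp h) m n * Q.map (solMap h)) := by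
    rw [Matrix.map_mul, Matrix.map_mul, rectId_map]
  refine exists_isTrivialization_of_closed h (E := M * (rectId (JetOp x₀) m n * Q))
    (Θ := Matrix.of Θ) (W := Matrix.of W₁) (by rw [eΘ, eE, h1]) (by rw [eΘ, h2])
    (by rw [eΘ, eE, eW, h3]) fun i => ?_
  rw [matAct_mul, ← omegaForms_eq]
  exact hcl i

end FlatFromClosed

/-! ### The state as a function of the coordinates $y_k^{(j)}$, $j\le\sigma_k$, and the bound $n\le
m+N$. -/

section OutputChart

variable {n m : ℕ} {F : (Fin n → ℝ) × (Fin n → ℝ) → Fin (n - m) → ℝ} {x₀ : Jet n}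

/-- The coordinates `y_k^{(j)}`, `j ≤ σ_k`. -/
def jetSelect (σ : Fin m → ℕ) (y : Jet m) : (Σ k : Fin m, Fin (σ k + 1)) → ℝ := fun p => y p.2 p.1

theorem jetSelect_analytic (σ : Fin m → ℕ) (y : Jet m) : JetMapAnalyticAt (jetSelect σ) y :=
  JetMapAnalyticAt.pi fun p => (JetAnalyticAt.coord p.2 p.1 y).toMap

theorem lineDeriv_jetSelect (σ : Fin m → ℕ) (y v : Jet m) :
    lineDeriv ℝ (jetSelect σ) y v = jetSelect σ v := by
  refine (JetMapAnalyticAt.lineDeriv_pi (f := fun (p : Σ k : Fin m, Fin (σ k + 1)) z => z p.2 p.1)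
    (fun p => (JetAnalyticAt.coord p.2 p.1 y).toMap) v).trans ?_
  funext p
  exact JetMapAnalyticAt.lineDeriv_coord _ _ _ _

namespace TrivFacts

variable {Φ : Jet m → Jet n} {Ψ : Jet n → Jet m}

/-- A coefficient beyond the column degree is the zero germ, so the corresponding partial derivative
vanishes near the base point; finitely many of them matter. -/
theorem lineDeriv_eq_zero (ht : TrivFacts F x₀ Φ Ψ) : ∀ᶠ y in 𝓝 (Ψ x₀), ∀ v : Jet m,
    jetSelect (colDegree (outputMatrix Φ (Ψ x₀))) v = 0 → lineDeriv ℝ (fun z => Φ z 0) y v = 0 := by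
  have hΦ := ht.anaΦ.self_of_nhds
  set σ := colDegree (outputMatrix Φ (Ψ x₀)) with hσ
  have hz : ∀ i k j, σ k < j → jetPartial (j, k) (fun y => Φ y 0 i) =ᶠ[𝓝 (Ψ x₀)] fun _ => 0 := by
    intro i k j hj
    have e : JetRing.of (Ψ x₀) (jetPartial (j, k) fun y => Φ y 0 i) = 0 := by
      rw [← opRow_coeff (hΦ 0 i)]
      refine Polynomial.coeff_eq_zero_of_natDegree_lt (lt_of_le_of_lt ?_ hj)
      exact Finset.le_sup (f := fun i => (outputMatrix Φ (Ψ x₀) i k).degree) (Finset.mem_univ i)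
    have := JetRing.rep_of ((hΦ 0 i).partialDeriv (j, k))
    rw [e] at this
    exact this.symm.trans JetRing.rep_zero
  choose N hN using fun i => (hΦ 0 i).lineDeriv_eq_sum
  have hz' : ∀ i, ∀ᶠ y in 𝓝 (Ψ x₀), ∀ p ∈ Finset.range (N i) ×ˢ (Finset.univ : Finset (Fin m)),
      σ p.2 < p.1 → jetPartial p (fun y => Φ y 0 i) y = 0 := by
    intro i
    refine (Finset.eventually_all _).mpr fun p _ => ?_
    by_cases hp : σ p.2 < p.1
    · exact (hz i p.2 p.1 hp).mono fun y hy _ => hy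
    · exact Eventually.of_forall fun _ hc => absurd hc hp
  filter_upwards [eventually_all.mpr hN, eventually_all.mpr hz', ht.anaΦ] with y h1 h2 h3 v hv
  rw [h3.lineDeriv_blockMap]
  funext i
  rw [jetDiff, (h1 i).2 _ le_rfl]
  refine Finset.sum_eq_zero fun p hp => ?_
  by_cases hc : σ p.2 < p.1
  · rw [h2 i p hp hc, mul_zero]
  · have : v p.1 p.2 = 0 := congrFun hv ⟨p.2, ⟨p.1, by omega⟩⟩
    rw [this, zero_mul]

/-- Vanishing partial derivatives give local independence of the coordinates beyond the column
degrees, by factorization through the linear projection that forgets them. -/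
theorem exists_outputChart (ht : TrivFacts F x₀ Φ Ψ) :
    ∃ f : ((Σ k : Fin m, Fin (colDegree (outputMatrix Φ (Ψ x₀)) k + 1)) → ℝ) → Fin n → ℝ,
      AnalyticAt ℝ f (jetSelect _ (Ψ x₀)) ∧ ∀ᶠ y in 𝓝 (Ψ x₀), Φ y 0 = f (jetSelect _ y) := by
  have hΦ := ht.anaΦ.self_of_nhds
  set σ := colDegree (outputMatrix Φ (Ψ x₀)) with hσ
  obtain ⟨k₀, hk₀⟩ := JetMapAnalyticAt.lift (hΦ.blockMap 0)
  obtain ⟨K, hK, hKσ⟩ : ∃ K, k₀ ≤ K ∧ ∀ k, σ k < K :=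
    ⟨max k₀ (Finset.univ.sup σ + 1), le_max_left _ _, fun k => lt_of_lt_of_le
      (Nat.lt_succ_of_le (Finset.le_sup (f := σ) (Finset.mem_univ k))) (le_max_right _ _)⟩
  obtain ⟨g, hg, hΦg⟩ := hk₀ K hK
  let q : (Fin K → Fin m → ℝ) →L[ℝ] ((Σ k : Fin m, Fin (σ k + 1)) → ℝ) :=
    ContinuousLinearMap.pi fun p =>
      (ContinuousLinearMap.proj (R := ℝ) (φ := fun _ : Fin m => ℝ) p.1).comp
        (ContinuousLinearMap.proj (R := ℝ) (φ := fun _ : Fin K => Fin m → ℝ)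
          ⟨p.2, lt_of_lt_of_le p.2.2 (hKσ p.1)⟩)
  have hq : ∀ y, q (jetTrunc K y) = jetSelect σ y := fun y => rfl
  have hqs : Function.Surjective q := by
    intro w
    refine ⟨fun j k => if hj : (j : ℕ) < σ k + 1 then w ⟨k, ⟨j, hj⟩⟩ else 0, ?_⟩
    funext p
    change (if hj : (p.2 : ℕ) < σ p.1 + 1 then w ⟨p.1, ⟨p.2, hj⟩⟩ else 0) = _
    rw [dif_pos p.2.2]
  obtain ⟨R, hR⟩ := q.toLinearMap.exists_rightInverse_of_surjective (LinearMap.range_eq_top.mpr hqs)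
  obtain ⟨f, hf, hfq⟩ := hg.exists_factorization (q.analyticAt _)
    (LinearMap.toContinuousLinearMap R) (fun u => by rw [q.fderiv]; exact LinearMap.congr_fun hR u) (by
      have e : ∀ᶠ y in 𝓝 (Ψ x₀), ∀ v, q (jetTrunc K v) = 0 →
          fderiv ℝ g (jetTrunc K y) (jetTrunc K v) = 0 := by
        filter_upwards [JetMapAnalyticAt.hasLineDerivAt_of_eq hg hΦg, ht.lineDeriv_eq_zero]
          with y h1 h2 v hv
        rw [← (h1 v).lineDeriv]
        exact h2 v hv
      filter_upwards [(tendsto_jetPad (Ψ x₀)).eventually e] with u hu v hv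
      have h1 := hu (jetPad 0 v)
      rw [jetTrunc_jetPad, jetTrunc_jetPad] at h1
      rw [q.fderiv] at hv
      exact h1 hv)
  refine ⟨f, hf, ?_⟩
  filter_upwards [hΦg, (jetTrunc_continuous K).continuousAt.eventually hfq] with y h1 h2
  rw [h1, h2, hq]

/-- Every vector is the $x$-component of a tangent vector of $\mathfrak X_0$, namely of the image of
any extension under the differential of the retraction. Along $\mathfrak X_0$ the map $f$ recovers
$x$ from $\Psi$. -/
theorem surjective_outputChart (h : RegularSystemAt F x₀) (ht : TrivFacts F x₀ Φ Ψ) {σ : Fin m → ℕ}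
    {f : ((Σ k : Fin m, Fin (σ k + 1)) → ℝ) → Fin n → ℝ}
    (hf : AnalyticAt ℝ f (jetSelect σ (Ψ x₀)))
    (hΦf : ∀ᶠ y in 𝓝 (Ψ x₀), Φ y 0 = f (jetSelect _ y)) :
    Function.Surjective (fderiv ℝ f (jetSelect σ (Ψ x₀))) := by
  intro w
  obtain ⟨c⟩ := h.nonempty_chart
  have hd := c.mem_dom h
  let v : Jet n := jetDiff c.ret x₀ (fun _ => w)
  have hv0 : v 0 = w := (c.jetDiff_ret_apply hd _).1
  have hvT : v ∈ solTangent F x₀ := by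
    have := c.jetDiff_ret_mem hd (fun _ => w)
    rwa [c.ret_eq_self hd h.mem] at this
  have hΨ := ht.anaΨ.self_of_nhds
  have hz : JetMapAnalyticAt (fun x => jetSelect σ (Ψ x)) x₀ :=
    hΨ.comp_map (jetSelect_analytic σ _)
  have e := h.eventually_lineDeriv_eq (f := fun x => f (jetSelect σ (Ψ x))) (g := fun x => x 0)
    (JetMapAnalyticAt.comp_analytic hf hz) (JetMapAnalyticAt.block 0 x₀) (by
      filter_upwards [ht.left, ht.tendsto.eventually hΦf] with x h1 h2
      rw [← h2, h1]) |>.self_of_nhdsWithin h.mem v hvT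
  rw [JetMapAnalyticAt.lineDeriv_comp_analytic (h := f) (f := fun x => jetSelect σ (Ψ x))
    hf.differentiableAt hz,
    JetMapAnalyticAt.lineDeriv_block, hv0] at e
  exact ⟨_, e⟩

theorem shift_outputChart (ht : TrivFacts F x₀ Φ Ψ) {σ : Fin m → ℕ}
    {f : ((Σ k : Fin m, Fin (σ k + 1)) → ℝ) → Fin n → ℝ}
    (hf : AnalyticAt ℝ f (jetSelect σ (Ψ x₀)))
    (hΦf : ∀ᶠ y in 𝓝 (Ψ x₀), Φ y 0 = f (jetSelect _ y)) :
    ∀ᶠ y in 𝓝 (Ψ x₀), Φ y 1 = fderiv ℝ f (jetSelect σ y) (jetSelect σ (jetShift y)) := by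
  filter_upwards [ht.lieΦ, ht.anaΦ, eventually_eventually_nhds.mpr hΦf,
    (jetSelect_analytic σ (Ψ x₀)).continuousAt.eventually hf.eventually_analyticAt] with y h1 h2 h3 h4
  rw [← lineDeriv_jetSelect σ y (jetShift y), ← JetMapAnalyticAt.lineDeriv_comp_analytic (h := f)
    h4.differentiableAt (jetSelect_analytic σ y), ← jetMap_lineDeriv_congr h3, h2.lineDeriv_blockMap]
  funext i
  rw [jetDiff, ← lieTau_eq_lieAlong (h2 0 i), h1]

/-- A dimension count for the submersion $f$. The coordinate $y_k$ itself is always counted, also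
for a column of degree zero, whence the summand $m$. -/
theorem le_sum_colDegree (h : RegularSystemAt F x₀) (ht : TrivFacts F x₀ Φ Ψ) :
    n ≤ m + ∑ k, colDegree (outputMatrix Φ (Ψ x₀)) k := by
  obtain ⟨f, hf, hΦf⟩ := ht.exists_outputChart
  have := LinearMap.finrank_le_finrank_of_surjective (f := (fderiv ℝ f _).toLinearMap)
    (ht.surjective_outputChart h hf hΦf)
  simp only [Module.finrank_fintype_fun_eq_card, Fintype.card_fin, Fintype.card_sigma,
    Finset.sum_add_distrib, Finset.sum_const, Finset.card_univ, smul_eq_mul, mul_one] at this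
  omega

end TrivFacts

end OutputChart

/-! ### The Brunovsky form: chains of integrators. -/

section Brunovsky

variable {m : ℕ} (σ : Fin m → ℕ)

/-- The nilpotent part of the Brunovsky form with chains of lengths `σ_k + 1`. -/
def brunovskyA : ((Σ k : Fin m, Fin (σ k + 1)) → ℝ) →ₗ[ℝ] ((Σ k : Fin m, Fin (σ k + 1)) → ℝ) where
  toFun w p := if h : (p.2 : ℕ) + 1 < σ p.1 + 1 then w ⟨p.1, ⟨p.2 + 1, h⟩⟩ else 0
  map_add' v w := by
    funext p
    simp only [Pi.add_apply]
    split_ifs <;> simp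
  map_smul' r w := by
    funext p
    simp only [Pi.smul_apply, RingHom.id_apply]
    split_ifs <;> simp

/-- The input part of the Brunovsky form. -/
def brunovskyB : (Fin m → ℝ) →ₗ[ℝ] ((Σ k : Fin m, Fin (σ k + 1)) → ℝ) where
  toFun v p := if (p.2 : ℕ) = σ p.1 then v p.1 else 0
  map_add' v w := by
    funext p
    simp only [Pi.add_apply]
    split_ifs <;> simp
  map_smul' r w := by
    funext p
    simp only [Pi.smul_apply, RingHom.id_apply]
    split_ifs <;> simp

theorem brunovskyB_injective : Function.Injective (brunovskyB σ) := by
  intro v w h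
  funext k
  have := congrFun h ⟨k, ⟨σ k, Nat.lt_succ_self _⟩⟩
  simpa [brunovskyB] using this

theorem jetSelect_jetShift (y : Jet m) : jetSelect σ (jetShift y) =
    brunovskyA σ (jetSelect σ y) + brunovskyB σ fun k => y (σ k + 1) k := by
  funext p
  have hp := p.2.2
  simp only [Pi.add_apply, brunovskyA, brunovskyB, LinearMap.coe_mk, AddHom.coe_mk, jetSelect,
    jetShift]
  by_cases h : (p.2 : ℕ) + 1 < σ p.1 + 1
  · rw [dif_pos h, if_neg (by omega), add_zero]
  · have h2 : (p.2 : ℕ) = σ p.1 := by omega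
    rw [dif_neg h, if_pos h2, zero_add, h2]

/-- The input enters at the end of its chain, and each application of $A$ moves it one place towards
the head. -/
theorem brunovskyA_pow (k : Fin m) (a : ℕ) (ha : a ≤ σ k) :
    (brunovskyA σ ^ a) (brunovskyB σ (Pi.single k 1)) =
      Pi.single ⟨k, ⟨σ k - a, by omega⟩⟩ 1 := by
  have hs : ∀ (j : ℕ) (hj : j < σ k + 1), (Pi.single ⟨k, ⟨j, hj⟩⟩ 1 : (Σ k, Fin (σ k + 1)) → ℝ) =
      fun p => if p.1 = k ∧ (p.2 : ℕ) = j then 1 else 0 := by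
    intro j hj
    funext p
    obtain ⟨k', j'⟩ := p
    by_cases hk : k' = k
    · subst hk
      by_cases hj' : (j' : ℕ) = j
      · subst hj'; simp
      · rw [Pi.single_eq_of_ne, if_neg (fun hc => hj' hc.2)]
        intro hc
        simp only [Sigma.mk.injEq, heq_eq_eq, true_and] at hc
        exact hj' (congrArg Fin.val hc)
    · rw [Pi.single_eq_of_ne, if_neg (fun hc => hk hc.1)]
      intro hc
      exact hk (congrArg Sigma.fst hc)
  induction a with
  | zero =>
    rw [hs]
    funext p
    simp only [pow_zero, Module.End.one_apply, brunovskyB, LinearMap.coe_mk, AddHom.coe_mk,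
      Nat.sub_zero, Pi.single_apply]
    by_cases hk : p.1 = k
    · rw [← hk]; simp
    · simp [hk]
  | succ a ih =>
    rw [pow_succ', Module.End.mul_apply, ih (by omega), hs, hs]
    funext p
    have hp := p.2.2
    simp only [brunovskyA, LinearMap.coe_mk, AddHom.coe_mk]
    by_cases hk : p.1 = k
    · have hk' : σ p.1 = σ k := by rw [hk]
      split_ifs <;> first | rfl | omega
    · simp [hk]

end Brunovsky

/-! ### Static feedback linearization when $n=m+N$. -/

section Linearization

variable {n m : ℕ} {F : (Fin n → ℝ) × (Fin n → ℝ) → Fin (n - m) → ℝ} {x₀ : Jet n}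

theorem isControllablePair_toMatrix' {A : (Fin n → ℝ) →ₗ[ℝ] (Fin n → ℝ)}
    {B : (Fin m → ℝ) →ₗ[ℝ] (Fin n → ℝ)}
    (h : ∀ i, ∃ (a : Fin n) (k : Fin m), (A ^ (a : ℕ)) (B (Pi.single k 1)) = Pi.single i 1) :
    IsControllablePair (LinearMap.toMatrix' A) (LinearMap.toMatrix' B) := by
  have hpow : ∀ a : ℕ, LinearMap.toMatrix' A ^ a * LinearMap.toMatrix' B =
      LinearMap.toMatrix' ((A ^ a).comp B) := by
    intro a
    rw [LinearMap.toMatrix'_comp]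
    congr 1
    exact (map_pow LinearMap.toMatrixAlgEquiv' A a).symm
  rw [IsControllablePair, Matrix.rank_eq_finrank_span_cols]
  have htop : Submodule.span ℝ (Set.range (Matrix.of fun (i : Fin n) (q : Fin n × Fin m) =>
      (LinearMap.toMatrix' A ^ (q.1 : ℕ) * LinearMap.toMatrix' B) i q.2).col) = ⊤ := by
    rw [eq_top_iff, ← (Pi.basisFun ℝ (Fin n)).span_eq]
    refine Submodule.span_mono ?_
    rintro _ ⟨i, rfl⟩
    obtain ⟨a, k, hak⟩ := h i
    refine ⟨(a, k), ?_⟩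
    rw [Pi.basisFun_apply, ← hak]
    funext l
    simp only [Matrix.col_apply, Matrix.of_apply, hpow, LinearMap.toMatrix'_apply]
    rw [LinearMap.comp_apply]
  rw [htop, finrank_top, Module.finrank_fin_fun]

/-- When the dimensions agree, the submersion $f$ is a local diffeomorphism. Its inverse $g$ takes
the state to the coordinates $y_k^{(j)}$, $j\le\sigma_k$, which form integrator chains driven by
$y_k^{(\sigma_k+1)}$. Taking these top derivatives as inputs of the explicit system makes the
feedback trivial. -/
theorem TrivFacts.staticFeedbackLinearizableAt_of_outputChart (h : RegularSystemAt F x₀)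
    {Φ : Jet m → Jet n} {Ψ : Jet n → Jet m} (ht : TrivFacts F x₀ Φ Ψ) {σ : Fin m → ℕ}
    (hn : n = m + ∑ k, σ k) {f : ((Σ k : Fin m, Fin (σ k + 1)) → ℝ) → Fin n → ℝ}
    (hf : AnalyticAt ℝ f (jetSelect σ (Ψ x₀)))
    (hΦf : (fun y => Φ y 0) =ᶠ[𝓝 (Ψ x₀)] fun y => f (jetSelect σ y)) :
    StaticFeedbackLinearizableAt F x₀ := by
  have hsurj := ht.surjective_outputChart h hf hΦf
  have hshift := ht.shift_outputChart hf hΦf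
  set z₀ := jetSelect σ (Ψ x₀) with hz₀
  have hcard : Fintype.card (Σ k : Fin m, Fin (σ k + 1)) = n := by
    simp only [Fintype.card_sigma, Fintype.card_fin, Finset.sum_add_distrib, Finset.sum_const,
      Finset.card_univ, smul_eq_mul, mul_one]
    omega
  have hbij : Function.Bijective (fderiv ℝ f z₀).toLinearMap := by
    refine ⟨?_, hsurj⟩
    refine (LinearMap.injective_iff_surjective_of_finrank_eq_finrank ?_).mpr hsurj
    rw [Module.finrank_fintype_fun_eq_card, Module.finrank_fintype_fun_eq_card, hcard,
      Fintype.card_fin]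
  let f' := (LinearEquiv.ofBijective _ hbij).toContinuousLinearEquiv
  have hf' : HasFDerivAt f (f' : _ →L[ℝ] _) z₀ := hf.differentiableAt.hasFDerivAt
  obtain ⟨g, hg, hgz, hgl, hgr⟩ := hf.exists_localInverse f' hf'
  have hfz : f z₀ = x₀ 0 := hΦf.self_of_nhds.symm.trans (congrFun ht.base 0)
  rw [hfz] at hg hgz hgr
  let e : Fin n ≃ Σ k : Fin m, Fin (σ k + 1) := (Fintype.equivFinOfCardEq hcard).symm
  let ρ : ((Σ k : Fin m, Fin (σ k + 1)) → ℝ) ≃ₗ[ℝ] (Fin n → ℝ) := LinearEquiv.funCongrLeft ℝ ℝ e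
  let ρc := ρ.toContinuousLinearEquiv
  let At := (ρ.toLinearMap.comp (brunovskyA σ)).comp ρ.symm.toLinearMap
  let Bt := ρ.toLinearMap.comp (brunovskyB σ)
  let Ac := LinearMap.toContinuousLinearMap (brunovskyA σ)
  let Bc := LinearMap.toContinuousLinearMap (brunovskyB σ)
  let u₀ : Fin m → ℝ := fun k => Ψ x₀ (σ k + 1) k
  -- The image under $f$ of the Brunovsky field.
  let s : (Fin n → ℝ) × (Fin m → ℝ) → (Fin n → ℝ) := fun p => fderiv ℝ f (g p.1) (Ac (g p.1) + Bc p.2)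
  have hg1 : AnalyticAt ℝ (fun p : (Fin n → ℝ) × (Fin m → ℝ) => g p.1) (x₀ 0, u₀) :=
    AnalyticAt.fun_comp (g := g) hg analyticAt_fst
  have hs : AnalyticAt ℝ s (x₀ 0, u₀) := by
    have h1 : AnalyticAt ℝ (fun p : (Fin n → ℝ) × (Fin m → ℝ) => fderiv ℝ f (g p.1)) (x₀ 0, u₀) :=
      AnalyticAt.fun_comp (g := fderiv ℝ f) (hgz.symm ▸ hf.fderiv) hg1
    have h2 : AnalyticAt ℝ (fun p : (Fin n → ℝ) × (Fin m → ℝ) => Ac (g p.1) + Bc p.2) (x₀ 0, u₀) :=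
      ((Ac.analyticAt _).comp hg1).add ((Bc.analyticAt _).comp analyticAt_snd)
    exact ((ContinuousLinearMap.id ℝ _).analyticAt_bilinear _).comp (h1.prod h2)
  -- A jet with prescribed chain coordinates and inputs, completed by the higher derivatives of the
  -- base jet so that it stays close to $\Psi(x_0)$. Its image under $\Phi$ lies in $\mathfrak X_0$,
  -- which shows that the explicit system satisfies $F=0$.
  let yv : ((Σ k : Fin m, Fin (σ k + 1)) → ℝ) → (Fin m → ℝ) → Jet m := fun w u j k =>
    if hj : j < σ k + 1 then w ⟨k, ⟨j, hj⟩⟩ else if j = σ k + 1 then u k else Ψ x₀ j k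
  have hyv1 : ∀ w u, jetSelect σ (yv w u) = w := by
    intro w u
    funext p
    simp only [jetSelect, yv]
    rw [dif_pos p.2.2]
  have hyv2 : ∀ w u, jetSelect σ (jetShift (yv w u)) = Ac w + Bc u := by
    intro w u
    rw [jetSelect_jetShift, hyv1]
    have : (fun k => yv w u (σ k + 1) k) = u := by
      funext k
      simp [yv]
    rw [this]
    rfl
  have hyv0 : yv z₀ u₀ = Ψ x₀ := by
    funext j k
    simp only [yv, z₀, jetSelect, u₀]
    split_ifs with h1 h2
    · rfl
    · rw [h2]
    · rfl
  have hyc : ContinuousAt (fun p : (Fin n → ℝ) × (Fin m → ℝ) => yv (g p.1) p.2) (x₀ 0, u₀) := by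
    refine continuousAt_pi.mpr fun j => continuousAt_pi.mpr fun k => ?_
    simp only [yv]
    split_ifs
    · exact (continuousAt_pi.mp hg1.continuousAt) _
    · exact ((continuous_apply k).comp continuous_snd).continuousAt
    · exact continuousAt_const
  have hyt : Tendsto (fun p : (Fin n → ℝ) × (Fin m → ℝ) => yv (g p.1) p.2) (𝓝 (x₀ 0, u₀)) (𝓝 (Ψ x₀)) := by
    have := hyc.tendsto
    simp only [hgz, hyv0] at this
    exact this
  have hfst : Tendsto (fun p : (Fin n → ℝ) × (Fin m → ℝ) => p.1) (𝓝 (x₀ 0, u₀)) (𝓝 (x₀ 0)) :=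
    continuous_fst.continuousAt
  have hjet : ∀ᶠ p in 𝓝 (x₀ 0, u₀), Φ (yv (g p.1) p.2) 0 = p.1 ∧ Φ (yv (g p.1) p.2) 1 = s p := by
    filter_upwards [hyt.eventually hΦf, hyt.eventually hshift, hfst.eventually hgr] with p h1 h2 h3
    rw [hyv1] at h1 h2
    rw [hyv2] at h2
    exact ⟨by rw [h1, h3], h2⟩
  have hs0 : s (x₀ 0, u₀) = x₀ 1 := by
    rw [← hjet.self_of_nhds.2]
    simp only [hgz, hyv0]
    rw [ht.base]
  have hfinj : Function.Injective (fderiv ℝ f z₀) := hbij.1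
  refine ⟨s, u₀, hs, hs0, ?_, ?_, fun x => ρc (g x), u₀, fun p => p.2, LinearMap.toMatrix' At,
    LinearMap.toMatrix' Bt, (ρc.toContinuousLinearMap.analyticAt _).comp hg, ?_, analyticAt_snd, rfl,
    ?_, ?_, ?_⟩
  · have h1 : HasFDerivAt (fun u => s (x₀ 0, u)) ((fderiv ℝ f z₀).comp Bc) u₀ := by
      have h2 : (fun u => s (x₀ 0, u)) = fun u => fderiv ℝ f z₀ (Ac z₀ + Bc u) := by
        funext u
        simp only [s, hgz]
      rw [h2]
      exact (fderiv ℝ f z₀).hasFDerivAt.comp u₀ (Bc.hasFDerivAt.const_add _)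
    rw [h1.fderiv]
    exact hfinj.comp (brunovskyB_injective σ)
  · filter_upwards [hjet, hyt.eventually ht.sol] with p h1 h2
    funext i
    have := h2 0 i
    change F (Φ _ 0, Φ _ 1) i = 0 at this
    rwa [h1.1, h1.2] at this
  · have h1 : HasFDerivAt (fun x => ρc (g x)) ((ρc : _ →L[ℝ] _).comp (fderiv ℝ g (x₀ 0))) (x₀ 0) :=
      ρc.toContinuousLinearMap.hasFDerivAt.comp _ hg.differentiableAt.hasFDerivAt
    have h2 : HasFDerivAt (fun z => g (f z)) ((fderiv ℝ g (x₀ 0)).comp (f' : _ →L[ℝ] _)) z₀ :=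
      HasFDerivAt.comp z₀ (hfz ▸ hg.differentiableAt.hasFDerivAt) hf'
    have h3 := (h2.congr_of_eventuallyEq (f₁ := id) (hgl.mono fun z hz => hz.symm)).unique
      (hasFDerivAt_id z₀)
    have h4 : ∀ w, fderiv ℝ g (x₀ 0) w = f'.symm w := by
      intro w
      have := DFunLike.congr_fun h3 (f'.symm w)
      simpa using this
    have h5 : (fderiv ℝ g (x₀ 0) : (Fin n → ℝ) → _) = f'.symm := funext h4
    rw [h1.fderiv]
    change Function.Bijective (ρc ∘ (fderiv ℝ g (x₀ 0)))
    rw [h5]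
    exact ρc.bijective.comp f'.symm.bijective
  · have : fderiv ℝ (fun v : Fin m → ℝ => v) u₀ = ContinuousLinearMap.id ℝ _ := fderiv_id
    change Function.Bijective (fderiv ℝ (fun v : Fin m → ℝ => v) u₀)
    rw [this]
    exact Function.bijective_id
  · refine isControllablePair_toMatrix' fun i => ?_
    have hAt : ∀ (a : ℕ) w, (At ^ a) (ρ w) = ρ ((brunovskyA σ ^ a) w) := by
      intro a w
      induction a with
      | zero => rfl
      | succ a ih =>
        rw [pow_succ', Module.End.mul_apply, ih, pow_succ', Module.End.mul_apply]
        simp [At]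
    have hlt := (e i).2.2
    have hle : σ (e i).1 + 1 ≤ n := by
      refine le_of_le_of_eq ?_ hcard
      rw [Fintype.card_sigma]
      simp only [Fintype.card_fin]
      exact Finset.single_le_sum (f := fun k => σ k + 1) (fun _ _ => Nat.zero_le _)
        (Finset.mem_univ (e i).1)
    -- The coordinate at place $j$ of a chain of length $\sigma+1$ is reached from its input after
    -- $\sigma-j$ steps, and $\sigma-j<n$ since the chain lengths add up to $n$.
    refine ⟨⟨σ (e i).1 - (e i).2, by omega⟩, (e i).1, ?_⟩
    change (At ^ _) (ρ (brunovskyB σ _)) = _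
    rw [hAt, brunovskyA_pow σ _ _ (by simp)]
    have h1 : (⟨(e i).1, ⟨σ (e i).1 - (σ (e i).1 - ((e i).2 : ℕ)), by omega⟩⟩ :
        Σ k : Fin m, Fin (σ k + 1)) = e i := by
      refine Sigma.ext rfl (heq_of_eq (Fin.ext ?_))
      simp only
      omega
    rw [h1]
    funext l
    change (Pi.single (e i) 1 : _ → ℝ) (e l) = _
    by_cases hl : l = i
    · subst hl; rw [Pi.single_eq_same, Pi.single_eq_same]
    · rw [Pi.single_eq_of_ne hl, Pi.single_eq_of_ne fun hc => hl (e.injective hc)]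
  · have h1 : ∀ᶠ x in 𝓝 (x₀ 0), ∀ w, fderiv ℝ g x (fderiv ℝ f (g x) w) = w := by
      have hgt : Tendsto g (𝓝 (x₀ 0)) (𝓝 z₀) := by
        have := hg.continuousAt.tendsto
        rwa [hgz] at this
      filter_upwards [hgr, hg.eventually_analyticAt, hgt.eventually hf.eventually_analyticAt,
        hgt.eventually (eventually_eventually_nhds.mpr hgl)] with x a1 a2 a3 a4 w
      have h2 : HasFDerivAt (fun z => g (f z)) ((fderiv ℝ g x).comp (fderiv ℝ f (g x))) (g x) :=
        HasFDerivAt.comp (g x) (a1.symm ▸ a2.differentiableAt.hasFDerivAt)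
          a3.differentiableAt.hasFDerivAt
      have h3 := (h2.congr_of_eventuallyEq (f₁ := id) (a4.mono fun z hz => hz.symm)).unique
        (hasFDerivAt_id (g x))
      exact DFunLike.congr_fun h3 w
    filter_upwards [hfst.eventually h1, hfst.eventually hg.eventually_analyticAt] with p a1 a2
    have h2 : HasFDerivAt (fun x => ρc (g x)) ((ρc : _ →L[ℝ] _).comp (fderiv ℝ g p.1)) p.1 :=
      ρc.toContinuousLinearMap.hasFDerivAt.comp _ a2.differentiableAt.hasFDerivAt
    rw [h2.fderiv, LinearMap.toMatrix'_mulVec, LinearMap.toMatrix'_mulVec]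
    change ρ (fderiv ℝ g p.1 (fderiv ℝ f (g p.1) (Ac (g p.1) + Bc p.2))) = _
    rw [a1]
    change ρ (brunovskyA σ (g p.1) + brunovskyB σ p.2) =
      ρ (brunovskyA σ (ρ.symm (ρ (g p.1)))) + ρ (brunovskyB σ p.2)
    rw [ρ.symm_apply_apply, map_add]

theorem TrivFacts.staticFeedbackLinearizableAt (h : RegularSystemAt F x₀) {Φ : Jet m → Jet n}
    {Ψ : Jet n → Jet m} (ht : TrivFacts F x₀ Φ Ψ)
    (hn : n = m + ∑ k, colDegree (outputMatrix Φ (Ψ x₀)) k) : StaticFeedbackLinearizableAt F x₀ := by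
  obtain ⟨f, hf, hΦf⟩ := ht.exists_outputChart
  exact ht.staticFeedbackLinearizableAt_of_outputChart h hn hf hΦf

end Linearization

/-! ### Bases made of chains of a linear map. -/

section Chains

open Module

variable {K E : Type*} [Field K] [AddCommGroup E] [Module K E] [FiniteDimensional K E]

/-- Chains `c, a c, …, a^σ c` forming a basis of `V`, all of whose elements but the last ones lie in
a subspace `W` with `a W ⊆ V` that contains no nontrivial `a`-invariant subspace. -/
theorem exists_chains (a : E →ₗ[K] E) (V W : Submodule K E) (hWV : W ≤ V) (haW : W.map a ≤ V)
    (hW : ∀ c, (∀ j : ℕ, (a ^ j) c ∈ W) → c = 0) :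
    ∃ (ι : Type) (_ : Fintype ι) (σ : ι → ℕ) (c : ι → E),
      (∀ i, ∀ j < σ i, (a ^ j) (c i) ∈ W) ∧ (∀ i, ∀ j ≤ σ i, (a ^ j) (c i) ∈ V) ∧
      V ≤ Submodule.span K (Set.range fun p : (Σ i, Fin (σ i + 1)) => (a ^ (p.2 : ℕ)) (c p.1)) ∧
      (∀ r : ι → K, ∑ i, r i • (a ^ σ i) (c i) ∈ W → r = 0) ∧
      ∑ i, (σ i + 1) = finrank K V ∧ Fintype.card ι + finrank K W = finrank K V := by
  induction hd : finrank K V using Nat.strong_induction_on generalizing V W with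
  | _ d ih =>
  -- If $V=W$, then $V$ is invariant under $a$ and contained in $W$, hence zero: there are no
  -- chains.
  by_cases hVW : V ≤ W
  · have hV : V = ⊥ := by
      rw [eq_bot_iff]
      intro c hc
      refine hW c fun j => ?_
      induction j with
      | zero => exact hVW hc
      | succ j hj =>
        rw [pow_succ', Module.End.mul_apply]
        exact hVW (haW (Submodule.mem_map_of_mem hj))
    have hW0 : W = ⊥ := by rw [eq_bot_iff, ← hV]; exact hWV
    subst hV hW0
    rw [finrank_bot] at hd
    refine ⟨Empty, inferInstance, Empty.elim, Empty.elim, fun i => i.elim, fun i => i.elim, bot_le,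
      fun r _ => funext fun i => i.elim, ?_, ?_⟩ <;> simp [← hd]
  · have hlt : finrank K W < d := hd ▸ Submodule.finrank_lt_finrank_of_lt (lt_of_le_not_ge hWV hVW)
    -- Induction passes to the smaller pair $W\supseteq W\cap a^{-1}W$. Its chains are each
    -- lengthened by one application of $a$; their new last elements $t_i$ are independent modulo
    -- $W$ because the old ones are independent modulo $a^{-1}W\cap W$.
    obtain ⟨ι, _, σ, c, h1, h2, h3, h4, h5, h6⟩ := ih _ hlt W (W ⊓ W.comap a) inf_le_left
      (Submodule.map_le_iff_le_comap.mpr inf_le_right) (fun c hc => hW c fun j => (hc j).1) rfl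
    let t : ι → E := fun i => (a ^ (σ i + 1)) (c i)
    have ht : ∀ i, t i = a ((a ^ σ i) (c i)) := fun i => by
      simp only [t]; rw [pow_succ', Module.End.mul_apply]
    have htV : ∀ i, t i ∈ V := fun i => ht i ▸ haW (Submodule.mem_map_of_mem (h2 i _ le_rfl))
    have htW : ∀ r : ι → K, ∑ i, r i • t i ∈ W → r = 0 := by
      intro r hr
      refine h4 r ⟨Submodule.sum_mem _ fun i _ => W.smul_mem _ (h2 i _ le_rfl), ?_⟩
      rw [SetLike.mem_coe, Submodule.mem_comap, map_sum]
      simpa only [map_smul, ← ht] using hr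
    have hti : LinearIndependent K t := by
      rw [Fintype.linearIndependent_iff]
      intro r hr
      exact congrFun (htW r (hr ▸ W.zero_mem))
    set T := Submodule.span K (Set.range t) with hT
    have hTW : T ⊓ W = ⊥ := by
      rw [eq_bot_iff]
      rintro x ⟨hx1, hx2⟩
      obtain ⟨r, rfl⟩ := (Submodule.mem_span_range_iff_exists_fun K).mp hx1
      rw [htW r hx2]
      simp
    have hTWV : T ⊔ W ≤ V := sup_le (Submodule.span_le.mpr (Set.range_subset_iff.mpr htV)) hWV
    -- What $T\oplus W$ misses in $V$ is filled by new chains with a single element, a basis of a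
    -- complement.
    obtain ⟨C', hC'⟩ := exists_isCompl (T ⊔ W)
    set C := C' ⊓ V with hC
    have hCs : T ⊔ W ⊔ C = V := by
      rw [hC, ← sup_inf_assoc_of_le C' hTWV, hC'.sup_eq_top, top_inf_eq]
    have hCi : (T ⊔ W) ⊓ C = ⊥ := by
      rw [hC, ← inf_assoc, hC'.inf_eq_bot, bot_inf_eq]
    have d1 : finrank K V = finrank K (T ⊔ W : Submodule K E) + finrank K C := by
      have := Submodule.finrank_sup_add_finrank_inf_eq (T ⊔ W) C
      rw [hCs, hCi, finrank_bot, add_zero] at this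
      exact this
    have d2 : finrank K (T ⊔ W : Submodule K E) = Fintype.card ι + finrank K W := by
      have := Submodule.finrank_sup_add_finrank_inf_eq T W
      rw [hTW, finrank_bot, add_zero, hT, finrank_span_eq_card hti] at this
      exact this
    let b := Module.finBasis K C
    refine ⟨ι ⊕ Fin (finrank K C), inferInstance, Sum.elim (fun i => σ i + 1) fun _ => 0,
      Sum.elim c fun l => (b l : E), ?_, ?_, ?_, ?_, ?_, ?_⟩
    · rintro (i | l) j hj
      · exact h2 i j (Nat.lt_succ_iff.mp hj)
      · exact absurd hj (Nat.not_lt_zero _)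
    · rintro (i | l) j hj
      · rcases Nat.lt_or_eq_of_le hj with hj | rfl
        · exact hWV (h2 i j (Nat.lt_succ_iff.mp hj))
        · exact htV i
      · obtain rfl : j = 0 := Nat.le_zero.mp hj
        exact (b l).2.2
    · rw [← hCs]
      refine sup_le (sup_le ?_ ?_) ?_
      · rw [hT, Submodule.span_le]
        rintro _ ⟨i, rfl⟩
        exact Submodule.subset_span ⟨⟨Sum.inl i, ⟨σ i + 1, Nat.lt_succ_self _⟩⟩, rfl⟩
      · refine h3.trans (Submodule.span_mono ?_)
        rintro _ ⟨p, rfl⟩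
        exact ⟨⟨Sum.inl p.1, ⟨p.2, p.2.2.trans (Nat.lt_succ_self _)⟩⟩, rfl⟩
      · intro x hx
        have h7 : C.subtype (∑ l, b.repr ⟨x, hx⟩ l • b l) = x := congrArg C.subtype (b.sum_repr _)
        rw [map_sum] at h7
        rw [← h7]
        exact Submodule.sum_mem _ fun l _ => Submodule.smul_mem _ _
          (Submodule.subset_span ⟨⟨Sum.inr l, 0⟩, rfl⟩)
    · intro r hr
      rw [Fintype.sum_sum_type] at hr
      change ∑ i, r (Sum.inl i) • t i + ∑ l, r (Sum.inr l) • (b l : E) ∈ W at hr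
      have hsT : ∑ i, r (Sum.inl i) • t i ∈ T :=
        Submodule.sum_mem _ fun i _ => T.smul_mem _ (Submodule.subset_span ⟨i, rfl⟩)
      have hsb : ((∑ l, r (Sum.inr l) • b l : C) : E) = ∑ l, r (Sum.inr l) • (b l : E) := by simp
      have h7 : ((∑ l, r (Sum.inr l) • b l : C) : E) ∈ (T ⊔ W) ⊓ C := by
        refine ⟨?_, (∑ l, r (Sum.inr l) • b l : C).2⟩
        have := Submodule.sub_mem _ (Submodule.mem_sup_right (S := T) hr)
          (Submodule.mem_sup_left (T := W) hsT)
        rwa [add_sub_cancel_left, ← hsb] at this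
      rw [hCi, Submodule.mem_bot] at h7
      have h8 : ∀ l, r (Sum.inr l) = 0 :=
        Fintype.linearIndependent_iff.mp b.linearIndependent _ (Subtype.ext h7)
      rw [← hsb, h7, add_zero] at hr
      have h9 := htW (fun i => r (Sum.inl i)) hr
      funext i
      rcases i with i | l
      · exact congrFun h9 i
      · exact h8 l
    · rw [Fintype.sum_sum_type]
      simp only [Sum.elim_inl, Sum.elim_inr, Finset.sum_add_distrib, Finset.sum_const,
        Finset.card_univ, Fintype.card_fin, smul_eq_mul] at h5 ⊢
      omega
    · rw [Fintype.card_sum, Fintype.card_fin]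
      omega

end Chains

/-! ### Controllability and Brunovsky's canonical form. -/

section Controllable

variable {n m : ℕ} {A : Matrix (Fin n) (Fin n) ℝ} {B : Matrix (Fin n) (Fin m) ℝ}

/-- The dual form of controllability: the rows of $(B,AB,\dots,A^{n-1}B)$ are independent. It says
that the annihilator of $\operatorname{im}B$ contains no nontrivial subspace invariant under $A$
acting on row vectors. -/
theorem IsControllablePair.eq_zero (h : IsControllablePair A B) {c : Fin n → ℝ}
    (hc : ∀ j : ℕ, Matrix.vecMul (Matrix.vecMul c (A ^ j)) B = 0) : c = 0 := by
  set M := Matrix.of fun (i : Fin n) (q : Fin n × Fin m) => (A ^ (q.1 : ℕ) * B) i q.2 with hM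
  have h1 : LinearIndependent ℝ M.row := by
    rw [linearIndependent_iff_card_eq_finrank_span, Fintype.card_fin]
    exact h.symm.trans (Matrix.rank_eq_finrank_span_row M)
  have h2 : Matrix.vecMul c M = 0 := by
    funext q
    have := congrFun (hc q.1) q.2
    rw [Matrix.vecMul_vecMul] at this
    exact this
  exact (Matrix.vecMul_injective_iff.mpr h1) (h2.trans (Matrix.zero_vecMul M).symm)

/-- Brunovsky's canonical form. -/
theorem IsControllablePair.exists_brunovsky (h : IsControllablePair A B)
    (hB : Function.Injective B.mulVec) :
    ∃ (σ : Fin m → ℕ) (T : (Fin n → ℝ) ≃ₗ[ℝ] ((Σ k : Fin m, Fin (σ k + 1)) → ℝ))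
      (L : ((Σ k : Fin m, Fin (σ k + 1)) → ℝ) →ₗ[ℝ] (Fin m → ℝ)) (D : (Fin m → ℝ) ≃ₗ[ℝ] (Fin m → ℝ)),
      ∑ k, (σ k + 1) = n ∧
      ∀ z v, T (A.mulVec z + B.mulVec v) = brunovskyA σ (T z) + brunovskyB σ (L (T z) + D v) := by
  let a := Matrix.vecMulLinear A
  have ha : ∀ (j : ℕ) c, (a ^ j) c = Matrix.vecMul c (A ^ j) := by
    intro j c
    induction j with
    | zero => simp
    | succ j ih => rw [pow_succ', Module.End.mul_apply, ih, pow_succ, ← Matrix.vecMul_vecMul]; rfl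
  -- Chains of covectors under $c\mapsto cA$, with $W=\{c: cB=0\}$. In the coordinates $cA^jz$ each
  -- one is the derivative of its predecessor, and the input enters only through the last one. There
  -- are $m$ chains because $B$ is injective.
  obtain ⟨ι, _, σ', c', h1, -, h3, -, h5, h6⟩ := exists_chains a ⊤ (LinearMap.ker (Matrix.vecMulLinear B))
    le_top le_top (fun c hc => h.eq_zero fun j => by
      rw [← ha]; exact hc j)
  rw [finrank_top, Module.finrank_fin_fun] at h5 h6
  have hcard : Fintype.card ι = m := by
    have hr : Module.finrank ℝ (LinearMap.range (Matrix.vecMulLinear B)) = m := by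
      rw [← Matrix.mulVecLin_transpose]
      change B.transpose.rank = m
      rw [Matrix.rank_transpose, Matrix.rank, LinearMap.finrank_range_of_inj (f := B.mulVecLin) hB, Module.finrank_fin_fun]
    have := LinearMap.finrank_range_add_finrank_ker (Matrix.vecMulLinear B)
    rw [Module.finrank_fin_fun, hr] at this
    omega
  let e : Fin m ≃ ι := (Fintype.equivFinOfCardEq hcard).symm
  let σ : Fin m → ℕ := fun k => σ' (e k)
  let c : Fin m → Fin n → ℝ := fun k => c' (e k)
  have hσ : ∑ k, (σ k + 1) = n := (Equiv.sum_comp e fun i => σ' i + 1).trans h5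
  let T₀ : (Fin n → ℝ) →ₗ[ℝ] ((Σ k : Fin m, Fin (σ k + 1)) → ℝ) :=
    LinearMap.pi fun p => dotProductBilin ℝ ℝ ((a ^ (p.2 : ℕ)) (c p.1))
  have hT₀ : ∀ z p, T₀ z p = dotProduct ((a ^ (p.2 : ℕ)) (c p.1)) z := fun z p => rfl
  have hinj : Function.Injective T₀ := by
    rw [injective_iff_map_eq_zero]
    intro z hz
    have h7 : ∀ w ∈ Submodule.span ℝ
        (Set.range fun p : (Σ i, Fin (σ' i + 1)) => (a ^ (p.2 : ℕ)) (c' p.1)), dotProduct w z = 0 := by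
      intro w hw
      induction hw using Submodule.span_induction with
      | mem w hw =>
        obtain ⟨⟨i, j⟩, rfl⟩ := hw
        obtain ⟨k, rfl⟩ := e.surjective i
        exact congrFun hz ⟨k, j⟩
      | zero => exact zero_dotProduct z
      | add w w' _ _ hw hw' => rw [add_dotProduct, hw, hw', add_zero]
      | smul r w _ hw => rw [smul_dotProduct, hw, smul_zero]
    exact dotProduct_self_eq_zero.mp (h7 z (h3 Submodule.mem_top))
  have hfr : Module.finrank ℝ (Fin n → ℝ) = Module.finrank ℝ ((Σ k : Fin m, Fin (σ k + 1)) → ℝ) := by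
    rw [Module.finrank_fin_fun, Module.finrank_fintype_fun_eq_card, Fintype.card_sigma]
    simpa using hσ.symm
  let T := LinearEquiv.ofBijective T₀
    ⟨hinj, (LinearMap.injective_iff_surjective_of_finrank_eq_finrank hfr).mp hinj⟩
  let last : ((Σ k : Fin m, Fin (σ k + 1)) → ℝ) →ₗ[ℝ] (Fin m → ℝ) :=
    LinearMap.pi fun k => LinearMap.proj ⟨k, ⟨σ k, Nat.lt_succ_self _⟩⟩
  have hTB : ∀ v, T (B.mulVec v) = brunovskyB σ (last (T (B.mulVec v))) := by
    intro v
    funext p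
    obtain ⟨k, ⟨j, hj⟩⟩ := p
    by_cases hjσ : j = σ k
    · subst hjσ
      simp only [brunovskyB, LinearMap.coe_mk, AddHom.coe_mk, if_true]
      rfl
    · simp only [brunovskyB, LinearMap.coe_mk, AddHom.coe_mk, if_neg hjσ]
      change dotProduct ((a ^ j) (c k)) (B.mulVec v) = 0
      rw [Matrix.dotProduct_mulVec]
      have := h1 (e k) j (lt_of_le_of_ne (Nat.lt_succ_iff.mp hj) hjσ)
      rw [LinearMap.mem_ker] at this
      change Matrix.vecMul ((a ^ j) (c k)) B = 0 at this
      rw [this, zero_dotProduct]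
  have hTA : ∀ z, T (A.mulVec z) = brunovskyA σ (T z) + brunovskyB σ (last (T (A.mulVec z))) := by
    intro z
    funext p
    obtain ⟨k, ⟨j, hj⟩⟩ := p
    by_cases hjσ : j = σ k
    · subst hjσ
      simp only [brunovskyA, brunovskyB, LinearMap.coe_mk, AddHom.coe_mk, if_true, Pi.add_apply,
        lt_irrefl, dite_false, zero_add]
      rfl
    · have hj' : j + 1 < σ k + 1 := by omega
      rw [Pi.add_apply]
      simp only [brunovskyA, brunovskyB, LinearMap.coe_mk, AddHom.coe_mk, if_neg hjσ, dif_pos hj',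
        add_zero]
      change dotProduct ((a ^ j) (c k)) (A.mulVec z) = dotProduct ((a ^ (j + 1)) (c k)) z
      rw [Matrix.dotProduct_mulVec, pow_succ', Module.End.mul_apply]
      rfl
  let D₀ : (Fin m → ℝ) →ₗ[ℝ] (Fin m → ℝ) := last.comp (T.toLinearMap.comp B.mulVecLin)
  -- $B$ acts only through the ends of the chains, so the new input matrix inherits the injectivity
  -- of $B$.
  have hD₀ : Function.Injective D₀ := by
    rw [injective_iff_map_eq_zero]
    intro v hv
    refine hB ?_
    rw [Matrix.mulVec_zero]
    refine T.injective ?_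
    rw [hTB, map_zero]
    change brunovskyB σ (D₀ v) = 0
    rw [hv, map_zero]
  refine ⟨σ, T, last.comp (T.toLinearMap.comp (A.mulVecLin.comp T.symm.toLinearMap)),
    LinearEquiv.ofInjectiveEndo D₀ hD₀, hσ, fun z v => ?_⟩
  rw [map_add, hTA, hTB, map_add (brunovskyB σ), add_assoc]
  congr 2
  simp

end Controllable

/-! ### Brunovsky coordinates for a static feedback linearizable system. -/

section BrunovskyChart

variable {n m : ℕ} {F : (Fin n → ℝ) × (Fin n → ℝ) → Fin (n - m) → ℝ} {x₀ : Jet n}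

/-- The last coordinates of the chains. -/
def brunovskyLast (σ : Fin m → ℕ) : ((Σ k : Fin m, Fin (σ k + 1)) → ℝ) →L[ℝ] (Fin m → ℝ) :=
  ContinuousLinearMap.pi fun k => ContinuousLinearMap.proj ⟨k, ⟨σ k, Nat.lt_succ_self _⟩⟩

/-- The vector field of the Brunovsky form. -/
def brunovskyField (σ : Fin m → ℕ) :
    ((Σ k : Fin m, Fin (σ k + 1)) → ℝ) × (Fin m → ℝ) →L[ℝ] ((Σ k : Fin m, Fin (σ k + 1)) → ℝ) :=
  (LinearMap.toContinuousLinearMap (brunovskyA σ)).comp (ContinuousLinearMap.fst ℝ _ _) +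
    (LinearMap.toContinuousLinearMap (brunovskyB σ)).comp (ContinuousLinearMap.snd ℝ _ _)

theorem brunovskyField_apply (σ : Fin m → ℕ) (w ν) :
    brunovskyField σ (w, ν) = brunovskyA σ w + brunovskyB σ ν := rfl

theorem brunovskyLast_field (σ : Fin m → ℕ) (w ν) :
    brunovskyLast σ (brunovskyField σ (w, ν)) = ν := by
  funext k
  change brunovskyA σ w ⟨k, ⟨σ k, _⟩⟩ + brunovskyB σ ν ⟨k, ⟨σ k, _⟩⟩ = ν k
  simp [brunovskyA, brunovskyB]

theorem brunovskyField_succ (σ : Fin m → ℕ) (w ν) (k : Fin m) (j : ℕ) (hj : j < σ k) :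
    brunovskyField σ (w, ν) ⟨k, ⟨j, hj.trans (Nat.lt_succ_self _)⟩⟩ =
      w ⟨k, ⟨j + 1, Nat.succ_lt_succ hj⟩⟩ := by
  change brunovskyA σ w ⟨k, ⟨j, _⟩⟩ + brunovskyB σ ν ⟨k, ⟨j, _⟩⟩ = _
  simp [brunovskyA, brunovskyB, hj, hj.ne]

/-- Coordinates `w = Y(x)` in which the solutions of the implicit system are the trajectories of
the Brunovsky form. -/
structure BrunovskyChart (F : (Fin n → ℝ) × (Fin n → ℝ) → Fin (n - m) → ℝ) (x₀ : Jet n)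
    (σ : Fin m → ℕ) where
  X : ((Σ k : Fin m, Fin (σ k + 1)) → ℝ) → Fin n → ℝ
  Y : (Fin n → ℝ) → (Σ k : Fin m, Fin (σ k + 1)) → ℝ
  ν₀ : Fin m → ℝ
  X_analytic : AnalyticAt ℝ X (Y (x₀ 0))
  Y_analytic : AnalyticAt ℝ Y (x₀ 0)
  left : ∀ᶠ x in 𝓝 (x₀ 0), X (Y x) = x
  right : ∀ᶠ w in 𝓝 (Y (x₀ 0)), Y (X w) = w
  base : fderiv ℝ X (Y (x₀ 0)) (brunovskyField σ (Y (x₀ 0), ν₀)) = x₀ 1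
  sol : ∀ᶠ p in 𝓝 (Y (x₀ 0), ν₀), F (X p.1, fderiv ℝ X p.1 (brunovskyField σ p)) = 0

theorem eventually_fderiv_comp_eq {E E' : Type*} [NormedAddCommGroup E] [NormedSpace ℝ E]
    [CompleteSpace E] [NormedAddCommGroup E'] [NormedSpace ℝ E'] [CompleteSpace E'] {f : E → E'}
    {g : E' → E} {a : E}
    (hf : AnalyticAt ℝ f a) (hg : AnalyticAt ℝ g (f a)) (h : ∀ᶠ x in 𝓝 a, g (f x) = x) :
    ∀ᶠ x in 𝓝 a, ∀ v, fderiv ℝ g (f x) (fderiv ℝ f x v) = v := by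
  filter_upwards [hf.eventually_analyticAt,
    hf.continuousAt.tendsto.eventually hg.eventually_analyticAt, eventually_eventually_nhds.mpr h]
    with x h1 h2 h3 v
  have h4 := HasFDerivAt.comp x h2.differentiableAt.hasFDerivAt h1.differentiableAt.hasFDerivAt
  have h5 := (h4.congr_of_eventuallyEq (f₁ := id) (h3.mono fun z hz => hz.symm)).unique
    (hasFDerivAt_id x)
  exact DFunLike.congr_fun h5 v

/-- The linearizing diffeomorphism is followed by Brunovsky's linear change of state $T$, and the
input becomes $\nu=Lw+Dv$. Only the diffeomorphism, its inverse and the solutions of $F=0$ are kept;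
the feedback disappears from the description. -/
theorem StaticFeedbackLinearizableAt.exists_brunovskyChart (hs : StaticFeedbackLinearizableAt F x₀) :
    ∃ σ : Fin m → ℕ, ∑ k, (σ k + 1) = n ∧ Nonempty (BrunovskyChart F x₀ σ) := by
  obtain ⟨f, u₀, hf, hf0, hfu, hfF, χ, v₀, α, A, B, hχ, hχ', hα, hα0, hαv, hAB, heq⟩ := hs
  have hfα : AnalyticAt ℝ (fun p : (Fin n → ℝ) × (Fin m → ℝ) => f (p.1, α p)) (x₀ 0, v₀) := by
    refine AnalyticAt.fun_comp (g := f) (f := fun p : (Fin n → ℝ) × (Fin m → ℝ) => (p.1, α p)) ?_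
      (analyticAt_fst.prod hα)
    simp only [hα0]
    exact hf
  -- Differentiating the linearization identity in $v$ gives $B=\chi'\circ\frac{\partial f}{\partial
  -- u}\circ\frac{\partial\alpha}{\partial v}$, a product of injective maps.
  have hB : Function.Injective B.mulVec := by
    have h1 : HasFDerivAt (fun v => α (x₀ 0, v)) (fderiv ℝ (fun v => α (x₀ 0, v)) v₀) v₀ := by
      have : AnalyticAt ℝ (fun v => α (x₀ 0, v)) v₀ :=
        AnalyticAt.fun_comp (g := α) (f := fun v => (x₀ 0, v)) hα (analyticAt_const.prod analyticAt_id)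
      exact this.differentiableAt.hasFDerivAt
    have h2 : HasFDerivAt (fun u => f (x₀ 0, u)) (fderiv ℝ (fun u => f (x₀ 0, u)) u₀) u₀ := by
      have : AnalyticAt ℝ (fun u => f (x₀ 0, u)) u₀ :=
        AnalyticAt.fun_comp (g := f) (f := fun u => (x₀ 0, u)) hf (analyticAt_const.prod analyticAt_id)
      exact this.differentiableAt.hasFDerivAt
    have h3 := (fderiv ℝ χ (x₀ 0)).hasFDerivAt.comp v₀
      (HasFDerivAt.comp (g := fun u => f (x₀ 0, u)) v₀ (hα0.symm ▸ h2) h1)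
    have h4 : HasFDerivAt (fun v => A.mulVec (χ (x₀ 0)) + B.mulVec v)
        (LinearMap.toContinuousLinearMap B.mulVecLin) v₀ :=
      (LinearMap.toContinuousLinearMap B.mulVecLin).hasFDerivAt.const_add _
    have h5 : Tendsto (fun v : Fin m → ℝ => (x₀ 0, v)) (𝓝 v₀) (𝓝 (x₀ 0, v₀)) :=
      (Continuous.prodMk_right (x₀ 0)).tendsto v₀
    have h6 := (h3.congr_of_eventuallyEq (f₁ := fun v => A.mulVec (χ (x₀ 0)) + B.mulVec v)
      ((h5.eventually heq).mono fun v hv => hv.symm)).unique h4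
    have h7 : B.mulVec = fun v => fderiv ℝ χ (x₀ 0) (fderiv ℝ (fun u => f (x₀ 0, u)) u₀
        (fderiv ℝ (fun v => α (x₀ 0, v)) v₀ v)) := by
      funext v
      rw [hα0] at h6
      exact (DFunLike.congr_fun h6 v).symm
    rw [h7]
    exact hχ'.1.comp (hfu.comp hαv.1)
  obtain ⟨σ, T, L, D, hσ, hT⟩ := hAB.exists_brunovsky hB
  let Tc := T.toContinuousLinearEquiv
  let Lc := LinearMap.toContinuousLinearMap L
  let Dc := D.toContinuousLinearEquiv
  let Y : (Fin n → ℝ) → (Σ k : Fin m, Fin (σ k + 1)) → ℝ := fun x => Tc (χ x)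
  have hY : AnalyticAt ℝ Y (x₀ 0) := (Tc.toContinuousLinearMap.analyticAt _).comp hχ
  have hYd : ∀ x, AnalyticAt ℝ χ x → HasFDerivAt Y ((Tc : _ →L[ℝ] _).comp (fderiv ℝ χ x)) x :=
    fun x hx => Tc.toContinuousLinearMap.hasFDerivAt.comp x hx.differentiableAt.hasFDerivAt
  let χ' := (LinearEquiv.ofBijective (fderiv ℝ χ (x₀ 0)).toLinearMap hχ').toContinuousLinearEquiv
  obtain ⟨X, hX, -, hXY, hYX⟩ := hY.exists_localInverse (χ'.trans Tc) (hYd _ hχ)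
  have hXY0 : X (Y (x₀ 0)) = x₀ 0 := hXY.self_of_nhds
  have hfield : ∀ᶠ p in 𝓝 (x₀ 0, v₀), fderiv ℝ Y p.1 (f (p.1, α p)) =
      brunovskyField σ (Y p.1, Lc (Y p.1) + Dc p.2) := by
    filter_upwards [heq, continuous_fst.continuousAt.eventually hχ.eventually_analyticAt]
      with p h1 h2
    rw [(hYd _ h2).fderiv]
    change T (fderiv ℝ χ p.1 (f (p.1, α p))) = _
    rw [h1, hT]
    rfl
  have hDXY : ∀ᶠ x in 𝓝 (x₀ 0), ∀ v, fderiv ℝ X (Y x) (fderiv ℝ Y x v) = v :=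
    eventually_fderiv_comp_eq hY hX hXY
  refine ⟨σ, hσ, ⟨⟨X, Y, Lc (Y (x₀ 0)) + Dc v₀, hX, hY, hXY, hYX, ?_, ?_⟩⟩⟩
  · rw [← hfield.self_of_nhds, hDXY.self_of_nhds]
    change f (x₀ 0, α (x₀ 0, v₀)) = _
    rw [hα0, hf0]
  -- The passage back from Brunovsky state and input to $(x,v)$, with $v=D^{-1}(\nu-Lw)$.
  · let κ : ((Σ k : Fin m, Fin (σ k + 1)) → ℝ) × (Fin m → ℝ) → (Fin n → ℝ) × (Fin m → ℝ) :=
      fun p => (X p.1, Dc.symm (p.2 - Lc p.1))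
    have hκ : Tendsto κ (𝓝 (Y (x₀ 0), Lc (Y (x₀ 0)) + Dc v₀)) (𝓝 (x₀ 0, v₀)) := by
      have h1 : ContinuousAt κ (Y (x₀ 0), Lc (Y (x₀ 0)) + Dc v₀) := by
        refine ContinuousAt.prodMk ?_ ?_
        · exact ContinuousAt.comp (f := Prod.fst) hX.continuousAt continuous_fst.continuousAt
        · exact (Dc.symm.continuous.comp (continuous_snd.sub (Lc.continuous.comp
            continuous_fst))).continuousAt
      have h2 := h1.tendsto
      simp only [κ, hXY0, add_sub_cancel_left, Dc.symm_apply_apply] at h2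
      exact h2
    have hα' : Tendsto (fun p : (Fin n → ℝ) × (Fin m → ℝ) => (p.1, α p)) (𝓝 (x₀ 0, v₀))
        (𝓝 (x₀ 0, u₀)) := by
      have := (continuousAt_fst.prodMk hα.continuousAt).tendsto
      simpa only [hα0] using this
    have hfst : Tendsto (fun p : ((Σ k : Fin m, Fin (σ k + 1)) → ℝ) × (Fin m → ℝ) => p.1)
        (𝓝 (Y (x₀ 0), Lc (Y (x₀ 0)) + Dc v₀)) (𝓝 (Y (x₀ 0))) := continuousAt_fst
    filter_upwards [hκ.eventually hfield, hκ.eventually (hα'.eventually hfF),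
      hκ.eventually (continuousAt_fst.eventually hDXY), hfst.eventually hYX] with p h1 h2 h3 h4
    have h5 : (Y (κ p).1, Lc (Y (κ p).1) + Dc (κ p).2) = p := by
      refine Prod.ext h4 ?_
      change Lc (Y (X p.1)) + Dc (Dc.symm (p.2 - Lc p.1)) = p.2
      rw [h4, Dc.apply_symm_apply]
      abel
    rw [h5] at h1
    have h6 := h3 (f ((κ p).1, α (κ p)))
    rw [h1] at h6
    change fderiv ℝ X (Y (X p.1)) _ = _ at h6
    rw [h4] at h6
    rw [h6]
    exact h2

end BrunovskyChart

/-! ### From Brunovsky coordinates to a trivialization of small order. -/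

section FlatOutput

variable {n m : ℕ} {F : (Fin n → ℝ) × (Fin n → ℝ) → Fin (n - m) → ℝ} {x₀ : Jet n} {σ : Fin m → ℕ}

namespace BrunovskyChart

theorem XY_base (b : BrunovskyChart F x₀ σ) : b.X (b.Y (x₀ 0)) = x₀ 0 := b.left.self_of_nhds

theorem velocity_base (b : BrunovskyChart F x₀ σ) :
    fderiv ℝ b.Y (x₀ 0) (x₀ 1) = brunovskyField σ (b.Y (x₀ 0), b.ν₀) := by
  have h := eventually_fderiv_comp_eq b.X_analytic (by rw [b.XY_base]; exact b.Y_analytic) b.right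
  rw [← h.self_of_nhds (brunovskyField σ (b.Y (x₀ 0), b.ν₀)), b.base, b.XY_base]

/-- Near the base point, all solutions of `F(x, ẋ) = 0` are velocities of the Brunovsky form. -/
theorem velocity_eq (b : BrunovskyChart F x₀ σ) (h : RegularSystemAt F x₀) (hm : m ≤ n)
    (hσ : ∑ k, (σ k + 1) = n) : ∀ᶠ p in 𝓝 (x₀ 0, x₀ 1), F p = 0 →
      ∃ ν, fderiv ℝ b.Y p.1 p.2 = brunovskyField σ (b.Y p.1, ν) := by
  set w₀ := b.Y (x₀ 0) with hw₀
  set η₀ := brunovskyField σ (w₀, b.ν₀) with hη₀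
  let W := (Σ k : Fin m, Fin (σ k + 1)) → ℝ
  let S : W × W → (Fin n → ℝ) × (Fin n → ℝ) := fun q => (b.X q.1, fderiv ℝ b.X q.1 q.2)
  have hS0 : S (w₀, η₀) = (x₀ 0, x₀ 1) := Prod.ext b.XY_base b.base
  have hX1 : AnalyticAt ℝ (fun q : W × W => b.X q.1) (w₀, η₀) :=
    AnalyticAt.fun_comp (g := b.X) b.X_analytic analyticAt_fst
  have hS : AnalyticAt ℝ S (w₀, η₀) := by
    refine hX1.prod ?_
    have h1 : AnalyticAt ℝ (fun q : W × W => fderiv ℝ b.X q.1) (w₀, η₀) :=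
      AnalyticAt.fun_comp (g := fderiv ℝ b.X) b.X_analytic.fderiv analyticAt_fst
    exact ((ContinuousLinearMap.id ℝ _).analyticAt_bilinear _).comp (h1.prod analyticAt_snd)
  have hFS : AnalyticAt ℝ (fun q => F (S q)) (w₀, η₀) :=
    AnalyticAt.fun_comp (g := F) (hS0.symm ▸ h.analytic) hS
  -- This map is a local diffeomorphism: the velocity derivative of $F$ is onto and kills the input
  -- directions, on which the last coordinates are onto, and the dimensions match since $n=(n-m)+m$.
  -- So a velocity solving $F=0$ is determined by its last coordinates.
  let N : W × W → W × (Fin (n - m) → ℝ) × (Fin m → ℝ) :=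
    fun q => (q.1, F (S q), brunovskyLast σ q.2)
  have hN : AnalyticAt ℝ N (w₀, η₀) :=
    analyticAt_fst.prod (hFS.prod (((brunovskyLast σ).analyticAt _).comp analyticAt_snd))
  have hDX : Function.Surjective (fderiv ℝ b.X w₀) := by
    intro v
    have := (eventually_fderiv_comp_eq b.Y_analytic b.X_analytic b.left).self_of_nhds v
    exact ⟨_, this⟩
  let DH : W × W →L[ℝ] (Fin (n - m) → ℝ) := fderiv ℝ (fun q => F (S q)) (w₀, η₀)
  have hDHη : ∀ δ, DH (0, δ) = velDeriv F (x₀ 0, x₀ 1) (fderiv ℝ b.X w₀ δ) := by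
    intro δ
    have h1 : HasFDerivAt (fun η : W => S (w₀, η))
        ((ContinuousLinearMap.inr ℝ _ _).comp (fderiv ℝ b.X w₀)) η₀ :=
      HasFDerivAt.congr_fderiv ((hasFDerivAt_const (b.X w₀) η₀).prodMk
        (fderiv ℝ b.X w₀).hasFDerivAt) rfl
    have h2 : HasFDerivAt F (fderiv ℝ F (x₀ 0, x₀ 1)) (S (w₀, η₀)) :=
      hS0.symm ▸ h.analytic.differentiableAt.hasFDerivAt
    have h3 := HasFDerivAt.comp (g := F) η₀ h2 h1
    have h4 := HasFDerivAt.comp (g := fun q => F (S q)) η₀ hFS.differentiableAt.hasFDerivAt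
      ((hasFDerivAt_const w₀ η₀).prodMk (hasFDerivAt_id η₀))
    exact DFunLike.congr_fun (h4.unique h3) δ
  have hDHB : ∀ ν, DH (0, brunovskyB σ ν) = 0 := by
    intro ν
    have h1 : HasFDerivAt (fun μ : Fin m → ℝ => (w₀, brunovskyField σ (w₀, μ)))
        ((ContinuousLinearMap.inr ℝ W W).comp (LinearMap.toContinuousLinearMap (brunovskyB σ)))
        b.ν₀ := by
      have h2 : HasFDerivAt (fun μ : Fin m → ℝ => brunovskyField σ (w₀, μ))
          (LinearMap.toContinuousLinearMap (brunovskyB σ)) b.ν₀ :=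
        (LinearMap.toContinuousLinearMap (brunovskyB σ)).hasFDerivAt.const_add (brunovskyA σ w₀)
      exact HasFDerivAt.congr_fderiv ((hasFDerivAt_const w₀ b.ν₀).prodMk h2) rfl
    have h3 := HasFDerivAt.comp (g := fun q => F (S q)) b.ν₀ hFS.differentiableAt.hasFDerivAt h1
    have h4 : Tendsto (fun μ : Fin m → ℝ => (w₀, μ)) (𝓝 b.ν₀) (𝓝 (w₀, b.ν₀)) :=
      (Continuous.prodMk_right w₀).tendsto _
    have h5 := (h3.congr_of_eventuallyEq (f₁ := fun _ => 0)
      ((h4.eventually b.sol).mono fun μ hμ => hμ.symm)).unique (hasFDerivAt_const _ _)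
    exact DFunLike.congr_fun h5 ν
  have hN' : HasFDerivAt N ((ContinuousLinearMap.fst ℝ W W).prod
      (DH.prod ((brunovskyLast σ).comp (ContinuousLinearMap.snd ℝ W W)))) (w₀, η₀) :=
    hasFDerivAt_fst.prodMk (hFS.differentiableAt.hasFDerivAt.prodMk
      ((brunovskyLast σ).hasFDerivAt.comp _ hasFDerivAt_snd))
  set N' := (ContinuousLinearMap.fst ℝ W W).prod
      (DH.prod ((brunovskyLast σ).comp (ContinuousLinearMap.snd ℝ W W))) with hN'def
  have hsurj : Function.Surjective N' := by
    rintro ⟨a, c, d⟩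
    have hv : Function.Surjective fun δ => DH (0, δ) := by
      intro u
      obtain ⟨R, hR⟩ := h.exists_rightInverse
      obtain ⟨δ, hδ⟩ := hDX (R u)
      exact ⟨δ, by simp only [hDHη, hδ, hR]⟩
    obtain ⟨δ, hδ⟩ := hv (c - DH (a, 0))
    refine ⟨(a, δ + brunovskyB σ (d - brunovskyLast σ δ)), ?_⟩
    refine Prod.ext rfl (Prod.ext ?_ ?_)
    · change DH (a, δ + brunovskyB σ (d - brunovskyLast σ δ)) = c
      have : ((a, δ + brunovskyB σ (d - brunovskyLast σ δ)) : W × W) =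
          (a, 0) + ((0, δ) + (0, brunovskyB σ (d - brunovskyLast σ δ))) := by
        simp
      rw [this, map_add, map_add, hDHB]
      change DH (a, 0) + (DH (0, δ) + 0) = c
      simp only at hδ
      rw [hδ]
      abel
    · change brunovskyLast σ (δ + brunovskyB σ (d - brunovskyLast σ δ)) = d
      have := brunovskyLast_field σ 0 (d - brunovskyLast σ δ)
      rw [brunovskyField_apply, map_zero, zero_add] at this
      rw [map_add, this]
      abel
  have hfr : Module.finrank ℝ (W × W) =
      Module.finrank ℝ (W × (Fin (n - m) → ℝ) × (Fin m → ℝ)) := by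
    have hW : Module.finrank ℝ W = n := by
      rw [Module.finrank_fintype_fun_eq_card, Fintype.card_sigma]
      simpa using hσ
    rw [Module.finrank_prod, Module.finrank_prod, Module.finrank_prod, hW, Module.finrank_fin_fun,
      Module.finrank_fin_fun]
    omega
  let e := (LinearEquiv.ofBijective N'.toLinearMap
    ⟨(LinearMap.injective_iff_surjective_of_finrank_eq_finrank hfr).mpr hsurj,
      hsurj⟩).toContinuousLinearEquiv
  obtain ⟨g, -, -, hg, -⟩ := hN.exists_localInverse e hN'
  let q : (Fin n → ℝ) × (Fin n → ℝ) → W × W := fun p => (b.Y p.1, fderiv ℝ b.Y p.1 p.2)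
  let q' : W × W → W × (Fin m → ℝ) := fun r => (r.1, brunovskyLast σ r.2)
  have hq0 : q (x₀ 0, x₀ 1) = (w₀, η₀) := Prod.ext rfl b.velocity_base
  have hq : Tendsto q (𝓝 (x₀ 0, x₀ 1)) (𝓝 (w₀, η₀)) := by
    have h1 : ContinuousAt q (x₀ 0, x₀ 1) := by
      refine ContinuousAt.prodMk (ContinuousAt.comp (g := b.Y) b.Y_analytic.continuousAt
        continuousAt_fst) ?_
      exact ContinuousAt.clm_apply (ContinuousAt.comp (g := fderiv ℝ b.Y) (f := Prod.fst)
        b.Y_analytic.fderiv.continuousAt continuousAt_fst) continuousAt_snd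
    have h2 := h1.tendsto
    rwa [hq0] at h2
  have hq' : Tendsto q' (𝓝 (w₀, η₀)) (𝓝 (w₀, b.ν₀)) := by
    have h1 : Continuous q' := continuous_fst.prodMk ((brunovskyLast σ).continuous.comp continuous_snd)
    have h2 := h1.tendsto (w₀, η₀)
    have h3 : q' (w₀, η₀) = (w₀, b.ν₀) := Prod.ext rfl (brunovskyLast_field σ w₀ b.ν₀)
    rwa [h3] at h2
  have hq'' : Tendsto (fun r => (r.1, brunovskyField σ r)) (𝓝 (w₀, b.ν₀)) (𝓝 (w₀, η₀)) :=
    (continuous_fst.prodMk (brunovskyField σ).continuous).tendsto _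
  filter_upwards [hq.eventually hg, (hq''.comp (hq'.comp hq)).eventually hg,
    (hq'.comp hq).eventually b.sol, continuousAt_fst.eventually b.left,
    continuousAt_fst.eventually (eventually_fderiv_comp_eq b.Y_analytic b.X_analytic b.left)]
    with p h1 h2 h3 h4 h5 hF
  refine ⟨brunovskyLast σ (fderiv ℝ b.Y p.1 p.2), ?_⟩
  -- The given velocity and the Brunovsky velocity with the same last coordinates both solve $F=0$,
  -- hence have the same image and coincide.
  have h6 : N (q p) = N ((fun r => (r.1, brunovskyField σ r)) (q' (q p))) := by
    refine Prod.ext rfl (Prod.ext ?_ ?_)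
    · change F (b.X (b.Y p.1), fderiv ℝ b.X (b.Y p.1) (fderiv ℝ b.Y p.1 p.2)) = F _
      rw [h4, h5]
      exact hF.trans h3.symm
    · exact (brunovskyLast_field σ _ _).symm
  have h7 := congrArg g h6
  rw [h1] at h7
  exact congrArg Prod.snd (h7.trans h2)

/-- The state as a function of the flat output. -/
def state (b : BrunovskyChart F x₀ σ) : Fin n → Jet m → ℝ := fun i y => b.X (jetSelect σ y) i

/-- The flat output. -/
def output (b : BrunovskyChart F x₀ σ) : Fin m → Jet n → ℝ := fun k x => b.Y (x 0) ⟨k, 0⟩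

theorem coord_analytic (b : BrunovskyChart F x₀ σ) (p) : JetAnalyticAt (fun x => b.Y (x 0) p) x₀ :=
  (JetMapAnalyticAt.apply (JetMapAnalyticAt.comp_analytic b.Y_analytic
    (JetMapAnalyticAt.block 0 x₀)) p)

theorem output_analytic (b : BrunovskyChart F x₀ σ) (k) : JetAnalyticAt (b.output k) x₀ :=
  b.coord_analytic _

theorem lieTau_coord (b : BrunovskyChart F x₀ σ) (p) : ∀ᶠ x : Jet n in 𝓝 x₀,
    lieTau (fun z => b.Y (z 0) p) x = fderiv ℝ b.Y (x 0) (x 1) p := by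
  filter_upwards [(b.coord_analytic p).eventually_at,
    (continuous_apply 0).continuousAt.eventually b.Y_analytic.eventually_analyticAt] with x h1 h2
  have h3 : JetMapAnalyticAt (fun z : Jet n => b.Y (z 0)) x :=
    JetMapAnalyticAt.comp_analytic (h := b.Y) h2 (JetMapAnalyticAt.block 0 x)
  rw [lieTau_eq_lieAlong h1, JetMapAnalyticAt.lineDeriv_apply h3,
    JetMapAnalyticAt.lineDeriv_comp_analytic (h := b.Y) h2.differentiableAt
      (JetMapAnalyticAt.block 0 x), JetMapAnalyticAt.lineDeriv_block]
  rfl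

/-- On $\mathfrak X_0$ all velocities are of Brunovsky form, so each derivative of the head of a
chain moves one place along it. -/
theorem iterate_output (b : BrunovskyChart F x₀ σ) (h : RegularSystemAt F x₀) (hm : m ≤ n)
    (hσ : ∑ k, (σ k + 1) = n) (k : Fin m) (j : ℕ) (hj : j < σ k + 1) :
    lieTau^[j] (b.output k) =ᶠ[𝓝[solSet F] x₀] fun x => b.Y (x 0) ⟨k, ⟨j, hj⟩⟩ := by
  induction j with
  | zero => exact EventuallyEq.rfl
  | succ j ih =>
    have hF : ∀ᶠ x : Jet n in 𝓝[solSet F] x₀, F (x 0, x 1) = 0 :=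
      eventually_mem_nhdsWithin.mono fun x hx => funext fun i => hx 0 i
    rw [Function.iterate_succ_apply']
    refine (h.lieTau_eq ((b.output_analytic k).iterate_lieTau j) (b.coord_analytic _)
      (ih (Nat.lt_of_succ_lt hj))).trans ?_
    filter_upwards [(b.lieTau_coord ⟨k, ⟨j, Nat.lt_of_succ_lt hj⟩⟩).filter_mono nhdsWithin_le_nhds,
      (continuous_jetPair.continuousAt.eventually (b.velocity_eq h hm hσ)).filter_mono
        nhdsWithin_le_nhds, hF] with x h1 h2 h3
    obtain ⟨ν, hν⟩ := h2 h3
    rw [h1]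
    change fderiv ℝ b.Y (jetPair x).1 (jetPair x).2 _ = _
    rw [hν]
    exact brunovskyField_succ σ _ _ k j (Nat.lt_of_succ_lt_succ hj)

theorem select_output (b : BrunovskyChart F x₀ σ) (h : RegularSystemAt F x₀) (hm : m ≤ n)
    (hσ : ∑ k, (σ k + 1) = n) :
    (fun x => jetSelect σ (jetProlong b.output x)) =ᶠ[𝓝[solSet F] x₀] fun x => b.Y (x 0) := by
  have : ∀ᶠ x in 𝓝[solSet F] x₀, ∀ p : Σ k : Fin m, Fin (σ k + 1),
      (lieTau^[(p.2 : ℕ)] (b.output p.1)) x = b.Y (x 0) p :=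
    eventually_all.mpr fun p => b.iterate_output h hm hσ p.1 p.2 p.2.2
  filter_upwards [this] with x hx
  exact funext hx

/-- The top derivatives of the output at the base jet are the base input of the chart, so the
equations of the chart hold at all jets near $y_0$. -/
theorem last_output (b : BrunovskyChart F x₀ σ) (h : RegularSystemAt F x₀) (hm : m ≤ n)
    (hσ : ∑ k, (σ k + 1) = n) : (fun k => jetProlong b.output x₀ (σ k + 1) k) = b.ν₀ := by
  funext k
  change (lieTau^[σ k + 1] (b.output k)) x₀ = _
  rw [Function.iterate_succ_apply',
    (h.lieTau_eq ((b.output_analytic k).iterate_lieTau _) (b.coord_analytic _)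
      (b.iterate_output h hm hσ k (σ k) (Nat.lt_succ_self _))).self_of_nhdsWithin h.mem,
    (b.lieTau_coord _).self_of_nhds, b.velocity_base]
  exact congrFun (brunovskyLast_field σ _ _) k

theorem state_analytic (b : BrunovskyChart F x₀ σ) {y : Jet m}
    (hy : AnalyticAt ℝ b.X (jetSelect σ y)) (i : Fin n) : JetAnalyticAt (b.state i) y :=
  JetMapAnalyticAt.apply (JetMapAnalyticAt.comp_analytic hy (jetSelect_analytic σ y)) i

theorem lineDeriv_state (b : BrunovskyChart F x₀ σ) {y : Jet m}
    (hy : AnalyticAt ℝ b.X (jetSelect σ y)) (i : Fin n) (v : Jet m) :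
    lineDeriv ℝ (b.state i) y v = fderiv ℝ b.X (jetSelect σ y) (jetSelect σ v) i := by
  have h := JetMapAnalyticAt.comp_analytic hy (jetSelect_analytic σ y)
  refine (JetMapAnalyticAt.lineDeriv_apply h i v).trans ?_
  rw [JetMapAnalyticAt.lineDeriv_comp_analytic (h := b.X) hy.differentiableAt
    (jetSelect_analytic σ y), lineDeriv_jetSelect]

theorem isTrivialization (b : BrunovskyChart F x₀ σ) (h : RegularSystemAt F x₀) (hm : m ≤ n)
    (hσ : ∑ k, (σ k + 1) = n) :
    IsTrivialization F x₀ (jetProlong b.output x₀) (jetProlong b.state) (jetProlong b.output) := by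
  have hsel := b.select_output h hm hσ
  have hsel0 : jetSelect σ (jetProlong b.output x₀) = b.Y (x₀ 0) := hsel.self_of_nhdsWithin h.mem
  have hX : AnalyticAt ℝ b.X (jetSelect σ (jetProlong b.output x₀)) := hsel0.symm ▸ b.X_analytic
  have hst : Tendsto (jetSelect σ) (𝓝 (jetProlong b.output x₀)) (𝓝 (b.Y (x₀ 0))) :=
    hsel0 ▸ (jetSelect_analytic σ _).continuousAt
  refine isTrivialization_jetProlong h (b.state_analytic hX) b.output_analytic rfl ?_ ?_ ?_
  · filter_upwards [hsel, (((continuous_apply 0).continuousAt (x := x₀)).eventually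
      b.left).filter_mono nhdsWithin_le_nhds] with x h1 h2 i
    change b.X (jetSelect σ (jetProlong b.output x)) i = _
    rw [h1, h2]
  · have hlast : Tendsto (fun y : Jet m => (jetSelect σ y, fun k => y (σ k + 1) k))
        (𝓝 (jetProlong b.output x₀)) (𝓝 (b.Y (x₀ 0), b.ν₀)) := by
      refine hst.prodMk_nhds ?_
      rw [← b.last_output h hm hσ]
      exact tendsto_pi_nhds.mpr fun k => ((continuous_apply k).comp (continuous_apply _)).tendsto _
    filter_upwards [hlast.eventually b.sol, hst.eventually b.X_analytic.eventually_analyticAt]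
      with y h1 h2 i
    have h3 : jetProlong b.state y 1 =
        fderiv ℝ b.X (jetSelect σ y) (brunovskyField σ (jetSelect σ y, fun k => y (σ k + 1) k)) := by
      funext i
      change lieTau (b.state i) y = _
      rw [lieTau_eq_lieAlong (b.state_analytic h2 i), b.lineDeriv_state h2, jetSelect_jetShift,
        brunovskyField_apply]
    change F (b.X (jetSelect σ y), jetProlong b.state y 1) i = 0
    rw [h3]
    exact congrFun h1 i
  · filter_upwards [hst.eventually b.right] with y h1 k
    change b.Y (b.X (jetSelect σ y)) _ = _
    rw [h1]
    rfl

/-- The state depends on $y_k^{(j)}$ only for $j\le\sigma_k$. An inequality suffices, since the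
reverse bound on the sum holds for every trivialization. -/
theorem colDegree_le (b : BrunovskyChart F x₀ σ) (h : RegularSystemAt F x₀) (hm : m ≤ n)
    (hσ : ∑ k, (σ k + 1) = n) (k : Fin m) :
    colDegree (outputMatrix (jetProlong b.state) (jetProlong b.output x₀)) k ≤ σ k := by
  have hsel0 : jetSelect σ (jetProlong b.output x₀) = b.Y (x₀ 0) :=
    (b.select_output h hm hσ).self_of_nhdsWithin h.mem
  have hX : AnalyticAt ℝ b.X (jetSelect σ (jetProlong b.output x₀)) := hsel0.symm ▸ b.X_analytic
  refine Finset.sup_le fun i _ => ?_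
  refine Polynomial.natDegree_le_iff_coeff_eq_zero.mpr fun j hj => ?_
  change (opRow (jetProlong b.output x₀) (b.state i) k).coeff j = 0
  rw [opRow_coeff (b.state_analytic hX i), ← JetRing.of_zero]
  refine JetRing.of_congr ((b.state_analytic hX i).partialDeriv _) ?_
  filter_upwards [(jetSelect_analytic σ _).continuousAt.eventually hX.eventually_analyticAt] with y hy
  rw [jetPartial, b.lineDeriv_state hy]
  have : jetSelect σ (jetBasis (j, k)) = 0 := by
    funext p
    have hp := p.2.2
    simp only [jetSelect, jetBasis, Pi.single_apply, Pi.zero_apply]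
    by_cases hk : p.1 = k
    · rw [if_neg]
      · rfl
      · rw [← hk] at hj; omega
    · split_ifs <;> simp [hk]
  rw [this, map_zero]
  rfl

end BrunovskyChart

theorem StaticFeedbackLinearizableAt.exists_isTrivialization (h : RegularSystemAt F x₀) (hm : m ≤ n)
    (hs : StaticFeedbackLinearizableAt F x₀) : ∃ Φ Ψ, IsTrivialization F x₀ (Ψ x₀) Φ Ψ ∧
      m + ∑ k, colDegree (outputMatrix Φ (Ψ x₀)) k ≤ n := by
  obtain ⟨σ, hσ, ⟨b⟩⟩ := hs.exists_brunovskyChart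
  refine ⟨_, _, b.isTrivialization h hm hσ, ?_⟩
  have := Finset.sum_le_sum fun k (_ : k ∈ Finset.univ) => b.colDegree_le h hm hσ k
  simp only [Finset.sum_add_distrib, Finset.sum_const, Finset.card_univ, Fintype.card_fin,
    smul_eq_mul, mul_one] at hσ
  omega

end FlatOutput

end

/-! ### The theorem: existence of the minimal $N$ and the criterion. -/

theorem mainTheorem6 (n m : ℕ) (hm : m ≤ n)
    (F : (Fin n → ℝ) × (Fin n → ℝ) → Fin (n - m) → ℝ) (x₀ : Jet n)
    (hF : AnalyticAt ℝ F (x₀ 0, x₀ 1))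
    (hreg : Function.Surjective (fderiv ℝ (fun v => F (x₀ 0, v)) (x₀ 1)))
    (hx₀ : x₀ ∈ solSet F) :
    (StrongClosednessCondition F x₀ → ∃ N, IsLeast (outputOrders F x₀) N) ∧
    (StaticFeedbackLinearizableAt F x₀ ↔
      StrongClosednessCondition F x₀ ∧ ∃ N, IsLeast (outputOrders F x₀) N ∧ n = m + N) := by
  have h : RegularSystemAt F x₀ := ⟨hF, hreg, hx₀⟩
  -- Every admissible $N$ is at least $n-m$; hence a trivialization reaching this value is
  -- automatically minimal.
  have hle : ∀ N ∈ outputOrders F x₀, n ≤ m + N := by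
    rintro _ ⟨U, Q, Z, Φ, Ψ, Θ, -, -, -, ht, -, -, rfl⟩
    exact ht.facts.le_sum_colDegree h
  refine ⟨fun hs => ?_, fun hs => ?_, ?_⟩
  · obtain ⟨Φ, Ψ, ht⟩ := hs.exists_isTrivialization h hm
    have hne : (outputOrders F x₀).Nonempty := ⟨_, (ht.mem_outputOrders h hm).2⟩
    exact ⟨_, Nat.sInf_mem hne, fun N hN => Nat.sInf_le hN⟩
  -- The trivialization given by Brunovsky coordinates has $m+N\le n$, so equality holds and no
  -- other choice can do better.
  · obtain ⟨Φ, Ψ, ht, hΦ⟩ := hs.exists_isTrivialization h hm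
    obtain ⟨h1, h2⟩ := ht.mem_outputOrders h hm
    refine ⟨h1, _, ⟨h2, fun N hN => ?_⟩, le_antisymm (hle _ h2) hΦ⟩
    have := hle N hN
    omega
  · rintro ⟨-, N, ⟨⟨U, Q, Z, Φ, Ψ, Θ, -, -, -, ht, -, -, rfl⟩, -⟩, hn⟩
    exact ht.facts.staticFeedbackLinearizableAt h hn
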